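/- Let $\alpha=\frac{1+\sqrt{-15}}2$, $K=\mathbb{Q}(\sqrt{-15})$, $F_k=N_{K/\mathbb{Q}}(1-4\alpha^k)=1-4(\alpha^k+\bar\alpha^k)+4^{k+2}$, and let $S$ be the set of natural numbers $k$ congruent modulo $240$ to one of $9,19,39,45,59,63,67,85,105,123,129,133,159,169,173,181,183,221,223,225,229$. For an integer $d$ let $E_d$ be the curve $y^2=x^3+a_{4,d}x+a_{6,d}$ with $a_{4,d}=-3234\,(16195646845-7242913457d)$ and $a_{6,d}=38416\,(5395199151946361-2412806411180256d)$, and let $P_d=(0,-10179930516+4552603328d)$. Consider the following primality test, whose input is $k\in S$: 1. If $5^{(F_k-1)/4}\not\equiv\pm1 \pmod{F_k}$, output "$F_k$ is composite" and terminate. 2. Compute $e:=(F_k-5)/8\in\mathbb{Z}$. 3. If $5^{(F_k-1)/4}\equiv1\pmod{F_k}$, compute $d:=5^{e+1}\bmod F_k$; otherwise compute $d:=2^{2e+1}5^{e+1}\bmod F_k$. 4. If $d^2\not\equiv5\pmod{F_k}$, output "$F_k$ is composite" and terminate. 5. Let $\bar P$ be the reduction of $P_d$ modulo $F_k$. 6.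 Compute $\bar Q=2^{2k+1}\bar P=[\bar x:\bar y:\bar z]\in E_d(\mathbb{Z}/F_k\mathbb{Z})$ and lift $[\bar x:\bar y:\bar z]$ to relatively prime integers $x,y,z$. 7. If $y\not\equiv0\pmod{F_k}$ or $\gcd(z,F_k)\ne1$, output "$F_k$ is composite"; otherwise output "$F_k$ is prime". The time complexity of this test is $O(k^2\log k\log\log k)$ bit operations. Precisely: there are a constant $C$ and a program for a random access machine with logarithmic cost such that for every $k\in S$ the program, started on input $k$, outputs the values computed in a run of the test, in order (first $F_k$ and $5^{(F_k-1)/4}\bmod F_k$; then, unless the run has terminated in step 1, $e$ and $d$; then, unless it has terminated in step 4, the coordinates of $\bar P$, the integers $x,y,z$ and $\gcd(z,F_k)$) and finally the verdict, and halts after time at most $C\,k^2\log k\,\log\log k$. Here the machine has registers and arrays holding natural numbers; its instructions are loading a constant, copying, addition, truncated subtraction, halving (rounded down), reading and writing an array cell with an index held in a register, appending a register to the output, and branching and looping on whether a register is nonzero (there is no multiplication or division instruction); each instruction and each test is charged one plus the total number of bits of the operands it handles, including array indices, and the time is the sum of these charges. -/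

import Mathlib

/-! ### The machine model

A random access machine over the natural numbers with *logarithmic* (bit) cost.  A program is a
fixed finite text; it uses finitely many registers `x₀, x₁, …` and finitely many arrays
`a₀, a₁, …`, each cell holding a natural number.  The arithmetic instructions are addition,
truncated subtraction and halving; there is no instruction for multiplication, division or modular
arithmetic.  Every instruction is charged the number of bits of all the operands it handles,
including the array index in an indirect access. -/

namespace RAM

/-- Contents of the registers, contents of the arrays, and the list of numbers output so far. -/
structure State where
  reg : ℕ → ℕ
  arr : ℕ → ℕ → ℕ
  out : List ℕ

/-- The machine at the start: the input is in register `0`, everything else is `0`, and nothing has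
been output. -/
def init (n : ℕ) : State where
  reg := Function.update (fun _ => 0) 0 n
  arr := fun _ _ => 0
  out := []

/-- Elementary instructions. -/
inductive Instr
  /-- `x ← c` -/
  | const (x c : ℕ)
  /-- `x ← y` -/
  | copy (x y : ℕ)
  /-- `x ← y + z` -/
  | add (x y z : ℕ)
  /-- `x ← max (y - z) 0` -/
  | sub (x y z : ℕ)
  /-- `x ← ⌊y / 2⌋` -/
  | half (x y : ℕ)
  /-- `x ← a[y]`, where `y` is a register -/
  | load (x a y : ℕ)
  /-- `a[x] ← y`, where `x` and `y` are registers -/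
  | store (a x y : ℕ)
  /-- append the contents of `x` to the output -/
  | print (x : ℕ)

/-- Store the number `v` in register `x`. -/
def State.set (s : State) (x v : ℕ) : State :=
  { s with reg := Function.update s.reg x v }

/-- The effect of an elementary instruction. -/
def Instr.run : Instr → State → State
  | const x c, s => s.set x c
  | copy x y, s => s.set x (s.reg y)
  | add x y z, s => s.set x (s.reg y + s.reg z)
  | sub x y z, s => s.set x (s.reg y - s.reg z)
  | half x y, s => s.set x (s.reg y / 2)
  | load x a y, s => s.set x (s.arr a (s.reg y))
  | store a x y, s =>
      { s with arr := Function.update s.arr a (Function.update (s.arr a) (s.reg x) (s.reg y)) }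
  | print x, s => { s with out := s.out ++ [s.reg x] }

/-- The cost of an elementary instruction: one plus the total bit length of what it handles
(`Nat.size n` is the number of binary digits of `n`). -/
def Instr.cost : Instr → State → ℕ
  | const _ c, _ => 1 + c.size
  | copy _ y, s => 1 + (s.reg y).size
  | add _ y z, s => 1 + (s.reg y).size + (s.reg z).size
  | sub _ y z, s => 1 + (s.reg y).size + (s.reg z).size
  | half _ y, s => 1 + (s.reg y).size
  | load _ a y, s => 1 + (s.reg y).size + (s.arr a (s.reg y)).size
  | store _ x y, s => 1 + (s.reg x).size + (s.reg y).size
  | print x, s => 1 + (s.reg x).size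

/-- Programs: instructions, sequencing, branching and loops on whether a register is nonzero. -/
inductive Prog
  | skip
  | instr (i : Instr)
  | seq (p q : Prog)
  /-- if register `x` is nonzero then `p` else `q` -/
  | ite (x : ℕ) (p q : Prog)
  /-- while register `x` is nonzero do `p` -/
  | loop (x : ℕ) (p : Prog)

/-- `Exec p s s' t`: started in state `s`, the program `p` halts in state `s'` after time `t`. -/
inductive Exec : Prog → State → State → ℕ → Prop
  | skip (s : State) : Exec Prog.skip s s 1
  | instr (i : Instr) (s : State) : Exec (Prog.instr i) s (i.run s) (i.cost s)
  | seq {p q : Prog} {s s' s'' : State} {t t' : ℕ} :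
      Exec p s s' t → Exec q s' s'' t' → Exec (Prog.seq p q) s s'' (t + t')
  | ite_true {x : ℕ} {p q : Prog} {s s' : State} {t : ℕ} :
      s.reg x ≠ 0 → Exec p s s' t → Exec (Prog.ite x p q) s s' (1 + (s.reg x).size + t)
  | ite_false {x : ℕ} {p q : Prog} {s s' : State} {t : ℕ} :
      s.reg x = 0 → Exec q s s' t → Exec (Prog.ite x p q) s s' (1 + (s.reg x).size + t)
  | loop_true {x : ℕ} {p : Prog} {s s' s'' : State} {t t' : ℕ} :
      s.reg x ≠ 0 → Exec p s s' t → Exec (Prog.loop x p) s' s'' t' →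
        Exec (Prog.loop x p) s s'' (1 + (s.reg x).size + t + t')
  | loop_false {x : ℕ} {p : Prog} {s : State} :
      s.reg x = 0 → Exec (Prog.loop x p) s s (1 + (s.reg x).size)

end RAM

/-! ### The numbers `F_k` and the primality test -/

namespace FkTest

/-- The ring `ℤ[α]` with `α ^ 2 = α - 4`, that is, `α = (1 + √-15) / 2`: the ring of integers of
`ℚ(√-15)`. -/
abbrev OK : Type := QuadraticAlgebra ℤ (-4) 1

/-- `α = (1 + √-15) / 2`. -/
def α : OK := ⟨0, 1⟩

/-- `F_k`, the norm of `1 - 4 α ^ k` (a nonnegative integer). -/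
def F (k : ℕ) : ℕ := (QuadraticAlgebra.norm (1 - 4 * α ^ k)).toNat

/-- The set of exponents `k` to which the test applies. -/
def S : Set ℕ :=
  {k | k % 240 ∈ ({9, 19, 39, 45, 59, 63, 67, 85, 105, 123, 129, 133, 159,
    169, 173, 181, 183, 221, 223, 225, 229} : Finset ℕ)}

/-- The residue of `5 ^ ((F_k - 1) / 4)` modulo `F_k`. -/
def r (k : ℕ) : ℕ := 5 ^ ((F k - 1) / 4) % F k

/-- `e = (F_k - 5) / 8`; the division is exact for `k ∈ S`. -/
def e (k : ℕ) : ℕ := (F k - 5) / 8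

/-- The candidate for a square root of `5` modulo `F_k`. -/
def d (k : ℕ) : ℕ :=
  if r k = 1 then 5 ^ (e k + 1) % F k else 2 ^ (2 * e k + 1) * 5 ^ (e k + 1) % F k

/-- The curve `E_d : y² = x³ + a_{4,d} x + a_{6,d}` over `ℤ / F_k ℤ`, for `d = d k`. -/
def E (k : ℕ) : WeierstrassCurve (ZMod (F k)) where
  a₁ := 0
  a₂ := 0
  a₃ := 0
  a₄ := -3234 * (16195646845 - 7242913457 * (d k : ZMod (F k)))
  a₆ := 38416 * (5395199151946361 - 2412806411180256 * (d k : ZMod (F k)))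

/-- The second coordinate of `P_d = (0, -10179930516 + 4552603328 d)`, reduced modulo `F_k`. -/
def yP (k : ℕ) : ℕ := ((-10179930516 + 4552603328 * (d k : ℤ)) % (F k : ℤ)).toNat

/-- Projective coordinates of the reduction of `P_d` modulo `F_k`. -/
def P (k : ℕ) : Fin 3 → ZMod (F k) := ![0, (yP k : ZMod (F k)), 1]

/-- Projective coordinates of `2 ^ (2k+1) P` on `E_d` over `ℤ / F_k ℤ`: the point `P` is doubled
`2k+1` times.  `dblXYZ` is the polynomial duplication formula of the group law in homogeneous
projective coordinates; it makes sense over every commutative ring and has no exceptional points on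
a nonsingular curve. -/
noncomputable def Q (k : ℕ) : Fin 3 → ZMod (F k) :=
  (WeierstrassCurve.Projective.dblXYZ (E k).toProjective)^[2 * k + 1] (P k)

/-- `Lift k x y z`: the integers `x, y, z` are relatively prime and `[x : y : z]` reduces to the
projective point `2 ^ (2k+1) P` modulo `F_k`. -/
def Lift (k x y z : ℕ) : Prop :=
  Nat.gcd x (Nat.gcd y z) = 1 ∧
    ∃ u : (ZMod (F k))ˣ, ![(x : ZMod (F k)), (y : ZMod (F k)), (z : ZMod (F k))] = u • Q k

/-- `Transcript k l`: the list `l` consists of the values that an execution of the test on `k`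
computes, in their order, followed by the verdict: `1` for "`F_k` is prime", `0` for "`F_k` is
composite". -/
inductive Transcript (k : ℕ) : List ℕ → Prop
  /-- `5 ^ ((F_k - 1) / 4)` is not `±1` modulo `F_k`: composite. -/
  | stop_power : r k ≠ 1 → r k ≠ F k - 1 → Transcript k [F k, r k, 0]
  /-- `d ^ 2` is not `5` modulo `F_k`: composite. -/
  | stop_root : (r k = 1 ∨ r k = F k - 1) → ¬ (d k) ^ 2 ≡ 5 [MOD F k] →
      Transcript k [F k, r k, e k, d k, 0]
  /-- `y` is not `0` modulo `F_k`, or `z` is not prime to `F_k`: composite. -/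
  | stop_point (x y z : ℕ) : (r k = 1 ∨ r k = F k - 1) → (d k) ^ 2 ≡ 5 [MOD F k] →
      Lift k x y z → (¬ y ≡ 0 [MOD F k] ∨ Nat.gcd z (F k) ≠ 1) →
      Transcript k [F k, r k, e k, d k, 0, yP k, 1, x, y, z, Nat.gcd z (F k), 0]
  /-- Otherwise: prime. -/
  | prime (x y z : ℕ) : (r k = 1 ∨ r k = F k - 1) → (d k) ^ 2 ≡ 5 [MOD F k] →
      Lift k x y z → y ≡ 0 [MOD F k] → Nat.gcd z (F k) = 1 →
      Transcript k [F k, r k, e k, d k, 0, yP k, 1, x, y, z, Nat.gcd z (F k), 1]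

end FkTest

/-!
A run of the test consists of two powers modulo `F = F k`, namely `5 ^ e` and `20 ^ e`, from which
`5 ^ ((F - 1) / 4)` and `d` are obtained, and of `2 k + 1` duplications on the curve, each of which is
a fixed sequence of multiplications modulo `F`.  These are `O(k)` multiplications, and so the time
bound follows if one multiplication of numbers of `O(k)` bits takes time `O(k log k log log k)` on the
machine, although this has no multiplication instruction.  All other work, such as finding `F`
from the powers of `α` or reducing the final coordinates by their greatest common divisor, takes
`O(k)` additions, subtractions and halvings of numbers of `O(k)` bits, hence time `O(k ^ 2)`.

*Multiplication.*  A number is cut into `h = O(k / log k)` digits of `b ≈ (log₂ k) / 2` bits.  The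
digits of two factors are multiplied as polynomials in `ℤ / M ℤ [x] / (x ^ D + 1)`, where `D = 2 h` is
a power of two and the odd number `M = O(k ^ 2 / log k)` exceeds all coefficients of the product
(`RAM.conv_spec`).  In this ring Nussbaumer's recursion applies.  With `D = T m` and `x ^ T` as a new
variable, an element becomes a polynomial of degree less than `T` over `ℤ / M ℤ [y] / (y ^ m + 1)`, and
since `y` is a root of unity of order `2 m`, such polynomials are multiplied by a Fourier transform
of length `2 T` whose twiddle factors are powers of `y`, that is, cyclic shifts with changes of sign
(`Nega.fwd_mul`, `Nega.el_level`).  Each level replaces the exponent `log₂ D` by half of it and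
doubles the amount of data, so that all levels cost `O(D log D)` steps, and after `L = O(log log k)`
levels blocks of length two are left (`RAM.ConvB.level`, `RAM.ConvB.last`).  They are multiplied by
means of a table of the quarter squares modulo `M`, which is short enough to be computed in advance
(`RAM.mulmod_spec`, `RAM.qsTable_spec`).  Altogether a product takes `O((L + 1) D log D)`, that is,
`O(k log log k)` instructions on words of `O(log k)` bits (`RAM.Par.For.macN_le`).

*Reduction modulo `F`.*  Residue classes are kept in Montgomery form by representatives less than
`2 F`, so that a modular multiplication is three multiplications of long numbers and needs no division
(`RAM.mac_spec`).  Its first factor may be a sum, which provides additions as well: everything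
between the preparation and the output is a sequence of operations `z ← (x + y) * c`
(`RAM.opsP_spec`, `RAM.dblLoop_spec`, `RAM.powLoop_spec`).

*Correctness.*  The program divides the final coordinates, as natural numbers, by their greatest
common divisor `g`.  That this gives the same projective point modulo `F` requires `g` to be prime to
`F`.  If `d ^ 2 ≡ 5` modulo `F`, the discriminant of the curve divides a number composed of the primes
`2`, `3`, `7` and `11`, up to a power of `2`, and these do not divide `F k` for `k ∈ S`; so the curve
has good reduction at every prime factor of `F`, and there the coordinates cannot all vanish
(`FkTest.exists_unit_coordinate`, `FkTest.coprime_of_eq_smul`).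

*Cost.*  Specifications of programs are stated as `RAM.Runs w p N s Q`: if all words of the state `s`
have at most `w` bits, then so have those of the final state, which satisfies `Q`, and the program `p`
executes at most `N` instructions, so that it takes time at most `N * (2 w + 1)`.  The parts of the
program are run with different `w` (`RAM.testProg_exec`): `O(k)` for preparation and output, and
`O(log k)` for the multiplications.
-/

set_option linter.unusedSimpArgs false

namespace RAM

/-! ### Programs and their cost -/

/-- Programs are composed with `;;`. -/
infixr:60 " ;; " => Prog.seq

/-- A straight-line program. -/
def block : List Instr → Prog
  | [] => Prog.skip
  | i :: l => Prog.seq (Prog.instr i) (block l)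

/-- The effect of a straight-line program. -/
def runL : List Instr → State → State
  | [], s => s
  | i :: l, s => runL l (i.run s)

/-- Every machine word of the state has at most `w` bits. -/
def Small (w : ℕ) (s : State) : Prop :=
  (∀ x, s.reg x < 2 ^ w) ∧ ∀ a i, s.arr a i < 2 ^ w

/-- The constants loaded and the sums computed by an instruction have at most `w` bits.  These are
the only instructions that can make words longer. -/
def Instr.Fits (w : ℕ) : Instr → State → Prop
  | .const _ c, _ => c < 2 ^ w
  | .add _ y z, s => s.reg y + s.reg z < 2 ^ w
  | _, _ => True

/-- `Instr.Fits` along a straight-line program. -/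
def FitsL (w : ℕ) : List Instr → State → Prop
  | [], _ => True
  | i :: l, s => i.Fits w s ∧ FitsL w l (i.run s)

/-- `Runs w p N s Q`: started in a state `s` all of whose words have at most `w` bits, the program
`p` halts in a state satisfying `Q`, all of whose words have at most `w` bits, after time at most
`N * (2 * w + 1)`; so `N` bounds the number of instructions executed. -/
def Runs (w : ℕ) (p : Prog) (N : ℕ) (s : State) (Q : State → Prop) : Prop :=
  Small w s → ∃ s' t, Exec p s s' t ∧ t ≤ N * (2 * w + 1) ∧ Small w s' ∧ Q s'

@[simp] theorem State.set_reg (s : State) (x v y : ℕ) :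
    (s.set x v).reg y = if y = x then v else s.reg y := by
  simp [State.set, Function.update_apply]

@[simp] theorem State.set_arr (s : State) (x v : ℕ) : (s.set x v).arr = s.arr := rfl

@[simp] theorem State.set_out (s : State) (x v : ℕ) : (s.set x v).out = s.out := rfl

/-- Store the number `v` in cell `i` of array `a`. -/
def State.put (s : State) (a i v : ℕ) : State :=
  { s with arr := Function.update s.arr a (Function.update (s.arr a) i v) }

@[simp] theorem State.put_reg (s : State) (a i v : ℕ) : (s.put a i v).reg = s.reg := rfl

@[simp] theorem State.put_out (s : State) (a i v : ℕ) : (s.put a i v).out = s.out := rfl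

@[simp] theorem State.put_arr (s : State) (a i v a' j : ℕ) :
    (s.put a i v).arr a' j = if a' = a ∧ j = i then v else s.arr a' j := by
  by_cases h : a' = a
  · subst h; simp [State.put, Function.update_apply]
  · simp [State.put, h]

@[simp] theorem run_const (x c : ℕ) (s : State) : (Instr.const x c).run s = s.set x c := rfl
@[simp] theorem run_copy (x y : ℕ) (s : State) : (Instr.copy x y).run s = s.set x (s.reg y) := rfl
@[simp] theorem run_add (x y z : ℕ) (s : State) :
    (Instr.add x y z).run s = s.set x (s.reg y + s.reg z) := rfl
@[simp] theorem run_sub (x y z : ℕ) (s : State) :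
    (Instr.sub x y z).run s = s.set x (s.reg y - s.reg z) := rfl
@[simp] theorem run_half (x y : ℕ) (s : State) :
    (Instr.half x y).run s = s.set x (s.reg y / 2) := rfl
@[simp] theorem run_load (x a y : ℕ) (s : State) :
    (Instr.load x a y).run s = s.set x (s.arr a (s.reg y)) := rfl
@[simp] theorem run_store (a x y : ℕ) (s : State) :
    (Instr.store a x y).run s = s.put a (s.reg x) (s.reg y) := rfl
@[simp] theorem run_print_reg (x : ℕ) (s : State) : ((Instr.print x).run s).reg = s.reg := rfl
@[simp] theorem run_print_arr (x : ℕ) (s : State) : ((Instr.print x).run s).arr = s.arr := rfl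
@[simp] theorem run_print_out (x : ℕ) (s : State) :
    ((Instr.print x).run s).out = s.out ++ [s.reg x] := rfl

@[simp] theorem runL_nil (s : State) : runL [] s = s := rfl
@[simp] theorem runL_cons (i : Instr) (l : List Instr) (s : State) :
    runL (i :: l) s = runL l (i.run s) := rfl
@[simp] theorem fitsL_nil (w : ℕ) (s : State) : FitsL w [] s ↔ True := Iff.rfl
@[simp] theorem fitsL_cons (w : ℕ) (i : Instr) (l : List Instr) (s : State) :
    FitsL w (i :: l) s ↔ i.Fits w s ∧ FitsL w l (i.run s) := Iff.rfl
@[simp] theorem fits_const (w x c : ℕ) (s : State) : (Instr.const x c).Fits w s ↔ c < 2 ^ w :=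
  Iff.rfl
@[simp] theorem fits_copy (w x y : ℕ) (s : State) : (Instr.copy x y).Fits w s ↔ True := Iff.rfl
@[simp] theorem fits_add (w x y z : ℕ) (s : State) :
    (Instr.add x y z).Fits w s ↔ s.reg y + s.reg z < 2 ^ w := Iff.rfl
@[simp] theorem fits_sub (w x y z : ℕ) (s : State) : (Instr.sub x y z).Fits w s ↔ True := Iff.rfl
@[simp] theorem fits_half (w x y : ℕ) (s : State) : (Instr.half x y).Fits w s ↔ True := Iff.rfl
@[simp] theorem fits_load (w x a y : ℕ) (s : State) : (Instr.load x a y).Fits w s ↔ True := Iff.rfl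
@[simp] theorem fits_store (w x a y : ℕ) (s : State) : (Instr.store a x y).Fits w s ↔ True :=
  Iff.rfl
@[simp] theorem fits_print (w x : ℕ) (s : State) : (Instr.print x).Fits w s ↔ True := Iff.rfl

theorem Small.set {w : ℕ} {s : State} (h : Small w s) {x v : ℕ} (hv : v < 2 ^ w) :
    Small w (s.set x v) :=
  ⟨fun y => by rw [State.set_reg]; split <;> [exact hv; exact h.1 y], h.2⟩

theorem Instr.Fits.small {w : ℕ} {i : Instr} {s : State} (hi : i.Fits w s) (h : Small w s) :
    Small w (i.run s) := by
  cases i with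
  | const x c => exact h.set hi
  | copy x y => exact h.set (h.1 y)
  | add x y z => exact h.set hi
  | sub x y z => exact h.set (lt_of_le_of_lt (Nat.sub_le _ _) (h.1 y))
  | half x y => exact h.set (lt_of_le_of_lt (Nat.div_le_self _ _) (h.1 y))
  | load x a y => exact h.set (h.2 a _)
  | store a x y =>
    refine ⟨h.1, fun a' i => ?_⟩
    rw [run_store, State.put_arr]
    split <;> [exact h.1 y; exact h.2 a' i]
  | print x => exact h

theorem Instr.Fits.cost_le {w : ℕ} {i : Instr} {s : State} (hi : i.Fits w s) (h : Small w s) :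
    i.cost s ≤ 2 * w + 1 := by
  have hr : ∀ x, (s.reg x).size ≤ w := fun x => Nat.size_le.2 (h.1 x)
  cases i with
  | const x c => have : c.size ≤ w := Nat.size_le.2 hi
                 simp only [Instr.cost]; omega
  | copy x y => have := hr y; simp only [Instr.cost]; omega
  | add x y z => have := hr y; have := hr z; simp only [Instr.cost]; omega
  | sub x y z => have := hr y; have := hr z; simp only [Instr.cost]; omega
  | half x y => have := hr y; simp only [Instr.cost]; omega
  | load x a y =>
    have := hr y
    have : (s.arr a (s.reg y)).size ≤ w := Nat.size_le.2 (h.2 a _)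
    simp only [Instr.cost]; omega
  | store a x y => have := hr x; have := hr y; simp only [Instr.cost]; omega
  | print x => have := hr x; simp only [Instr.cost]; omega

theorem Runs.of_le {w : ℕ} {p : Prog} {N N' : ℕ} {s : State} {Q : State → Prop}
    (h : Runs w p N s Q) (hN : N ≤ N') : Runs w p N' s Q := fun hs => by
  obtain ⟨s', t, he, ht, hs', hq⟩ := h hs
  exact ⟨s', t, he, ht.trans (Nat.mul_le_mul_right _ hN), hs', hq⟩

theorem Runs.mono {w : ℕ} {p : Prog} {N : ℕ} {s : State} {Q Q' : State → Prop}
    (h : Runs w p N s Q) (hQ : ∀ s', Q s' → Q' s') : Runs w p N s Q' := fun hs => by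
  obtain ⟨s', t, he, ht, hs', hq⟩ := h hs
  exact ⟨s', t, he, ht, hs', hQ _ hq⟩

theorem Runs.seq {w : ℕ} {p q : Prog} {N₁ N₂ : ℕ} {s : State} {Q : State → Prop}
    (h : Runs w p N₁ s fun s' => Runs w q N₂ s' Q) : Runs w (p ;; q) (N₁ + N₂) s Q := fun hs => by
  obtain ⟨s', t, he, ht, hs', hq⟩ := h hs
  obtain ⟨s'', t', he', ht', hs'', hq'⟩ := hq hs'
  exact ⟨s'', t + t', .seq he he', by rw [Nat.add_mul]; exact Nat.add_le_add ht ht', hs'', hq'⟩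

theorem Runs.skip {w : ℕ} {s : State} {Q : State → Prop} (h : Q s) : Runs w .skip 1 s Q :=
  fun hs => ⟨s, 1, .skip s, by omega, hs, h⟩

theorem Runs.block {w : ℕ} (l : List Instr) {s : State} {Q : State → Prop} (hf : FitsL w l s)
    (hQ : Q (runL l s)) : Runs w (block l) (l.length + 1) s Q := by
  induction l generalizing s with
  | nil => exact Runs.skip hQ
  | cons i l ih =>
    intro hs
    obtain ⟨s', t, he, ht, hs', hq⟩ := ih hf.2 hQ (hf.1.small hs)
    refine ⟨s', _, .seq (.instr i s) he, ?_, hs', hq⟩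
    have := hf.1.cost_le hs
    rw [List.length_cons, show l.length + 1 + 1 = 1 + (l.length + 1) by ring, Nat.add_mul (1 : ℕ)]
    omega

/-- The size of a word is part of the hypotheses of a triple and may be used in its proof. -/
theorem Runs.of_small {w : ℕ} {p : Prog} {N : ℕ} {s : State} {Q : State → Prop}
    (h : Small w s → Runs w p N s Q) : Runs w p N s Q := fun hs => h hs hs

/-- The rule for branching: the bound is that of the longer branch. -/
theorem Runs.ite {w x : ℕ} {p q : Prog} {N₁ N₂ : ℕ} {s : State} {Q : State → Prop}
    (hp : s.reg x ≠ 0 → Runs w p N₁ s Q) (hq : s.reg x = 0 → Runs w q N₂ s Q) :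
    Runs w (.ite x p q) (max N₁ N₂ + 1) s Q := fun hs => by
  have hx : (s.reg x).size ≤ w := Nat.size_le.2 (hs.1 x)
  by_cases h : s.reg x = 0
  · obtain ⟨s', t, he, ht, hs', hQ⟩ := (hq h).of_le (le_max_right N₁ N₂) hs
    exact ⟨s', _, .ite_false h he, by rw [Nat.add_mul]; omega, hs', hQ⟩
  · obtain ⟨s', t, he, ht, hs', hQ⟩ := (hp h).of_le (le_max_left N₁ N₂) hs
    exact ⟨s', _, .ite_true h he, by rw [Nat.add_mul]; omega, hs', hQ⟩

/-! ### What a program leaves unchanged -/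

/-- The register an instruction writes. -/
def Instr.wregs : Instr → List ℕ
  | .const x _ | .copy x _ | .add x _ _ | .sub x _ _ | .half x _ | .load x _ _ => [x]
  | .store _ _ _ | .print _ => []

/-- The array an instruction writes. -/
def Instr.warrs : Instr → List ℕ
  | .store a _ _ => [a]
  | _ => []

/-- Does the instruction print? -/
def Instr.prints : Instr → Bool
  | .print _ => true
  | _ => false

/-- The registers a program may write. -/
def wregs : Prog → List ℕ
  | .skip => []
  | .instr i => i.wregs
  | .seq p q => wregs p ++ wregs q
  | .ite _ p q => wregs p ++ wregs q
  | .loop _ p => wregs p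

/-- The arrays a program may write. -/
def warrs : Prog → List ℕ
  | .skip => []
  | .instr i => i.warrs
  | .seq p q => warrs p ++ warrs q
  | .ite _ p q => warrs p ++ warrs q
  | .loop _ p => warrs p

/-- May the program print? -/
def prints : Prog → Bool
  | .skip => false
  | .instr i => i.prints
  | .seq p q => prints p || prints q
  | .ite _ p q => prints p || prints q
  | .loop _ p => prints p

/-- The states `s` and `s'` agree on everything that `p` cannot write. -/
structure Frame (p : Prog) (s s' : State) : Prop where
  reg : ∀ x, x ∉ wregs p → s'.reg x = s.reg x
  arr : ∀ a, a ∉ warrs p → s'.arr a = s.arr a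
  out : prints p = false → s'.out = s.out

theorem Frame.refl (p : Prog) (s : State) : Frame p s s :=
  ⟨fun _ _ => rfl, fun _ _ => rfl, fun _ => rfl⟩

theorem Frame.trans {p : Prog} {s s' s'' : State} (h : Frame p s s') (h' : Frame p s' s'') :
    Frame p s s'' :=
  ⟨fun x hx => (h'.reg x hx).trans (h.reg x hx), fun x hx => (h'.arr x hx).trans (h.arr x hx),
    fun hx => (h'.out hx).trans (h.out hx)⟩

theorem Frame.of_subset {p q : Prog} {s s' : State} (h : Frame p s s')
    (h₁ : ∀ x, x ∈ wregs p → x ∈ wregs q) (h₂ : ∀ x, x ∈ warrs p → x ∈ warrs q)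
    (h₃ : prints q = false → prints p = false) : Frame q s s' :=
  ⟨fun x hx => h.reg x fun h => hx (h₁ x h), fun x hx => h.arr x fun h => hx (h₂ x h),
    fun hx => h.out (h₃ hx)⟩

theorem Frame.instr (i : Instr) (s : State) : Frame (.instr i) s (i.run s) := by
  refine ⟨fun x hx => ?_, fun a ha => ?_, fun ho => ?_⟩
  · cases i <;> simp_all [wregs, Instr.wregs]
  · funext j
    cases i <;> simp_all [warrs, Instr.warrs]
  · cases i <;> simp_all [prints, Instr.prints]

/-- An execution changes nothing but what the text of the program allows it to write. -/
theorem Exec.frame {p : Prog} {s s' : State} {t : ℕ} (h : Exec p s s' t) : Frame p s s' := by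
  induction h with
  | skip s => exact Frame.refl _ _
  | instr i s => exact Frame.instr i s
  | seq _ _ ih ih' =>
    exact (ih.of_subset (by simp +contextual [wregs]) (by simp +contextual [warrs])
      (by simp +contextual [prints])).trans (ih'.of_subset (by simp +contextual [wregs])
      (by simp +contextual [warrs]) (by simp +contextual [prints]))
  | ite_true _ _ ih =>
    exact ih.of_subset (by simp +contextual [wregs]) (by simp +contextual [warrs])
      (by simp +contextual [prints])
  | ite_false _ _ ih =>
    exact ih.of_subset (by simp +contextual [wregs]) (by simp +contextual [warrs])
      (by simp +contextual [prints])
  | loop_true _ _ _ ih ih' =>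
    exact (ih.of_subset (by simp +contextual [wregs]) (by simp +contextual [warrs])
      (by simp +contextual [prints])).trans ih'
  | loop_false _ => exact Frame.refl _ _

theorem Runs.frame {w : ℕ} {p : Prog} {N : ℕ} {s : State} {Q : State → Prop}
    (h : Runs w p N s Q) : Runs w p N s fun s' => Frame p s s' ∧ Q s' := fun hs => by
  obtain ⟨s', t, he, ht, hs', hq⟩ := h hs
  exact ⟨s', t, he, ht, hs', he.frame, hq⟩

/-- The form in which a specification of `p` is used inside a longer program: the state after `p`
is only known through the specification and through what `p` cannot write. -/
theorem Runs.call {w : ℕ} {p : Prog} {N : ℕ} {s : State} {Q Q' : State → Prop}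
    (h : Runs w p N s Q) (hQ : ∀ s', Frame p s s' → Q s' → Q' s') : Runs w p N s Q' :=
  h.frame.mono fun s' hs => hQ s' hs.1 hs.2

theorem Runs.block_seq {w : ℕ} {l : List Instr} {q : Prog} {N : ℕ} {s : State} {Q : State → Prop}
    (hf : FitsL w l s) (h : Runs w q N (runL l s) Q) :
    Runs w (RAM.block l ;; q) (l.length + 1 + N) s Q :=
  Runs.seq (Runs.block l hf h)

theorem Runs.call_seq {w : ℕ} {p q : Prog} {N₁ N₂ : ℕ} {s : State} {Q₁ Q : State → Prop}
    (h : Runs w p N₁ s Q₁) (hq : ∀ s', Frame p s s' → Q₁ s' → Runs w q N₂ s' Q) :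
    Runs w (p ;; q) (N₁ + N₂) s Q :=
  Runs.seq (h.call hq)

/-! ### Counted loops -/

/-- The loop `for c = n, n - 1, …, 1 do p`, where `n` is the content of register `r`.  Register `0`
is a scratch register of every program here. -/
def forN (c r : ℕ) (p : Prog) : Prog :=
  block [.copy c r] ;; .loop c (p ;; block [.const 0 1, .sub c c 0])

/-- The rule for counted loops, where the `i`-th iteration takes `N i` steps. -/
theorem Runs.forN' {w c r n : ℕ} {p : Prog} {N : ℕ → ℕ} {s : State} {Q : State → Prop}
    (I : ℕ → State → Prop) (hn : s.reg r = n) (hc0 : c ≠ 0) (hw : 0 < w)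
    (hI : I 0 (s.set c n))
    (hp : ∀ i s', i < n → s'.reg c = n - i → Frame (forN c r p) s s' → I i s' →
      Runs w p (N i) s' fun s'' => s''.reg c = n - i ∧
        I (i + 1) ((s''.set 0 1).set c (n - (i + 1))))
    (hQ : ∀ s', Frame (forN c r p) s s' → s'.reg c = 0 → I n s' → Q s') :
    Runs w (forN c r p) (∑ i ∈ Finset.range n, (N i + 4) + 3) s Q := by
  have h1 : 1 < 2 ^ w := Nat.one_lt_two_pow hw.ne'
  have key : ∀ j s', j ≤ n → s'.reg c = j → Frame (forN c r p) s s' → I (n - j) s' →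
      Runs w (.loop c (p ;; RAM.block [.const 0 1, .sub c c 0]))
        (∑ i ∈ Finset.range j, (N (n - 1 - i) + 4) + 1) s' Q := by
    intro j
    induction j with
    | zero =>
      intro s' _ hc hf hI hs
      refine ⟨s', _, .loop_false hc, ?_, hs, hQ s' hf hc hI⟩
      simp [hc]
    | succ j ih =>
      intro s' hj hc hf hI' hs
      have hcs : (s'.reg c).size ≤ w := Nat.size_le.2 (hs.1 c)
      obtain ⟨s₁, t₁, he₁, ht₁, hs₁, hc₁, hI₁⟩ :=
        hp (n - (j + 1)) s' (by omega) (by omega) hf hI' hs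
      obtain ⟨s₂, t₂, he₂, ht₂, hs₂, rfl⟩ :=
        Runs.block (w := w) [.const 0 1, .sub c c 0] (s := s₁)
          (Q := fun s => s = runL [.const 0 1, .sub c c 0] s₁) (by simp [h1]) rfl hs₁
      have hrun : runL [.const 0 1, .sub c c 0] s₁ = (s₁.set 0 1).set c (s₁.reg c - 1) := by
        simp [hc0]
      have hfr : Frame (forN c r p) s (runL [.const 0 1, .sub c c 0] s₁) := by
        refine hf.trans ((Exec.seq he₁ he₂).frame.of_subset ?_ ?_ ?_)
        · intro x hx
          simp only [forN, wregs, List.mem_append] at hx ⊢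
          exact Or.inr hx
        · intro x hx
          simp only [forN, warrs, List.mem_append] at hx ⊢
          exact Or.inr hx
        · intro h
          simp only [forN, prints, Bool.or_eq_false_iff] at h ⊢
          exact h.2
      have hI₂ : I (n - j) (runL [.const 0 1, .sub c c 0] s₁) := by
        rw [hrun, hc₁]
        convert hI₁ using 2 <;> omega
      obtain ⟨s₃, t₃, he₃, ht₃, hs₃, hQ₃⟩ :=
        ih _ (by omega) (by rw [hrun, State.set_reg, if_pos rfl, hc₁]; omega) hfr hI₂ hs₂
      refine ⟨s₃, _, .loop_true (by omega) (Exec.seq he₁ he₂) he₃, ?_, hs₃, hQ₃⟩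
      have hN : N (n - 1 - j) = N (n - (j + 1)) := by congr 1; omega
      simp only [List.length_cons, List.length_nil] at ht₂
      rw [Finset.sum_range_succ, hN]
      nlinarith
  have hf : Frame (RAM.forN c r p) s (runL [.copy c r] s) :=
    (Frame.instr (.copy c r) s).of_subset
      (fun x hx => by simp only [RAM.forN, wregs, RAM.block, List.mem_append]; exact Or.inl (Or.inl hx))
      (by simp [warrs, Instr.warrs]) (by simp [prints, Instr.prints])
  have hrun : runL [.copy c r] s = s.set c n := by simp [hn]
  have := Runs.seq (Runs.block (w := w) [.copy c r] (s := s) (Q := fun s' => Runs w _ _ s' Q)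
    (by simp) (by rw [hrun] at hf ⊢; exact key n _ le_rfl (by simp) hf (by simpa using hI)))
  refine this.of_le ?_
  rw [← Finset.sum_range_reflect (fun i => N i + 4)]
  simp only [List.length_cons, List.length_nil]
  omega

/-- The rule for counted loops with a uniform bound for the iterations. -/
theorem Runs.forN {w c r n N : ℕ} {p : Prog} {s : State} {Q : State → Prop}
    (I : ℕ → State → Prop) (hn : s.reg r = n) (hc0 : c ≠ 0) (hw : 0 < w)
    (hI : I 0 (s.set c n))
    (hp : ∀ i s', i < n → s'.reg c = n - i → Frame (forN c r p) s s' → I i s' →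
      Runs w p N s' fun s'' => s''.reg c = n - i ∧ I (i + 1) ((s''.set 0 1).set c (n - (i + 1))))
    (hQ : ∀ s', Frame (forN c r p) s s' → s'.reg c = 0 → I n s' → Q s') :
    Runs w (forN c r p) (n * (N + 4) + 3) s Q :=
  (Runs.forN' I hn hc0 hw hI hp hQ).of_le (by simp)

end RAM

/-! ### Negacyclic rings -/

namespace Nega

open Polynomial

variable {K : Type*} [CommRing K]

/-- The extension of `u 0, …, u (m - 1)` to a sequence with `u (n + m) = - u n`. -/
def ext (m : ℕ) (u : ℕ → K) (n : ℕ) : K :=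
  if n % (2 * m) < m then u (n % (2 * m)) else -u (n % (2 * m) - m)

/-- The ring `K[x] / (x ^ m + 1)`. -/
abbrev Ring (K : Type*) [CommRing K] (m : ℕ) : Type _ := AdjoinRoot (X ^ m + 1 : K[X])

/-- The class of `x`. -/
noncomputable abbrev x (K : Type*) [CommRing K] (m : ℕ) : Ring K m := AdjoinRoot.root _

/-- The element `∑ u l * x ^ l` of `K[x] / (x ^ m + 1)` with coefficients `u 0, …, u (m - 1)`. -/
noncomputable def el (m : ℕ) (u : ℕ → K) : Ring K m :=
  ∑ l ∈ Finset.range m, AdjoinRoot.of _ (u l) * x K m ^ l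

theorem x_pow (m : ℕ) : x K m ^ m = -1 := by
  have h : AdjoinRoot.mk (X ^ m + 1 : K[X]) (X ^ m + 1) = 0 := AdjoinRoot.mk_self
  rw [map_add, map_pow, map_one, AdjoinRoot.mk_X] at h
  exact eq_neg_of_add_eq_zero_left h

theorem x_pow_two_mul (m : ℕ) : x K m ^ (2 * m) = 1 := by
  rw [mul_comm, pow_mul, x_pow]; norm_num

theorem el_congr {m : ℕ} {u v : ℕ → K} (h : ∀ l < m, u l = v l) : el m u = el m v :=
  Finset.sum_congr rfl fun l hl => by rw [h l (Finset.mem_range.1 hl)]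

theorem el_add (m : ℕ) (u v : ℕ → K) : el m (fun l => u l + v l) = el m u + el m v := by
  simp [el, add_mul, Finset.sum_add_distrib]

theorem ext_of_lt {m n : ℕ} (u : ℕ → K) (h : n < m) : ext m u n = u n := by
  rw [ext, Nat.mod_eq_of_lt (by omega), if_pos h]

theorem ext_of_ge {m n : ℕ} (u : ℕ → K) (h : m ≤ n) (h' : n < 2 * m) :
    ext m u n = -u (n - m) := by
  rw [ext, Nat.mod_eq_of_lt h', if_neg (by omega)]

theorem ext_add_two_mul (m n : ℕ) (u : ℕ → K) : ext m u (n + 2 * m) = ext m u n := by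
  simp [ext]

theorem ext_add {m : ℕ} (hm : 0 < m) (u : ℕ → K) (n : ℕ) : ext m u (n + m) = -ext m u n := by
  have h : (n + m) % (2 * m) = (n % (2 * m) + m) % (2 * m) := by simp [Nat.add_mod]
  have h' := Nat.mod_lt n (show 0 < 2 * m by omega)
  by_cases hn : n % (2 * m) < m
  · rw [ext, h, Nat.mod_eq_of_lt (by omega), if_neg (by omega), ext, if_pos hn]
    simp
  · have : (n % (2 * m) + m) % (2 * m) = n % (2 * m) - m := by
      rw [show n % (2 * m) + m = n % (2 * m) - m + 2 * m by omega, Nat.add_mod_right,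
        Nat.mod_eq_of_lt (by omega)]
    rw [ext, h, this, if_pos (by omega), ext, if_neg hn, neg_neg]

theorem sum_range_shift {A : Type*} [AddCommGroup A] {m : ℕ} {g : ℕ → A}
    (hg : ∀ n, g (n + m) = g n) (c : ℕ) :
    ∑ l ∈ Finset.range m, g (l + c) = ∑ l ∈ Finset.range m, g l := by
  induction c with
  | zero => rfl
  | succ c ih =>
    rw [← ih]
    have h1 := Finset.sum_range_succ' (fun l => g (l + c)) m
    have h2 := Finset.sum_range_succ (fun l => g (l + c)) m
    rw [h2] at h1
    simp only [Nat.zero_add, add_comm m c, hg] at h1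
    have h3 := add_right_cancel h1
    rw [h3]
    exact Finset.sum_congr rfl fun l _ => by congr 1; ring

/-- Reading the antiperiodic extension from position `2 * m - e` on multiplies by `x ^ e`. -/
theorem el_ext {m e : ℕ} (hm : 0 < m) (he : e ≤ 2 * m) (u : ℕ → K) :
    el m (fun l => ext m u (2 * m - e + l)) = x K m ^ e * el m u := by
  have hper : ∀ n, AdjoinRoot.of _ (ext m u (n + m)) * x K m ^ (n + m) =
      AdjoinRoot.of _ (ext m u n) * x K m ^ n := fun n => by
    rw [ext_add hm, pow_add, x_pow]; simp
  have h := sum_range_shift (g := fun n => AdjoinRoot.of _ (ext m u n) * x K m ^ n) hper (2 * m - e)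
  have h' : el m u = ∑ l ∈ Finset.range m, AdjoinRoot.of _ (ext m u l) * x K m ^ l :=
    Finset.sum_congr rfl fun l hl => by rw [ext_of_lt _ (Finset.mem_range.1 hl)]
  rw [h', ← h, Finset.mul_sum, el]
  refine Finset.sum_congr rfl fun l _ => ?_
  rw [add_comm (2 * m - e) l]
  have : x K m ^ (l + (2 * m - e)) * x K m ^ e = x K m ^ l := by
    rw [← pow_add, show l + (2 * m - e) + e = l + 2 * m by omega, pow_add, x_pow_two_mul, mul_one]
  rw [← this]
  ring

/-- The class of a polynomial of degree less than `m` determines its coefficients.  So a product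
of two polynomials of small degree can be computed modulo `x ^ m + 1`. -/
theorem el_injective [Nontrivial K] {m : ℕ} (hm : 0 < m) {u v : ℕ → K} (h : el m u = el m v) :
    ∀ l < m, u l = v l := by
  set P : K[X] := ∑ l ∈ Finset.range m, C (u l - v l) * X ^ l with hP
  have hmon : (X ^ m + 1 : K[X]).Monic := monic_X_pow_add_C 1 hm.ne'
  have hdeg : (X ^ m + 1 : K[X]).degree = m := degree_X_pow_add_C hm 1
  have h0 : AdjoinRoot.mk (X ^ m + 1 : K[X]) P = 0 := by
    rw [← sub_eq_zero] at h
    rw [← h, hP, el, el, ← Finset.sum_sub_distrib, map_sum]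
    refine Finset.sum_congr rfl fun l _ => ?_
    rw [map_mul, AdjoinRoot.mk_C, map_pow, AdjoinRoot.mk_X, map_sub]
    ring
  have hlt : P.degree < (X ^ m + 1 : K[X]).degree := by
    rw [hdeg]
    refine (degree_sum_le _ _).trans_lt ((Finset.sup_lt_iff (by simp)).2 fun l hl => ?_)
    exact (degree_C_mul_X_pow_le _ _).trans_lt (by exact_mod_cast Finset.mem_range.1 hl)
  have hP0 : P = 0 := by
    by_contra hne
    exact hmon.not_dvd_of_degree_lt hne hlt (AdjoinRoot.mk_eq_zero.1 h0)
  intro l hl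
  have := congrArg (fun p => p.coeff l) hP0
  simp only [hP, finsetSum_coeff, coeff_C_mul, coeff_X_pow, coeff_zero] at this
  rw [Finset.sum_eq_single l (fun b _ hb => by simp [Ne.symm hb])
    (fun h => absurd (Finset.mem_range.2 hl) h)] at this
  simpa [sub_eq_zero] using this

/-! ### The constant geometry transform -/

/-- The exponent `tw m t o` of the twiddle factor that stage `t` of the transform applies to output
`o`, for a root of unity of order `2 m`.  At output `2 i` it is half the exponent that stage `t - 1`
has at output `i`; at output `2 i + 1` it is that half plus `m`, which gives the other square
root. -/
def tw (m : ℕ) : ℕ → ℕ → ℕ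
  | 0, _ => 0
  | t + 1, o => tw m t (o / 2) / 2 + o % 2 * m

theorem tw_lt {m : ℕ} (hm : 0 < m) (t o : ℕ) : tw m t o < 2 * m := by
  induction t generalizing o with
  | zero => rw [tw]; omega
  | succ t ih =>
    rw [tw]
    have := ih (o / 2)
    have h2 : o % 2 * m ≤ 1 * m := Nat.mul_le_mul_right _ (by omega)
    omega

theorem tw_two_mul (m t i : ℕ) : tw m (t + 1) (2 * i) = tw m t i / 2 := by
  rw [tw, Nat.mul_div_cancel_left _ (by norm_num)]; simp

theorem tw_two_mul_add_one (m t i : ℕ) : tw m (t + 1) (2 * i + 1) = tw m t i / 2 + m := by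
  rw [tw, show (2 * i + 1) / 2 = i by omega, show (2 * i + 1) % 2 = 1 by omega, one_mul]

theorem tw_dvd (q t o : ℕ) (ht : t ≤ q + 1) : 2 ^ (q + 1 - t) ∣ tw (2 ^ q) t o := by
  induction t generalizing o with
  | zero => simp [tw]
  | succ t ih =>
    rw [tw]
    refine dvd_add ?_ ((pow_dvd_pow 2 (by omega)).mul_left _)
    obtain ⟨c, hc⟩ := ih (o / 2) (by omega)
    refine ⟨c, ?_⟩
    rw [hc, show q + 1 - t = q + 1 - (t + 1) + 1 by omega, pow_succ, mul_assoc, mul_left_comm,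
      Nat.mul_div_cancel_left _ (by norm_num)]

/-- The exponents of stage `t` are periodic with period `2 ^ t`. -/
theorem tw_add (m t o c : ℕ) : tw m t (o + c * 2 ^ t) = tw m t o := by
  induction t generalizing o with
  | zero => rfl
  | succ t ih =>
    rw [tw, tw, show o + c * 2 ^ (t + 1) = o + 2 * (c * 2 ^ t) by ring,
      Nat.add_mul_div_left _ _ (by norm_num), ih, Nat.add_mul_mod_self_left]

variable {S : Type*} [CommRing S]

/-- One stage of the transform of `2 * T` elements.  All stages have the same pattern of access:
output `o` is computed from the inputs `o / 2` and `T + o / 2`. -/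
def stF (ξ : S) (T : ℕ) (E : ℕ → ℕ) (f : ℕ → S) (o : ℕ) : S :=
  f (o / 2) + ξ ^ E o * f (T + o / 2)

/-- One stage of the inverse transform, up to a factor `2`. -/
def stI (ξ : S) (m T : ℕ) (E : ℕ → ℕ) (f : ℕ → S) (o : ℕ) : S :=
  if o < T then f (2 * o) + f (2 * o + 1)
  else ξ ^ (2 * m - E (2 * (o - T))) * f (2 * (o - T)) +
    ξ ^ (2 * m - E (2 * (o - T) + 1)) * f (2 * (o - T) + 1)

/-- The first `t` stages of the transform. -/
def fwd (ξ : S) (m T : ℕ) (f : ℕ → S) : ℕ → ℕ → S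
  | 0 => f
  | t + 1 => stF ξ T (tw m (t + 1)) (fwd ξ m T f t)

/-- An inverse stage undoes the stage of the transform with the same exponents, up to a factor
`2`.  The exponents of neighbouring outputs `2 i` and `2 i + 1` differ by `m`, so that the two
roots of unity are negatives of each other. -/
theorem stI_stF {ξ : S} {m T t : ℕ} (hξ : ξ ^ m = -1) (hm : 0 < m) (f : ℕ → S) {o : ℕ}
    (ho : o < 2 * T) : stI ξ m T (tw m (t + 1)) (stF ξ T (tw m (t + 1)) f) o = 2 * f o := by
  have h2 : ξ ^ (2 * m) = 1 := by rw [mul_comm, pow_mul, hξ]; norm_num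
  have hlt := tw_lt hm t
  rw [stI]
  split_ifs with h
  · rw [stF, stF, tw_two_mul, tw_two_mul_add_one, pow_add, hξ,
      Nat.mul_div_cancel_left _ (by norm_num), show (2 * o + 1) / 2 = o by omega]
    ring
  · obtain ⟨i, rfl⟩ : ∃ i, o = T + i := ⟨o - T, by omega⟩
    rw [Nat.add_sub_cancel_left, stF, stF, Nat.mul_div_cancel_left _ (by norm_num),
      show (2 * i + 1) / 2 = i by omega]
    have e1 : ξ ^ (2 * m - tw m (t + 1) (2 * i)) * ξ ^ tw m (t + 1) (2 * i) = 1 := by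
      rw [← pow_add, Nat.sub_add_cancel (tw_lt hm _ _).le, h2]
    have e2 : ξ ^ (2 * m - tw m (t + 1) (2 * i + 1)) * ξ ^ tw m (t + 1) (2 * i + 1) = 1 := by
      rw [← pow_add, Nat.sub_add_cancel (tw_lt hm _ _).le, h2]
    have e3 : ξ ^ (2 * m - tw m (t + 1) (2 * i + 1)) = -ξ ^ (2 * m - tw m (t + 1) (2 * i)) := by
      have := hlt i
      rw [tw_two_mul, tw_two_mul_add_one,
        show 2 * m - tw m t i / 2 = 2 * m - (tw m t i / 2 + m) + m by omega, pow_add, hξ]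
      ring
    have key : ∀ (p p' q q' u v : S), p * q = 1 → p' * q' = 1 → p' = -p →
        p * (u + q * v) + p' * (u + q' * v) = 2 * v := by
      intro p p' q q' u v h1 h2 h3
      linear_combination v * h1 + v * h2 + u * h3
    exact key _ _ _ _ _ _ e1 e2 e3

/-- After `t` stages, the entry `j * 2 ^ t + v` is the `j`-th coefficient of the reduction modulo
`Y ^ (2 T / 2 ^ t) - ξ ^ (tw t v)` of the polynomial with coefficients `f`. -/
theorem fwd_apply {ξ : S} {q l t : ℕ} (hξ : ξ ^ 2 ^ q = -1) (hl : l ≤ q) (f : ℕ → S)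
    (ht : t ≤ l + 1) {j v : ℕ} (hj : j < 2 ^ (l + 1 - t)) (hv : v < 2 ^ t) :
    fwd ξ (2 ^ q) (2 ^ l) f t (j * 2 ^ t + v) =
      ∑ k ∈ Finset.range (2 ^ t), f (j + k * 2 ^ (l + 1 - t)) * ξ ^ (k * tw (2 ^ q) t v) := by
  induction t generalizing j v with
  | zero =>
    obtain rfl : v = 0 := by simpa using hv
    simp [fwd]
  | succ t ih =>
    have h2 : ξ ^ (2 * 2 ^ q) = 1 := by rw [mul_comm, pow_mul, hξ]; norm_num
    have hodd : (j * 2 ^ (t + 1) + v) / 2 = j * 2 ^ t + v / 2 := by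
      rw [show j * 2 ^ (t + 1) + v = v + 2 * (j * 2 ^ t) by ring,
        Nat.add_mul_div_left _ _ (by norm_num)]; ring
    have hT : 2 ^ l + (j * 2 ^ t + v / 2) = (j + 2 ^ (l - t)) * 2 ^ t + v / 2 := by
      have : 2 ^ l = 2 ^ (l - t) * 2 ^ t := by rw [← pow_add]; congr 1; omega
      rw [add_mul, this]; ring
    have he : l + 1 - (t + 1) = l - t := by omega
    have he' : 2 ^ (l + 1 - t) = 2 * 2 ^ (l - t) := by
      rw [show l + 1 - t = l - t + 1 by omega, pow_succ, mul_comm]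
    rw [he] at hj ⊢
    rw [pow_succ] at hv
    have hE : tw (2 ^ q) (t + 1) (j * 2 ^ (t + 1) + v) = tw (2 ^ q) (t + 1) v := by
      rw [add_comm (j * _), tw_add]
    -- twice the new exponent is the old one modulo the order `2 * 2 ^ q` of `ξ`
    have hpow : ξ ^ (2 * tw (2 ^ q) (t + 1) v) = ξ ^ tw (2 ^ q) t (v / 2) := by
      have hd : 2 ∣ tw (2 ^ q) t (v / 2) :=
        (dvd_pow_self 2 (by omega)).trans (tw_dvd q t (v / 2) (by omega))
      rw [tw, mul_add, Nat.mul_div_cancel' hd, pow_add, mul_left_comm, mul_comm (v % 2), pow_mul,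
        h2, one_pow, mul_one]
    rw [fwd, stF, hE, hodd, hT, ih (by omega) (by omega) (by omega),
      ih (by omega) (by omega) (by omega), he', pow_succ, mul_comm (2 ^ t) 2, two_mul (2 ^ t),
      ← two_mul]
    have hsum : ∀ g : ℕ → S, ∑ k ∈ Finset.range (2 * 2 ^ t), g k =
        ∑ k ∈ Finset.range (2 ^ t), (g (2 * k) + g (2 * k + 1)) := by
      intro g
      induction 2 ^ t with
      | zero => simp
      | succ n ihn =>
        rw [Finset.sum_range_succ, ← ihn, show 2 * (n + 1) = 2 * n + 1 + 1 by ring,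
          Finset.sum_range_succ, Finset.sum_range_succ, add_assoc]
    rw [hsum, Finset.mul_sum, ← Finset.sum_add_distrib]
    refine Finset.sum_congr rfl fun k _ => ?_
    have e1 : ξ ^ (2 * k * tw (2 ^ q) (t + 1) v) = ξ ^ (k * tw (2 ^ q) t (v / 2)) := by
      rw [mul_comm 2 k, mul_assoc, mul_comm k, pow_mul, hpow, ← pow_mul, mul_comm k]
    have e2 : ξ ^ ((2 * k + 1) * tw (2 ^ q) (t + 1) v) =
        ξ ^ (k * tw (2 ^ q) t (v / 2)) * ξ ^ tw (2 ^ q) (t + 1) v := by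
      rw [add_mul (2 * k), one_mul, pow_add, e1]
    rw [e1, e2]
    ring_nf

/-- The full transform is multiplicative: it sends the product of two polynomials of degree less
than `T` to the product of their values. -/
theorem fwd_mul {ξ : S} {q l : ℕ} (hξ : ξ ^ 2 ^ q = -1) (hl : l ≤ q) (P Q : S[X])
    (hP : P.natDegree < 2 ^ l) (hQ : Q.natDegree < 2 ^ l) {v : ℕ} (hv : v < 2 ^ (l + 1)) :
    fwd ξ (2 ^ q) (2 ^ l) (P * Q).coeff (l + 1) v =
      fwd ξ (2 ^ q) (2 ^ l) P.coeff (l + 1) v * fwd ξ (2 ^ q) (2 ^ l) Q.coeff (l + 1) v := by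
  have key : ∀ R : S[X], R.natDegree < 2 ^ (l + 1) →
      fwd ξ (2 ^ q) (2 ^ l) R.coeff (l + 1) v = R.eval (ξ ^ tw (2 ^ q) (l + 1) v) := by
    intro R hR
    have := fwd_apply hξ hl R.coeff le_rfl (j := 0) (by simp) hv
    rw [zero_mul, zero_add] at this
    rw [this, eval_eq_sum_range' hR]
    refine Finset.sum_congr rfl fun k _ => ?_
    rw [← pow_mul, mul_comm k]; simp [mul_comm k]
  have h2 : 2 ^ (l + 1) = 2 ^ l + 2 ^ l := by ring
  rw [key _ (natDegree_mul_le.trans_lt (by omega)), key _ (by omega), key _ (by omega), eval_mul]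

end Nega

/-! ### The levels of the transform -/

namespace Nega

open Polynomial

variable {K : Type*} [CommRing K]

/-- The `i`-th block of length `m` of a sequence. -/
def blk (m : ℕ) (X : ℕ → K) (i l : ℕ) : K := X (i * m + l)

/-- Every block of length `T * m` is spread over `2 * T` blocks of length `m`: the coefficients
whose index is `j` modulo `T` go to the blocks `2 * j` and `2 * j + 1`.  This is the first stage of
the transform of the sequence of blocks, padded with zeros. -/
def spread (m T : ℕ) (X : ℕ → K) (p : ℕ) : K :=
  X (p / m / (2 * T) * (T * m) + p / m % (2 * T) / 2 + T * (p % m))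

/-- A stage of the transform within each group of `2 * T` blocks of length `m`. -/
def fstage (m T : ℕ) (E : ℕ → ℕ) (X : ℕ → K) (p : ℕ) : K :=
  ext m (blk m X (p / m / (2 * T) * (2 * T) + p / m % (2 * T) / 2)) (2 * m + p % m) +
  ext m (blk m X (p / m / (2 * T) * (2 * T) + T + p / m % (2 * T) / 2))
    (2 * m - E (p / m % (2 * T)) + p % m)

/-- A stage of the inverse transform within each group of `2 * T` blocks of length `m`. -/
def istage (m T : ℕ) (E : ℕ → ℕ) (X : ℕ → K) (p : ℕ) : K :=
  if p / m % (2 * T) < T then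
    ext m (blk m X (p / m / (2 * T) * (2 * T) + 2 * (p / m % (2 * T)))) (2 * m + p % m) +
    ext m (blk m X (p / m / (2 * T) * (2 * T) + 2 * (p / m % (2 * T)) + 1)) (2 * m + p % m)
  else
    ext m (blk m X (p / m / (2 * T) * (2 * T) + 2 * (p / m % (2 * T) - T)))
      (E (2 * (p / m % (2 * T) - T)) + p % m) +
    ext m (blk m X (p / m / (2 * T) * (2 * T) + 2 * (p / m % (2 * T) - T) + 1))
      (E (2 * (p / m % (2 * T) - T) + 1) + p % m)

/-- The blocks `c 0, …, c (2 T - 1)` of length `m` of each group are assembled to the block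
of length `T * m` representing `∑ y ^ k * c k`, where `x = y ^ T`. -/
def merge (m T : ℕ) (X : ℕ → K) (p : ℕ) : K :=
  ext m (blk m X (p / T / m * (2 * T) + p % T)) (2 * m + p / T % m) +
  ext m (blk m X (p / T / m * (2 * T) + T + p % T)) (2 * m - 1 + p / T % m)

/-- The forward transform of one level, after `t + 1` stages. -/
def fwds (m T : ℕ) (X : ℕ → K) : ℕ → ℕ → K
  | 0 => spread m T X
  | t + 1 => fstage m T (tw m (t + 2)) (fwds m T X t)

/-- The first `t` of the `n` stages of the inverse transform of one level. -/
def invs (m T n : ℕ) (Z : ℕ → K) : ℕ → ℕ → K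
  | 0 => Z
  | t + 1 => istage m T (tw m (n - t)) (invs m T n Z t)

theorem mul_add_div_of_lt {a l m : ℕ} (h : l < m) : (a * m + l) / m = a := by
  rw [mul_comm, Nat.mul_add_div (by omega), Nat.div_eq_of_lt h, add_zero]

theorem mul_add_mod_of_lt {a l m : ℕ} (h : l < m) : (a * m + l) % m = l := by
  rw [mul_comm, Nat.mul_add_mod, Nat.mod_eq_of_lt h]

theorem fstage_apply {m T g o l : ℕ} (E : ℕ → ℕ) (X : ℕ → K) (ho : o < 2 * T) (hl : l < m) :
    fstage m T E X ((g * (2 * T) + o) * m + l) =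
      ext m (blk m X (g * (2 * T) + o / 2)) (2 * m + l) +
      ext m (blk m X (g * (2 * T) + T + o / 2)) (2 * m - E o + l) := by
  simp only [fstage, mul_add_div_of_lt hl, mul_add_mod_of_lt hl, mul_add_div_of_lt ho,
    mul_add_mod_of_lt ho]

theorem istage_apply_lt {m T g o l : ℕ} (E : ℕ → ℕ) (X : ℕ → K) (ho : o < T) (hl : l < m) :
    istage m T E X ((g * (2 * T) + o) * m + l) =
      ext m (blk m X (g * (2 * T) + 2 * o)) (2 * m + l) +
      ext m (blk m X (g * (2 * T) + 2 * o + 1)) (2 * m + l) := by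
  have ho' : o < 2 * T := by omega
  simp only [istage, mul_add_div_of_lt hl, mul_add_mod_of_lt hl, mul_add_div_of_lt ho',
    mul_add_mod_of_lt ho', if_pos ho]

theorem istage_apply_ge {m T g o l : ℕ} (E : ℕ → ℕ) (X : ℕ → K) (ho : o < T) (hl : l < m) :
    istage m T E X ((g * (2 * T) + (T + o)) * m + l) =
      ext m (blk m X (g * (2 * T) + 2 * o)) (E (2 * o) + l) +
      ext m (blk m X (g * (2 * T) + 2 * o + 1)) (E (2 * o + 1) + l) := by
  have ho' : T + o < 2 * T := by omega
  simp only [istage, mul_add_div_of_lt hl, mul_add_mod_of_lt hl, mul_add_div_of_lt ho',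
    mul_add_mod_of_lt ho', if_neg (show ¬ T + o < T by omega), Nat.add_sub_cancel_left]

theorem merge_apply {m T g j l : ℕ} (X : ℕ → K) (hj : j < T) (hl : l < m) :
    merge m T X (g * (T * m) + (l * T + j)) =
      ext m (blk m X (g * (2 * T) + j)) (2 * m + l) +
      ext m (blk m X (g * (2 * T) + T + j)) (2 * m - 1 + l) := by
  have h : g * (T * m) + (l * T + j) = (g * m + l) * T + j := by ring
  simp only [merge, h, mul_add_div_of_lt hl, mul_add_mod_of_lt hl, mul_add_div_of_lt hj,
    mul_add_mod_of_lt hj]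

theorem spread_apply {K : Type*} {m T g o l : ℕ} (X : ℕ → K) (ho : o < 2 * T) (hl : l < m) :
    spread m T X ((g * (2 * T) + o) * m + l) = X (g * (T * m) + o / 2 + T * l) := by
  simp only [spread, mul_add_div_of_lt hl, mul_add_mod_of_lt hl, mul_add_div_of_lt ho,
    mul_add_mod_of_lt ho]

theorem el_ext_two_mul {m : ℕ} (hm : 0 < m) (u : ℕ → K) :
    el m (fun l => ext m u (2 * m + l)) = el m u := by
  simpa using el_ext hm (Nat.zero_le (2 * m)) u

theorem el_ext_of_le {m e : ℕ} (hm : 0 < m) (he : e ≤ 2 * m) (u : ℕ → K) :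
    el m (fun l => ext m u (e + l)) = x K m ^ (2 * m - e) * el m u := by
  rw [← el_ext hm (Nat.sub_le _ _) u, Nat.sub_sub_self he]

theorem el_fstage {m T g o : ℕ} (hm : 0 < m) {E : ℕ → ℕ} (hE : ∀ o, E o ≤ 2 * m) (X : ℕ → K)
    (ho : o < 2 * T) :
    el m (blk m (fstage m T E X) (g * (2 * T) + o)) =
      stF (x K m) T E (fun i => el m (blk m X (g * (2 * T) + i))) o := by
  rw [stF, ← el_ext hm (hE o), ← el_ext_two_mul hm (blk m X (g * (2 * T) + o / 2)), ← el_add]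
  refine el_congr fun l hl => ?_
  rw [blk, fstage_apply E X ho hl, add_assoc _ T]

theorem el_istage {m T g o : ℕ} (hm : 0 < m) {E : ℕ → ℕ} (hE : ∀ o, E o ≤ 2 * m) (X : ℕ → K)
    (ho : o < 2 * T) :
    el m (blk m (istage m T E X) (g * (2 * T) + o)) =
      stI (x K m) m T E (fun i => el m (blk m X (g * (2 * T) + i))) o := by
  rw [stI]
  split_ifs with h
  · rw [← el_ext_two_mul hm (blk m X (g * (2 * T) + 2 * o)),
      ← el_ext_two_mul hm (blk m X (g * (2 * T) + (2 * o + 1))), ← el_add]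
    exact el_congr fun l hl => by rw [blk, istage_apply_lt E X h hl, add_assoc _ (2 * o)]
  · obtain ⟨i, rfl⟩ : ∃ i, o = T + i := ⟨o - T, by omega⟩
    rw [Nat.add_sub_cancel_left, ← el_ext_of_le hm (hE _), ← el_ext_of_le hm (hE _), ← el_add]
    exact el_congr fun l hl => by
      rw [blk, istage_apply_ge E X (by omega) hl, add_assoc _ (2 * i)]

/-- The coefficients with respect to the powers of `y`, as elements of `K[x] / (x ^ m + 1)`, of the
element of `K[y] / (y ^ (T * m) + 1)` given by a block of length `T * m`, where `x = y ^ T`. -/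
noncomputable def coef (m T : ℕ) (u : ℕ → K) (j : ℕ) : Ring K m :=
  if j < T then el m (fun l => u (j + T * l)) else 0

/-- The forward passes over the coefficients compute the transform of the sequence of elements of
`K[x] / (x ^ m + 1)` given by the blocks. -/
theorem el_fwds {m T g o : ℕ} (hm : 0 < m) (X : ℕ → K) (t : ℕ) (ho : o < 2 * T) :
    el m (blk m (fwds m T X t) (g * (2 * T) + o)) =
      fwd (x K m) m T (coef m T (blk (T * m) X g)) (t + 1) o := by
  induction t generalizing o with
  | zero =>
    rw [fwds, fwd, fwd, stF, coef, if_pos (by omega), coef, if_neg (by omega), mul_zero, add_zero]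
    refine el_congr fun l hl => ?_
    rw [blk, spread_apply X ho hl, blk, add_assoc]
  | succ t ih =>
    rw [fwds, el_fstage hm (fun o => (tw_lt hm _ o).le) _ ho, fwd, stF, stF, ih (by omega),
      ih (by omega)]

theorem stI_const_mul {S : Type*} [CommRing S] (ξ κ : S) (m T : ℕ) (E : ℕ → ℕ) {f f' : ℕ → S}
    (h : ∀ o < 2 * T, f' o = κ * f o) {o : ℕ} (ho : o < 2 * T) :
    stI ξ m T E f' o = κ * stI ξ m T E f o := by
  simp only [stI]
  split_ifs with hT
  · rw [h _ (by omega), h _ (by omega)]; ring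
  · rw [h _ (by omega), h _ (by omega)]; ring

/-- The inverse passes undo the stages of the transform one by one, each up to a factor `2`. -/
theorem el_invs {m T g n : ℕ} (hm : 0 < m) (Z : ℕ → K) (κ : Ring K m) (f : ℕ → Ring K m)
    (h : ∀ o < 2 * T, el m (blk m Z (g * (2 * T) + o)) = κ * fwd (x K m) m T f n o)
    {t o : ℕ} (ht : t ≤ n) (ho : o < 2 * T) :
    el m (blk m (invs m T n Z t) (g * (2 * T) + o)) =
      κ * 2 ^ t * fwd (x K m) m T f (n - t) o := by
  induction t generalizing o with
  | zero => simpa [invs] using h o ho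
  | succ t ih =>
    rw [invs, el_istage hm (fun o => (tw_lt hm _ o).le) _ ho,
      stI_const_mul _ (κ * 2 ^ t) m T _ (fun o ho => ih (by omega) ho) ho,
      show n - t = n - (t + 1) + 1 by omega]
    conv_lhs => rw [fwd]
    rw [stI_stF (x_pow m) hm _ ho]
    ring

theorem sum_range_mul {A : Type*} [AddCommMonoid A] (T m : ℕ) (F : ℕ → A) :
    ∑ i ∈ Finset.range (T * m), F i =
      ∑ l ∈ Finset.range m, ∑ j ∈ Finset.range T, F (l * T + j) := by
  induction m with
  | zero => simp
  | succ m ih =>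
    rw [Nat.mul_succ, Finset.sum_range_add, ih, Finset.sum_range_succ, mul_comm T m]

/-- The inclusion of `K[x] / (x ^ m + 1)` into `K[y] / (y ^ (T * m) + 1)` with `x = y ^ T`. -/
noncomputable def incl (m T : ℕ) : Ring K m →+* Ring K (T * m) :=
  AdjoinRoot.lift (AdjoinRoot.of _) (x K (T * m) ^ T) (by
    rw [eval₂_add, eval₂_pow, eval₂_X, eval₂_one, ← pow_mul, x_pow]; ring)

theorem incl_el (m T : ℕ) (u : ℕ → K) :
    incl m T (el m u) =
      ∑ l ∈ Finset.range m, AdjoinRoot.of _ (u l) * x K (T * m) ^ (T * l) := by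
  rw [el, map_sum]
  refine Finset.sum_congr rfl fun l _ => ?_
  rw [map_mul, map_pow, incl, AdjoinRoot.lift_of, AdjoinRoot.lift_root, pow_mul (x K (T * m))]

theorem el_eq_sum_incl (m T : ℕ) (u : ℕ → K) :
    el (T * m) u = ∑ j ∈ Finset.range T,
      x K (T * m) ^ j * incl m T (el m (fun l => u (j + T * l))) := by
  rw [el, sum_range_mul, Finset.sum_comm]
  refine Finset.sum_congr rfl fun j _ => ?_
  rw [incl_el, Finset.mul_sum]
  refine Finset.sum_congr rfl fun l _ => ?_
  rw [mul_comm l T, add_comm (T * l), pow_add]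
  ring

/-- Assembling the blocks evaluates the polynomial with coefficients `c 0, …, c (2 T - 1)` at `y`:
the upper half of the coefficients is multiplied by `y ^ T = x`, a shift within the blocks. -/
theorem el_merge {m T g : ℕ} (hm : 0 < m) (X : ℕ → K) :
    el (T * m) (blk (T * m) (merge m T X) g) = ∑ k ∈ Finset.range (2 * T),
      x K (T * m) ^ k * incl m T (el m (blk m X (g * (2 * T) + k))) := by
  rw [el_eq_sum_incl, two_mul T, Finset.sum_range_add, ← Finset.sum_add_distrib]
  refine Finset.sum_congr rfl fun j hj => ?_
  have hj := Finset.mem_range.1 hj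
  have h1 : el m (fun l => blk (T * m) (merge m T X) g (j + T * l)) =
      el m (blk m X (g * (T + T) + j)) + x K m * el m (blk m X (g * (T + T) + (T + j))) := by
    rw [← el_ext_two_mul hm (blk m X (g * (T + T) + j))]
    conv_rhs => rw [← pow_one (x K m), ← el_ext hm (show 1 ≤ 2 * m by omega), ← el_add]
    refine el_congr fun l hl => ?_
    rw [blk, show j + T * l = l * T + j by ring, merge_apply X hj hl, two_mul T, add_assoc _ T j]
  have h2 : incl m T (x K m) = x K (T * m) ^ T := AdjoinRoot.lift_root _
  rw [h1, map_add, map_mul, h2, pow_add]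
  ring

/-- An element of `K[y] / (y ^ (T * m) + 1)` is the value at `y` of a polynomial of degree less than
`T` over `K[x] / (x ^ m + 1)`, where `x = y ^ T`. -/
theorem coef_sum (m T : ℕ) (u : ℕ → K) :
    ∃ P : (Ring K m)[X], (0 < T → P.natDegree < T) ∧ P.coeff = coef m T u ∧
      P.eval₂ (incl m T) (x K (T * m)) = el (T * m) u := by
  classical
  let P : (Ring K m)[X] := ∑ j ∈ Finset.range T, C (el m (fun l => u (j + T * l))) * X ^ j
  refine ⟨P, fun hT => ?_, ?_, ?_⟩
  · refine lt_of_le_of_lt (b := T - 1) (natDegree_sum_le_of_forall_le _ _ fun j hj => ?_) (by omega)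
    exact (natDegree_C_mul_X_pow_le _ _).trans (by have := Finset.mem_range.1 hj; omega)
  · funext j
    simp only [P, finsetSum_coeff, coeff_C_mul_X_pow, coef]
    rw [Finset.sum_ite_eq]
    simp
  · rw [el_eq_sum_incl, eval₂_finsetSum]
    refine Finset.sum_congr rfl fun j _ => ?_
    rw [eval₂_mul, eval₂_C, eval₂_X_pow, mul_comm (incl m T _)]

/-- One level of the algorithm: if the blocks of `Z` are, up to the factor `κ`, the products of the
corresponding blocks of the transforms of the operands, which occupy the first and the second half
of `X`, then the inverse transform of `Z` consists of the products of the blocks of `X`. -/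
theorem el_level {q l g G : ℕ} (hl : l ≤ q) (X Z : ℕ → K) (κ : ℕ)
    (h : ∀ o < 2 * 2 ^ l, el (2 ^ q) (blk (2 ^ q) Z (g * (2 * 2 ^ l) + o)) =
      κ * el (2 ^ q) (blk (2 ^ q) (fwds (2 ^ q) (2 ^ l) X l) (g * (2 * 2 ^ l) + o)) *
        el (2 ^ q) (blk (2 ^ q) (fwds (2 ^ q) (2 ^ l) X l) ((G + g) * (2 * 2 ^ l) + o))) :
    el (2 ^ l * 2 ^ q) (blk (2 ^ l * 2 ^ q)
      (merge (2 ^ q) (2 ^ l) (invs (2 ^ q) (2 ^ l) (l + 1) Z (l + 1))) g) =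
      (κ * 2 ^ (l + 1) : ℕ) * el (2 ^ l * 2 ^ q) (blk (2 ^ l * 2 ^ q) X g) *
        el (2 ^ l * 2 ^ q) (blk (2 ^ l * 2 ^ q) X (G + g)) := by
  have hm : 0 < 2 ^ q := by positivity
  have hT : 0 < 2 ^ l := by positivity
  obtain ⟨P, hPd, hPc, hPe⟩ := coef_sum (2 ^ q) (2 ^ l) (blk (2 ^ l * 2 ^ q) X g)
  obtain ⟨Q, hQd, hQc, hQe⟩ := coef_sum (2 ^ q) (2 ^ l) (blk (2 ^ l * 2 ^ q) X (G + g))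
  have h' : ∀ o < 2 * 2 ^ l, el (2 ^ q) (blk (2 ^ q) Z (g * (2 * 2 ^ l) + o)) =
      (κ : Ring K (2 ^ q)) * fwd (x K (2 ^ q)) (2 ^ q) (2 ^ l) (P * Q).coeff (l + 1) o := by
    intro o ho
    rw [h o ho, el_fwds hm X l ho, el_fwds hm X l ho, ← hPc, ← hQc,
      fwd_mul (x_pow _) hl P Q (hPd hT) (hQd hT) (by rw [pow_succ']; exact ho), mul_assoc]
  rw [el_merge hm, ← hPe, ← hQe, mul_assoc, ← eval₂_mul,
    eval₂_eq_sum_range' _ (show (P * Q).natDegree < 2 * 2 ^ l by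
      have := hPd hT; have := hQd hT
      exact natDegree_mul_le.trans_lt (by omega)), Finset.mul_sum]
  refine Finset.sum_congr rfl fun k hk => ?_
  rw [el_invs hm Z κ (P * Q).coeff h' le_rfl (Finset.mem_range.1 hk), Nat.sub_self, fwd, map_mul,
    map_mul, map_pow, map_natCast, map_ofNat]
  push_cast
  ring

end Nega

/-! ### Reading antiperiodic sequences -/

namespace RAM

open Nega

/-!
Registers and arrays are numbers; the ones used in the multiplication of polynomials have names.
Register `rM` holds the modulus `M` of the coefficients.  On each level, `vm`, `vmm` hold the length
`m` of the blocks and `2 m`, `vT`, `vTT`, `vTm` hold `T`, `2 T` and `T m`, `vnb` holds the number of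
groups of blocks.  The entries to be added are read from the blocks of `aX` at the addresses `va`,
`va'`, at the positions `vd`, `vd'` of their antiperiodic extensions; their values go to `vx`, `vx'`,
and the sum goes to position `vp` of `aY`.  The addresses of the current group and block are `vg` and
`vi`; `ve` is a position in the array `aW` of exponents, and `vtb` is the position where those of the
current stage start.  The counters of nested loops are `kl`, `ki`, `kg`, `ks`, `kv`, from the inside
out.
-/

notation "rM" => 2
notation "vm" => 10
notation "vmm" => 11
notation "vT" => 12
notation "vTT" => 13
notation "vTm" => 14
notation "vnb" => 17
notation "vp" => 21
notation "va" => 22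
notation "va'" => 23
notation "vd" => 24
notation "vd'" => 25
notation "vx" => 26
notation "vx'" => 27
notation "kl" => 35
notation "ki" => 36
notation "kg" => 37
notation "ks" => 38
notation "kv" => 39
notation "vg" => 29
notation "vi" => 30
notation "ve" => 31
notation "vtb" => 32
notation "aX" => 0
notation "aY" => 1
notation "aW" => 2

/-- The first `n` cells of array `a` hold representatives of `G 0, …, G (n - 1)` that are at most
`M`. -/
def Pre (M : ℕ) (s : State) (a : ℕ) (G : ℕ → ZMod M) (n : ℕ) : Prop :=
  ∀ p < n, s.arr a p ≤ M ∧ ((s.arr a p : ℕ) : ZMod M) = G p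

theorem Pre.frame {M : ℕ} {s s' : State} {a n : ℕ} {G : ℕ → ZMod M} (h : Pre M s a G n)
    (hs : s'.arr a = s.arr a) : Pre M s' a G n := fun p hp => by rw [hs]; exact h p hp

@[simp] theorem pre_set {M : ℕ} {s : State} {x v a n : ℕ} {G : ℕ → ZMod M} :
    Pre M (s.set x v) a G n ↔ Pre M s a G n := Iff.rfl

/-- Set `x` to the value at `d` of the antiperiodic extension of the `m` cells of `aX` from `a` on,
for `d < 3 * m`. -/
def rd (x a d : ℕ) : Prog :=
  block [.sub 0 vmm d] ;;
  .ite 0 (block [.sub 0 vm d] ;;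
      .ite 0 (block [.add 0 a d, .load x aX 0])
        (block [.sub 0 d vm, .add 0 a 0, .load x aX 0, .sub x rM x]))
    (block [.sub 0 d vmm, .add 0 a 0, .load x aX 0])

variable {M w : ℕ}

theorem rd_spec {x a d m : ℕ} {s : State} {X : ℕ → ZMod M} (hx : x ≠ rM) (ha : a ≠ 0) (hd : d ≠ 0)
    (hM : s.reg rM = M) (hm : s.reg vm = m) (hmm : s.reg vmm = 2 * m) (hdm : s.reg d < 3 * m)
    (haw : s.reg a + m < 2 ^ w)
    (hX : ∀ l < m, s.arr aX (s.reg a + l) ≤ M ∧ (s.arr aX (s.reg a + l) : ZMod M) = X l) :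
    Runs w (rd x a d) 12 s fun s' =>
      s'.reg x ≤ M ∧ (s'.reg x : ZMod M) = ext m X (s.reg d) := by
  apply Runs.of_le
  · apply Runs.block_seq
    · simp
    apply Runs.ite
    · intro h
      simp [hd, hmm] at h
      apply Runs.block_seq
      · simp
      apply Runs.ite
      · intro h'
        simp [hd, hm] at h'
        apply Runs.block
        · simp [ha, hd]; omega
        · simp [ha, hd]
          rw [ext_of_lt _ (by omega)]
          exact hX _ (by omega)
      · intro h'
        simp [hd, hm] at h'
        apply Runs.block
        · simp [ha, hd, hm]; omega
        · simp [ha, hd, hx.symm, hm, hM]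
          rw [ext_of_ge _ (by omega) (by omega)]
          have := hX (s.reg d - m) (by omega)
          rw [Nat.cast_sub this.1, this.2]
          simp
    · intro h
      simp [hd, hmm] at h
      apply Runs.block
      · simp [ha, hd, hmm]; omega
      · simp [ha, hd, hmm]
        have := ext_add_two_mul m (s.reg d - 2 * m) X
        rw [Nat.sub_add_cancel (by omega)] at this
        rw [this, ext_of_lt _ (by omega)]
        exact hX _ (by omega)
  · simp

/-- Write the sum of the two entries described by `va`, `vd` and by `va'`, `vd'` at position `vp`
of `aY`. -/
def step : Prog :=
  rd vx va vd ;; rd vx' va' vd' ;; block [.add vx vx vx', .sub 0 vx rM] ;;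
  .ite 0 (block [.copy vx 0]) .skip ;; block [.store aY vp vx, .const 0 1, .add vp vp 0]

/-- The hypotheses under which an entry can be read: the modulus, the block length, and the block of
`aX` at the address in register `a`, with contents `X`. -/
structure RdOK (M w m : ℕ) (s : State) (a d : ℕ) (X : ℕ → ZMod M) : Prop where
  hd : s.reg d < 3 * m
  haw : s.reg a + m < 2 ^ w
  hX : ∀ l < m, s.arr aX (s.reg a + l) ≤ M ∧ (s.arr aX (s.reg a + l) : ZMod M) = X l

theorem step_spec {m : ℕ} {s : State} {X X' G : ℕ → ZMod M} (hw : 0 < w)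
    (hM : s.reg rM = M) (hm : s.reg vm = m) (hmm : s.reg vmm = 2 * m)
    (h : RdOK M w m s va vd X) (h' : RdOK M w m s va' vd' X') (hMw : 2 * M < 2 ^ w)
    (hp : s.reg vp + 1 < 2 ^ w) (hY : Pre M s aY G (s.reg vp))
    (hG : G (s.reg vp) = ext m X (s.reg vd) + ext m X' (s.reg vd')) :
    Runs w step 40 s fun s' => s'.reg vp = s.reg vp + 1 ∧ Pre M s' aY G (s.reg vp + 1) := by
  apply Runs.of_le
  · apply Runs.call_seq (rd_spec (by decide) (by decide) (by decide) hM hm hmm h.hd h.haw h.hX)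
    intro s1 f1 ⟨hx1, hx2⟩
    have hX' : s1.arr aX = s.arr aX := f1.arr _ (by decide)
    apply Runs.call_seq (rd_spec (X := X') (by decide) (by decide) (by decide)
      ((f1.reg _ (by decide)).trans hM) ((f1.reg _ (by decide)).trans hm)
      ((f1.reg _ (by decide)).trans hmm) (by rw [f1.reg _ (by decide)]; exact h'.hd)
      (by rw [f1.reg _ (by decide)]; exact h'.haw)
      (by rw [f1.reg _ (by decide), hX']; exact h'.hX))
    intro s2 f2 ⟨hy1, hy2⟩
    have e1 : s2.reg vx = s1.reg vx := f2.reg _ (by decide)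
    have e2 : s2.reg rM = M := by rw [f2.reg _ (by decide), f1.reg _ (by decide), hM]
    have e3 : s2.reg vp = s.reg vp := by rw [f2.reg _ (by decide), f1.reg _ (by decide)]
    have e4 : s2.arr aY = s.arr aY := by rw [f2.arr _ (by decide), f1.arr _ (by decide)]
    rw [f1.reg vd' (by decide)] at hy2
    apply Runs.block_seq
    · simp [e1]; omega
    apply Runs.call_seq (Q₁ := fun s' => s'.reg vx ≤ M ∧ (s'.reg vx : ZMod M) = G (s.reg vp))
    · apply Runs.ite
      · intro hne
        simp [e1, e2] at hne
        apply Runs.block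
        · simp
        · simp [e1, e2]
          refine ⟨by omega, ?_⟩
          rw [Nat.cast_sub (by omega), Nat.cast_add, hx2, hy2, hG]
          simp
      · intro hz
        simp [e1, e2] at hz
        apply Runs.skip
        simp [e1, e2]
        exact ⟨by omega, by rw [hx2, hy2, hG]⟩
    · intro s3 f3 ⟨hz1, hz2⟩
      have e5 : s3.reg vp = s.reg vp := by rw [f3.reg _ (by decide)]; simp [e3]
      have e6 : s3.arr aY = s.arr aY := by rw [f3.arr _ (by decide)]; simp [e4]
      apply Runs.block
      · simp [e5]; omega
      · simp [e5, Pre, e6]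
        intro p hpp
        split_ifs with hpe
        · subst hpe; exact ⟨hz1, hz2⟩
        · exact hY p (by omega)
  · simp

/-- Write `m` consecutive entries of `aY`, each the sum of entries of two blocks of `aX`, read from
the positions in `vd` and `vd'` on. -/
def comb : Prog :=
  forN kl vm (step ;; block [.const 0 1, .add vd vd 0, .add vd' vd' 0])

theorem comb_spec {m : ℕ} {s : State} {X X' G : ℕ → ZMod M} (hw : 0 < w)
    (hM : s.reg rM = M) (hm : s.reg vm = m) (hmm : s.reg vmm = 2 * m)
    (hd : s.reg vd ≤ 2 * m) (hd' : s.reg vd' ≤ 2 * m) (ha : s.reg va + m < 2 ^ w)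
    (ha' : s.reg va' + m < 2 ^ w)
    (hX : ∀ l < m, s.arr aX (s.reg va + l) ≤ M ∧ (s.arr aX (s.reg va + l) : ZMod M) = X l)
    (hX' : ∀ l < m, s.arr aX (s.reg va' + l) ≤ M ∧ (s.arr aX (s.reg va' + l) : ZMod M) = X' l)
    (hMw : 2 * M < 2 ^ w) (hmw : 3 * m + 1 < 2 ^ w)
    (hp : s.reg vp + m < 2 ^ w) (hY : Pre M s aY G (s.reg vp))
    (hG : ∀ l < m, G (s.reg vp + l) = ext m X (s.reg vd + l) + ext m X' (s.reg vd' + l)) :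
    Runs w comb (m * 48 + 3) s fun s' =>
      s'.reg vp = s.reg vp + m ∧ Pre M s' aY G (s.reg vp + m) := by
  apply Runs.forN (N := 44) (fun i s' => s'.reg vp = s.reg vp + i ∧ s'.reg vd = s.reg vd + i ∧
    s'.reg vd' = s.reg vd' + i ∧ Pre M s' aY G (s.reg vp + i)) hm (by decide) hw
  · simpa [Pre] using hY
  · intro i s1 hi hk f ⟨i1, i2, i3, i4⟩
    have g1 : s1.reg va = s.reg va := f.reg _ (by decide)
    have g2 : s1.reg va' = s.reg va' := f.reg _ (by decide)
    have g3 : s1.arr aX = s.arr aX := f.arr _ (by decide)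
    apply Runs.of_le
    · apply Runs.call_seq (step_spec hw (X := X) (X' := X') (G := G) ((f.reg _ (by decide)).trans hM)
        ((f.reg _ (by decide)).trans hm) ((f.reg _ (by decide)).trans hmm)
        ⟨by omega, by rwa [g1], by rwa [g1, g3]⟩ ⟨by omega, by rwa [g2], by rwa [g2, g3]⟩ hMw
        (by omega) (by rwa [i1]) (by rw [i1, i2, i3]; exact hG i hi))
      intro s2 f2 ⟨j1, j2⟩
      have h1 : s2.reg vd = s.reg vd + i := (f2.reg _ (by decide)).trans i2
      have h2 : s2.reg vd' = s.reg vd' + i := (f2.reg _ (by decide)).trans i3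
      have h3 : s2.reg kl = m - i := (f2.reg _ (by decide)).trans hk
      rw [i1] at j1 j2
      apply Runs.block
      · simp [h1, h2]; omega
      · simp [h1, h2, h3, j1, add_assoc]
        exact j2
    · simp
  · intro s' f hz ⟨i1, i2, i3, i4⟩
    exact ⟨i1, i4⟩

end RAM

/-! ### The passes over the data -/

namespace RAM

open Nega

variable {M w m T nb tb : ℕ}

/-- The number of entries of the data. -/
notation "vtot" => 18

/-- The registers describing the current level: `nb` groups, each of `2 * T` blocks of length
`m`. -/
structure Lev (M m T nb : ℕ) (s : State) : Prop where
  hM : s.reg rM = M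
  hm : s.reg vm = m
  hmm : s.reg vmm = 2 * m
  hT : s.reg vT = T
  hTm : s.reg vTm = T * m
  hnb : s.reg vnb = nb

theorem Lev.frame {p : Prog} {s s' : State} (h : Lev M m T nb s) (f : Frame p s s')
    (hp : ∀ x ∈ [rM, vm, vmm, vT, vTm, vnb], x ∉ wregs p) : Lev M m T nb s' := by
  simp only [List.forall_mem_cons] at hp
  obtain ⟨h1, h2, h3, h4, h5, h6, -⟩ := hp
  exact ⟨(f.reg _ h1).trans h.hM, (f.reg _ h2).trans h.hm, (f.reg _ h3).trans h.hmm,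
    (f.reg _ h4).trans h.hT, (f.reg _ h5).trans h.hTm, (f.reg _ h6).trans h.hnb⟩

/-- The numbers occurring in a level fit into words. -/
structure LevB (M w m T nb : ℕ) : Prop where
  hw : 0 < w
  hM : 2 * M < 2 ^ w
  hm : 3 * m + 1 < 2 ^ w
  hm0 : 0 < m
  hT0 : 0 < T
  htot : nb * (2 * T) * m < 2 ^ w

theorem addr_le {g i n m nb : ℕ} (hg : g < nb) (hi : i < n) : (g * n + i) * m + m ≤ nb * n * m := by
  have h1 : g * n + i + 1 ≤ nb * n := by nlinarith [Nat.mul_le_mul_right n hg]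
  calc (g * n + i) * m + m = (g * n + i + 1) * m := by ring
    _ ≤ nb * n * m := Nat.mul_le_mul_right _ h1

/-- The distance between the addresses of consecutive groups. -/
notation "vgs" => 33

/-- Run `p` for each of the groups, with the address of the group in `vg`.  The stride of these
addresses is the contents of `vTm` plus those of `z`. -/
def groups (z : ℕ) (p : Prog) : Prog :=
  block [.const vp 0, .const vg 0, .add vgs vTm z] ;; forN kg vnb (p ;; block [.add vg vg vgs])

/-- The rule for a loop over the groups, where each group occupies `st` entries of `aX` and yields
`S` entries of `aY`.  A group has `2 * T * m` entries in the transformed data and `T * m` entries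
before the transform. -/
theorem groups_spec {z st S N : ℕ} {p : Prog} {s : State} {G : ℕ → ZMod M} (L : Lev M m T nb s)
    (B : LevB M w m T nb) (hz : z = vTm ∧ st = 2 * T * m ∨ z = vp ∧ st = T * m)
    (hst : st < 2 ^ w) (hst' : nb * st < 2 ^ w)
    (hr : ∀ x ∈ [rM, vm, vmm, vT, vTm, vnb, vg, vgs, kg, vtb], x ∉ wregs p)
    (ha : ∀ a ∈ [aX, aW], a ∉ warrs p)
    (hp : ∀ g s', g < nb → Lev M m T nb s' → s'.arr aX = s.arr aX → s'.arr aW = s.arr aW →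
      s'.reg vtb = s.reg vtb → s'.reg vp = g * S → s'.reg vg = g * st → Pre M s' aY G (g * S) →
      Runs w p N s' fun s'' => s''.reg vp = (g + 1) * S ∧ Pre M s'' aY G ((g + 1) * S)) :
    Runs w (groups z p) (nb * (N + 6) + 7) s fun s' => Pre M s' aY G (nb * S) := by
  simp only [List.forall_mem_cons, List.forall_mem_nil, and_true] at hr ha
  obtain ⟨r1, r2, r3, r4, r5, r6, r7, r8, r9, r10⟩ := hr
  have hw := B.hw
  have hrun : runL [.const vp 0, .const vg 0, .add vgs vTm z] s =
      ((s.set vp 0).set vg 0).set vgs st := by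
    rcases hz with ⟨rfl, rfl⟩ | ⟨rfl, rfl⟩ <;> simp [L.hTm]
    congr 1; ring
  have hwr : ∀ x, x ∉ wregs p → x ≠ kg → x ≠ 0 → x ≠ vg →
      x ∉ wregs (forN kg vnb (p ;; block [.add vg vg vgs])) := by
    intro x h1 h2 h3 h4
    simp [forN, wregs, RAM.block, Instr.wregs, h1, h2, h3, h4]
  have hwa : ∀ a, a ∉ warrs p → a ∉ warrs (forN kg vnb (p ;; block [.add vg vg vgs])) := by
    intro a h
    simp [forN, warrs, RAM.block, Instr.warrs, h]
  apply Runs.of_le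
  · apply Runs.block_seq
    · rcases hz with ⟨rfl, rfl⟩ | ⟨rfl, rfl⟩ <;> simp [L.hTm] <;> [skip; omega]
      convert hst using 1; ring
    rw [hrun]
    apply Runs.forN (N := N + 2) (n := nb) (fun g s' =>
      s'.reg vp = g * S ∧ s'.reg vg = g * st ∧ Pre M s' aY G (g * S)) (by simp [L.hnb])
      (by decide) hw
    · simp [Pre]
    · intro g s1 hg hk f ⟨i1, i2, i3⟩
      have fr : ∀ x, x ∉ wregs p → x ≠ kg → x ≠ 0 → x ≠ vg → x ≠ vp → x ≠ vgs →
          s1.reg x = s.reg x := by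
        intro x h1 h2 h3 h4 h5 h6
        rw [f.reg x (hwr x h1 h2 h3 h4)]
        simp [h4, h5, h6]
      apply Runs.call_seq
      · apply hp g s1 hg
        · exact ⟨(fr _ r1 (by decide) (by decide) (by decide) (by decide) (by decide)).trans L.hM,
            (fr _ r2 (by decide) (by decide) (by decide) (by decide) (by decide)).trans L.hm,
            (fr _ r3 (by decide) (by decide) (by decide) (by decide) (by decide)).trans L.hmm,
            (fr _ r4 (by decide) (by decide) (by decide) (by decide) (by decide)).trans L.hT,
            (fr _ r5 (by decide) (by decide) (by decide) (by decide) (by decide)).trans L.hTm,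
            (fr _ r6 (by decide) (by decide) (by decide) (by decide) (by decide)).trans L.hnb⟩
        · rw [f.arr _ (hwa _ ha.1)]; simp
        · rw [f.arr _ (hwa _ ha.2.1)]; simp
        · exact fr _ r10.1 (by decide) (by decide) (by decide) (by decide) (by decide)
        · exact i1
        · exact i2
        · exact i3
      · intro s2 f2 ⟨j1, j2⟩
        have h1 : s2.reg vg = g * st := by rw [f2.reg _ r7, i2]
        have h2 : s2.reg vgs = st := by
          rw [f2.reg _ r8, f.reg _ (hwr _ r8 (by decide) (by decide) (by decide))]; simp
        have h3 : s2.reg kg = nb - g := by rw [f2.reg _ r9, hk]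
        have h4 : (g + 1) * st ≤ nb * st := Nat.mul_le_mul_right _ hg
        have h5 : (g + 1) * st = g * st + st := by ring
        apply Runs.block
        · simp [h1, h2]; omega
        · simp [h1, h2, h3, j1, h5]
          exact j2
    · intro s' f hz ⟨i1, i2, i3⟩
      exact i3
  · simp; ring_nf; omega

/-- Compute one block of a stage of the transform. -/
def fblock : Prog :=
  block [.copy va vi, .add va' vi vTm, .copy vd vmm, .load 0 aW ve, .sub vd' vmm 0, .const 0 1,
    .add ve ve 0] ;; comb

/-- A stage of the transform, from `aX` to `aY`; the exponents start at `vtb` in `aW`. -/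
def fpass : Prog :=
  groups vTm (block [.copy vi vg, .copy ve vtb] ;;
    forN ki vT (fblock ;; fblock ;; block [.add vi vi vm]))

theorem fblock_spec {g o : ℕ} {s : State} {X : ℕ → ZMod M} {E : ℕ → ℕ} (L : Lev M m T nb s)
    (B : LevB M w m T nb) (hX : Pre M s aX X (nb * (2 * T) * m))
    (hE : ∀ o < 2 * T, s.arr aW (tb + o) = E o ∧ E o ≤ 2 * m)
    (htb : tb + 2 * T < 2 ^ w) (hg : g < nb) (ho : o < 2 * T)
    (hvp : s.reg vp = (g * (2 * T) + o) * m) (hvi : s.reg vi = (g * (2 * T) + o / 2) * m)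
    (hve : s.reg ve = tb + o) (hY : Pre M s aY (fstage m T E X) ((g * (2 * T) + o) * m)) :
    Runs w fblock (m * 48 + 12) s fun s' => s'.reg vp = (g * (2 * T) + (o + 1)) * m ∧
      s'.reg ve = tb + (o + 1) ∧ Pre M s' aY (fstage m T E X) ((g * (2 * T) + (o + 1)) * m) := by
  have a1 := addr_le (m := m) hg (show o / 2 < 2 * T by omega)
  have a2 := addr_le (m := m) hg (show T + o / 2 < 2 * T by omega)
  have a3 := addr_le (m := m) hg ho
  have e2 : (g * (2 * T) + o / 2) * m + T * m = (g * (2 * T) + T + o / 2) * m := by ring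
  have e2' : (g * (2 * T) + (T + o / 2)) * m = (g * (2 * T) + T + o / 2) * m := by ring
  have e3 : (g * (2 * T) + (o + 1)) * m = (g * (2 * T) + o) * m + m := by ring
  have htot := B.htot
  have hw := B.hw
  obtain ⟨hE1, hE2⟩ := hE o ho
  apply Runs.of_le
  · apply Runs.block_seq
    · simp [hvi, L.hTm, hve]; omega
    apply Runs.call (comb_spec (m := m) (X := blk m X (g * (2 * T) + o / 2))
      (X' := blk m X (g * (2 * T) + T + o / 2)) (G := fstage m T E X) hw (by simp [L.hM])
      (by simp [L.hm]) (by simp [L.hmm]) (by simp [L.hmm]) (by simp [L.hmm, hve, hE1])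
      (by simp [hvi]; omega) (by simp [hvi, L.hTm]; omega) ?_ ?_ B.hM B.hm
      (by simp [hvp]; omega) (by simpa [hvp] using hY) ?_)
    · intro s' f ⟨h1, h2⟩
      simp [hvp] at h1 h2
      refine ⟨by rw [h1, e3], ?_, by rwa [e3]⟩
      rw [f.reg _ (by decide)]
      simp [hve, add_assoc]
    · intro l hl
      simp [hvi]
      exact hX _ (by omega)
    · intro l hl
      simp [hvi, L.hTm, e2]
      exact hX _ (by omega)
    · intro l hl
      simp [hvp, L.hmm, hve, hE1]
      exact fstage_apply E X ho hl
  · simp; omega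

theorem LevB.group (B : LevB M w m T nb) (hnb : 0 < nb) : 2 * T * m < 2 ^ w := by
  have := B.htot
  calc 2 * T * m = 1 * (2 * T * m) := by ring
    _ ≤ nb * (2 * T * m) := Nat.mul_le_mul_right _ hnb
    _ = nb * (2 * T) * m := by ring
    _ < 2 ^ w := this

theorem fpass_spec {s : State} {X : ℕ → ZMod M} {E : ℕ → ℕ} (L : Lev M m T nb s)
    (B : LevB M w m T nb) (hnb : 0 < nb) (hX : Pre M s aX X (nb * (2 * T) * m))
    (hE : ∀ o < 2 * T, s.arr aW (tb + o) = E o ∧ E o ≤ 2 * m)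
    (htb : tb + 2 * T < 2 ^ w) (hvtb : s.reg vtb = tb) :
    Runs w fpass (nb * (T * (2 * (m * 48) + 40) + 40) + 10) s fun s' =>
      Pre M s' aY (fstage m T E X) (nb * (2 * T) * m) := by
  have htot := B.htot
  have hw := B.hw
  apply Runs.of_le
  · rw [mul_assoc nb]
    refine groups_spec (st := 2 * T * m) (S := 2 * T * m) (N := T * (2 * (m * 48) + 40) + 20) L B
      (Or.inl ⟨rfl, rfl⟩) (B.group hnb) (by rw [← mul_assoc]; exact htot) (by decide) (by decide) ?_
    intro g s1 hg L1 hX1 hW1 htb1 i1 i2 i3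
    rw [hvtb] at htb1
    rw [← mul_assoc] at i1 i2 i3
    apply Runs.of_le
    · apply Runs.block_seq
      · simp
      apply Runs.forN (N := 2 * (m * 48) + 34) (n := T) (fun i s' =>
        s'.reg vp = (g * (2 * T) + 2 * i) * m ∧ s'.reg vi = (g * (2 * T) + i) * m ∧
        s'.reg ve = tb + 2 * i ∧
        Pre M s' aY (fstage m T E X) ((g * (2 * T) + 2 * i) * m)) (by simp [L1.hT])
        (by decide) hw
      · simp [i1, i2, htb1]
        exact i3
      · intro i s2 hi hk2 f2 ⟨j1, j2, j3, j4⟩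
        have L2 : Lev M m T nb s2 := Lev.frame ⟨by simp [L1.hM], by simp [L1.hm],
          by simp [L1.hmm], by simp [L1.hT], by simp [L1.hTm], by simp [L1.hnb]⟩ f2 (by decide)
        have hX2 : s2.arr aX = s.arr aX := by rw [f2.arr _ (by decide)]; simp [hX1]
        have hW2 : s2.arr aW = s.arr aW := by rw [f2.arr _ (by decide)]; simp [hW1]
        apply Runs.of_le
        · apply Runs.call_seq (fblock_spec (o := 2 * i) L2 B (hX.frame hX2) (by rwa [hW2]) htb
            hg (by omega) j1 (by rw [j2]; congr 2; omega) j3 j4)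
          intro s3 f3 ⟨k1, k2, k3⟩
          have L3 : Lev M m T nb s3 := L2.frame f3 (by decide)
          have hX3 : s3.arr aX = s.arr aX := by rw [f3.arr _ (by decide), hX2]
          have hW3 : s3.arr aW = s.arr aW := by rw [f3.arr _ (by decide), hW2]
          have hvi3 : s3.reg vi = (g * (2 * T) + i) * m := by rw [f3.reg _ (by decide), j2]
          apply Runs.call_seq (fblock_spec (o := 2 * i + 1) L3 B (hX.frame hX3) (by rwa [hW3])
            htb hg (by omega) k1 (by rw [hvi3]; congr 2; omega) k2 k3)
          intro s4 f4 ⟨l1, l2, l3⟩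
          have hvi4 : s4.reg vi = (g * (2 * T) + i) * m := by rw [f4.reg _ (by decide), hvi3]
          have hm4 : s4.reg vm = m := by rw [f4.reg _ (by decide), L3.hm]
          have hk4 : s4.reg ki = T - i := by
            rw [f4.reg _ (by decide), f3.reg _ (by decide), hk2]
          have := addr_le (m := m) hg (show i < 2 * T by omega)
          rw [show 2 * i + 1 + 1 = 2 * (i + 1) by ring] at l1 l2 l3
          apply Runs.block
          · simp [hvi4, hm4]; omega
          · simp [hvi4, hm4, hk4, l1, l2]
            exact ⟨by ring, l3⟩
        · simp; omega
      · intro s2 f2 hz ⟨j1, j2, j3, j4⟩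
        rw [show (g + 1) * (2 * T * m) = (g * (2 * T) + 2 * T) * m by ring]
        exact ⟨j1, j4⟩
    · simp; ring_nf; omega
  · ring_nf; omega

/-! ### The inverse stages -/

/-- A stage of the inverse transform, from `aX` to `aY`; the exponents start at `vtb` in `aW`. -/
def ipass : Prog :=
  groups vTm (block [.copy vi vg] ;;
    forN ki vT (block [.copy va vi, .add va' vi vm, .copy vd vmm, .copy vd' vmm] ;; comb ;;
      block [.add vi vi vmm]) ;;
    block [.copy vi vg, .copy ve vtb] ;;
    forN ki vT (block [.copy va vi, .add va' vi vm, .load vd aW ve, .const 0 1, .add ve ve 0,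
      .load vd' aW ve, .add ve ve 0] ;; comb ;; block [.add vi vi vmm]))

theorem ipass_spec {s : State} {X : ℕ → ZMod M} {E : ℕ → ℕ} (L : Lev M m T nb s)
    (B : LevB M w m T nb) (hnb : 0 < nb) (hX : Pre M s aX X (nb * (2 * T) * m))
    (hE : ∀ o < 2 * T, s.arr aW (tb + o) = E o ∧ E o ≤ 2 * m)
    (htb : tb + 2 * T < 2 ^ w) (hvtb : s.reg vtb = tb) :
    Runs w ipass (nb * (T * (2 * (m * 48) + 60) + 40) + 10) s fun s' =>
      Pre M s' aY (istage m T E X) (nb * (2 * T) * m) := by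
  have htot := B.htot
  have hw := B.hw
  have hmw := B.hm
  apply Runs.of_le
  · rw [mul_assoc nb]
    refine groups_spec (st := 2 * T * m) (S := 2 * T * m) (N := T * (2 * (m * 48) + 60) + 30) L B
      (Or.inl ⟨rfl, rfl⟩) (B.group hnb) (by rw [← mul_assoc]; exact htot) (by decide) (by decide) ?_
    intro g s1 hg L1 hX1 hW1 htb1 i1 i2 i3
    rw [hvtb] at htb1
    rw [← mul_assoc] at i1 i2 i3
    -- the addresses of the blocks with even and odd numbers
    have ev : ∀ i < T, (g * (2 * T) + 2 * i) * m + m ≤ nb * (2 * T) * m := fun i hi =>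
      addr_le (m := m) hg (show 2 * i < 2 * T by omega)
    have od : ∀ i < T, (g * (2 * T) + 2 * i) * m + m + m ≤ nb * (2 * T) * m := fun i hi => by
      have := addr_le (m := m) hg (show 2 * i + 1 < 2 * T by omega)
      rwa [← add_assoc, add_mul (_ + _) 1, one_mul] at this
    have od' : ∀ i, (g * (2 * T) + 2 * i + 1) * m = (g * (2 * T) + 2 * i) * m + m := fun i => by
      ring
    have nx : ∀ i, (g * (2 * T) + 2 * (i + 1)) * m = (g * (2 * T) + 2 * i) * m + 2 * m := fun i => by
      ring
    apply Runs.of_le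
    · apply Runs.block_seq
      · simp
      apply Runs.call_seq
      · apply Runs.forN (N := m * 48 + 20) (n := T) (fun i s' =>
          s'.reg vp = (g * (2 * T) + i) * m ∧ s'.reg vi = (g * (2 * T) + 2 * i) * m ∧
          Pre M s' aY (istage m T E X) ((g * (2 * T) + i) * m)) (by simp [L1.hT]) (by decide) hw
          (Q := fun s' => s'.reg vp = (g * (2 * T) + T) * m ∧
            Pre M s' aY (istage m T E X) ((g * (2 * T) + T) * m))
        · simp [i1, i2]
          exact i3
        · intro i s2 hi hk2 f2 ⟨j1, j2, j3⟩
          have L2 : Lev M m T nb s2 := Lev.frame ⟨by simp [L1.hM], by simp [L1.hm],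
            by simp [L1.hmm], by simp [L1.hT], by simp [L1.hTm], by simp [L1.hnb]⟩ f2 (by decide)
          have hX2 : s2.arr aX = s.arr aX := by rw [f2.arr _ (by decide)]; simp [hX1]
          have b1 := ev i hi
          have b2 := od i hi
          have b3 := addr_le (m := m) hg (show i < 2 * T by omega)
          have e3 : (g * (2 * T) + (i + 1)) * m = (g * (2 * T) + i) * m + m := by ring
          apply Runs.of_le
          · apply Runs.block_seq
            · simp [j2, L2.hm]; omega
            apply Runs.call_seq (comb_spec (m := m) (X := blk m X (g * (2 * T) + 2 * i))
              (X' := blk m X (g * (2 * T) + 2 * i + 1)) (G := istage m T E X) hw (by simp [L2.hM])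
              (by simp [L2.hm]) (by simp [L2.hmm]) (by simp [L2.hmm]) (by simp [L2.hmm])
              (by simp [j2]; omega) (by simp [j2, L2.hm]; omega) ?_ ?_ B.hM B.hm
              (by simp [j1]; omega) (by simpa [j1] using j3) ?_)
            · intro s3 f3 ⟨k1, k2⟩
              simp [j1] at k1 k2
              have h1 : s3.reg vi = (g * (2 * T) + 2 * i) * m := by
                rw [f3.reg _ (by decide)]; simp [j2]
              have h2 : s3.reg vmm = 2 * m := by rw [f3.reg _ (by decide)]; simp [L2.hmm]
              have h3 : s3.reg ki = T - i := by rw [f3.reg _ (by decide)]; simp [hk2]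
              apply Runs.block
              · simp [h1, h2]; omega
              · simp [h1, h2, h3, k1, e3]
                exact ⟨(nx i).symm, k2⟩
            · intro l hl
              simp [j2, hX2]
              exact hX _ (by omega)
            · intro l hl
              simp [j2, hX2, L2.hm]
              rw [blk, od']
              exact hX _ (by omega)
            · intro l hl
              simp [j1, L2.hmm]
              exact istage_apply_lt E X hi hl
          · simp; omega
        · intro s2 f2 hz ⟨j1, j2, j3⟩
          exact ⟨j1, j3⟩
      intro s2 f2 ⟨i4, i5⟩
      have L2 : Lev M m T nb s2 := Lev.frame ⟨by simp [L1.hM], by simp [L1.hm],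
        by simp [L1.hmm], by simp [L1.hT], by simp [L1.hTm], by simp [L1.hnb]⟩ f2 (by decide)
      have hX2 : s2.arr aX = s.arr aX := by rw [f2.arr _ (by decide)]; simp [hX1]
      have hW2 : s2.arr aW = s.arr aW := by rw [f2.arr _ (by decide)]; simp [hW1]
      have htb2 : s2.reg vtb = tb := by rw [f2.reg _ (by decide)]; simp [htb1]
      have hvg2 : s2.reg vg = g * (2 * T) * m := by rw [f2.reg _ (by decide)]; simp [i2]
      apply Runs.block_seq
      · simp
      apply Runs.forN (N := m * 48 + 25) (n := T) (fun i s' =>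
        s'.reg vp = (g * (2 * T) + (T + i)) * m ∧ s'.reg vi = (g * (2 * T) + 2 * i) * m ∧
        s'.reg ve = tb + 2 * i ∧
        Pre M s' aY (istage m T E X) ((g * (2 * T) + (T + i)) * m)) (by simp [L2.hT]) (by decide) hw
      · simp [i4, hvg2, htb2]
        exact i5
      · intro i s3 hi hk2 f3 ⟨j1, j2, j3, j4⟩
        have L3 : Lev M m T nb s3 := Lev.frame ⟨by simp [L2.hM], by simp [L2.hm],
          by simp [L2.hmm], by simp [L2.hT], by simp [L2.hTm], by simp [L2.hnb]⟩ f3 (by decide)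
        have hX3 : s3.arr aX = s.arr aX := by rw [f3.arr _ (by decide)]; simp [hX2]
        have hW3 : s3.arr aW = s.arr aW := by rw [f3.arr _ (by decide)]; simp [hW2]
        have b1 := ev i hi
        have b2 := od i hi
        have b3 := addr_le (m := m) hg (show T + i < 2 * T by omega)
        have e3 : (g * (2 * T) + (T + (i + 1))) * m = (g * (2 * T) + (T + i)) * m + m := by ring
        obtain ⟨E1, E1'⟩ := hE (2 * i) (by omega)
        obtain ⟨E2, E2'⟩ := hE (2 * i + 1) (by omega)
        rw [← add_assoc] at E2
        apply Runs.of_le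
        · apply Runs.block_seq
          · simp [j2, L3.hm, j3]; omega
          apply Runs.call_seq (comb_spec (m := m) (X := blk m X (g * (2 * T) + 2 * i))
            (X' := blk m X (g * (2 * T) + 2 * i + 1)) (G := istage m T E X) hw (by simp [L3.hM])
            (by simp [L3.hm]) (by simp [L3.hmm]) (by simpa [j3, hW3, E1] using E1')
            (by simpa [j3, hW3, E2] using E2')
            (by simp [j2]; omega) (by simp [j2, L3.hm]; omega) ?_ ?_ B.hM B.hm
            (by simp [j1]; omega) (by simpa [j1] using j4) ?_)
          · intro s4 f4 ⟨k1, k2⟩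
            simp [j1] at k1 k2
            have h1 : s4.reg vi = (g * (2 * T) + 2 * i) * m := by
              rw [f4.reg _ (by decide)]; simp [j2]
            have h2 : s4.reg vmm = 2 * m := by rw [f4.reg _ (by decide)]; simp [L3.hmm]
            have h3 : s4.reg ki = T - i := by rw [f4.reg _ (by decide)]; simp [hk2]
            have h4 : s4.reg ve = tb + 2 * (i + 1) := by
              rw [f4.reg _ (by decide)]; simp [j3]; ring
            apply Runs.block
            · simp [h1, h2]; omega
            · simp [h1, h2, h3, h4, k1, e3]
              exact ⟨(nx i).symm, k2⟩
          · intro l hl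
            simp [j2, hX3]
            exact hX _ (by omega)
          · intro l hl
            simp [j2, hX3, L3.hm]
            rw [blk, od']
            exact hX _ (by omega)
          · intro l hl
            simp [j1, L3.hmm, j3, hW3, E1, E2]
            exact istage_apply_ge E X hi hl
        · simp; omega
      · intro s3 f3 hz ⟨j1, j2, j3, j4⟩
        rw [show (g + 1) * (2 * T * m) = (g * (2 * T) + (T + T)) * m by ring]
        exact ⟨j1, j4⟩
    · simp; ring_nf; omega
  · ring_nf; omega

/-! ### Going from one level to the next -/

/-- Write a block of `aY` from every `T`-th entry of `aX`, starting at `vi`. -/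
def sblock : Prog :=
  block [.copy va vi] ;;
  forN kl vm (block [.load vx aX va, .store aY vp vx, .add va va vT, .const 0 1, .add vp vp 0])

/-- The first stage of the transform, from `aX` to `aY`. -/
def spass : Prog :=
  groups vp (block [.copy vi vg] ;; forN ki vT (sblock ;; sblock ;; block [.const 0 1, .add vi vi 0]))

theorem sblock_spec {g o : ℕ} {s : State} {X : ℕ → ZMod M} (L : Lev M m T nb s)
    (B : LevB M w m T nb) (hX : Pre M s aX X (nb * (T * m))) (hg : g < nb) (ho : o < 2 * T)
    (hvp : s.reg vp = (g * (2 * T) + o) * m) (hvi : s.reg vi = g * (T * m) + o / 2)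
    (hY : Pre M s aY (spread m T X) ((g * (2 * T) + o) * m)) :
    Runs w sblock (m * 10 + 5) s fun s' => s'.reg vp = (g * (2 * T) + (o + 1)) * m ∧
      Pre M s' aY (spread m T X) ((g * (2 * T) + (o + 1)) * m) := by
  have htot := B.htot
  have hw := B.hw
  have a3 := addr_le (m := m) hg ho
  have e3 : (g * (2 * T) + (o + 1)) * m = (g * (2 * T) + o) * m + m := by ring
  have hb : ∀ l < m, g * (T * m) + o / 2 + T * l + T ≤ nb * (T * m) + T := fun l hl => by
    have h1 : T * (l + 1) ≤ T * m := Nat.mul_le_mul_left _ hl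
    have h2 : (g + 1) * (T * m) ≤ nb * (T * m) := Nat.mul_le_mul_right _ hg
    have h3 : (g + 1) * (T * m) = g * (T * m) + T * m := by ring
    have h4 : T * (l + 1) = T * l + T := by ring
    omega
  have hb' : ∀ l < m, g * (T * m) + o / 2 + T * l < nb * (T * m) := fun l hl => by
    have h1 : T * (l + 1) ≤ T * m := Nat.mul_le_mul_left _ hl
    have h2 : (g + 1) * (T * m) ≤ nb * (T * m) := Nat.mul_le_mul_right _ hg
    have h3 : (g + 1) * (T * m) = g * (T * m) + T * m := by ring
    have h4 : T * (l + 1) = T * l + T := by ring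
    omega
  have hTm : T ≤ nb * (T * m) := by
    calc T = 1 * (T * 1) := by ring
      _ ≤ nb * (T * m) := Nat.mul_le_mul (by omega) (Nat.mul_le_mul_left _ B.hm0)
  have htot' : nb * (2 * T) * m = nb * (T * m) + nb * (T * m) := by ring
  apply Runs.of_le
  · apply Runs.block_seq
    · simp
    apply Runs.forN (N := 6) (n := m) (fun l s' =>
      s'.reg vp = (g * (2 * T) + o) * m + l ∧ s'.reg va = g * (T * m) + o / 2 + T * l ∧
      Pre M s' aY (spread m T X) ((g * (2 * T) + o) * m + l)) (by simp [L.hm]) (by decide) hw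
    · simp [hvp, hvi]
      exact hY
    · intro l s1 hl hk f ⟨i1, i2, i3⟩
      have hX1 : s1.arr aX = s.arr aX := by rw [f.arr _ (by decide)]; simp
      have hT1 : s1.reg vT = T := by rw [f.reg _ (by decide)]; simp [L.hT]
      have := hb l hl
      apply Runs.block
      · simp [i1, i2, hT1]; omega
      · simp [i1, i2, hT1, hk, hX1, Pre]
        refine ⟨by ring, by ring, fun p hp => ?_⟩
        split_ifs with hpe
        · subst hpe
          rw [spread_apply X ho hl]
          exact hX _ (hb' l hl)
        · exact i3 p (by omega)
    · intro s' f hz ⟨i1, i2, i3⟩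
      rw [e3]
      exact ⟨i1, i3⟩
  · simp; ring_nf; omega

theorem spass_spec {s : State} {X : ℕ → ZMod M} (L : Lev M m T nb s)
    (B : LevB M w m T nb) (hnb : 0 < nb) (hX : Pre M s aX X (nb * (T * m))) :
    Runs w spass (nb * (T * (2 * (m * 10) + 40) + 40) + 10) s fun s' =>
      Pre M s' aY (spread m T X) (nb * (2 * T) * m) := by
  have htot := B.htot
  have hw := B.hw
  have hgr := B.group hnb
  have hgr' : 2 * T * m = T * m + T * m := by ring
  have htot' : nb * (2 * T) * m = nb * (T * m) + nb * (T * m) := by ring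
  apply Runs.of_le
  · rw [mul_assoc nb]
    refine groups_spec (st := T * m) (S := 2 * T * m) (N := T * (2 * (m * 10) + 40) + 20) L B
      (Or.inr ⟨rfl, rfl⟩) (by omega) (by omega) (by decide) (by decide) ?_
    intro g s1 hg L1 hX1 _ _ i1 i2 i3
    rw [← mul_assoc] at i1 i3
    apply Runs.of_le
    · apply Runs.block_seq
      · simp
      apply Runs.forN (N := 2 * (m * 10) + 14) (n := T) (fun i s' =>
        s'.reg vp = (g * (2 * T) + 2 * i) * m ∧ s'.reg vi = g * (T * m) + i ∧
        Pre M s' aY (spread m T X) ((g * (2 * T) + 2 * i) * m)) (by simp [L1.hT])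
        (by decide) hw
      · simp [i1, i2]
        exact i3
      · intro i s2 hi hk2 f2 ⟨j1, j2, j3⟩
        have L2 : Lev M m T nb s2 := Lev.frame ⟨by simp [L1.hM], by simp [L1.hm],
          by simp [L1.hmm], by simp [L1.hT], by simp [L1.hTm], by simp [L1.hnb]⟩ f2 (by decide)
        have hX2 : s2.arr aX = s.arr aX := by rw [f2.arr _ (by decide)]; simp [hX1]
        apply Runs.of_le
        · apply Runs.call_seq (sblock_spec (o := 2 * i) L2 B (hX.frame hX2) hg (by omega) j1
            (by rw [j2]; congr 1; omega) j3)
          intro s3 f3 ⟨k1, k2⟩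
          have L3 : Lev M m T nb s3 := L2.frame f3 (by decide)
          have hX3 : s3.arr aX = s.arr aX := by rw [f3.arr _ (by decide), hX2]
          have hvi3 : s3.reg vi = g * (T * m) + i := by rw [f3.reg _ (by decide), j2]
          apply Runs.call_seq (sblock_spec (o := 2 * i + 1) L3 B (hX.frame hX3) hg (by omega) k1
            (by rw [hvi3]; congr 1; omega) k2)
          intro s4 f4 ⟨l1, l2⟩
          have hvi4 : s4.reg vi = g * (T * m) + i := by rw [f4.reg _ (by decide), hvi3]
          have hk4 : s4.reg ki = T - i := by
            rw [f4.reg _ (by decide), f3.reg _ (by decide), hk2]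
          rw [show 2 * i + 1 + 1 = 2 * (i + 1) by ring] at l1 l2
          have h2 : (g + 1) * (T * m) ≤ nb * (T * m) := Nat.mul_le_mul_right _ hg
          have h3 : (g + 1) * (T * m) = g * (T * m) + T * m := by ring
          have h4 : T * 1 ≤ T * m := Nat.mul_le_mul_left _ B.hm0
          apply Runs.block
          · simp [hvi4]; omega
          · simp [hvi4, hk4, l1]
            exact ⟨by ring, l2⟩
        · simp; omega
      · intro s2 f2 hz ⟨j1, j2, j3⟩
        rw [show (g + 1) * (2 * T * m) = (g * (2 * T) + 2 * T) * m by ring]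
        exact ⟨j1, j3⟩
    · simp; ring_nf; omega
  · ring_nf; omega

/-- The last step of the inverse transform, from `aX` to `aY`. -/
def mpass : Prog :=
  groups vTm (block [.copy vd vmm, .const 0 1, .sub vd' vmm 0] ;;
    forN kl vm (block [.copy va vg, .add va' vg vTm] ;;
      forN ki vT (step ;; block [.add va va vm, .add va' va' vm]) ;;
      block [.const 0 1, .add vd vd 0, .add vd' vd' 0]))

theorem mpass_spec {s : State} {X : ℕ → ZMod M} (L : Lev M m T nb s)
    (B : LevB M w m T nb) (hnb : 0 < nb) (hX : Pre M s aX X (nb * (2 * T) * m)) :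
    Runs w mpass (nb * (m * (T * 50 + 40) + 40) + 10) s fun s' =>
      Pre M s' aY (merge m T X) (nb * (T * m)) := by
  have htot := B.htot
  have hw := B.hw
  have hmw := B.hm
  have hgr := B.group hnb
  have hm0 := B.hm0
  have htot' : nb * (2 * T) * m = nb * (T * m) + nb * (T * m) := by ring
  apply Runs.of_le
  · refine groups_spec (st := 2 * T * m) (S := T * m) (N := m * (T * 50 + 30) + 20) L B
      (Or.inl ⟨rfl, rfl⟩) hgr (by rw [← mul_assoc]; omega) (by decide) (by decide) ?_
    intro g s1 hg L1 hX1 _ _ i1 i2 i3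
    apply Runs.of_le
    · apply Runs.block_seq
      · simp; omega
      apply Runs.forN (N := T * 50 + 26) (n := m) (fun l s' =>
        s'.reg vp = g * (T * m) + l * T ∧ s'.reg vd = 2 * m + l ∧ s'.reg vd' = 2 * m - 1 + l ∧
        Pre M s' aY (merge m T X) (g * (T * m) + l * T)) (by simp [L1.hm]) (by decide) hw
      · simp [i1, L1.hmm]
        exact i3
      · intro l s2 hl hk2 f2 ⟨j1, j2, j3, j4⟩
        have L2 : Lev M m T nb s2 := Lev.frame ⟨by simp [L1.hM], by simp [L1.hm],
          by simp [L1.hmm], by simp [L1.hT], by simp [L1.hTm], by simp [L1.hnb]⟩ f2 (by decide)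
        have hX2 : s2.arr aX = s.arr aX := by rw [f2.arr _ (by decide)]; simp [hX1]
        have hvg2 : s2.reg vg = g * (2 * T * m) := by rw [f2.reg _ (by decide)]; simp [i2]
        have b0 := addr_le (m := T * m) (n := 2) hg (show 1 < 2 by omega)
        have b1 : g * (2 * T * m) + T * m + T * m ≤ nb * (2 * T) * m := by
          convert b0 using 1 <;> ring
        have b2 : g * (T * m) + T * m ≤ nb * (T * m) := by
          have := Nat.mul_le_mul_right (T * m) (Nat.succ_le_of_lt hg)
          rwa [Nat.succ_mul] at this
        have b3 : l * T + T ≤ T * m := by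
          have := Nat.mul_le_mul_right T (Nat.succ_le_of_lt hl)
          rwa [Nat.succ_mul, mul_comm m T] at this
        apply Runs.of_le
        · apply Runs.block_seq
          · simp [hvg2, L2.hTm]; omega
          apply Runs.call_seq
          · apply Runs.forN (N := 44) (n := T) (fun j s' =>
              s'.reg vp = g * (T * m) + (l * T + j) ∧ s'.reg va = (g * (2 * T) + j) * m ∧
              s'.reg va' = (g * (2 * T) + T + j) * m ∧
              Pre M s' aY (merge m T X) (g * (T * m) + (l * T + j))) (by simp [L2.hT]) (by decide) hw
              (Q := fun s' => s'.reg vp = g * (T * m) + (l + 1) * T ∧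
                Pre M s' aY (merge m T X) (g * (T * m) + (l + 1) * T))
            · simp [j1, hvg2, L2.hTm]
              exact ⟨by ring, by ring, j4⟩
            · intro j s3 hj hk3 f3 ⟨k1, k2, k3, k4⟩
              have L3 : Lev M m T nb s3 := Lev.frame ⟨by simp [L2.hM], by simp [L2.hm],
                by simp [L2.hmm], by simp [L2.hT], by simp [L2.hTm], by simp [L2.hnb]⟩ f3
                (by decide)
              have hX3 : s3.arr aX = s.arr aX := by rw [f3.arr _ (by decide)]; simp [hX2]
              have hd3 : s3.reg vd = 2 * m + l := by rw [f3.reg _ (by decide)]; simp [j2]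
              have hd3' : s3.reg vd' = 2 * m - 1 + l := by rw [f3.reg _ (by decide)]; simp [j3]
              have c1 := addr_le (m := m) hg (show j < 2 * T by omega)
              have c2 := addr_le (m := m) hg (show T + j < 2 * T by omega)
              rw [← add_assoc] at c2
              apply Runs.of_le
              · apply Runs.call_seq (step_spec (m := m) (X := blk m X (g * (2 * T) + j))
                  (X' := blk m X (g * (2 * T) + T + j)) (G := merge m T X) hw L3.hM L3.hm L3.hmm
                  ⟨by omega, by omega, ?_⟩ ⟨by omega, by omega, ?_⟩ B.hM (by omega)
                  (by rw [k1]; exact k4) ?_)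
                · intro s4 f4 ⟨l1, l2⟩
                  have h1 : s4.reg va = (g * (2 * T) + j) * m := by rw [f4.reg _ (by decide), k2]
                  have h2 : s4.reg va' = (g * (2 * T) + T + j) * m := by
                    rw [f4.reg _ (by decide), k3]
                  have h3 : s4.reg vm = m := by rw [f4.reg _ (by decide), L3.hm]
                  have h4 : s4.reg ki = T - j := by rw [f4.reg _ (by decide), hk3]
                  rw [k1] at l1 l2
                  apply Runs.block
                  · simp [h1, h2, h3]; omega
                  · simp [h1, h2, h3, h4, l1]
                    exact ⟨by ring, by ring, by ring, l2⟩
                · intro l' hl'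
                  rw [k2, hX3]
                  exact hX _ (by omega)
                · intro l' hl'
                  rw [k3, hX3]
                  exact hX _ (by omega)
                · rw [k1, hd3, hd3']
                  exact merge_apply X hj hl
              · simp
            · intro s3 f3 hz ⟨k1, k2, k3, k4⟩
              rw [show (l + 1) * T = l * T + T by ring]
              exact ⟨k1, k4⟩
          · intro s3 f3 ⟨k1, k2⟩
            have h1 : s3.reg vd = 2 * m + l := by rw [f3.reg _ (by decide)]; simp [j2]
            have h2 : s3.reg vd' = 2 * m - 1 + l := by rw [f3.reg _ (by decide)]; simp [j3]
            have h3 : s3.reg kl = m - l := by rw [f3.reg _ (by decide)]; simp [hk2]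
            apply Runs.block
            · simp [h1, h2]; omega
            · simp [h1, h2, h3, k1]
              exact ⟨by ring, by ring, k2⟩
        · simp; ring_nf; omega
      · intro s2 f2 hz ⟨j1, j2, j3, j4⟩
        rw [show (g + 1) * (T * m) = g * (T * m) + m * T by ring]
        exact ⟨j1, j4⟩
    · simp; ring_nf; omega
  · ring_nf; omega

/-- Copy the first cells of `aY` to `aX`, as many as `vtot` says. -/
def copyBack : Prog :=
  block [.const vi 0] ;;
  forN ki vtot (block [.load vx aY vi, .store aX vi vx, .const 0 1, .add vi vi 0])

theorem copyBack_spec {n : ℕ} {s : State} {X : ℕ → ZMod M} (hw : 0 < w) (hn : n < 2 ^ w)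
    (htot : s.reg vtot = n) (hY : Pre M s aY X n) :
    Runs w copyBack (n * 9 + 5) s fun s' => Pre M s' aX X n := by
  apply Runs.of_le
  · apply Runs.block_seq
    · simp
    apply Runs.forN (N := 5) (n := n) (fun i s' => s'.reg vi = i ∧ Pre M s' aX X i)
      (by simp [htot]) (by decide) hw
    · simp [Pre]
    · intro i s1 hi hk f ⟨i1, i2⟩
      have hY1 : s1.arr aY = s.arr aY := by rw [f.arr _ (by decide)]; simp
      apply Runs.block
      · simp [i1]; omega
      · simp [i1, hk, hY1, Pre]
        intro p hp
        split_ifs with hpe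
        · subst hpe; exact hY _ (by omega)
        · exact i2 p (by omega)
    · intro s' f hz ⟨i1, i2⟩
      exact i2
  · simp; omega

end RAM

/-! ### One level of the transform -/

namespace RAM

open Nega

variable {M w m T nb tb : ℕ}

/-!
On a level, `vQ` holds the binary logarithm `Q` of the length of the blocks to be transformed, `vlo`
and `vhi` hold `⌊Q / 2⌋` and `⌈Q / 2⌉`, and `vst` holds the number of stages.  The numbers `Q` of the
levels entered are kept in the array `aQ`, whose next free cell is `vix`.  Register `vsc` is the
inverse of the power of `2` by which the inverse transforms have multiplied the data; `vt` is a
scratch register.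
-/

notation "vQ" => 9
notation "vlo" => 15
notation "vst" => 16
notation "vsc" => 19
notation "vix" => 20
notation "vt" => 28
notation "vhi" => 34
notation "aQ" => 4

/-- Double `x` as often as register `r` says. -/
def dbl (x r : ℕ) : Prog := forN kl r (block [.add x x x])

/-- Halve `x` as often as register `r` says. -/
def hlv (x r : ℕ) : Prog := forN kl r (block [.half x x])

theorem dbl_spec {x r n : ℕ} {s : State} (hw : 0 < w) (hx : x ≠ kl) (hx0 : x ≠ 0)
    (hr : s.reg r = n) (hb : s.reg x * 2 ^ n < 2 ^ w) :
    Runs w (dbl x r) (n * 6 + 3) s fun s' => s'.reg x = s.reg x * 2 ^ n := by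
  apply Runs.forN (N := 2) (n := n) (fun i s' => s'.reg x = s.reg x * 2 ^ i) hr (by decide) hw
  · simp [hx]
  · intro i s1 hi hk _ i1
    have h : s.reg x * 2 ^ (i + 1) ≤ s.reg x * 2 ^ n :=
      Nat.mul_le_mul_left _ (Nat.pow_le_pow_right (by norm_num) hi)
    rw [pow_succ, ← mul_assoc] at h
    apply Runs.block
    · simp [i1]; omega
    · simp [i1, hk, hx, hx0, hx.symm]
      rw [pow_succ]; ring
  · intro s' _ _ h
    exact h

theorem hlv_spec {x r n a : ℕ} {s : State} (hw : 0 < w) (hx : x ≠ kl) (hx0 : x ≠ 0)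
    (hr : s.reg r = n) (hb : s.reg x = a * 2 ^ n) :
    Runs w (hlv x r) (n * 6 + 3) s fun s' => s'.reg x = a := by
  apply Runs.forN (N := 2) (n := n) (fun i s' => s'.reg x = a * 2 ^ (n - i)) hr (by decide) hw
  · simp [hx, hb]
  · intro i s1 hi hk _ i1
    apply Runs.block
    · simp
    · simp [i1, hk, hx, hx0, hx.symm]
      rw [show n - i = n - (i + 1) + 1 by omega, pow_succ, ← mul_assoc,
        Nat.mul_div_cancel _ (by norm_num)]
  · intro s' _ _ h
    simpa using h

/-- Compute the parameters of a level with blocks of length `2 ^ vQ`. -/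
def setup : Prog :=
  block [.half vlo vQ, .sub vhi vQ vlo, .const 0 1, .add vst vlo 0, .const vm 1, .const vT 1] ;;
  dbl vm vhi ;; dbl vT vlo ;;
  block [.copy vTm vm, .add vmm vm vm, .add vTT vT vT] ;; dbl vTm vlo

/-- The parameters of a level with blocks of length `2 ^ Q`. -/
structure SetupOK (Q : ℕ) (s : State) : Prop where
  hm : s.reg vm = 2 ^ (Q - Q / 2)
  hmm : s.reg vmm = 2 * 2 ^ (Q - Q / 2)
  hT : s.reg vT = 2 ^ (Q / 2)
  hTT : s.reg vTT = 2 * 2 ^ (Q / 2)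
  hTm : s.reg vTm = 2 ^ (Q / 2) * 2 ^ (Q - Q / 2)
  hlo : s.reg vlo = Q / 2
  hst : s.reg vst = Q / 2 + 1
  hhi : s.reg vhi = Q - Q / 2

theorem SetupOK.frame {p : Prog} {s s' : State} {Q : ℕ} (h : SetupOK Q s) (f : Frame p s s')
    (hp : ∀ x ∈ [vm, vmm, vT, vTT, vTm, vlo, vst, vhi], x ∉ wregs p) : SetupOK Q s' := by
  simp only [List.forall_mem_cons] at hp
  obtain ⟨h1, h2, h3, h4, h5, h6, h7, h8, -⟩ := hp
  exact ⟨(f.reg _ h1).trans h.hm, (f.reg _ h2).trans h.hmm, (f.reg _ h3).trans h.hT,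
    (f.reg _ h4).trans h.hTT, (f.reg _ h5).trans h.hTm, (f.reg _ h6).trans h.hlo,
    (f.reg _ h7).trans h.hst, (f.reg _ h8).trans h.hhi⟩

theorem setup_spec {Q : ℕ} {s : State} (hQ : s.reg vQ = Q) (hb : 2 * 2 ^ Q < 2 ^ w) :
    Runs w setup (Q * 12 + 40) s (SetupOK Q) := by
  have hw : 0 < w := by
    rcases Nat.eq_zero_or_pos w with rfl | h
    · have := Nat.one_le_two_pow (n := Q); omega
    · exact h
  have hQw : Q < 2 ^ w := Nat.lt_two_pow_self.trans (by omega)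
  have h1 : 2 ^ (Q - Q / 2) ≤ 2 ^ Q := Nat.pow_le_pow_right (by norm_num) (by omega)
  have h2 : 2 ^ (Q / 2) ≤ 2 ^ Q := Nat.pow_le_pow_right (by norm_num) (by omega)
  have h3 : 2 ^ (Q - Q / 2) * 2 ^ (Q / 2) = 2 ^ Q := by rw [← pow_add]; congr 1; omega
  have h0 := Nat.one_le_two_pow (n := Q)
  apply Runs.of_le
  · apply Runs.block_seq
    · simp [hQ]; omega
    apply Runs.call_seq (dbl_spec (n := Q - Q / 2) hw (by decide) (by decide) (by simp [hQ])
      (by simp; omega))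
    intro s1 f1 i1
    simp at i1
    have a1 : s1.reg vT = 1 := by rw [f1.reg _ (by decide)]; simp
    have a2 : s1.reg vlo = Q / 2 := by rw [f1.reg _ (by decide)]; simp [hQ]
    have a3 : s1.reg vhi = Q - Q / 2 := by rw [f1.reg _ (by decide)]; simp [hQ]
    have a4 : s1.reg vst = Q / 2 + 1 := by rw [f1.reg _ (by decide)]; simp [hQ]
    apply Runs.call_seq (dbl_spec (n := Q / 2) hw (by decide) (by decide) a2 (by simp [a1]; omega))
    intro s2 f2 i2
    simp [a1] at i2
    have b1 : s2.reg vm = 2 ^ (Q - Q / 2) := by rw [f2.reg _ (by decide), i1]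
    have b2 : s2.reg vlo = Q / 2 := by rw [f2.reg _ (by decide), a2]
    have b3 : s2.reg vhi = Q - Q / 2 := by rw [f2.reg _ (by decide), a3]
    have b4 : s2.reg vst = Q / 2 + 1 := by rw [f2.reg _ (by decide), a4]
    apply Runs.block_seq
    · simp [b1, i2]; omega
    apply Runs.call (dbl_spec (n := Q / 2) hw (by decide) (by decide) (by simp [b2])
      (by simp [b1]; omega))
    intro s3 f3 i3
    simp [b1] at i3
    refine ⟨?_, ?_, ?_, ?_, by rw [i3, mul_comm], ?_, ?_, ?_⟩ <;> rw [f3.reg _ (by decide)] <;>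
      simp [b1, b2, b3, b4, i2, two_mul]
  · simp; omega

/-- Compute the exponents of the twiddle factors of a level; those of stage `t` occupy the cells of
`aW` from `t * (2 * T)` on.  Stage `0` has only zeros. -/
def tbl : Prog :=
  block [.const ve 0, .const vx 0] ;;
  forN ki vTT (block [.store aW ve vx, .const 0 1, .add ve ve 0]) ;;
  block [.const vi 0] ;;
  forN ks vst (forN ki vT (block [.load vx aW vi, .half vx vx, .store aW ve vx, .const 0 1,
      .add ve ve 0, .add vx vx vm, .store aW ve vx, .add ve ve 0, .add vi vi 0]) ;;
    block [.add vi vi vT])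

theorem tbl_spec {n : ℕ} {s : State} (hw : 0 < w) (hm : s.reg vm = m) (hT : s.reg vT = T)
    (hTT : s.reg vTT = 2 * T) (hst : s.reg vst = n) (hm0 : 0 < m)
    (hb : (n + 1) * (2 * T) + 1 < 2 ^ w) (hbm : 2 * m < 2 ^ w) :
    Runs w tbl (2 * T * 8 + n * (T * 14 + 9) + 13) s fun s' =>
      ∀ t ≤ n, ∀ o < 2 * T, s'.arr aW (t * (2 * T) + o) = tw m t o := by
  apply Runs.of_le
  · apply Runs.block_seq
    · simp
    apply Runs.call_seq
    · apply Runs.forN (N := 4) (n := 2 * T) (fun i s' =>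
        s'.reg ve = i ∧ s'.reg vx = 0 ∧ ∀ o < i, s'.arr aW o = 0) (by simp [hTT]) (by decide) hw
        (Q := fun s' => s'.reg ve = 2 * T ∧ ∀ o < 2 * T, s'.arr aW o = 0)
      · simp
      · intro i s1 hi hk f ⟨i1, i2, i3⟩
        have : 2 * T ≤ (n + 1) * (2 * T) := Nat.le_mul_of_pos_left _ (by omega)
        apply Runs.block
        · simp [i1]; omega
        · simp [i1, i2, hk]
          intro o ho hne
          exact i3 o (by omega)
      · intro s1 f hz ⟨i1, i2, i3⟩
        exact ⟨i1, i3⟩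
    intro s1 f1 ⟨i1, i2⟩
    have a1 : s1.reg vm = m := by rw [f1.reg _ (by decide)]; simp [hm]
    have a2 : s1.reg vT = T := by rw [f1.reg _ (by decide)]; simp [hT]
    have a3 : s1.reg vst = n := by rw [f1.reg _ (by decide)]; simp [hst]
    apply Runs.block_seq
    · simp
    apply Runs.forN (N := T * 14 + 5) (n := n) (fun t s' =>
      s'.reg ve = (t + 1) * (2 * T) ∧ s'.reg vi = t * (2 * T) ∧
      ∀ t' ≤ t, ∀ o < 2 * T, s'.arr aW (t' * (2 * T) + o) = tw m t' o) (by simp [a3])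
      (by decide) hw
    · simp [i1]
      intro o ho
      rw [i2 o ho]; rfl
    · intro t s2 ht hk f2 ⟨j1, j2, j3⟩
      have b1 : s2.reg vm = m := by rw [f2.reg _ (by decide)]; simp [a1]
      have b2 : s2.reg vT = T := by rw [f2.reg _ (by decide)]; simp [a2]
      have hb1 : (t + 2) * (2 * T) ≤ (n + 1) * (2 * T) := Nat.mul_le_mul_right _ (by omega)
      have hb2 : (t + 2) * (2 * T) = t * (2 * T) + 2 * T + 2 * T := by ring
      have hb3 : (t + 1) * (2 * T) = t * (2 * T) + 2 * T := by ring
      apply Runs.of_le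
      · apply Runs.call_seq
        · apply Runs.forN (N := 10) (n := T) (fun i s' =>
            s'.reg ve = (t + 1) * (2 * T) + 2 * i ∧ s'.reg vi = t * (2 * T) + i ∧
            (∀ t' ≤ t, ∀ o < 2 * T, s'.arr aW (t' * (2 * T) + o) = tw m t' o) ∧
            ∀ o < 2 * i, s'.arr aW ((t + 1) * (2 * T) + o) = tw m (t + 1) o) (by simp [b2])
            (by decide) hw (Q := fun s' => s'.reg ve = (t + 2) * (2 * T) ∧
              s'.reg vi = t * (2 * T) + T ∧
              ∀ t' ≤ t + 1, ∀ o < 2 * T, s'.arr aW (t' * (2 * T) + o) = tw m t' o)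
          · simp [j1, j2]
            exact j3
          · intro i s3 hi hk3 f3 ⟨k1, k2, k3, k4⟩
            have c1 : s3.reg vm = m := by rw [f3.reg _ (by decide)]; simp [b1]
            have hld := k3 t le_rfl i (by omega)
            have hlt := tw_lt hm0 t i
            apply Runs.block
            · simp [k1, k2, c1, hld]; omega
            · simp [k1, k2, c1, hld, hk3]
              refine ⟨by ring, by ring, fun t' ht' o ho => ?_, fun o ho => ?_⟩
              · have h1 : t' * (2 * T) ≤ t * (2 * T) := Nat.mul_le_mul_right _ ht'
                rw [if_neg (by omega), if_neg (by omega)]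
                exact k3 t' ht' o ho
              · split_ifs with h1 h2
                · obtain rfl : o = 2 * i + 1 := by omega
                  rw [tw_two_mul_add_one]
                · subst h2; rw [tw_two_mul]
                · exact k4 o (by omega)
          · intro s3 f3 hz ⟨k1, k2, k3, k4⟩
            refine ⟨by rw [k1]; ring, k2, fun t' ht' o ho => ?_⟩
            rcases Nat.lt_or_ge t t' with h | h
            · obtain rfl : t' = t + 1 := by omega
              exact k4 o ho
            · exact k3 t' h o ho
        intro s3 f3 ⟨k1, k2, k3⟩
        have c2 : s3.reg vT = T := by rw [f3.reg _ (by decide), b2]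
        have c3 : s3.reg ks = n - t := by rw [f3.reg _ (by decide), hk]
        apply Runs.block
        · simp [k2, c2]; omega
        · simp [k1, k2, c2, c3]
          exact ⟨by ring, k3⟩
      · simp
    · intro s2 f2 hz ⟨j1, j2, j3⟩
      exact j3
  · simp; ring_nf; omega

end RAM

/-! ### The forward transform of a level -/

namespace RAM

open Nega

variable {M w m T nb tb : ℕ}

/-- The stages of the transform after the first one. -/
def fstages : Prog := forN ks vlo (fpass ;; copyBack ;; block [.add vtb vtb vTT])

/-- Transform the data by one level. -/
def fwdLevel : Prog :=
  block [.store aQ vix vQ, .const 0 1, .add vix vix 0] ;; setup ;; tbl ;;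
  block [.add vtot vtot vtot] ;; spass ;; copyBack ;; block [.add vtb vTT vTT] ;;
  fstages ;; dbl vnb vst ;;
  block [.copy vQ vhi]

/-- Halve the scale `vsc` modulo the odd number `M`. -/
def halfScale : Prog :=
  block [.half vt vsc, .add 0 vt vt, .sub 0 vsc 0] ;;
  .ite 0 (block [.add vsc vsc rM, .half vsc vsc]) (block [.copy vsc vt])

/-- All stages of the inverse transform. -/
def istages : Prog := forN ks vst (ipass ;; copyBack ;; halfScale ;; block [.sub vtb vtb vTT])

/-- Transform the data back by one level. -/
def bwdLevel : Prog :=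
  block [.const 0 1, .sub vix vix 0, .load vQ aQ vix] ;; setup ;; tbl ;; hlv vnb vst ;;
  block [.copy vtb vTT] ;; forN kl vlo (block [.add vtb vtb vTT]) ;; istages ;;
  block [.half vtot vtot] ;; mpass ;; copyBack

/-- A level that splits `nb` blocks of length `2 ^ Q` fits into words as soon as the data do. -/
theorem levB_of {Q : ℕ} (hnb : 0 < nb) (hM : 2 * M < 2 ^ w) (hb : 8 * (nb * 2 ^ Q) < 2 ^ w) :
    LevB M w (2 ^ (Q - Q / 2)) (2 ^ (Q / 2)) nb ∧
      nb * (2 * 2 ^ (Q / 2)) * 2 ^ (Q - Q / 2) = 2 * (nb * 2 ^ Q) ∧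
      nb * (2 ^ (Q / 2) * 2 ^ (Q - Q / 2)) = nb * 2 ^ Q ∧ 2 ^ Q ≤ nb * 2 ^ Q ∧ 1 ≤ 2 ^ Q ∧
      (Q / 2 + 1 + 1) * (2 * 2 ^ (Q / 2)) ≤ 4 * 2 ^ Q ∧ 2 ^ (Q - Q / 2) ≤ 2 ^ Q := by
  have h3 : 2 ^ (Q / 2) * 2 ^ (Q - Q / 2) = 2 ^ Q := by rw [← pow_add]; congr 1; omega
  have h1 : 2 ^ (Q - Q / 2) ≤ 2 ^ Q := Nat.pow_le_pow_right (by norm_num) (by omega)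
  have h0 := Nat.one_le_two_pow (n := Q)
  have h4 : 2 ^ Q ≤ nb * 2 ^ Q := Nat.le_mul_of_pos_left _ hnb
  have h5 : nb * (2 * 2 ^ (Q / 2)) * 2 ^ (Q - Q / 2) = 2 * (nb * 2 ^ Q) := by rw [← h3]; ring
  have h6 : Q / 2 + 2 ≤ 2 * 2 ^ (Q / 2) := by have := Nat.lt_two_pow_self (n := Q / 2); omega
  have h7 : 2 ^ (Q / 2) * 2 ^ (Q / 2) ≤ 2 ^ Q := by
    rw [← pow_add]; exact Nat.pow_le_pow_right (by norm_num) (by omega)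
  refine ⟨⟨?_, hM, by omega, by positivity, by positivity, by rw [h5]; omega⟩, h5, by rw [h3], h4,
    h0, ?_, h1⟩
  · rcases Nat.eq_zero_or_pos w with rfl | h
    · omega
    · exact h
  · calc (Q / 2 + 2) * (2 * 2 ^ (Q / 2)) ≤ 2 * 2 ^ (Q / 2) * (2 * 2 ^ (Q / 2)) :=
        Nat.mul_le_mul_right _ h6
      _ = 4 * (2 ^ (Q / 2) * 2 ^ (Q / 2)) := by ring
      _ ≤ 4 * 2 ^ Q := Nat.mul_le_mul_left _ h7

/-- Every pass over the data takes a bounded number of steps per entry. -/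
theorem pass_cost (B : LevB M w m T nb) (hnb : 0 < nb) {S : ℕ} (hS : nb * (2 * T) * m = S) :
    nb * (T * (2 * (m * 48) + 40) + 40) + 10 ≤ 110 * S ∧
    nb * (T * (2 * (m * 48) + 60) + 40) + 10 ≤ 110 * S ∧
    nb * (T * (2 * (m * 10) + 40) + 40) + 10 ≤ 110 * S ∧
    nb * (m * (T * 50 + 40) + 40) + 10 ≤ 110 * S := by
  have hm0 := B.hm0
  have hT0 := B.hT0
  have h1 : nb * T ≤ nb * T * m := Nat.le_mul_of_pos_right _ hm0
  have h2 : nb * m ≤ nb * m * T := Nat.le_mul_of_pos_right _ hT0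
  have h3 : nb ≤ nb * T := Nat.le_mul_of_pos_right _ hT0
  rw [show nb * m * T = nb * T * m by ring] at h2
  rw [show nb * (2 * T) * m = 2 * (nb * T * m) by ring] at hS
  refine ⟨?_, ?_, ?_, ?_⟩ <;> ring_nf at * <;> omega

/-- Computing the parameters and the exponents of a level costs no more than the passes over the
data. -/
theorem table_cost {Q S : ℕ} (hS : 2 * 2 ^ Q ≤ S) :
    Q * 12 + 40 ≤ 26 * S ∧
      2 * 2 ^ (Q / 2) * 8 + (Q / 2 + 1) * (2 ^ (Q / 2) * 14 + 9) + 13 ≤ 32 * (Q / 2 + 1) * S := by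
  have h0 : Q < 2 ^ Q := Nat.lt_two_pow_self
  have h1 : 2 ^ (Q / 2) ≤ 2 ^ Q := Nat.pow_le_pow_right (by norm_num) (by omega)
  refine ⟨by omega, ?_⟩
  have h2 : 2 ^ (Q / 2) * 14 + 9 ≤ 16 * S := by omega
  have h3 : (Q / 2 + 1) * (2 ^ (Q / 2) * 14 + 9) ≤ (Q / 2 + 1) * (16 * S) :=
    Nat.mul_le_mul_left _ h2
  have h4 : 2 * 2 ^ (Q / 2) * 8 + 13 ≤ 16 * S := by omega
  have h5 : 16 * S ≤ (Q / 2 + 1) * (16 * S) := Nat.le_mul_of_pos_left _ (by omega)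
  calc _ ≤ (Q / 2 + 1) * (16 * S) + (Q / 2 + 1) * (16 * S) := by omega
    _ = _ := by ring

theorem fstages_spec {Q : ℕ} {s4 : State} {X : ℕ → ZMod M} {A : ℕ → ℕ} (U4 : SetupOK Q s4)
    (d1 : s4.reg rM = M) (d2 : s4.reg vnb = nb) (d3 : s4.reg vtot = 2 * (nb * 2 ^ Q))
    (htb4 : s4.reg vtb = 2 * (2 * 2 ^ (Q / 2))) (d7 : s4.arr aW = A)
    (hW2 : ∀ t ≤ Q / 2 + 1, ∀ o < 2 * 2 ^ (Q / 2),
      A (t * (2 * 2 ^ (Q / 2)) + o) = tw (2 ^ (Q - Q / 2)) t o)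
    (hnb : 0 < nb) (hMw : 2 * M < 2 ^ w) (hb : 8 * (nb * 2 ^ Q) < 2 ^ w)
    (hX4 : Pre M s4 aX (fwds (2 ^ (Q - Q / 2)) (2 ^ (Q / 2)) X 0) (2 * (nb * 2 ^ Q))) :
    Runs w fstages (Q / 2 * (130 * (2 * (nb * 2 ^ Q)) + 4) + 3) s4 fun s' =>
      Pre M s' aX (fwds (2 ^ (Q - Q / 2)) (2 ^ (Q / 2)) X (Q / 2)) (2 * (nb * 2 ^ Q)) := by
  obtain ⟨B, htt, hTm, hQn, hQ1, htw, hmQ⟩ := levB_of (Q := Q) hnb hMw hb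
  have hw := B.hw
  obtain ⟨pc1, -, pc3, -⟩ := pass_cost B hnb htt
  have htw' : ∀ t ≤ Q / 2, (t + 2) * (2 * 2 ^ (Q / 2)) ≤ 4 * 2 ^ Q := fun t ht =>
    (Nat.mul_le_mul_right _ (by omega)).trans htw
  apply Runs.forN (N := 130 * (2 * (nb * 2 ^ Q))) (n := Q / 2) (fun t s' =>
    s'.reg vtb = (t + 2) * (2 * 2 ^ (Q / 2)) ∧
    Pre M s' aX (fwds (2 ^ (Q - Q / 2)) (2 ^ (Q / 2)) X t) (2 * (nb * 2 ^ Q)))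
    U4.hlo (by decide +kernel) hw (Q := fun s' =>
      Pre M s' aX (fwds (2 ^ (Q - Q / 2)) (2 ^ (Q / 2)) X (Q / 2)) (2 * (nb * 2 ^ Q)))
  · refine ⟨?_, by simpa using hX4⟩
    simp [htb4]
  · intro t s5 ht hk f5 ⟨i1, i2⟩
    have U5 : SetupOK Q s5 := U4.frame f5 (by decide +kernel)
    have e1 : s5.reg rM = M := by rw [f5.reg _ (by decide +kernel), d1]
    have e2 : s5.reg vnb = nb := by rw [f5.reg _ (by decide +kernel), d2]
    have e3 : s5.reg vtot = 2 * (nb * 2 ^ Q) := by rw [f5.reg _ (by decide +kernel), d3]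
    have e7 : s5.arr aW = A := by rw [f5.arr _ (by decide +kernel), d7]
    have hwt := htw' t (by omega)
    have hwt' := htw' (t + 1) (by omega)
    have hwt'' : (t + 1 + 2) * (2 * 2 ^ (Q / 2)) =
      (t + 2) * (2 * 2 ^ (Q / 2)) + 2 * 2 ^ (Q / 2) := by ring
    apply Runs.of_le
    · apply Runs.call_seq (Runs.of_le (fpass_spec (X := fwds (2 ^ (Q - Q / 2)) (2 ^ (Q / 2)) X t)
        (E := tw (2 ^ (Q - Q / 2)) (t + 2)) (tb := (t + 2) * (2 * 2 ^ (Q / 2)))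
        ⟨e1, U5.hm, U5.hmm, U5.hT, U5.hTm, e2⟩ B hnb (by rw [htt]; exact i2)
        (fun o ho => ⟨by rw [e7]; exact hW2 _ (by omega) o ho, (tw_lt B.hm0 _ _).le⟩)
        (by omega) i1) pc1)
      intro s6 f6 hY6
      rw [htt] at hY6
      have g1 : s6.reg vtot = 2 * (nb * 2 ^ Q) := by rw [f6.reg _ (by decide +kernel), e3]
      apply Runs.call_seq (copyBack_spec hw (by omega) g1 hY6)
      intro s7 f7 hX7
      have g2 : s7.reg vtb = (t + 2) * (2 * 2 ^ (Q / 2)) := by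
        rw [f7.reg _ (by decide +kernel), f6.reg _ (by decide +kernel), i1]
      have g3 : s7.reg vTT = 2 * 2 ^ (Q / 2) := by
        rw [f7.reg _ (by decide +kernel), f6.reg _ (by decide +kernel), U5.hTT]
      have g4 : s7.reg ks = Q / 2 - t := by
        rw [f7.reg _ (by decide +kernel), f6.reg _ (by decide +kernel), hk]
      apply Runs.block
      · simp [g2, g3]; omega
      · simp [g2, g3, g4]
        exact ⟨hwt''.symm, hX7⟩
    · clear pc1 pc3 htw htw' hwt hwt' hwt'' htt hTm hMw hmQ hb
      simp; omega
  · intro s5 f5 hz ⟨i1, i2⟩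
    exact i2

/-- A level replaces `nb` blocks of length `2 ^ Q` by `nb * 2 ^ (Q / 2 + 1)` blocks of about half
the exponent: it doubles the amount of data, and it takes a number of steps proportional to that amount
and to the number of stages. -/
theorem fwdLevel_spec {Q ix : ℕ} {s : State} {X : ℕ → ZMod M} (hM : s.reg rM = M)
    (hQ : s.reg vQ = Q) (hvnb : s.reg vnb = nb) (htot : s.reg vtot = nb * 2 ^ Q)
    (hix : s.reg vix = ix) (hixw : ix + 1 < 2 ^ w)
    (hnb : 0 < nb) (hMw : 2 * M < 2 ^ w) (hb : 8 * (nb * 2 ^ Q) < 2 ^ w)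
    (hX : Pre M s aX X (nb * 2 ^ Q)) :
    Runs w fwdLevel (300 * (Q / 2 + 1) * (2 * (nb * 2 ^ Q))) s fun s' =>
      Pre M s' aX (fwds (2 ^ (Q - Q / 2)) (2 ^ (Q / 2)) X (Q / 2)) (2 * (nb * 2 ^ Q)) ∧
      s'.reg vtot = 2 * (nb * 2 ^ Q) ∧ s'.reg vnb = nb * (2 * 2 ^ (Q / 2)) ∧
      s'.reg vQ = Q - Q / 2 ∧ s'.reg vix = ix + 1 ∧
      ∀ j, s'.arr aQ j = if j = ix then Q else s.arr aQ j := by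
  obtain ⟨B, htt, hTm, hQn, hQ1, htw, hmQ⟩ := levB_of (Q := Q) hnb hMw hb
  have hw := B.hw
  obtain ⟨pc1, -, pc3, -⟩ := pass_cost B hnb htt
  obtain ⟨tc1, tc2⟩ := table_cost (Q := Q) (S := 2 * (nb * 2 ^ Q)) (by omega)
  apply Runs.of_le
  · apply Runs.block_seq
    · simp [hix]; omega
    apply Runs.call_seq (setup_spec (Q := Q) (by simp [hQ]) (by omega))
    intro s1 f1 U1
    have a1 : s1.reg rM = M := by rw [f1.reg _ (by decide +kernel)]; simp [hM]
    have a2 : s1.reg vnb = nb := by rw [f1.reg _ (by decide +kernel)]; simp [hvnb]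
    have a3 : s1.reg vtot = nb * 2 ^ Q := by rw [f1.reg _ (by decide +kernel)]; simp [htot]
    have a4 : s1.reg vix = ix + 1 := by rw [f1.reg _ (by decide +kernel)]; simp [hix]
    have a5 : ∀ j, s1.arr aQ j = if j = ix then Q else s.arr aQ j := by
      intro j; rw [f1.arr _ (by decide +kernel)]; simp [hix, hQ]
    have a6 : s1.arr aX = s.arr aX := by rw [f1.arr _ (by decide +kernel)]; funext j; simp
    apply Runs.call_seq (tbl_spec hw U1.hm U1.hT U1.hTT U1.hst B.hm0 (by omega) (by omega))
    intro s2 f2 hW2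
    have U2 := U1.frame f2 (by decide +kernel)
    have b1 : s2.reg rM = M := by rw [f2.reg _ (by decide +kernel), a1]
    have b2 : s2.reg vnb = nb := by rw [f2.reg _ (by decide +kernel), a2]
    have b3 : s2.reg vtot = nb * 2 ^ Q := by rw [f2.reg _ (by decide +kernel), a3]
    have b4 : s2.reg vix = ix + 1 := by rw [f2.reg _ (by decide +kernel), a4]
    have b5 : ∀ j, s2.arr aQ j = if j = ix then Q else s.arr aQ j := by
      intro j; rw [f2.arr _ (by decide +kernel), a5]
    have b6 : s2.arr aX = s.arr aX := by rw [f2.arr _ (by decide +kernel), a6]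
    apply Runs.block_seq
    · simp [b3]; omega
    apply Runs.call_seq (spass_spec (X := X) (m := 2 ^ (Q - Q / 2)) (T := 2 ^ (Q / 2)) (nb := nb)
      ⟨by simp [b1], by simp [U2.hm], by simp [U2.hmm], by simp [U2.hT], by simp [U2.hTm],
        by simp [b2]⟩ B hnb (by rw [hTm]; exact hX.frame (by simp [b6])))
    intro s3 f3 hY3
    rw [htt] at hY3
    have U3 : SetupOK Q s3 := SetupOK.frame ⟨by simp [U2.hm], by simp [U2.hmm], by simp [U2.hT],
      by simp [U2.hTT], by simp [U2.hTm], by simp [U2.hlo], by simp [U2.hst], by simp [U2.hhi]⟩ f3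
      (by decide +kernel)
    have c1 : s3.reg rM = M := by rw [f3.reg _ (by decide +kernel)]; simp [b1]
    have c2 : s3.reg vnb = nb := by rw [f3.reg _ (by decide +kernel)]; simp [b2]
    have c3 : s3.reg vtot = 2 * (nb * 2 ^ Q) := by
      rw [f3.reg _ (by decide +kernel)]; simp [b3]; ring
    have c4 : s3.reg vix = ix + 1 := by rw [f3.reg _ (by decide +kernel)]; simp [b4]
    have c5 : ∀ j, s3.arr aQ j = if j = ix then Q else s.arr aQ j := by
      intro j; rw [f3.arr _ (by decide +kernel)]; simp [b5]
    have c7 : s3.arr aW = s2.arr aW := by rw [f3.arr _ (by decide +kernel)]; simp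
    apply Runs.call_seq (copyBack_spec hw (by omega) c3 hY3)
    intro s4 f4 hX4
    have U4 := U3.frame f4 (by decide +kernel)
    have d1 : s4.reg rM = M := by rw [f4.reg _ (by decide +kernel), c1]
    have d2 : s4.reg vnb = nb := by rw [f4.reg _ (by decide +kernel), c2]
    have d3 : s4.reg vtot = 2 * (nb * 2 ^ Q) := by rw [f4.reg _ (by decide +kernel), c3]
    have d4 : s4.reg vix = ix + 1 := by rw [f4.reg _ (by decide +kernel), c4]
    have d5 : ∀ j, s4.arr aQ j = if j = ix then Q else s.arr aQ j := by
      intro j; rw [f4.arr _ (by decide +kernel), c5]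
    have d7 : s4.arr aW = s2.arr aW := by rw [f4.arr _ (by decide +kernel), c7]
    have htw' : ∀ t ≤ Q / 2, (t + 2) * (2 * 2 ^ (Q / 2)) ≤ 4 * 2 ^ Q := fun t ht =>
      (Nat.mul_le_mul_right _ (by omega)).trans htw
    apply Runs.block_seq
    · simp [U4.hTT]
      have := htw' 0 (by omega)
      omega
    apply Runs.call_seq (fstages_spec (s4 := runL [.add vtb vTT vTT] s4) (X := X) (nb := nb) (Q := Q)
      (A := s2.arr aW) ⟨by simp [U4.hm], by simp [U4.hmm],
      by simp [U4.hT], by simp [U4.hTT], by simp [U4.hTm], by simp [U4.hlo], by simp [U4.hst],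
      by simp [U4.hhi]⟩ (by simp [d1]) (by simp [d2]) (by simp [d3]) (by simp [U4.hTT]; ring)
      (by simp [d7]) hW2 hnb hMw hb (by rw [fwds]; simpa using hX4))
    intro s5 f5 hX5
    have U5 : SetupOK Q s5 := SetupOK.frame ⟨by simp [U4.hm], by simp [U4.hmm],
      by simp [U4.hT], by simp [U4.hTT], by simp [U4.hTm], by simp [U4.hlo], by simp [U4.hst],
      by simp [U4.hhi]⟩ f5 (by decide +kernel)
    have e2 : s5.reg vnb = nb := by rw [f5.reg _ (by decide +kernel)]; simp [d2]
    have e3 : s5.reg vtot = 2 * (nb * 2 ^ Q) := by rw [f5.reg _ (by decide +kernel)]; simp [d3]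
    have e4 : s5.reg vix = ix + 1 := by rw [f5.reg _ (by decide +kernel)]; simp [d4]
    have e5 : ∀ j, s5.arr aQ j = if j = ix then Q else s.arr aQ j := by
      intro j; rw [f5.arr _ (by decide +kernel)]; simp [d5]
    have hnb2 : nb * 2 ^ (Q / 2 + 1) ≤ 2 * (nb * 2 ^ Q) := by
      calc nb * 2 ^ (Q / 2 + 1) = 2 * (nb * 2 ^ (Q / 2)) := by ring
        _ ≤ 2 * (nb * 2 ^ Q) := Nat.mul_le_mul_left _ (Nat.mul_le_mul_left _
            (Nat.pow_le_pow_right (by norm_num) (by omega)))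
    apply Runs.call_seq (dbl_spec hw (by decide +kernel) (by decide +kernel) U5.hst (by rw [e2]; omega))
    intro s6 f6 h6
    have g1 : s6.reg vhi = Q - Q / 2 := by rw [f6.reg _ (by decide +kernel), U5.hhi]
    have g2 : s6.reg vtot = 2 * (nb * 2 ^ Q) := by rw [f6.reg _ (by decide +kernel), e3]
    have g3 : s6.reg vix = ix + 1 := by rw [f6.reg _ (by decide +kernel), e4]
    have g4 : ∀ j, s6.arr aQ j = if j = ix then Q else s.arr aQ j := by
      intro j; rw [f6.arr _ (by decide +kernel), e5]
    apply Runs.block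
    · simp
    · simp [g1, g2, g3, g4, h6, e2, pow_succ']
      exact hX5.frame (by rw [f6.arr _ (by decide +kernel)])
  · have h2 : 1 ≤ Q / 2 + 1 := by omega
    have hS0 : 2 * 2 ^ Q ≤ 2 * (nb * 2 ^ Q) := by omega
    generalize 2 * (nb * 2 ^ Q) = S at *
    have e1 : Q / 2 * (130 * S + 4) ≤ Q / 2 * (132 * S) := Nat.mul_le_mul_left _ (by omega)
    have e2 : 300 * (Q / 2 + 1) * S = (Q / 2) * (132 * S) + 32 * (Q / 2 + 1) * S +
      136 * ((Q / 2) * S) + 268 * S := by ring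
    have e3 : Q / 2 ≤ S := by have := Nat.lt_two_pow_self (n := Q); omega
    simp
    omega

end RAM

/-! ### The inverse transform of a level -/

namespace RAM

open Nega

variable {M w m T nb tb : ℕ}

theorem halfScale_spec {s : State} {v : ℕ} (hMo : M % 2 = 1) (hMw : 2 * M < 2 ^ w)
    (hM : s.reg rM = M) (hv : s.reg vsc = v) (hvM : v ≤ M) :
    Runs w halfScale 15 s fun s' => s'.reg vsc ≤ M ∧ 2 * (s'.reg vsc : ZMod M) = v := by
  apply Runs.of_le
  · apply Runs.block_seq
    · simp [hv]; omega
    apply Runs.ite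
    · intro h
      simp [hv] at h
      apply Runs.block
      · simp [hv, hM]; omega
      · simp [hv, hM]
        refine ⟨by omega, ?_⟩
        have : 2 * ((v + M) / 2) = v + M := by omega
        have h2 := congrArg (Nat.cast : ℕ → ZMod M) this
        push_cast at h2
        simpa using h2
    · intro h
      simp [hv] at h
      apply Runs.block
      · simp
      · simp [hv]
        refine ⟨by omega, ?_⟩
        have : 2 * (v / 2) = v := by omega
        have h2 := congrArg (Nat.cast : ℕ → ZMod M) this
        push_cast at h2
        simpa using h2
  · simp

theorem istages_spec {Q v : ℕ} {s4 : State} {Z : ℕ → ZMod M} {A : ℕ → ℕ} (U4 : SetupOK Q s4)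
    (d1 : s4.reg rM = M) (d2 : s4.reg vnb = nb) (d3 : s4.reg vtot = 2 * (nb * 2 ^ Q))
    (htb4 : s4.reg vtb = (Q / 2 + 1) * (2 * 2 ^ (Q / 2))) (d7 : s4.arr aW = A)
    (hW2 : ∀ t ≤ Q / 2 + 1, ∀ o < 2 * 2 ^ (Q / 2),
      A (t * (2 * 2 ^ (Q / 2)) + o) = tw (2 ^ (Q - Q / 2)) t o)
    (hMo : M % 2 = 1) (hsc : s4.reg vsc = v) (hvM : v ≤ M)
    (hnb : 0 < nb) (hMw : 2 * M < 2 ^ w) (hb : 8 * (nb * 2 ^ Q) < 2 ^ w)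
    (hX4 : Pre M s4 aX Z (2 * (nb * 2 ^ Q))) :
    Runs w istages ((Q / 2 + 1) * (130 * (2 * (nb * 2 ^ Q)) + 4) + 3) s4 fun s' =>
      Pre M s' aX (invs (2 ^ (Q - Q / 2)) (2 ^ (Q / 2)) (Q / 2 + 1) Z (Q / 2 + 1))
        (2 * (nb * 2 ^ Q)) ∧ s'.reg vsc ≤ M ∧ 2 ^ (Q / 2 + 1) * (s'.reg vsc : ZMod M) = v := by
  obtain ⟨B, htt, hTm, hQn, hQ1, htw, hmQ⟩ := levB_of (Q := Q) hnb hMw hb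
  have hw := B.hw
  obtain ⟨-, pc1, pc3, -⟩ := pass_cost B hnb htt
  have htw' : ∀ t ≤ Q / 2 + 1, (t + 1) * (2 * 2 ^ (Q / 2)) ≤ 4 * 2 ^ Q := fun t ht =>
    (Nat.mul_le_mul_right _ (by omega)).trans htw
  apply Runs.forN (N := 130 * (2 * (nb * 2 ^ Q))) (n := Q / 2 + 1) (fun t s' =>
    s'.reg vtb = (Q / 2 + 1 - t) * (2 * 2 ^ (Q / 2)) ∧
    Pre M s' aX (invs (2 ^ (Q - Q / 2)) (2 ^ (Q / 2)) (Q / 2 + 1) Z t) (2 * (nb * 2 ^ Q)) ∧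
    s'.reg vsc ≤ M ∧ 2 ^ t * (s'.reg vsc : ZMod M) = v)
    U4.hst (by decide) hw
  · refine ⟨?_, by rw [invs]; simpa using hX4, ?_⟩
    · simp [htb4]
    · simp [hsc, hvM]
  · intro t s5 ht hk f5 ⟨i1, i2, i3, i4⟩
    have U5 : SetupOK Q s5 := U4.frame f5 (by decide +kernel)
    have e1 : s5.reg rM = M := by rw [f5.reg _ (by decide +kernel), d1]
    have e2 : s5.reg vnb = nb := by rw [f5.reg _ (by decide +kernel), d2]
    have e3 : s5.reg vtot = 2 * (nb * 2 ^ Q) := by rw [f5.reg _ (by decide +kernel), d3]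
    have e7 : s5.arr aW = A := by rw [f5.arr _ (by decide +kernel), d7]
    have hwt := htw' (Q / 2 + 1 - t) (by omega)
    have hwt'' : (Q / 2 + 1 - t) * (2 * 2 ^ (Q / 2)) - 2 * 2 ^ (Q / 2) =
      (Q / 2 + 1 - (t + 1)) * (2 * 2 ^ (Q / 2)) := by
      rw [← Nat.sub_one_mul]; congr 1
    have hwt3 : (Q / 2 + 1 - t + 1) * (2 * 2 ^ (Q / 2)) =
      (Q / 2 + 1 - t) * (2 * 2 ^ (Q / 2)) + 2 * 2 ^ (Q / 2) := by ring
    apply Runs.of_le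
    · apply Runs.call_seq (Runs.of_le (ipass_spec
        (X := invs (2 ^ (Q - Q / 2)) (2 ^ (Q / 2)) (Q / 2 + 1) Z t)
        (E := tw (2 ^ (Q - Q / 2)) (Q / 2 + 1 - t)) (tb := (Q / 2 + 1 - t) * (2 * 2 ^ (Q / 2)))
        ⟨e1, U5.hm, U5.hmm, U5.hT, U5.hTm, e2⟩ B hnb (by rw [htt]; exact i2)
        (fun o ho => ⟨by rw [e7]; exact hW2 _ (by omega) o ho, (tw_lt B.hm0 _ _).le⟩)
        (by omega) i1) pc1)
      intro s6 f6 hY6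
      rw [htt] at hY6
      have g1 : s6.reg vtot = 2 * (nb * 2 ^ Q) := by rw [f6.reg _ (by decide +kernel), e3]
      apply Runs.call_seq (copyBack_spec hw (by omega) g1 hY6)
      intro s7 f7 hX7
      have g5 : s7.reg vsc = s5.reg vsc := by
        rw [f7.reg _ (by decide +kernel), f6.reg _ (by decide +kernel)]
      have g6 : s7.reg rM = M := by
        rw [f7.reg _ (by decide +kernel), f6.reg _ (by decide +kernel), e1]
      apply Runs.call_seq (halfScale_spec hMo hMw g6 g5 i3)
      intro s8 f8 ⟨j1, j2⟩
      have g2 : s8.reg vtb = (Q / 2 + 1 - t) * (2 * 2 ^ (Q / 2)) := by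
        rw [f8.reg _ (by decide +kernel), f7.reg _ (by decide +kernel),
          f6.reg _ (by decide +kernel), i1]
      have g3 : s8.reg vTT = 2 * 2 ^ (Q / 2) := by
        rw [f8.reg _ (by decide +kernel), f7.reg _ (by decide +kernel),
          f6.reg _ (by decide +kernel), U5.hTT]
      have g4 : s8.reg ks = Q / 2 + 1 - t := by
        rw [f8.reg _ (by decide +kernel), f7.reg _ (by decide +kernel),
          f6.reg _ (by decide +kernel), hk]
      apply Runs.block
      · simp
      · simp [g2, g3, g4]
        refine ⟨by rw [hwt'']; congr 1; omega, hX7.frame (f8.arr _ (by decide +kernel)), j1, ?_⟩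
        rw [pow_succ, mul_assoc, j2, i4]
    · clear pc1 pc3 htw htw' hwt hwt'' htt hTm hMw hmQ hb hwt3
      simp; omega
  · intro s5 f5 hz ⟨i1, i2⟩
    exact i2

/-- The way back through a level halves the amount of data; the scale `vsc` takes up the factors `2`
of the stages. -/
theorem bwdLevel_spec {Q ix v : ℕ} {s : State} {Z : ℕ → ZMod M} (hM : s.reg rM = M)
    (hQ : s.arr aQ ix = Q) (hvnb : s.reg vnb = nb * (2 * 2 ^ (Q / 2)))
    (htot : s.reg vtot = 2 * (nb * 2 ^ Q)) (hix : s.reg vix = ix + 1)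
    (hMo : M % 2 = 1) (hsc : s.reg vsc = v) (hvM : v ≤ M)
    (hnb : 0 < nb) (hMw : 2 * M < 2 ^ w) (hb : 8 * (nb * 2 ^ Q) < 2 ^ w)
    (hX : Pre M s aX Z (2 * (nb * 2 ^ Q))) :
    Runs w bwdLevel (600 * (Q / 2 + 1) * (2 * (nb * 2 ^ Q))) s fun s' =>
      Pre M s' aX (merge (2 ^ (Q - Q / 2)) (2 ^ (Q / 2)) (invs (2 ^ (Q - Q / 2)) (2 ^ (Q / 2))
        (Q / 2 + 1) Z (Q / 2 + 1))) (nb * 2 ^ Q) ∧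
      s'.reg vtot = nb * 2 ^ Q ∧ s'.reg vnb = nb ∧ s'.reg vix = ix ∧
      s'.reg vsc ≤ M ∧ 2 ^ (Q / 2 + 1) * (s'.reg vsc : ZMod M) = v := by
  obtain ⟨B, htt, hTm, hQn, hQ1, htw, hmQ⟩ := levB_of (Q := Q) hnb hMw hb
  have hw := B.hw
  obtain ⟨-, -, -, pc⟩ := pass_cost B hnb htt
  obtain ⟨tc1, tc2⟩ := table_cost (Q := Q) (S := 2 * (nb * 2 ^ Q)) (by omega)
  apply Runs.of_le
  · apply Runs.block_seq
    · simp; omega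
    apply Runs.call_seq (Runs.of_le (setup_spec (Q := Q) (by simp [hQ, hix]) (by omega)) tc1)
    intro s1 f1 U1
    have a1 : s1.reg rM = M := by rw [f1.reg _ (by decide +kernel)]; simp [hM]
    have a2 : s1.reg vnb = nb * (2 * 2 ^ (Q / 2)) := by
      rw [f1.reg _ (by decide +kernel)]; simp [hvnb]
    have a3 : s1.reg vtot = 2 * (nb * 2 ^ Q) := by rw [f1.reg _ (by decide +kernel)]; simp [htot]
    have a4 : s1.reg vix = ix := by rw [f1.reg _ (by decide +kernel)]; simp [hix]
    have a5 : s1.reg vsc = v := by rw [f1.reg _ (by decide +kernel)]; simp [hsc]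
    have a6 : s1.arr aX = s.arr aX := by rw [f1.arr _ (by decide +kernel)]; funext j; simp
    apply Runs.call_seq (Runs.of_le (tbl_spec hw U1.hm U1.hT U1.hTT U1.hst B.hm0 (by omega)
      (by omega)) tc2)
    intro s2 f2 hW2
    have U2 := U1.frame f2 (by decide +kernel)
    have b1 : s2.reg rM = M := by rw [f2.reg _ (by decide +kernel), a1]
    have b2 : s2.reg vnb = nb * (2 * 2 ^ (Q / 2)) := by rw [f2.reg _ (by decide +kernel), a2]
    have b3 : s2.reg vtot = 2 * (nb * 2 ^ Q) := by rw [f2.reg _ (by decide +kernel), a3]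
    have b4 : s2.reg vix = ix := by rw [f2.reg _ (by decide +kernel), a4]
    have b5 : s2.reg vsc = v := by rw [f2.reg _ (by decide +kernel), a5]
    have b6 : s2.arr aX = s.arr aX := by rw [f2.arr _ (by decide +kernel), a6]
    apply Runs.call_seq (hlv_spec (a := nb) hw (by decide) (by decide) U2.hst
      (by rw [b2, pow_succ']))
    intro s3 f3 h3
    have U3 := U2.frame f3 (by decide +kernel)
    have c1 : s3.reg rM = M := by rw [f3.reg _ (by decide +kernel), b1]
    have c3 : s3.reg vtot = 2 * (nb * 2 ^ Q) := by rw [f3.reg _ (by decide +kernel), b3]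
    have c4 : s3.reg vix = ix := by rw [f3.reg _ (by decide +kernel), b4]
    have c5 : s3.reg vsc = v := by rw [f3.reg _ (by decide +kernel), b5]
    have c6 : s3.arr aX = s.arr aX := by rw [f3.arr _ (by decide +kernel), b6]
    have c7 : s3.arr aW = s2.arr aW := by rw [f3.arr _ (by decide +kernel)]
    apply Runs.block_seq
    · simp
    apply Runs.call_seq
    · apply Runs.forN (N := 2) (n := Q / 2) (fun i s' => s'.reg vtb = (i + 1) * (2 * 2 ^ (Q / 2)))
        (by simp [U3.hlo]) (by decide) hw
        (Q := fun s' => s'.reg vtb = (Q / 2 + 1) * (2 * 2 ^ (Q / 2)))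
      · simp [U3.hTT]
      · intro i s' hi hk f hi1
        have hTT : s'.reg vTT = 2 * 2 ^ (Q / 2) := by
          rw [f.reg _ (by decide +kernel)]; simp [U3.hTT]
        have h5 : (i + 1 + 1) * (2 * 2 ^ (Q / 2)) ≤ 4 * 2 ^ Q :=
          (Nat.mul_le_mul_right _ (by omega)).trans htw
        have h6 : (i + 1 + 1) * (2 * 2 ^ (Q / 2)) =
          (i + 1) * (2 * 2 ^ (Q / 2)) + 2 * 2 ^ (Q / 2) := by ring
        apply Runs.block
        · simp [hi1, hTT]; omega
        · simp [hi1, hTT, hk, h6]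
      · intro s' f hz h; exact h
    intro s4 f4 h4
    have U4 : SetupOK Q s4 := SetupOK.frame ⟨by simp [U3.hm], by simp [U3.hmm], by simp [U3.hT],
      by simp [U3.hTT], by simp [U3.hTm], by simp [U3.hlo], by simp [U3.hst], by simp [U3.hhi]⟩ f4
      (by decide +kernel)
    have d1 : s4.reg rM = M := by rw [f4.reg _ (by decide +kernel)]; simp [c1]
    have d2 : s4.reg vnb = nb := by rw [f4.reg _ (by decide +kernel)]; simp [h3]
    have d3 : s4.reg vtot = 2 * (nb * 2 ^ Q) := by rw [f4.reg _ (by decide +kernel)]; simp [c3]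
    have d4 : s4.reg vix = ix := by rw [f4.reg _ (by decide +kernel)]; simp [c4]
    have d5 : s4.reg vsc = v := by rw [f4.reg _ (by decide +kernel)]; simp [c5]
    have d6 : s4.arr aX = s.arr aX := by rw [f4.arr _ (by decide +kernel)]; simp [c6]
    have d7 : s4.arr aW = s2.arr aW := by rw [f4.arr _ (by decide +kernel)]; simp [c7]
    apply Runs.call_seq (istages_spec (nb := nb) (Q := Q) U4 d1 d2 d3 h4 d7 hW2 hMo d5 hvM hnb
      hMw hb (hX.frame d6))
    intro s5 f5 ⟨hX5, hs5, hs5'⟩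
    have U5 := U4.frame f5 (by decide +kernel)
    have e1 : s5.reg rM = M := by rw [f5.reg _ (by decide +kernel), d1]
    have e2 : s5.reg vnb = nb := by rw [f5.reg _ (by decide +kernel), d2]
    have e3 : s5.reg vtot = 2 * (nb * 2 ^ Q) := by rw [f5.reg _ (by decide +kernel), d3]
    have e4 : s5.reg vix = ix := by rw [f5.reg _ (by decide +kernel), d4]
    apply Runs.block_seq
    · simp
    apply Runs.call_seq (Runs.of_le (mpass_spec
      (X := invs (2 ^ (Q - Q / 2)) (2 ^ (Q / 2)) (Q / 2 + 1) Z (Q / 2 + 1))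
      (s := runL [.half vtot vtot] s5)
      (m := 2 ^ (Q - Q / 2)) (T := 2 ^ (Q / 2)) (nb := nb)
      ⟨by simp [e1], by simp [U5.hm], by simp [U5.hmm], by simp [U5.hT], by simp [U5.hTm],
        by simp [e2]⟩ B hnb (by rw [htt]; simpa using hX5)) pc)
    intro s6 f6 hY6
    rw [hTm] at hY6
    have g1 : s6.reg vnb = nb := by rw [f6.reg _ (by decide +kernel)]; simp [e2]
    have g2 : s6.reg vtot = nb * 2 ^ Q := by rw [f6.reg _ (by decide +kernel)]; simp [e3]
    have g3 : s6.reg vix = ix := by rw [f6.reg _ (by decide +kernel)]; simp [e4]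
    have g4 : s6.reg vsc = s5.reg vsc := by rw [f6.reg _ (by decide +kernel)]; simp
    apply Runs.call (copyBack_spec hw (by omega) g2 hY6)
    intro s7 f7 hX7
    refine ⟨hX7, ?_, ?_, ?_, ?_⟩
    · rw [f7.reg _ (by decide +kernel), g2]
    · rw [f7.reg _ (by decide +kernel), g1]
    · rw [f7.reg _ (by decide +kernel), g3]
    · rw [f7.reg _ (by decide +kernel), g4]
      exact ⟨hs5, hs5'⟩
  · have hQS : Q / 2 ≤ nb * 2 ^ Q := by
      have := Nat.lt_two_pow_self (n := Q); omega
    have hS : 1 ≤ nb * 2 ^ Q := by omega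
    clear pc tc1 tc2 htt hTm hQn hQ1 htw hmQ hb B hMw
    generalize nb * 2 ^ Q = S at *
    generalize Q / 2 = u at *
    simp
    nlinarith [Nat.zero_le (u * S)]

end RAM

/-! ### Multiplication by quarter squares -/

namespace RAM

open Nega

/-!
The array `aQS` is the table of quarter squares.  The polynomials to be multiplied have `2 ^ q`
coefficients; `rD`, `rq`, `rL` hold `2 ^ q`, `q` and the number of levels.  Registers `mt` and `mu`
are scratch registers.
-/

notation "aQS" => 3
notation "rD" => 4
notation "rq" => 6
notation "rL" => 7
notation "mt" => 40
notation "mu" => 41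

variable {M w m T nb tb : ℕ}

/-- The table of the quarter squares `⌊i ^ 2 / 4⌋` modulo `M`. -/
def QSOK (M : ℕ) (s : State) : Prop := ∀ i ≤ 2 * M, s.arr aQS i = i * i / 4 % M

theorem QSOK.frame {s s' : State} (h : QSOK M s) (f : s'.arr aQS = s.arr aQS) : QSOK M s' :=
  fun i hi => by rw [f]; exact h i hi

/-- Set `z` to the product of `x` and `y` modulo `M`, by quarter squares. -/
def mulmod (z x y : ℕ) : Prog :=
  block [.add 0 x y, .load z aQS 0, .sub mt x y, .sub mu y x, .add mt mt mu, .load mt aQS mt,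
    .sub mt rM mt, .add z z mt, .sub 0 rM z] ;;
  .ite 0 .skip (block [.sub z z rM])

/-- The product `x * y` is the difference of the integral parts of `(x + y) ^ 2 / 4` and
`(x - y) ^ 2 / 4`, since `x + y` and `x - y` have the same parity. -/
theorem mul_add_sq_div (x y : ℕ) (h : y ≤ x) :
    x * y + (x - y) * (x - y) / 4 = (x + y) * (x + y) / 4 := by
  obtain ⟨d, rfl⟩ := Nat.exists_eq_add_of_le h
  rw [Nat.add_sub_cancel_left, show (y + d + y) * (y + d + y) = d * d + 4 * ((y + d) * y) by ring,
    Nat.add_mul_div_left _ _ (by norm_num)]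
  ring

theorem mulmod_spec {z x y : ℕ} {s : State} (hz : z ∉ [0, rM, mt, mu, x, y])
    (hx : x ∉ [0, mt, mu]) (hy : y ∉ [0, mt, mu]) (hMw : 2 * M < 2 ^ w) (hM0 : 0 < M)
    (hM : s.reg rM = M) (hQS : QSOK M s) (hxM : s.reg x ≤ M) (hyM : s.reg y ≤ M) :
    Runs w (mulmod z x y) 14 s fun s' => s'.reg z = s.reg x * s.reg y % M := by
  simp only [List.mem_cons, List.not_mem_nil, or_false, not_or] at hz hx hy
  obtain ⟨hz0, hz1, hz2, hz3, hz4, hz5⟩ := hz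
  obtain ⟨hx0, hx1, hx2⟩ := hx
  obtain ⟨hy0, hy1, hy2⟩ := hy
  have hA := hQS (s.reg x + s.reg y) (by omega)
  have hB := hQS (s.reg x - s.reg y + (s.reg y - s.reg x)) (by omega)
  have key : s.reg x * s.reg y + (s.reg x - s.reg y + (s.reg y - s.reg x)) *
      (s.reg x - s.reg y + (s.reg y - s.reg x)) / 4 =
      (s.reg x + s.reg y) * (s.reg x + s.reg y) / 4 := by
    rcases le_total (s.reg y) (s.reg x) with h | h
    · rw [Nat.sub_eq_zero_of_le h, add_zero, mul_add_sq_div _ _ h]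
    · rw [Nat.sub_eq_zero_of_le h, zero_add, mul_comm, mul_add_sq_div _ _ h, add_comm (s.reg x)]
  set u := s.arr aQS (s.reg x + s.reg y) with hu
  set v := s.arr aQS (s.reg x - s.reg y + (s.reg y - s.reg x)) with hv
  have hu' : u < M := by rw [hA]; exact Nat.mod_lt _ hM0
  have hv' : v < M := by rw [hB]; exact Nat.mod_lt _ hM0
  have hmod : (u + (M - v)) % M = s.reg x * s.reg y % M := by
    have h1 : (s.reg x * s.reg y + v) % M = u := by rw [hA, hB, ← key]; simp
    have h2 : (u + (M - v) + v) % M = (s.reg x * s.reg y + v) % M := by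
      rw [h1, add_assoc, Nat.sub_add_cancel hv'.le, Nat.add_mod_right, Nat.mod_eq_of_lt hu']
    exact Nat.ModEq.add_right_cancel' v h2
  have e1 : Function.update s.reg 0 (s.reg x + s.reg y) x = s.reg x := by
    simp [Function.update_apply, hx0]
  apply Runs.of_le
  · apply Runs.block_seq
    · simp [hx0, hx1, hx2, hy0, hy1, hy2, hz0, hz1, hz2, hz3, hz4, hz5, Ne.symm hz2, Ne.symm hz1,
        Ne.symm hz3, Ne.symm hz4, Ne.symm hz5, hM, ← hu, ← hv]
      omega
    apply Runs.ite
    · intro h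
      simp [hx0, hx1, hx2, hy0, hy1, hy2, hz0, hz1, hz2, hz3, hz4, hz5, Ne.symm hz2, Ne.symm hz1,
        Ne.symm hz3, Ne.symm hz4, Ne.symm hz5, hM, ← hu, ← hv] at h
      apply Runs.skip
      simp [hx0, hx1, hx2, hy0, hy1, hy2, hz0, hz1, hz2, hz3, hz4, hz5, Ne.symm hz2, Ne.symm hz1,
        Ne.symm hz3, Ne.symm hz4, Ne.symm hz5, hM, ← hu, ← hv]
      rw [← hmod, Nat.mod_eq_of_lt (by omega)]
    · intro h
      simp [hx0, hx1, hx2, hy0, hy1, hy2, hz0, hz1, hz2, hz3, hz4, hz5, Ne.symm hz2, Ne.symm hz1,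
        Ne.symm hz3, Ne.symm hz4, Ne.symm hz5, hM, ← hu, ← hv] at h
      apply Runs.block
      · simp
      · simp [hx0, hx1, hx2, hy0, hy1, hy2, hz0, hz1, hz2, hz3, hz4, hz5, Ne.symm hz2, Ne.symm hz1,
          Ne.symm hz3, Ne.symm hz4, Ne.symm hz5, hM, ← hu, ← hv]
        rw [← hmod, Nat.mod_eq_sub_mod (by omega), Nat.mod_eq_of_lt (by omega)]
  · simp

/-- Reduce `vp`, which is at most `2 * M`, to at most `M`. -/
def red : Prog := block [.sub 0 vp rM] ;; .ite 0 (block [.copy vp 0]) .skip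

theorem red_spec {s : State} (hM : s.reg rM = M) (hv : s.reg vp ≤ 2 * M) :
    Runs w red 6 s fun s' => s'.reg vp ≤ M ∧ (s'.reg vp : ZMod M) = (s.reg vp : ℕ) := by
  apply Runs.of_le
  · apply Runs.block_seq
    · simp
    apply Runs.ite
    · intro h
      simp [hM] at h
      apply Runs.block
      · simp
      · simp [hM]
        exact ⟨by omega, by rw [Nat.cast_sub (by omega)]; simp⟩
    · intro h
      simp [hM] at h
      apply Runs.skip
      simp [hM]
      omega
  · simp

/-- Replace the blocks of length two in the first half of the data by their products with those in
the second half, modulo `x ^ 2 + 1`. -/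
def base : Prog :=
  block [.half vnb vnb, .half vtot vtot, .const va 0, .copy vd vtot] ;;
  forN ki vnb (
    block [.load vx aX va, .load vx' aX vd, .const 0 1, .add va' va 0, .add vd' vd 0,
      .load vg aX va', .load ve aX vd'] ;;
    mulmod vp vx vx' ;; mulmod vi vg ve ;; block [.sub vi rM vi, .add vp vp vi] ;; red ;;
    block [.store aX va vp] ;;
    mulmod vp vx ve ;; mulmod vi vg vx' ;; block [.add vp vp vi] ;; red ;;
    block [.store aX va' vp, .const 0 1, .add va va' 0, .add vd vd' 0])

/-- The product of `a + b i` and `c + d i`, where the data start at `2 * g` and `2 * (G + g)`. -/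
def bprod {K : Type*} [CommRing K] (G : ℕ) (X : ℕ → K) (p : ℕ) : K :=
  if p % 2 = 0 then X p * X (2 * G + p) - X (p + 1) * X (2 * G + (p + 1))
  else X (p - 1) * X (2 * G + p) + X p * X (2 * G + (p - 1))

/-- The blocks of length two represent elements `a + b x` with `x ^ 2 = -1`. -/
theorem el_bprod {K : Type*} [CommRing K] (G g : ℕ) (X : ℕ → K) :
    el 2 (blk 2 (bprod G X) g) = el 2 (blk 2 X g) * el 2 (blk 2 X (G + g)) := by
  have hx := x_pow (K := K) 2
  have h1 : (G + g) * 2 = 2 * G + g * 2 := by ring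
  simp only [el, Finset.sum_range_succ, Finset.sum_range_zero, blk, bprod, h1, add_zero, pow_zero,
    pow_one, mul_one, zero_add]
  rw [if_pos (by omega), if_neg (by omega), Nat.add_sub_cancel]
  simp only [map_sub, map_add, map_mul, add_assoc]
  linear_combination (-(AdjoinRoot.of (Polynomial.X ^ 2 + 1) (X (g * 2 + 1)) *
    AdjoinRoot.of _ (X (2 * G + (g * 2 + 1))))) * hx

theorem base_spec {G : ℕ} {s : State} {X : ℕ → ZMod M} (hw : 0 < w) (hM0 : 0 < M)
    (hMw : 2 * M < 2 ^ w) (hGw : 4 * G + 1 < 2 ^ w) (hM : s.reg rM = M) (hQS : QSOK M s)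
    (hvnb : s.reg vnb = 2 * G) (htot : s.reg vtot = 2 * (2 * G)) (hX : Pre M s aX X (4 * G)) :
    Runs w base (G * 110 + 10) s fun s' => Pre M s' aX (bprod G X) (2 * G) ∧
      s'.reg vnb = G ∧ s'.reg vtot = 2 * G := by
  apply Runs.of_le
  · apply Runs.block_seq
    · simp
    apply Runs.forN (N := 105) (n := G) (fun i s' => s'.reg va = 2 * i ∧ s'.reg vd = 2 * G + 2 * i ∧
        Pre M s' aX (bprod G X) (2 * i) ∧
        ∀ p, 2 * i ≤ p → p < 4 * G → s'.arr aX p ≤ M ∧ (s'.arr aX p : ZMod M) = X p)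
      (by simp [hvnb]) (by decide) hw
    · simp [htot, Pre]
      exact hX
    · intro i s1 hi hk f1 ⟨i1, i2, i3, i4⟩
      have e1 : s1.reg rM = M := by rw [f1.reg _ (by decide +kernel)]; simp [hM]
      have e2 : QSOK M s1 := hQS.frame (by rw [f1.arr _ (by decide +kernel)]; funext j; simp)
      obtain ⟨a0, a0'⟩ := i4 (2 * i) le_rfl (by omega)
      obtain ⟨a1, a1'⟩ := i4 (2 * i + 1) (by omega) (by omega)
      obtain ⟨b0, b0'⟩ := i4 (2 * G + 2 * i) (by omega) (by omega)
      obtain ⟨b1, b1'⟩ := i4 (2 * G + 2 * i + 1) (by omega) (by omega)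
      apply Runs.of_le
      · apply Runs.block_seq
        · simp [i1, i2]; omega
        apply Runs.call_seq (mulmod_spec (by decide) (by decide) (by decide) hMw hM0 (by simp [e1])
          (e2.frame (by simp)) (by simp [i1, a0]) (by simp [i2, b0]))
        intro s2 f2 h2
        apply Runs.call_seq (mulmod_spec (by decide) (by decide) (by decide) hMw hM0
          (by rw [f2.reg _ (by decide +kernel)]; simp [e1])
          (e2.frame (by rw [f2.arr _ (by decide +kernel)]; simp))
          (by rw [f2.reg _ (by decide +kernel)]; simp [i1, a1])
          (by rw [f2.reg _ (by decide +kernel)]; simp [i2, b1]))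
        intro s3 f3 h3
        rw [f2.reg vg (by decide +kernel), f2.reg ve (by decide +kernel)] at h3
        simp [i1, i2] at h2 h3
        have c1 : s3.reg rM = M := by
          rw [f3.reg _ (by decide +kernel), f2.reg _ (by decide +kernel)]; simp [e1]
        have c2 : s3.reg vx = s1.arr aX (2 * i) := by
          rw [f3.reg _ (by decide +kernel), f2.reg _ (by decide +kernel)]; simp [i1]
        have c3 : s3.reg vx' = s1.arr aX (2 * G + 2 * i) := by
          rw [f3.reg _ (by decide +kernel), f2.reg _ (by decide +kernel)]; simp [i2]
        have c4 : s3.reg vg = s1.arr aX (2 * i + 1) := by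
          rw [f3.reg _ (by decide +kernel), f2.reg _ (by decide +kernel)]; simp [i1]
        have c5 : s3.reg ve = s1.arr aX (2 * G + 2 * i + 1) := by
          rw [f3.reg _ (by decide +kernel), f2.reg _ (by decide +kernel)]; simp [i2]
        have c6 : s3.reg va = 2 * i := by
          rw [f3.reg _ (by decide +kernel), f2.reg _ (by decide +kernel)]; simp [i1]
        have c7 : s3.reg va' = 2 * i + 1 := by
          rw [f3.reg _ (by decide +kernel), f2.reg _ (by decide +kernel)]; simp [i1]
        have c8 : s3.reg vd' = 2 * G + 2 * i + 1 := by
          rw [f3.reg _ (by decide +kernel), f2.reg _ (by decide +kernel)]; simp [i2]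
        have c9 : s3.reg ki = G - i := by
          rw [f3.reg _ (by decide +kernel), f2.reg _ (by decide +kernel)]; simp [hk]
        have c10 : s3.arr = s1.arr := by
          funext a
          rw [f3.arr a (by simp [mulmod, warrs, RAM.block, Instr.warrs]),
            f2.arr a (by simp [mulmod, warrs, RAM.block, Instr.warrs])]
          simp
        have c11 : s3.reg vp < M := by rw [f3.reg _ (by decide +kernel), h2]; exact Nat.mod_lt _ hM0
        have c12 : s3.reg vi < M := by rw [h3]; exact Nat.mod_lt _ hM0
        have c13 : (s3.reg vp : ZMod M) = X (2 * i) * X (2 * G + 2 * i) := by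
          rw [f3.reg _ (by decide +kernel), h2, ZMod.natCast_mod, Nat.cast_mul, a0', b0']
        have c14 : (s3.reg vi : ZMod M) = X (2 * i + 1) * X (2 * G + 2 * i + 1) := by
          rw [h3, ZMod.natCast_mod, Nat.cast_mul, a1', b1']
        clear h2 h3
        apply Runs.block_seq
        · simp [c1]; omega
        apply Runs.call_seq (red_spec (M := M) (by simp [c1]) (by simp [c1]; omega))
        intro s4 f4 ⟨h4, h4'⟩
        simp [c1] at h4'
        rw [Nat.cast_sub c12.le, c13, c14] at h4'
        have d6 : s4.reg va = 2 * i := by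
          rw [f4.reg _ (by decide +kernel)]; simp [c6]
        have dX : s4.arr = s1.arr := by
          funext a
          rw [f4.arr a (by simp [red, warrs, RAM.block, Instr.warrs])]
          simp [c10]
        apply Runs.block_seq
        · simp
        simp [d6]
        have d1 : s4.reg rM = M := by rw [f4.reg _ (by decide +kernel)]; simp [c1]
        have d2 : s4.reg vx = s1.arr aX (2 * i) := by
          rw [f4.reg _ (by decide +kernel)]; simp [c2]
        have d3 : s4.reg vx' = s1.arr aX (2 * G + 2 * i) := by
          rw [f4.reg _ (by decide +kernel)]; simp [c3]
        have d4 : s4.reg vg = s1.arr aX (2 * i + 1) := by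
          rw [f4.reg _ (by decide +kernel)]; simp [c4]
        have d5 : s4.reg ve = s1.arr aX (2 * G + 2 * i + 1) := by
          rw [f4.reg _ (by decide +kernel)]; simp [c5]
        have d7 : s4.reg va' = 2 * i + 1 := by
          rw [f4.reg _ (by decide +kernel)]; simp [c7]
        have d8 : s4.reg vd' = 2 * G + 2 * i + 1 := by
          rw [f4.reg _ (by decide +kernel)]; simp [c8]
        have d9 : s4.reg ki = G - i := by
          rw [f4.reg _ (by decide +kernel)]; simp [c9]
        apply Runs.call_seq (mulmod_spec (by decide) (by decide) (by decide) hMw hM0 (by simp [d1])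
          (e2.frame (by funext j; simp [dX])) (by simp [d2, a0]) (by simp [d5, b1]))
        intro s5 f5 h5
        apply Runs.call_seq (mulmod_spec (by decide) (by decide) (by decide) hMw hM0
          (by rw [f5.reg _ (by decide +kernel)]; simp [d1])
          (e2.frame (by rw [f5.arr _ (by decide +kernel)]; funext j; simp [dX]))
          (by rw [f5.reg _ (by decide +kernel)]; simp [d4, a1])
          (by rw [f5.reg _ (by decide +kernel)]; simp [d3, b0]))
        intro s6 f6 h6
        rw [f5.reg vg (by decide +kernel), f5.reg vx' (by decide +kernel)] at h6
        simp [d2, d3, d4, d5] at h5 h6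
        have g1 : s6.reg rM = M := by
          rw [f6.reg _ (by decide +kernel), f5.reg _ (by decide +kernel)]; simp [d1]
        have g7 : s6.reg va' = 2 * i + 1 := by
          rw [f6.reg _ (by decide +kernel), f5.reg _ (by decide +kernel)]; simp [d7]
        have g8 : s6.reg vd' = 2 * G + 2 * i + 1 := by
          rw [f6.reg _ (by decide +kernel), f5.reg _ (by decide +kernel)]; simp [d8]
        have g9 : s6.reg ki = G - i := by
          rw [f6.reg _ (by decide +kernel), f5.reg _ (by decide +kernel)]; simp [d9]
        have gX : ∀ p, s6.arr aX p = if p = 2 * i then s4.reg vp else s1.arr aX p := by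
          intro p
          rw [f6.arr _ (by decide +kernel), f5.arr _ (by decide +kernel)]; simp [dX]
        have g11 : s6.reg vp < M := by rw [f6.reg _ (by decide +kernel), h5]; exact Nat.mod_lt _ hM0
        have g12 : s6.reg vi < M := by rw [h6]; exact Nat.mod_lt _ hM0
        have g13 : (s6.reg vp : ZMod M) = X (2 * i) * X (2 * G + 2 * i + 1) := by
          rw [f6.reg _ (by decide +kernel), h5, ZMod.natCast_mod, Nat.cast_mul, a0', b1']
        have g14 : (s6.reg vi : ZMod M) = X (2 * i + 1) * X (2 * G + 2 * i) := by
          rw [h6, ZMod.natCast_mod, Nat.cast_mul, a1', b0']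
        clear h5 h6
        apply Runs.block_seq
        · simp; omega
        apply Runs.call_seq (red_spec (M := M) (by simp [g1]) (by simp; omega))
        intro s7 f7 ⟨h7, h7'⟩
        simp at h7'
        rw [g13, g14] at h7'
        have j7 : s7.reg va' = 2 * i + 1 := by
          rw [f7.reg _ (by decide +kernel)]; simp [g7]
        have j8 : s7.reg vd' = 2 * G + 2 * i + 1 := by
          rw [f7.reg _ (by decide +kernel)]; simp [g8]
        have j9 : s7.reg ki = G - i := by
          rw [f7.reg _ (by decide +kernel)]; simp [g9]
        have jX : ∀ p, s7.arr aX p = if p = 2 * i then s4.reg vp else s1.arr aX p := by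
          intro p
          rw [f7.arr _ (by decide +kernel)]; simp [gX]
        apply Runs.block
        · simp [j7, j8, hw.ne']; omega
        · simp [j7, j8, j9]
          refine ⟨by ring, by ring, ?_, ?_⟩
          · intro p hp
            simp [j7, jX]
            rcases Nat.lt_or_ge p (2 * i) with h | h
            · simp only [if_neg (show ¬ p = 2 * i + 1 by omega), if_neg (show ¬ p = 2 * i by omega)]
              exact i3 p h
            · obtain rfl | rfl : p = 2 * i ∨ p = 2 * i + 1 := by omega
              · simp only [if_neg (show ¬ 2 * i = 2 * i + 1 by omega), if_true]
                refine ⟨h4, h4'.trans ?_⟩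
                rw [bprod, if_pos (by omega)]
                simp [add_assoc]; ring
              · simp only [if_true]
                refine ⟨h7, h7'.trans ?_⟩
                rw [bprod, if_neg (by omega), Nat.add_sub_cancel]
                rfl
          · intro p hp hp'
            simp [jX]
            simp only [if_neg (show ¬ p = 2 * i + 1 by omega), if_neg (show ¬ p = 2 * i by omega)]
            exact i4 p (by omega) hp'
      · simp
    · intro s1 f1 hz ⟨i1, i2, i3, i4⟩
      refine ⟨i3, ?_, ?_⟩
      · rw [f1.reg _ (by decide +kernel)]; simp [hvnb]
      · rw [f1.reg _ (by decide +kernel)]; simp [htot]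
  · simp; omega

end RAM

/-! ### Multiplication of polynomials modulo `x ^ D + 1` -/

namespace RAM

open Nega

variable {M w q L : ℕ}

/-- The lengths of the blocks on the successive levels are `2 ^ lv q i`. -/
def lv (q : ℕ) : ℕ → ℕ
  | 0 => q
  | i + 1 => lv q i - lv q i / 2

/-- Half the number of blocks on the successive levels. -/
def nblk (q : ℕ) : ℕ → ℕ
  | 0 => 1
  | i + 1 => nblk q i * (2 * 2 ^ (lv q i / 2))

/-- The data on the successive levels. -/
def dat {K : Type*} [CommRing K] (q : ℕ) (X : ℕ → K) : ℕ → ℕ → K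
  | 0 => X
  | i + 1 => fwds (2 ^ (lv q i - lv q i / 2)) (2 ^ (lv q i / 2)) (dat q X i) (lv q i / 2)

/-- Each level halves the exponent of the block length, up to rounding. -/
theorem lv_bound (q i : ℕ) : 2 ^ i * (lv q i - 1) ≤ q - 1 := by
  induction i with
  | zero => simp [lv]
  | succ i ih =>
    rw [lv, pow_succ, mul_assoc]
    exact (Nat.mul_le_mul_left _ (by omega)).trans ih

/-- Each level doubles the amount of data. -/
theorem nblk_mul (q i : ℕ) : nblk q i * 2 ^ lv q i = 2 ^ i * 2 ^ q := by
  induction i with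
  | zero => simp [nblk, lv]
  | succ i ih =>
    have h3 : 2 ^ (lv q i / 2) * 2 ^ (lv q i - lv q i / 2) = 2 ^ lv q i := by
      rw [← pow_add]; congr 1; omega
    rw [nblk, lv, show nblk q i * (2 * 2 ^ (lv q i / 2)) * 2 ^ (lv q i - lv q i / 2) =
      2 * (nblk q i * (2 ^ (lv q i / 2) * 2 ^ (lv q i - lv q i / 2))) by ring, h3, ih]
    ring

theorem nblk_pos (q i : ℕ) : 0 < nblk q i := by
  induction i with
  | zero => simp [nblk]
  | succ i ih => rw [nblk]; positivity

/-- The parameters of the multiplication of two elements of `ℤ / M ℤ [x] / (x ^ (2 ^ q) + 1)`. -/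
structure ConvOK (M q L : ℕ) (s : State) : Prop where
  hM : s.reg rM = M
  hD : s.reg rD = 2 ^ q
  hq : s.reg rq = q
  hL : s.reg rL = L
  hQS : QSOK M s

theorem ConvOK.frame {p : Prog} {s s' : State} (h : ConvOK M q L s) (f : Frame p s s')
    (hp : ∀ x ∈ [rM, rD, rq, rL], x ∉ wregs p) (ha : aQS ∉ warrs p) : ConvOK M q L s' := by
  simp only [List.forall_mem_cons] at hp
  obtain ⟨h1, h2, h3, h4, -⟩ := hp
  exact ⟨(f.reg _ h1).trans h.hM, (f.reg _ h2).trans h.hD, (f.reg _ h3).trans h.hq,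
    (f.reg _ h4).trans h.hL, h.hQS.frame (f.arr _ ha)⟩

theorem ConvOK.set {s : State} (h : ConvOK M q L s) {x v : ℕ} (hx : x ∉ [rM, rD, rq, rL]) :
    ConvOK M q L (s.set x v) := by
  simp only [List.mem_cons, List.not_mem_nil, or_false, not_or] at hx
  obtain ⟨h1, h2, h3, h4⟩ := hx
  exact ⟨by simp [Ne.symm h1, h.hM], by simp [Ne.symm h2, h.hD], by simp [Ne.symm h3, h.hq],
    by simp [Ne.symm h4, h.hL], h.hQS⟩

/-- The modulus `M` is odd, `L` levels lead to blocks of length two, and everything fits into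
words. -/
structure ConvB (M w q L : ℕ) : Prop where
  hMo : M % 2 = 1
  hM1 : 1 < M
  hMw : 2 * M < 2 ^ w
  hq : 1 ≤ q
  hlv1 : lv q L = 1
  hlv : ∀ i < L, 2 ≤ lv q i
  hqw : 32 * (q * 2 ^ q) < 2 ^ w

theorem ConvB.hw (B : ConvB M w q L) : 0 < w := by
  rcases Nat.eq_zero_or_pos w with rfl | h
  · have := B.hqw
    simp at this
    have := B.hq
    omega
  · exact h

/-- The work done on level `i` is proportional to the number `lv q i / 2 + 1` of stages and to the
amount `2 ^ (i + 1) * 2 ^ q` of data.  The halving of the exponents compensates for the doubling of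
the data, so every level costs the same, `O(q * 2 ^ q)`. -/
theorem ConvB.level (B : ConvB M w q L) {i : ℕ} (hi : i < L) :
    (lv q i / 2 + 1) * 2 ^ i ≤ 2 * q ∧ 2 ^ i ≤ q := by
  have h1 := lv_bound q i
  have h2 := B.hlv i hi
  constructor
  · calc (lv q i / 2 + 1) * 2 ^ i ≤ (2 * (lv q i - 1)) * 2 ^ i :=
        Nat.mul_le_mul_right _ (by omega)
      _ = 2 * (2 ^ i * (lv q i - 1)) := by ring
      _ ≤ 2 * q := by omega
  · calc 2 ^ i ≤ 2 ^ i * (lv q i - 1) := Nat.le_mul_of_pos_right _ (by omega)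
      _ ≤ q := by omega

/-- The number of levels is at most about the binary logarithm of `q`. -/
theorem ConvB.last (B : ConvB M w q L) : 2 ^ L ≤ 2 * q := by
  rcases Nat.eq_zero_or_pos L with rfl | h
  · have := B.hq; simp; omega
  · have := (B.level (i := L - 1) (by omega)).2
    have e : 2 ^ L = 2 * 2 ^ (L - 1) := by rw [← pow_succ']; congr 1; omega
    omega

/-- All levels of the transform. -/
def fwdAll : Prog := forN kv rL fwdLevel

theorem fwdAll_spec {s : State} {X : ℕ → ZMod M} (B : ConvB M w q L) (C : ConvOK M q L s)
    (hQ : s.reg vQ = q) (hnb : s.reg vnb = 2) (htot : s.reg vtot = 2 * 2 ^ q)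
    (hix : s.reg vix = 0) (hX : Pre M s aX X (2 * 2 ^ q)) :
    Runs w fwdAll (L * (2400 * (q * 2 ^ q) + 4) + 3) s fun s' =>
      Pre M s' aX (dat q X L) (2 * nblk q L * 2 ^ lv q L) ∧
      s'.reg vtot = 2 * nblk q L * 2 ^ lv q L ∧ s'.reg vnb = 2 * nblk q L ∧ s'.reg vix = L ∧
      ∀ j < L, s'.arr aQ j = lv q j := by
  have hqw := B.hqw
  have hLL : L < 2 ^ L := Nat.lt_two_pow_self
  have hlast := B.last
  have h2q : q ≤ q * 2 ^ q := Nat.le_mul_of_pos_right _ (by positivity)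
  apply Runs.forN (N := 2400 * (q * 2 ^ q)) (n := L) (fun i s' =>
    Pre M s' aX (dat q X i) (2 * nblk q i * 2 ^ lv q i) ∧ s'.reg vQ = lv q i ∧
    s'.reg vtot = 2 * nblk q i * 2 ^ lv q i ∧ s'.reg vnb = 2 * nblk q i ∧ s'.reg vix = i ∧
    ∀ j < i, s'.arr aQ j = lv q j) C.hL (by decide) B.hw
  · simp [dat, nblk, lv, hQ, hnb, htot, hix]
    exact hX
  · intro i s1 hi hk f ⟨i1, i2, i3, i4, i5, i6⟩
    have C1 := C.frame f (by decide +kernel) (by decide +kernel)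
    have hb : 2 * nblk q i * 2 ^ lv q i = 2 * (2 ^ i * 2 ^ q) := by rw [mul_assoc, nblk_mul]
    obtain ⟨l1, l2⟩ := B.level hi
    have l3 := Nat.mul_le_mul_right (2 ^ q) l1
    have l4 := Nat.mul_le_mul_right (2 ^ q) l2
    have hsucc : nblk q (i + 1) * 2 ^ lv q (i + 1) = 2 * (nblk q i * 2 ^ lv q i) := by
      rw [nblk_mul, nblk_mul]; ring
    apply Runs.of_le
    · apply Runs.call (fwdLevel_spec (X := dat q X i) C1.hM i2 i4 i3 i5 (by omega)
        (by have := nblk_pos q i; omega) B.hMw (by rw [hb]; omega) i1)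
      intro s2 f2 ⟨j1, j2, j3, j4, j5, j6⟩
      have h1 : 2 * (2 * nblk q i * 2 ^ lv q i) = 2 * nblk q (i + 1) * 2 ^ lv q (i + 1) := by
        rw [mul_assoc 2 (nblk q (i + 1)), hsucc]; ring
      refine ⟨by rw [f2.reg _ (by decide +kernel), hk], ?_, ?_⟩
      · rw [← h1]; exact j1
      · simp [j2, j3, j4, j5]
        refine ⟨rfl, h1, by rw [nblk]; ring, ?_⟩
        intro j hj
        rw [j6]
        split_ifs with h
        · rw [h]
        · exact i6 j (by omega)
    · rw [hb]
      calc 300 * (lv q i / 2 + 1) * (2 * (2 * (2 ^ i * 2 ^ q))) =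
          1200 * ((lv q i / 2 + 1) * 2 ^ i * 2 ^ q) := by ring
        _ ≤ 1200 * (2 * q * 2 ^ q) := Nat.mul_le_mul_left _ l3
        _ = _ := by ring
  · intro s' _ _ ⟨i1, _, i3, i4, i5, i6⟩
    exact ⟨i1, i3, i4, i5, i6⟩

/-- All levels of the inverse transform. -/
def bwdAll : Prog := forN kv rL bwdLevel

/-- Going back through the levels turns products of blocks into products of the original
polynomials.  The factor `κ` accumulates the factors `2` of all stages, and `vsc` is its inverse
modulo `M`. -/
theorem bwdAll_spec {s : State} {X : ℕ → ZMod M} (B : ConvB M w q L) (C : ConvOK M q L s)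
    (htot : s.reg vtot = nblk q L * 2 ^ lv q L) (hnb : s.reg vnb = nblk q L)
    (hix : s.reg vix = L) (hQa : ∀ j < L, s.arr aQ j = lv q j) (hsc : s.reg vsc = 1)
    {Z₀ : ℕ → ZMod M} (hZ₀ : Pre M s aX Z₀ (nblk q L * 2 ^ lv q L))
    (hel : ∀ g < nblk q L, el (2 ^ lv q L) (blk (2 ^ lv q L) Z₀ g) =
      el (2 ^ lv q L) (blk (2 ^ lv q L) (dat q X L) g) *
      el (2 ^ lv q L) (blk (2 ^ lv q L) (dat q X L) (nblk q L + g))) :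
    Runs w bwdAll (L * (4800 * (q * 2 ^ q) + 4) + 3) s fun s' => ∃ (Z : ℕ → ZMod M) (κ : ℕ),
      Pre M s' aX Z (2 ^ q) ∧ s'.reg vsc ≤ M ∧ (κ : ZMod M) * (s'.reg vsc : ZMod M) = 1 ∧
      el (2 ^ q) Z = κ * (el (2 ^ q) X * el (2 ^ q) (fun p => X (2 ^ q + p))) := by
  have hqw := B.hqw
  have h2q : q ≤ q * 2 ^ q := Nat.le_mul_of_pos_right _ (by positivity)
  apply Runs.forN (N := 4800 * (q * 2 ^ q)) (n := L) (fun t s' =>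
    ∃ (Z : ℕ → ZMod M) (κ : ℕ), Pre M s' aX Z (nblk q (L - t) * 2 ^ lv q (L - t)) ∧
    s'.reg vtot = nblk q (L - t) * 2 ^ lv q (L - t) ∧ s'.reg vnb = nblk q (L - t) ∧
    s'.reg vix = L - t ∧ s'.reg vsc ≤ M ∧ (κ : ZMod M) * (s'.reg vsc : ZMod M) = 1 ∧
    ∀ g < nblk q (L - t), el (2 ^ lv q (L - t)) (blk (2 ^ lv q (L - t)) Z g) =
      κ * el (2 ^ lv q (L - t)) (blk (2 ^ lv q (L - t)) (dat q X (L - t)) g) *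
      el (2 ^ lv q (L - t)) (blk (2 ^ lv q (L - t)) (dat q X (L - t)) (nblk q (L - t) + g)))
    C.hL (by decide) B.hw
  · refine ⟨Z₀, 1, hZ₀, ?_⟩
    simp [htot, hnb, hix, hsc, B.hM1.le]
    exact hel
  · intro t s1 ht hk f ⟨Z, κ, i1, i2, i3, i4, i5, i6, i7⟩
    obtain ⟨i, hi⟩ : ∃ i, L - t = i + 1 := ⟨L - t - 1, by omega⟩
    have hi' : L - (t + 1) = i := by omega
    have hiL : i < L := by omega
    rw [hi] at i1 i2 i3 i4 i7
    have C1 := C.frame f (by decide +kernel) (by decide +kernel)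
    have hb : nblk q i * 2 ^ lv q i = 2 ^ i * 2 ^ q := nblk_mul q i
    obtain ⟨l1, l2⟩ := B.level hiL
    have l3 := Nat.mul_le_mul_right (2 ^ q) l1
    have l4 := Nat.mul_le_mul_right (2 ^ q) l2
    have hsucc : nblk q (i + 1) * 2 ^ lv q (i + 1) = 2 * (nblk q i * 2 ^ lv q i) := by
      rw [nblk_mul, nblk_mul]; ring
    rw [hsucc] at i1 i2
    have hQ1 : s1.arr aQ i = lv q i := by rw [f.arr _ (by decide +kernel)]; simp [hQa i hiL]
    apply Runs.of_le
    · apply Runs.call (bwdLevel_spec (Z := Z) (nb := nblk q i) C1.hM hQ1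
        (by rw [i3, nblk]) i2 i4 B.hMo rfl i5 (nblk_pos q i) B.hMw (by rw [hb]; omega) i1)
      intro s2 f2 ⟨j1, j2, j3, j4, j5, j6⟩
      refine ⟨by rw [f2.reg _ (by decide +kernel), hk], ?_⟩
      rw [hi']
      refine ⟨_, κ * 2 ^ (lv q i / 2 + 1), j1, by simp [j2], by simp [j3], by simp [j4],
        by simpa using j5, ?_, ?_⟩
      · simp
        rw [mul_assoc, j6, i6]
      · intro g hg
        have h3 : 2 ^ (lv q i / 2) * 2 ^ (lv q i - lv q i / 2) = 2 ^ lv q i := by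
          rw [← pow_add]; congr 1; omega
        have := el_level (q := lv q i - lv q i / 2) (l := lv q i / 2) (g := g) (G := nblk q i)
          (by omega) (dat q X i) Z κ (fun o ho => by
            have := i7 (g * (2 * 2 ^ (lv q i / 2)) + o) (by
              rw [nblk]
              calc g * (2 * 2 ^ (lv q i / 2)) + o < (g + 1) * (2 * 2 ^ (lv q i / 2)) := by
                    rw [add_mul]; omega
                _ ≤ _ := Nat.mul_le_mul_right _ hg)
            rw [lv, dat, nblk, ← add_assoc, ← add_mul] at this
            exact this)
        rw [h3] at this
        exact this
    · rw [hb]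
      calc 600 * (lv q i / 2 + 1) * (2 * (2 ^ i * 2 ^ q)) =
          1200 * ((lv q i / 2 + 1) * 2 ^ i * 2 ^ q) := by ring
        _ ≤ 1200 * (2 * q * 2 ^ q) := Nat.mul_le_mul_left _ l3
        _ ≤ _ := by rw [mul_assoc 2 q]; omega
  · intro s' _ _ ⟨Z, κ, i1, i2, i3, i4, i5, i6, i7⟩
    rw [Nat.sub_self] at i1 i7
    simp [nblk, lv] at i1 i7
    refine ⟨Z, κ, i1, i5, i6, ?_⟩
    have e : ∀ (u : ℕ → ZMod M), blk (2 ^ q) u 0 = u := fun u => by funext l; simp [blk]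
    have e1 : ∀ (u : ℕ → ZMod M), blk (2 ^ q) u 1 = fun p => u (2 ^ q + p) := fun u => by
      funext l; simp [blk]
    rw [e, dat, e, e1] at i7
    exact i7.trans (mul_assoc _ _ _)

/-- Multiply the elements of `ℤ / M ℤ [x] / (x ^ D + 1)` with coefficients in the cells from `0` and
from `D` on in `aX`. -/
def conv : Prog :=
  block [.copy vQ rq, .const vnb 2, .add vtot rD rD, .const vix 0, .const vsc 1] ;;
  fwdAll ;; base ;; bwdAll ;; block [.const va 0] ;;
  forN ki rD (block [.load vx aX va] ;; mulmod vp vx vsc ;;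
    block [.store aX va vp, .const 0 1, .add va va 0])

/-- A product in `ℤ / M ℤ [x] / (x ^ D + 1)`, where `D = 2 ^ q`, takes `O(L * D * log D)` steps with
`L` levels. -/
theorem conv_el {s : State} {X : ℕ → ZMod M} (B : ConvB M w q L) (C : ConvOK M q L s)
    (hX : Pre M s aX X (2 * 2 ^ q)) :
    Runs w conv (8000 * ((L + 1) * (q * 2 ^ q))) s fun s' => ∃ Z : ℕ → ZMod M,
      el (2 ^ q) Z = el (2 ^ q) X * el (2 ^ q) (fun p => X (2 ^ q + p)) ∧
      ∀ p < 2 ^ q, s'.arr aX p < M ∧ (s'.arr aX p : ZMod M) = Z p := by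
  have hw := B.hw
  have hqw := B.hqw
  have hq := B.hq
  have h2q : 2 ^ q ≤ q * 2 ^ q := Nat.le_mul_of_pos_left _ hq
  have h2q' := Nat.one_le_two_pow (n := q)
  have hlast := Nat.mul_le_mul_right (2 ^ q) B.last
  have hG := nblk_mul q L
  have hlv1 := B.hlv1
  rw [hlv1, pow_one] at hG
  have hG4 : nblk q L ≤ q * 2 ^ q := by linarith
  have hM0 := B.hM1
  apply Runs.of_le
  · apply Runs.block_seq
    · simp [C.hD, hw.ne']
      refine ⟨?_, by omega⟩
      have := B.hMw; omega
    apply Runs.call_seq (fwdAll_spec (X := X) B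
      (by simp only [runL_cons, runL_nil, run_const, run_copy, run_add]
          exact ((((C.set (by decide)).set (by decide)).set (by decide)).set (by decide)).set
            (by decide))
      (by simp [C.hq]) (by simp) (by simp [C.hD]; ring) (by simp) (by simpa using hX))
    intro s1 f1 ⟨a1, a2, a3, a4, a5⟩
    have C1 : ConvOK M q L s1 := by
      refine ConvOK.frame ?_ f1 (by decide +kernel) (by decide +kernel)
      simp only [runL_cons, runL_nil, run_const, run_copy, run_add]
      exact ((((C.set (by decide)).set (by decide)).set (by decide)).set (by decide)).set
            (by decide)
    have a6 : s1.reg vsc = 1 := by rw [f1.reg _ (by decide +kernel)]; simp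
    apply Runs.call_seq (base_spec (G := nblk q L) (X := dat q X L) hw (by omega) B.hMw
      (by omega) C1.hM C1.hQS a3 (by rw [a2, hlv1]; ring)
      (by rw [hlv1] at a1; convert a1 using 1; ring))
    intro s2 f2 ⟨b1, b2, b3⟩
    have C2 := C1.frame f2 (by decide +kernel) (by decide +kernel)
    apply Runs.call_seq (bwdAll_spec (X := X) (Z₀ := bprod (nblk q L) (dat q X L)) B C2
      (by rw [b3, hlv1]; ring) b2 (by rw [f2.reg _ (by decide +kernel), a4])
      (by rw [f2.arr _ (by decide +kernel)]; exact a5)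
      (by rw [f2.reg _ (by decide +kernel), a6]) (by rw [hlv1]; convert b1 using 1; ring)
      (fun g hg => by rw [hlv1]; exact el_bprod _ _ _))
    intro s3 f3 ⟨Z, κ, c1, c2, c3, c4⟩
    have C3 := C2.frame f3 (by decide +kernel) (by decide +kernel)
    apply Runs.block_seq
    · simp
    -- the final loop removes the factor `κ`
    apply Runs.forN (N := 23) (n := 2 ^ q) (fun i s' => s'.reg va = i ∧
        (∀ p < i, s'.arr aX p < M ∧ (s'.arr aX p : ZMod M) = Z p * s3.reg vsc) ∧
        ∀ p, i ≤ p → p < 2 ^ q → s'.arr aX p ≤ M ∧ (s'.arr aX p : ZMod M) = Z p)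
      (by simp [C3.hD]) (by decide) hw
    · simp
      exact c1
    · intro i s4 hi hk f4 ⟨i1, i2, i3⟩
      have C4 : ConvOK M q L s4 := by
        refine ConvOK.frame (C3.set (x := va) (v := 0) (by decide)) f4 (by decide +kernel)
          (by decide +kernel)
      have d1 : s4.reg vsc = s3.reg vsc := by rw [f4.reg _ (by decide +kernel)]; simp
      obtain ⟨i4, i5⟩ := i3 i le_rfl hi
      apply Runs.of_le
      · apply Runs.block_seq
        · simp
        apply Runs.call_seq (mulmod_spec (M := M) (by decide) (by decide) (by decide) B.hMw
          (by omega) (by simp [C4.hM]) (C4.hQS.frame (by simp)) (by simp [i1, i4])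
          (by simp [d1, c2]))
        intro s5 f5 h5
        have e1 : s5.reg va = i := by rw [f5.reg _ (by decide +kernel)]; simp [i1]
        have e2 : s5.arr aX = s4.arr aX := by rw [f5.arr _ (by decide +kernel)]; simp
        have e3 : s5.reg ki = 2 ^ q - i := by rw [f5.reg _ (by decide +kernel)]; simp [hk]
        simp [i1, d1] at h5
        have e4 : s5.reg vp < M := by rw [h5]; exact Nat.mod_lt _ (by omega)
        have e5 : (s5.reg vp : ZMod M) = Z i * s3.reg vsc := by
          rw [h5, ZMod.natCast_mod, Nat.cast_mul, i5]
        apply Runs.block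
        · simp [e1, hw.ne']; omega
        · simp [e1, e3, e2]
          constructor
          · intro p hp
            rcases Nat.lt_or_ge p i with h | h
            · simp only [if_neg (show ¬ p = i by omega)]
              exact i2 p h
            · obtain rfl : p = i := by omega
              simp only [if_true]
              exact ⟨e4, e5⟩
          · intro p hp hp'
            simp only [if_neg (show ¬ p = i by omega)]
            exact i3 p (by omega) hp'
      · simp
    · intro s4 f4 hz ⟨i1, i2, i3⟩
      refine ⟨fun p => Z p * s3.reg vsc, ?_, i2⟩
      have h1 : el (2 ^ q) (fun p => Z p * (s3.reg vsc : ZMod M)) =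
          AdjoinRoot.of _ (s3.reg vsc : ZMod M) * el (2 ^ q) Z := by
        simp only [el, Finset.mul_sum]
        refine Finset.sum_congr rfl fun p _ => ?_
        rw [map_mul]; ring
      have h2 : AdjoinRoot.of (Polynomial.X ^ 2 ^ q + 1 : Polynomial (ZMod M)) (κ : ZMod M) *
          AdjoinRoot.of _ (s3.reg vsc : ZMod M) = 1 := by
        rw [← map_mul, c3, map_one]
      rw [map_natCast] at h2
      rw [h1, c4, ← mul_assoc, mul_comm _ (κ : Ring (ZMod M) (2 ^ q)), h2, one_mul]
  · have h4 : nblk q L * 110 ≤ 110 * (q * 2 ^ q) := by omega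
    generalize nblk q L = G at *
    generalize q * 2 ^ q = S at *
    have h5 : 8000 * ((L + 1) * S) = 8000 * (L * S) + 8000 * S := by ring
    have h6 : L * (2400 * S + 4) = 2400 * (L * S) + 4 * L := by ring
    have h7 : L * (4800 * S + 4) = 4800 * (L * S) + 4 * L := by ring
    have h8 : L ≤ L * S := Nat.le_mul_of_pos_right _ (by have := Nat.one_le_two_pow (n := q); omega)
    have h9 := Nat.one_le_two_pow (n := q)
    simp
    omega

end RAM

/-! ### Numbers as arrays of digits -/

/-- The coefficients of a product of polynomials. -/
def cv (A B : ℕ → ℕ) (p : ℕ) : ℕ := ∑ i ∈ Finset.range (p + 1), A i * B (p - i)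

/-- The value of the first `n` digits `f 0, f 1, …` to the base `β`. -/
def dval (β : ℕ) (f : ℕ → ℕ) (n : ℕ) : ℕ := ∑ i ∈ Finset.range n, f i * β ^ i

/-- The coefficients `cv A B` are those of the product also after reduction modulo `x ^ D + 1`, since
the product has degree less than `2 * h ≤ D`. -/
theorem sum_cv {S : Type*} [CommSemiring S] (x : S) {A B : ℕ → ℕ} {h D : ℕ} (hh : 0 < h)
    (hA : ∀ p, h ≤ p → A p = 0) (hB : ∀ p, h ≤ p → B p = 0) (hD : 2 * h ≤ D) :
    ∑ p ∈ Finset.range D, (cv A B p : S) * x ^ p =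
      (∑ p ∈ Finset.range D, (A p : S) * x ^ p) * ∑ p ∈ Finset.range D, (B p : S) * x ^ p := by
  classical
  let P : (ℕ → ℕ) → Polynomial ℕ := fun A => ∑ i ∈ Finset.range h, Polynomial.monomial i (A i)
  have hc : ∀ A : ℕ → ℕ, (∀ p, h ≤ p → A p = 0) → (P A).coeff = A := by
    intro A hA
    funext p
    simp only [P, Polynomial.finsetSum_coeff, Polynomial.coeff_monomial]
    rw [Finset.sum_ite_eq']
    split_ifs with h1
    · rfl
    · rw [hA p (by simpa using h1)]
  have hd : ∀ A : ℕ → ℕ, (P A).natDegree < h := by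
    intro A
    refine lt_of_le_of_lt (b := h - 1) (Polynomial.natDegree_sum_le_of_forall_le _ _ fun j hj => ?_)
      (by omega)
    exact (Polynomial.natDegree_monomial_le _).trans (by have := Finset.mem_range.1 hj; omega)
  have e : ∀ R : Polynomial ℕ, R.natDegree < D →
      R.eval₂ (Nat.castRingHom S) x = ∑ p ∈ Finset.range D, (R.coeff p : S) * x ^ p := by
    intro R hR
    rw [Polynomial.eval₂_eq_sum_range' _ hR]
    rfl
  have h1 := e (P A) ((hd A).trans_le (by omega))
  have h2 := e (P B) ((hd B).trans_le (by omega))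
  have h3 := e (P A * P B) (by
    have := Polynomial.natDegree_mul_le (p := P A) (q := P B)
    have := hd A; have := hd B; omega)
  rw [hc A hA] at h1
  rw [hc B hB] at h2
  rw [Polynomial.eval₂_mul, h1, h2] at h3
  rw [h3]
  refine Finset.sum_congr rfl fun p _ => ?_
  rw [Polynomial.coeff_mul, hc A hA, hc B hB, Finset.Nat.sum_antidiagonal_eq_sum_range_succ_mk]
  rfl

theorem cv_le {A B : ℕ → ℕ} {h a b : ℕ} (hA : ∀ p, h ≤ p → A p = 0) (hAa : ∀ p, A p ≤ a)
    (hBb : ∀ p, B p ≤ b) (p : ℕ) : cv A B p ≤ h * (a * b) := by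
  calc cv A B p ≤ ∑ i ∈ Finset.range h, A i * B (p - i) := by
        refine Finset.sum_le_sum_of_ne_zero fun i _ hi => ?_
        rw [Finset.mem_range]
        by_contra hc
        exact hi (by rw [hA i (by omega), zero_mul])
    _ ≤ ∑ i ∈ Finset.range h, a * b :=
        Finset.sum_le_sum fun i _ => Nat.mul_le_mul (hAa i) (hBb _)
    _ = h * (a * b) := by simp

theorem dval_succ (β : ℕ) (f : ℕ → ℕ) (n : ℕ) : dval β f (n + 1) = dval β f n + f n * β ^ n :=
  Finset.sum_range_succ _ _

theorem dval_congr {β n : ℕ} {f g : ℕ → ℕ} (h : ∀ i < n, f i = g i) : dval β f n = dval β g n :=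
  Finset.sum_congr rfl fun i hi => by rw [h i (Finset.mem_range.1 hi)]

theorem dval_add (β n : ℕ) (f g : ℕ → ℕ) :
    dval β (fun i => f i + g i) n = dval β f n + dval β g n := by
  simp [dval, add_mul, Finset.sum_add_distrib]

theorem dval_lt {β n : ℕ} {f : ℕ → ℕ} (h : ∀ i < n, f i < β) : dval β f n < β ^ n := by
  induction n with
  | zero => simp [dval]
  | succ n ih =>
    rw [dval_succ, pow_succ]
    have h1 := ih fun i hi => h i (by omega)
    have h2 := h n (by omega)
    calc dval β f n + f n * β ^ n < β ^ n + f n * β ^ n := by omega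
      _ = (f n + 1) * β ^ n := by ring
      _ ≤ β * β ^ n := Nat.mul_le_mul_right _ h2
      _ = β ^ n * β := mul_comm _ _

theorem dval_append (β m n : ℕ) (f : ℕ → ℕ) :
    dval β f (m + n) = dval β f m + β ^ m * dval β (fun i => f (m + i)) n := by
  rw [dval, Finset.sum_range_add, dval, dval, Finset.mul_sum]
  congr 1
  refine Finset.sum_congr rfl fun i _ => ?_
  rw [pow_add]; ring

theorem dval_of_zero {β m n : ℕ} {f : ℕ → ℕ} (hmn : m ≤ n) (h : ∀ p, m ≤ p → f p = 0) :
    dval β f n = dval β f m := by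
  obtain ⟨d, rfl⟩ := Nat.exists_eq_add_of_le hmn
  rw [dval_append]
  simp [dval, h]

theorem dval_cv {A B : ℕ → ℕ} {h : ℕ} (β : ℕ) (hh : 0 < h) (hA : ∀ p, h ≤ p → A p = 0)
    (hB : ∀ p, h ≤ p → B p = 0) : dval β (cv A B) (2 * h) = dval β A h * dval β B h := by
  have := sum_cv (S := ℕ) β hh hA hB le_rfl
  simp only [Nat.cast_id] at this
  rw [← dval_of_zero (m := h) (n := 2 * h) (by omega) hA,
    ← dval_of_zero (m := h) (n := 2 * h) (by omega) hB]
  exact this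

namespace RAM

open Nega

/-!
Numbers have `h` digits of `b` bits each; `rh` and `rb` hold `h` and `b`.  A modular multiplication
uses the arrays `aT` and `aU` for intermediate results, `aZ`, which holds zeros only, and `aFm` and
`aFi`, which hold the modulus `F` and the negative of its inverse modulo the base of the Montgomery
representation.
-/

notation "rb" => 3
notation "rh" => 5
notation "aT" => 5
notation "aU" => 6
notation "aZ" => 7
notation "aFm" => 9
notation "aFi" => 10

variable {M w q L : ℕ}

/-- If no coefficient of the product reaches `M`, the multiplication of polynomials modulo `M` and
`x ^ D + 1` is the multiplication over the natural numbers. -/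
theorem conv_spec {s : State} {A B : ℕ → ℕ} {h a b : ℕ} (CB : ConvB M w q L)
    (C : ConvOK M q L s) (hD : 2 * h = 2 ^ q)
    (hA : ∀ p, h ≤ p → A p = 0) (hB : ∀ p, h ≤ p → B p = 0) (hAa : ∀ p, A p ≤ a)
    (hBb : ∀ p, B p ≤ b) (hM : h * (a * b) < M) (haM : a ≤ M) (hbM : b ≤ M)
    (hXA : ∀ p < 2 * h, s.arr aX p = A p) (hXB : ∀ p < 2 * h, s.arr aX (2 * h + p) = B p) :
    Runs w conv (8000 * ((L + 1) * (q * 2 ^ q))) s fun s' =>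
      ∀ p < 2 * h, s'.arr aX p = cv A B p := by
  have hh : 0 < h := by
    have := Nat.one_le_two_pow (n := q)
    omega
  have : Fact (1 < M) := ⟨CB.hM1⟩
  have hX : Pre M s aX (fun p => ((s.arr aX p : ℕ) : ZMod M)) (2 * 2 ^ q) := by
    intro p hp
    refine ⟨?_, rfl⟩
    rcases Nat.lt_or_ge p (2 * h) with h1 | h1
    · rw [hXA p h1]; exact (hAa p).trans haM
    · obtain ⟨d, rfl⟩ := Nat.exists_eq_add_of_le h1
      rw [hXB d (by omega)]; exact (hBb d).trans hbM
  refine (conv_el CB C hX).mono ?_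
  rintro s' ⟨Z, h1, h2⟩
  have h3 : el (2 ^ q) Z = el (2 ^ q) (fun p => ((cv A B p : ℕ) : ZMod M)) := by
    rw [h1, el_congr (v := fun p => ((A p : ℕ) : ZMod M)) (fun l hl => by
      rw [hXA l (by omega)]), el_congr (u := fun p => ((s.arr aX (2 ^ q + p) : ℕ) : ZMod M))
      (v := fun p => ((B p : ℕ) : ZMod M)) (fun l hl => by rw [← hD, hXB l (by omega)])]
    have := sum_cv (S := Ring (ZMod M) (2 ^ q)) (x (ZMod M) (2 ^ q)) hh hA hB hD.le
    simp only [el, map_natCast]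
    exact this.symm
  have h4 := el_injective (by positivity) h3
  intro p hp
  obtain ⟨h5, h6⟩ := h2 p (by omega)
  rw [h4 p (by omega), ZMod.natCast_eq_natCast_iff', Nat.mod_eq_of_lt h5,
    Nat.mod_eq_of_lt ((cv_le hA hAa hBb p).trans_lt hM)] at h6
  exact h6

/-- Repeated halving divides by a power of two, rounding down. -/
theorem hlv_div_spec {x r n : ℕ} {s : State} (hw : 0 < w) (hx : x ≠ kl) (hx0 : x ≠ 0)
    (hr : s.reg r = n) :
    Runs w (hlv x r) (n * 6 + 3) s fun s' => s'.reg x = s.reg x / 2 ^ n := by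
  apply Runs.forN (N := 2) (n := n) (fun i s' => s'.reg x = s.reg x / 2 ^ i) hr (by decide) hw
  · simp [hx]
  · intro i s1 hi hk _ i1
    apply Runs.block
    · simp
    · simp [i1, hk, hx, hx0, hx.symm]
      rw [Nat.div_div_eq_div_mul, pow_succ]
  · intro s' _ _ h
    exact h

/-- Divide `vx` with remainder by `2 ^ b`: the remainder goes to `vx` and the quotient to `vx'`. -/
def split (r : ℕ) : Prog :=
  block [.copy vx' vx] ;; hlv vx' r ;; block [.copy vg vx'] ;; dbl vg r ;; block [.sub vx vx vg]

theorem split_spec {r b : ℕ} {s : State} (hw : 0 < w) (hr : r ∉ [0, kl, vx', vg])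
    (hb : s.reg r = b) :
    Runs w (split r) (b * 12 + 20) s fun s' =>
      s'.reg vx = s.reg vx % 2 ^ b ∧ s'.reg vx' = s.reg vx / 2 ^ b := by
  apply Runs.of_small
  intro hs
  have h1 := hs.1 vx
  simp only [List.mem_cons, List.not_mem_nil, or_false, not_or] at hr
  obtain ⟨hr0, hr1, hr2, hr3⟩ := hr
  have h2 : s.reg vx / 2 ^ b * 2 ^ b ≤ s.reg vx := Nat.div_mul_le_self _ _
  apply Runs.of_le
  · apply Runs.block_seq
    · simp
    apply Runs.call_seq (hlv_div_spec (n := b) hw (by decide) (by decide) (by simp [hr2, hb]))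
    intro s1 f1 h3
    simp at h3
    have a1 : s1.reg vx = s.reg vx := by
      rw [f1.reg _ (by simp [hlv, forN, wregs, RAM.block, Instr.wregs])]; simp
    have a2 : s1.reg r = b := by
      rw [f1.reg _ (by simp [hlv, forN, wregs, RAM.block, Instr.wregs, hr0, hr1, hr2])]
      simp [hr2, hb]
    apply Runs.block_seq
    · simp
    apply Runs.call_seq (dbl_spec (n := b) hw (by decide) (by decide) (by simp [hr3, a2])
      (by simp [h3]; omega))
    intro s2 f2 h4
    simp [h3] at h4
    have b1 : s2.reg vx = s.reg vx := by
      rw [f2.reg _ (by simp [dbl, forN, wregs, RAM.block, Instr.wregs])]; simp [a1]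
    have b2 : s2.reg vx' = s.reg vx / 2 ^ b := by
      rw [f2.reg _ (by simp [dbl, forN, wregs, RAM.block, Instr.wregs])]; simp [h3]
    apply Runs.block
    · simp
    · simp [b1, b2, h4]
      have := Nat.div_add_mod (s.reg vx) (2 ^ b)
      rw [mul_comm] at this
      omega
  · simp; omega

/-- Add the cells of `aX` and of the array `a` and write the digits of the number thus represented
into the array `z`. -/
def carry (z a : ℕ) : Prog :=
  block [.const va 0, .const vd 0] ;;
  forN ki rD (block [.load vx aX va, .load vx' a va, .add vx vx vx', .add vx vx vd] ;; split rb ;;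
    block [.copy vd vx', .store z va vx, .const 0 1, .add va va 0])

/-- The carries stay below `2 * M`, so that they fit into words, and the carry out of the last
position vanishes because the result has at most `D` digits. -/
theorem carry_spec {s : State} {z a b D : ℕ} {A B : ℕ → ℕ} (hw : 0 < w) (hMw : 4 * M < 2 ^ w)
    (hM : 2 ^ b ≤ M) (hb1 : 1 ≤ b) (hb : s.reg rb = b) (hD : s.reg rD = D) (hz : z ≠ aX)
    (hDw : D + 1 < 2 ^ w)
    (hA : ∀ p < D, s.arr aX p = A p ∧ A p < M) (hB : ∀ p < D, s.arr a p = B p ∧ B p < 2 ^ b)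
    (hval : dval (2 ^ b) A D + dval (2 ^ b) B D < (2 ^ b) ^ D) :
    Runs w (carry z a) (D * (b * 12 + 40) + 10) s fun s' =>
      (∀ p < D, s'.arr z p < 2 ^ b) ∧
      dval (2 ^ b) (s'.arr z) D = dval (2 ^ b) A D + dval (2 ^ b) B D := by
  have hb2 : 2 ≤ 2 ^ b := by
    calc 2 = 2 ^ 1 := rfl
      _ ≤ 2 ^ b := Nat.pow_le_pow_right (by norm_num) hb1
  apply Runs.of_le
  · apply Runs.block_seq
    · simp
    apply Runs.forN (N := b * 12 + 34) (n := D) (fun i s' => s'.reg va = i ∧ s'.reg vd ≤ 2 * M ∧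
        (∀ p < D, s'.arr aX p = A p) ∧ (∀ p, i ≤ p → p < D → s'.arr a p = B p) ∧
        (∀ p < i, s'.arr z p < 2 ^ b) ∧
        dval (2 ^ b) (s'.arr z) i + s'.reg vd * (2 ^ b) ^ i =
          dval (2 ^ b) A i + dval (2 ^ b) B i) (by simp [hD]) (by decide) hw
    · simp [dval]
      exact ⟨fun p hp => (hA p hp).1, fun p hp => (hB p hp).1⟩
    · intro i s1 hi hk f1 ⟨i1, i2, i3, i4, i5, i6⟩
      obtain ⟨hAi, hAi'⟩ := hA i hi
      obtain ⟨hBi, hBi'⟩ := hB i hi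
      have c1 : s1.reg rb = b := by
        rw [f1.reg _ (by simp [forN, wregs, RAM.block, Instr.wregs, split, hlv, dbl])]; simp [hb]
      apply Runs.of_le
      · apply Runs.block_seq
        · simp [i1, i3 i hi, i4 i le_rfl hi]
          omega
        apply Runs.call_seq (split_spec (b := b) hw (by decide) (by simp [c1]))
        intro s2 f2 ⟨h1, h2⟩
        simp [i1, i3 i hi, i4 i le_rfl hi] at h1 h2
        have d1 : s2.reg va = i := by rw [f2.reg _ (by decide +kernel)]; simp [i1]
        have d2 : s2.reg ki = D - i := by rw [f2.reg _ (by decide +kernel)]; simp [hk]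
        have d3 : s2.arr = s1.arr := by
          funext a
          rw [f2.arr _ (by simp [split, hlv, dbl, forN, warrs, RAM.block, Instr.warrs])]
          simp
        have h3 : s2.reg vx < 2 ^ b := by rw [h1]; exact Nat.mod_lt _ (by positivity)
        have h4 : 2 ^ b * s2.reg vx' + s2.reg vx = A i + B i + s1.reg vd := by
          rw [h1, h2]; exact Nat.div_add_mod _ _
        have h5 : s2.reg vx' ≤ 2 * M := by
          rw [h2]
          calc (A i + B i + s1.reg vd) / 2 ^ b ≤ (A i + B i + s1.reg vd) / 2 :=
                Nat.div_le_div_left hb2 (by norm_num)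
            _ ≤ 2 * M := by omega
        clear h1 h2
        apply Runs.block
        · simp [d1, hw.ne']
          omega
        · simp [d1, d2, d3, h5]
          refine ⟨?_, ?_, ?_, ?_⟩
          · intro p hp
            rw [if_neg (fun h => hz h.1.symm)]
            exact i3 p hp
          · intro p hp hp'
            rw [if_neg (by omega)]
            exact i4 p (by omega) hp'
          · intro p hp
            split_ifs with hpi
            · exact h3
            · exact i5 p (by omega)
          · have e1 : dval (2 ^ b) (fun p => if p = i then s2.reg vx else s1.arr z p) i =
                dval (2 ^ b) (s1.arr z) i := dval_congr fun p hp => by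
              rw [if_neg (by omega)]
            have e2 : ((s2.set vd (s2.reg vx')).put z i (s2.reg vx)).arr z =
                fun p => if p = i then s2.reg vx else s1.arr z p := by
              funext p; simp [d3]
            rw [e2, dval_succ, dval_succ, dval_succ, if_pos rfl, e1]
            rw [pow_succ]
            calc _ = dval (2 ^ b) (s1.arr z) i +
                  (2 ^ b * s2.reg vx' + s2.reg vx) * (2 ^ b) ^ i := by ring
              _ = dval (2 ^ b) (s1.arr z) i + s1.reg vd * (2 ^ b) ^ i +
                  (A i + B i) * (2 ^ b) ^ i := by rw [h4]; ring
              _ = _ := by rw [i6]; ring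
      · simp
        omega
    · intro s1 f1 hz ⟨i1, i2, i3, i4, i5, i6⟩
      refine ⟨i5, ?_⟩
      have : s1.reg vd = 0 := by
        by_contra h
        have h1 : (2 ^ b) ^ D ≤ s1.reg vd * (2 ^ b) ^ D := Nat.le_mul_of_pos_left _ (by omega)
        omega
      rw [this, zero_mul, add_zero] at i6
      exact i6
  · simp; ring_nf; omega

/-- Prepare a multiplication: the digitwise sum of the numbers in the arrays `a` and `a'` goes to
`aX`, followed by the number in the array `c`, both padded with zeros. -/
def fill (a a' c : ℕ) : Prog :=
  block [.const va 0, .copy vd rh, .copy va' rD, .add vd' rD rh] ;;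
  forN ki rh (block [.load vx a va, .load vx' a' va, .add vx vx vx', .store aX va vx,
    .load vx c va, .store aX va' vx, .const 0 0, .store aX vd 0, .store aX vd' 0, .const 0 1,
    .add va va 0, .add vd vd 0, .add va' va' 0, .add vd' vd' 0])

theorem fill_spec {s : State} {a a' c h B : ℕ} (hw : 0 < w) (hh : s.reg rh = h)
    (hD : s.reg rD = 2 * h) (hhw : 4 * h < 2 ^ w) (hBw : 2 * B < 2 ^ w) (ha : a ≠ aX) (ha' : a' ≠ aX)
    (hc : c ≠ aX) (h1 : ∀ p < h, s.arr a p ≤ B) (h2 : ∀ p < h, s.arr a' p ≤ B) :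
    Runs w (fill a a' c) (h * 20 + 10) s fun s' =>
      (∀ p < 2 * h, s'.arr aX p = if p < h then s.arr a p + s.arr a' p else 0) ∧
      ∀ p < 2 * h, s'.arr aX (2 * h + p) = if p < h then s.arr c p else 0 := by
  apply Runs.of_le
  · apply Runs.block_seq
    · simp [hh, hD]; omega
    apply Runs.forN (N := 15) (n := h) (fun i s' => s'.reg va = i ∧ s'.reg vd = h + i ∧
        s'.reg va' = 2 * h + i ∧ s'.reg vd' = 3 * h + i ∧ (∀ a ≠ aX, s'.arr a = s.arr a) ∧
        (∀ p < i, s'.arr aX p = s.arr a p + s.arr a' p) ∧ (∀ p < i, s'.arr aX (h + p) = 0) ∧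
        (∀ p < i, s'.arr aX (2 * h + p) = s.arr c p) ∧ ∀ p < i, s'.arr aX (3 * h + p) = 0)
      (by simp [hh]) (by decide) hw
    · simp [hh, hD]; ring
    · intro i s1 hi hk f1 ⟨i1, i2, i3, i4, i5, i6, i7, i8, i9⟩
      have e1 : s1.arr a i = s.arr a i := by rw [i5 a ha]
      have e2 : s1.arr a' i = s.arr a' i := by rw [i5 a' ha']
      have e3 : s1.arr c i = s.arr c i := by rw [i5 c hc]
      have := h1 i hi
      have := h2 i hi
      apply Runs.block
      · simp [i1, i2, i3, i4, e1, e2, hw.ne']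
        omega
      · simp [i1, i2, i3, i4, e1, e2, e3, ha, ha', hc, hk, add_assoc]
        refine ⟨?_, ?_, ?_, ?_, ?_⟩
        · intro a'' h''
          funext j
          simp [h'', i5 a'' h'']
        · intro p hp
          rw [if_neg (by omega), if_neg (by omega), if_neg (by omega)]
          split_ifs with hpi
          · rw [hpi]
          · exact i6 p (by omega)
        · intro p hp hp1 hp2
          rw [if_neg (by omega), if_neg (by omega)]
          exact i7 p (by omega)
        · intro p hp
          rw [if_neg (by omega), if_neg (by omega)]
          split_ifs with hpi
          · rw [hpi]
          · omega
          · exact i8 p (by omega)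
        · intro p hp hp1 _
          rw [if_neg (by omega), if_neg (by omega)]
          exact i9 p (by omega)
    · intro s1 f1 hz ⟨i1, i2, i3, i4, i5, i6, i7, i8, i9⟩
      constructor
      · intro p hp
        split_ifs with h'
        · exact i6 p h'
        · have := i7 (p - h) (by omega)
          rwa [show h + (p - h) = p by omega] at this
      · intro p hp
        split_ifs with h'
        · exact i8 p h'
        · have := i9 (p - h) (by omega)
          rwa [show 3 * h + (p - h) = 2 * h + p by omega] at this
  · simp; omega

end RAM

/-! ### Montgomery multiplication -/

namespace RAM

/-- The numbers on which the arithmetic modulo `F` depends: word length, modulus of the digit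
products, dimensions of the transform, number of bits of a digit, number of digits, the modulus `F`,
and the negative of its inverse modulo the base `R` of the Montgomery representation. -/
structure Par where
  (w M q L b h F F' : ℕ)

/-- The base of the Montgomery representation. -/
def Par.R (P : Par) : ℕ := (2 ^ P.b) ^ P.h

/-- The conditions on the parameters.  By `hM` the coefficients of the product of a sum of two numbers
and a number are less than `M`; by `hF` the Montgomery product of `x + y` and `c` is less than `2 * F`
if `x`, `y` and `c` are. -/
structure Par.OK (P : Par) : Prop where
  conv : ConvB P.M P.w P.q P.L
  hD : 2 * P.h = 2 ^ P.q
  hb : 1 ≤ P.b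
  hM : P.h * (2 * 2 ^ P.b * 2 ^ P.b) < P.M
  hM4 : 4 * P.M < 2 ^ P.w
  hF1 : 1 < P.F
  hF : 8 * P.F ≤ P.R
  hF' : P.F' < P.R
  hinv : P.R ∣ P.F * P.F' + 1

/-- Array `a` holds the number `n` by its digits. -/
def Digs (P : Par) (s : State) (a n : ℕ) : Prop :=
  (∀ p < P.h, s.arr a p < 2 ^ P.b) ∧ dval (2 ^ P.b) (s.arr a) P.h = n

theorem Digs.frame {P : Par} {s s' : State} {a n : ℕ} (h : Digs P s a n)
    (f : s'.arr a = s.arr a) : Digs P s' a n := by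
  rw [Digs, f]; exact h

/-- The parameters and constants of the arithmetic modulo `F` are in place. -/
structure NumOK (P : Par) (s : State) : Prop where
  conv : ConvOK P.M P.q P.L s
  hb : s.reg rb = P.b
  hh : s.reg rh = P.h
  hF : Digs P s aFm P.F
  hF' : Digs P s aFi P.F'
  hZ : ∀ p, s.arr aZ p = 0

theorem NumOK.frame {P : Par} {p : Prog} {s s' : State} (H : NumOK P s) (f : Frame p s s')
    (hp : ∀ x ∈ [rM, rD, rq, rL, rb, rh], x ∉ wregs p)
    (ha : ∀ x ∈ [aQS, aFm, aFi, aZ], x ∉ warrs p) : NumOK P s' := by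
  simp only [List.forall_mem_cons] at hp ha
  obtain ⟨h1, h2, h3, h4, h5, h6, -⟩ := hp
  obtain ⟨a1, a2, a3, a4, -⟩ := ha
  refine ⟨H.conv.frame f (by simp [h1, h2, h3, h4]) a1, (f.reg _ h5).trans H.hb,
    (f.reg _ h6).trans H.hh, H.hF.frame (f.arr _ a2), H.hF'.frame (f.arr _ a3), fun p => ?_⟩
  rw [f.arr _ a4, H.hZ]

/-- Array `a` holds the residue class `v` modulo `F` in Montgomery form, by a representative less
than `2 * F`. -/
def Slot (P : Par) (s : State) (a : ℕ) (v : ZMod P.F) : Prop :=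
  ∃ n, Digs P s a n ∧ n < 2 * P.F ∧ (n : ZMod P.F) = v * P.R

theorem Slot.frame {P : Par} {s s' : State} {a : ℕ} {v : ZMod P.F} (h : Slot P s a v)
    (f : s'.arr a = s.arr a) : Slot P s' a v := by
  obtain ⟨n, h1, h2⟩ := h
  exact ⟨n, h1.frame f, h2⟩

/-- Copy the upper half of the digits in `aU` to `z`. -/
def copyHi (z : ℕ) : Prog :=
  block [.const va 0, .copy vd rh] ;;
  forN ki rh (block [.load vx aU vd, .store z va vx, .const 0 1, .add va va 0, .add vd vd 0])

theorem copyHi_spec {w : ℕ} {s : State} {z h : ℕ} (hw : 0 < w) (hh : s.reg rh = h)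
    (hhw : 2 * h < 2 ^ w) (hz : z ≠ aU) :
    Runs w (copyHi z) (h * 10 + 10) s fun s' => ∀ p < h, s'.arr z p = s.arr aU (h + p) := by
  apply Runs.of_le
  · apply Runs.block_seq
    · simp
    apply Runs.forN (N := 6) (n := h) (fun i s' => s'.reg va = i ∧ s'.reg vd = h + i ∧
        s'.arr aU = s.arr aU ∧ ∀ p < i, s'.arr z p = s.arr aU (h + p))
      (by simp [hh]) (by decide) hw
    · simp [hh]
    · intro i s1 hi hk f1 ⟨i1, i2, i3, i4⟩
      apply Runs.block
      · simp [i1, i2, hw.ne']; omega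
      · simp [i1, i2, i3, hk, add_assoc]
        refine ⟨?_, ?_⟩
        · funext j
          simp [i3, hz.symm]
        · intro p hp
          split_ifs with hpi
          · rw [hpi]
          · exact i4 p (by omega)
    · intro s1 f1 hz ⟨i1, i2, i3, i4⟩
      exact i4
  · simp; omega

/-- Multiply the digit sums of `a`, `a'` with the number in `c`, add the number in `e`, and write
the digits of the result to `z`. -/
def mulAdd (z a a' c e : ℕ) : Prog := fill a a' c ;; conv ;; carry z e

/-- The number of steps of a multiplication. -/
def Par.mulN (P : Par) : ℕ :=
  8000 * ((P.L + 1) * (P.q * 2 ^ P.q)) + 24 * (P.b * P.h) + 100 * P.h + 20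

theorem mulAdd_spec {P : Par} (O : P.OK) {s : State} (H : NumOK P s) {z a a' c e na na' nc ne : ℕ}
    (hz : z ≠ aX) (ha : a ≠ aX) (ha' : a' ≠ aX) (hc : c ≠ aX) (he : e ∉ [aX, aY, aW, aQ])
    (h1 : Digs P s a na) (h2 : Digs P s a' na') (h3 : Digs P s c nc)
    (h4 : ∀ p < 2 * P.h, s.arr e p < 2 ^ P.b) (h5 : dval (2 ^ P.b) (s.arr e) (2 * P.h) = ne)
    (hlt : (na + na') * nc + ne < P.R * P.R) :
    Runs P.w (mulAdd z a a' c e) P.mulN s fun s' =>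
      (∀ p < 2 * P.h, s'.arr z p < 2 ^ P.b) ∧
      dval (2 ^ P.b) (s'.arr z) (2 * P.h) = (na + na') * nc + ne := by
  obtain ⟨h1, rfl⟩ := h1
  obtain ⟨h2, rfl⟩ := h2
  obtain ⟨h3, rfl⟩ := h3
  have hw := O.conv.hw
  have hqw := O.conv.hqw
  have hD := O.hD
  have hM := O.hM
  have hM4 := O.hM4
  have h2q : 2 ^ P.q ≤ P.q * 2 ^ P.q := Nat.le_mul_of_pos_left _ O.conv.hq
  have hh : 0 < P.h := by have := Nat.one_le_two_pow (n := P.q); omega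
  have hβ : 0 < 2 ^ P.b := by positivity
  have hb2 : 2 * 2 ^ P.b ≤ P.h * (2 * 2 ^ P.b * 2 ^ P.b) :=
    (Nat.le_mul_of_pos_right _ hβ).trans (Nat.le_mul_of_pos_left _ hh)
  have hR : P.R * P.R = (2 ^ P.b) ^ (2 * P.h) := by rw [Par.R, ← pow_add]; congr 1; omega
  simp only [List.mem_cons, List.not_mem_nil, or_false, not_or] at he
  obtain ⟨he1, he2, he3, he4⟩ := he
  apply Runs.of_le
  · apply Runs.call_seq (fill_spec (a := a) (a' := a') (c := c) (B := 2 ^ P.b) hw H.hh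
      (by rw [H.conv.hD, O.hD]) (by omega) (by omega) ha ha' hc (fun p hp => (h1 p hp).le)
      (fun p hp => (h2 p hp).le))
    intro s1 f1 ⟨a1, a2⟩
    have C1 : ConvOK P.M P.q P.L s1 := H.conv.frame f1 (by
      show ∀ x ∈ [rM, rD, rq, rL], x ∉ wregs (fill 0 0 0)
      decide +kernel) (by
      show aQS ∉ warrs (fill 0 0 0)
      decide +kernel)
    have b1 : s1.reg rb = P.b := by
      rw [f1.reg _ (show rb ∉ wregs (fill 0 0 0) by decide +kernel), H.hb]
    have e1 : s1.arr e = s.arr e := by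
      rw [f1.arr _ (by simp [fill, forN, warrs, RAM.block, Instr.warrs, he1])]
    apply Runs.call_seq (conv_spec (h := P.h) (a := 2 * 2 ^ P.b) (b := 2 ^ P.b)
      (A := fun p => if p < P.h then s.arr a p + s.arr a' p else 0)
      (B := fun p => if p < P.h then s.arr c p else 0) O.conv C1 hD
      (fun p hp => if_neg (by omega)) (fun p hp => if_neg (by omega))
      (fun p => by
        split_ifs with h
        · have := h1 p h; have := h2 p h; omega
        · omega)
      (fun p => by
        split_ifs with h
        · exact (h3 p h).le
        · omega) hM (by omega) (by omega) a1 a2)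
    intro s2 f2 hX
    have b2 : s2.reg rb = P.b := by rw [f2.reg _ (by decide +kernel), b1]
    have d2 : s2.reg rD = 2 * P.h := by rw [f2.reg _ (by decide +kernel), C1.hD, hD]
    have e2 : s2.arr e = s.arr e := by
      have : e ∉ warrs conv := fun h => by
        have : ∀ x ∈ warrs conv, x = 0 ∨ x = 1 ∨ x = 2 ∨ x = 4 := by decide +kernel
        have := this e h
        omega
      rw [f2.arr _ this, e1]
    have hval := dval_cv (2 ^ P.b) (A := fun p => if p < P.h then s.arr a p + s.arr a' p else 0)
      (B := fun p => if p < P.h then s.arr c p else 0) hh (fun p hp => if_neg (by omega))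
      (fun p hp => if_neg (by omega))
    rw [dval_congr (g := fun p => s.arr a p + s.arr a' p) (fun p hp => if_pos hp),
      dval_congr (f := fun p => if p < P.h then s.arr c p else 0) (g := s.arr c)
      (fun p hp => if_pos hp), dval_add] at hval
    apply Runs.mono (carry_spec (M := P.M) (b := P.b) (D := 2 * P.h) (a := e)
      (A := cv (fun p => if p < P.h then s.arr a p + s.arr a' p else 0)
        (fun p => if p < P.h then s.arr c p else 0)) (B := s.arr e) hw hM4 (by omega) O.hb b2 d2 hz
      (by omega) (fun p hp => ⟨hX p hp, (cv_le (h := P.h) (a := 2 * 2 ^ P.b) (b := 2 ^ P.b)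
        (fun p hp => if_neg (by omega))
        (fun p => by
          split_ifs with h
          · have := h1 p h; have := h2 p h; omega
          · omega)
        (fun p => by
          split_ifs with h
          · exact (h3 p h).le
          · omega) p).trans_lt hM⟩) (fun p hp => ⟨by rw [e2], h4 p hp⟩)
      (by rw [hval, h5, ← hR]; exact hlt))
    intro s3 ⟨g1, g2⟩
    refine ⟨g1, ?_⟩
    rw [g2, hval, h5]
  · simp only [Par.mulN]
    have : 2 * P.h * (P.b * 12 + 40) = 24 * (P.b * P.h) + 80 * P.h := by ring
    omega

/-- The basic operation: the Montgomery product of `x + y` and `c` goes to `z`. -/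
def mac (z x y c : ℕ) : Prog :=
  mulAdd aT x y c aZ ;; mulAdd aU aT aZ aFi aZ ;; mulAdd aU aU aZ aFm aT ;; copyHi z

/-- The number of steps of a Montgomery multiplication. -/
def Par.macN (P : Par) : ℕ := 3 * P.mulN + (P.h * 10 + 10)

theorem wregs_mac (z x y c : ℕ) : ∀ r ∈ wregs (mac z x y c), r ∉ [rM, rD, rq, rL, rb, rh] ∧
    r < 64 := by
  show ∀ r ∈ wregs (mac 0 0 0 0), r ∉ [rM, rD, rq, rL, rb, rh] ∧ r < 64
  decide +kernel

theorem warrs_mac (z x y c : ℕ) : ∀ a ∈ warrs (mac z x y c), a = z ∨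
    a ∉ [aQS, aFm, aFi, aZ] ∧ a < 16 := by
  intro a ha
  have h1 : warrs (mac z x y c) = warrs (mulAdd aT 0 0 0 aZ ;; mulAdd aU aT aZ aFi aZ ;;
    mulAdd aU aU aZ aFm aT) ++ [z] := by
    simp only [mac, warrs, List.append_assoc]
    rfl
  rw [h1, List.mem_append, List.mem_singleton] at ha
  rcases ha with h | h
  · right
    revert a
    decide +kernel
  · exact Or.inl h

theorem prints_mac (z x y c : ℕ) : prints (mac z x y c) = false := by
  show prints (mac 0 0 0 0) = false
  decide +kernel

theorem NumOK.frame_mac {P : Par} {s s' : State} {z x y c : ℕ} (H : NumOK P s) (hz : 32 ≤ z)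
    (f : Frame (mac z x y c) s s') : NumOK P s' := by
  refine H.frame f (fun x hx h => (wregs_mac _ _ _ _ x h).1 hx) (fun a ha h => ?_)
  rcases warrs_mac _ _ _ _ a h with h | h
  · subst h
    simp at ha
    omega
  · exact h.1 ha

/-- Montgomery multiplication.  The product `t = (x + y) * c` is at most `F * R`; with
`u ≡ t * F' mod R` the number `t + u * F` is divisible by `R`, and the quotient is less than
`2 * F`. -/
theorem mac_spec {P : Par} (O : P.OK) {s : State} (H : NumOK P s) {z x y c : ℕ}
    {px py pc : ZMod P.F} (hz : 32 ≤ z) (hx : 32 ≤ x) (hy : 32 ≤ y) (hc : 32 ≤ c)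
    (sx : Slot P s x px) (sy : Slot P s y py) (sc : Slot P s c pc) :
    Runs P.w (mac z x y c) P.macN s fun s' => Slot P s' z ((px + py) * pc) := by
  obtain ⟨nx, dx, bx, ex⟩ := sx
  obtain ⟨ny, dy, by', ey⟩ := sy
  obtain ⟨nc, dc, bc, ec⟩ := sc
  have hw := O.conv.hw
  have hqw := O.conv.hqw
  have hD := O.hD
  have h2q : 2 ^ P.q ≤ P.q * 2 ^ P.q := Nat.le_mul_of_pos_left _ O.conv.hq
  have hF := O.hF
  have hF1 := O.hF1
  have hZ0 : ∀ {s : State} {n : ℕ}, (∀ p, s.arr aZ p = 0) →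
      dval (2 ^ P.b) (s.arr aZ) n = 0 := fun h => by simp [dval, h]
  have hβ : 0 < 2 ^ P.b := by positivity
  have hT : (nx + ny) * nc ≤ P.F * P.R := by
    calc (nx + ny) * nc ≤ (4 * P.F) * (2 * P.F) := Nat.mul_le_mul (by omega) (by omega)
      _ = P.F * (8 * P.F) := by ring
      _ ≤ _ := Nat.mul_le_mul_left _ hF
  have hFR : P.F * P.R + P.R * P.F < P.R * P.R := by
    have : 8 * (P.F * P.R) ≤ P.R * P.R := by rw [← mul_assoc]; exact Nat.mul_le_mul_right _ hF
    have h0 : 0 < P.F * P.R := by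
      have : 0 < P.R := by omega
      positivity
    rw [mul_comm P.R P.F]
    omega
  have low : ∀ {s : State} {a : ℕ}, (∀ p < 2 * P.h, s.arr a p < 2 ^ P.b) →
      (∃ hi, dval (2 ^ P.b) (s.arr a) (2 * P.h) = dval (2 ^ P.b) (s.arr a) P.h + P.R * hi ∧
        hi = dval (2 ^ P.b) (fun i => s.arr a (P.h + i)) P.h) ∧
      Digs P s a (dval (2 ^ P.b) (s.arr a) P.h) ∧ dval (2 ^ P.b) (s.arr a) P.h < P.R := by
    intro s a h
    exact ⟨⟨_, by rw [two_mul, dval_append]; rfl, rfl⟩, ⟨fun p hp => h p (by omega), rfl⟩,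
      dval_lt fun p hp => h p (by omega)⟩
  apply Runs.of_le
  · apply Runs.call_seq (mulAdd_spec (z := aT) O H (by decide) (by omega) (by omega) (by omega)
      (by decide) dx dy dc (fun p _ => by rw [H.hZ]; exact hβ) (hZ0 H.hZ) (by omega))
    intro s1 f1 ⟨a1, a2⟩
    have H1 : NumOK P s1 := H.frame f1
      (show ∀ x ∈ [rM, rD, rq, rL, rb, rh], x ∉ wregs (mulAdd aT 0 0 0 aZ) by decide +kernel)
      (show ∀ x ∈ [aQS, aFm, aFi, aZ], x ∉ warrs (mulAdd aT 0 0 0 aZ) by decide +kernel)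
    obtain ⟨⟨t1, a3, -⟩, a4, a5⟩ := low a1
    apply Runs.call_seq (mulAdd_spec (z := aU) O H1 (by decide) (by decide) (by decide) (by decide)
      (by decide) a4 (na' := 0) ⟨fun p _ => by rw [H1.hZ]; exact hβ, hZ0 H1.hZ⟩ H1.hF'
      (fun p _ => by rw [H1.hZ]; exact hβ) (hZ0 H1.hZ)
      (by rw [add_zero, add_zero]; exact Nat.mul_lt_mul'' a5 O.hF'))
    intro s2 f2 ⟨b1, b2⟩
    have H2 := H1.frame f2 (by decide +kernel) (by decide +kernel)
    have hT2 : s2.arr aT = s1.arr aT := f2.arr _ (by decide +kernel)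
    obtain ⟨⟨t2, b3, -⟩, b4, b5⟩ := low b1
    set u := dval (2 ^ P.b) (s2.arr aU) P.h with hu
    have huF : u * P.F < P.R * P.F := Nat.mul_lt_mul_of_pos_right b5 (by omega)
    apply Runs.call_seq (mulAdd_spec (z := aU) O H2 (by decide) (by decide) (by decide) (by decide)
      (by decide) b4 (na' := 0) ⟨fun p _ => by rw [H2.hZ]; exact hβ, hZ0 H2.hZ⟩ H2.hF
      (fun p hp => by rw [hT2]; exact a1 p hp) (by rw [hT2, a2]) (by rw [add_zero, add_zero]; omega))
    intro s3 f3 ⟨c1, c2⟩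
    have H3 := H2.frame f3 (by decide +kernel) (by decide +kernel)
    obtain ⟨⟨t3, c3, c6⟩, -, c5⟩ := low c1
    apply Runs.mono (copyHi_spec hw H3.hh (by omega) (by omega))
    intro s4 h4
    simp only [add_zero] at a2 b2 c2
    rw [a2] at a3
    rw [b2] at b3
    rw [c2] at c3
    -- the low half of the result vanishes
    have hdvd : P.R ∣ u * P.F + (nx + ny) * nc := by
      obtain ⟨c, hc⟩ := O.hinv
      set tl := dval (2 ^ P.b) (s1.arr aT) P.h
      refine (Nat.dvd_add_right (show P.R ∣ P.R * t2 * P.F from ⟨t2 * P.F, by ring⟩)).1 ?_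
      refine ⟨tl * c + t1, ?_⟩
      calc P.R * t2 * P.F + (u * P.F + (nx + ny) * nc) = (u + P.R * t2) * P.F + (nx + ny) * nc := by
            ring
        _ = tl * (P.F * P.F' + 1) + P.R * t1 := by rw [← b3, a3]; ring
        _ = _ := by rw [hc]; ring
    have hlow : dval (2 ^ P.b) (s3.arr aU) P.h = 0 := by
      rw [c3] at hdvd
      exact Nat.eq_zero_of_dvd_of_lt ((Nat.dvd_add_left (dvd_mul_right _ _)).1 hdvd) c5
    rw [hlow, zero_add] at c3
    have hz4 : dval (2 ^ P.b) (s4.arr z) P.h = t3 := by rw [c6]; exact dval_congr h4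
    refine ⟨t3, ⟨fun p hp => by rw [h4 p hp]; exact c1 _ (by omega), hz4⟩, ?_, ?_⟩
    · refine lt_of_mul_lt_mul_left (a := P.R) ?_ (Nat.zero_le _)
      rw [← c3]
      calc u * P.F + (nx + ny) * nc < P.R * P.F + P.F * P.R := by omega
        _ = P.R * (2 * P.F) := by ring
    · obtain ⟨c, hc⟩ := O.hinv
      have hc' := congrArg (Nat.cast : ℕ → ZMod P.F) hc
      have c3' := congrArg (Nat.cast : ℕ → ZMod P.F) c3
      push_cast at hc' c3'
      simp only [ZMod.natCast_self, zero_mul, mul_zero, zero_add] at hc' c3'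
      rw [ex, ey, ec] at c3'
      linear_combination ((t3 : ZMod P.F) - (px + py) * pc * P.R) * hc' - (c : ZMod P.F) * c3'
  · simp only [Par.macN]; omega

end RAM

/-! ### Straight-line computations modulo `F` -/

namespace RAM

/-- A call of `mac`: the product of `x + y` and `c` goes to `z`, where the names are those of
arrays. -/
structure Op where
  (z x y c : ℕ)

/-- A sequence of multiplications. -/
def opsP : List Op → Prog
  | [] => .skip
  | o :: l => mac o.z o.x o.y o.c ;; opsP l

/-- What a sequence of multiplications does to the residue classes in the arrays. -/
def runOps {K : Type*} [CommRing K] : List Op → (ℕ → K) → ℕ → K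
  | [], env => env
  | o :: l, env => runOps l (Function.update env o.z ((env o.x + env o.y) * env o.c))

/-- Everything is ready for computing modulo `F`, and the arrays from number `32` on hold the
residue classes `env`. -/
structure Ari (P : Par) (s : State) (env : ℕ → ZMod P.F) : Prop where
  num : NumOK P s
  slot : ∀ a, 32 ≤ a → Slot P s a (env a)

/-- The states agree on the registers from `n` on, on the output and on the arrays that are neither
used for the multiplication nor hold residue classes. -/
structure Kept (n : ℕ) (s s' : State) : Prop where
  reg : ∀ x, n ≤ x → s'.reg x = s.reg x
  out : s'.out = s.out
  arr : ∀ a, 16 ≤ a → a < 32 → s'.arr a = s.arr a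

theorem Kept.refl (n : ℕ) (s : State) : Kept n s s := ⟨fun _ _ => rfl, rfl, fun _ _ _ => rfl⟩

theorem Kept.trans {n : ℕ} {s s' s'' : State} (h : Kept n s s') (h' : Kept n s' s'') :
    Kept n s s'' :=
  ⟨fun x hx => (h'.reg x hx).trans (h.reg x hx), h'.out.trans h.out,
    fun a ha ha' => (h'.arr a ha ha').trans (h.arr a ha ha')⟩

theorem Kept.mono {n m : ℕ} {s s' : State} (h : Kept n s s') (hnm : n ≤ m) : Kept m s s' :=
  ⟨fun x hx => h.reg x (hnm.trans hx), h.out, h.arr⟩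

theorem Kept.set {n : ℕ} {s s' : State} (h : Kept n s s') {x v : ℕ} (hx : x < n) :
    Kept n s (s'.set x v) :=
  ⟨fun y hy => by rw [State.set_reg, if_neg (by omega), h.reg y hy], h.out, h.arr⟩

theorem Ari.set {P : Par} {s : State} {env : ℕ → ZMod P.F} (h : Ari P s env) {x v : ℕ}
    (hx : x ∉ [rM, rD, rq, rL, rb, rh]) : Ari P (s.set x v) env := by
  refine ⟨h.num.frame (p := .instr (.const x v)) (Frame.instr (.const x v) s) ?_ ?_, h.slot⟩
  · intro y hy h
    simp only [wregs, Instr.wregs, List.mem_singleton] at h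
    exact hx (h ▸ hy)
  · intro y _
    simp [warrs, Instr.warrs]

theorem opsP_spec {P : Par} (O : P.OK) (l : List Op)
    (hl : ∀ o ∈ l, 32 ≤ o.z ∧ 32 ≤ o.x ∧ 32 ≤ o.y ∧ 32 ≤ o.c) {s : State} {env : ℕ → ZMod P.F}
    (A : Ari P s env) :
    Runs P.w (opsP l) (l.length * P.macN + 1) s fun s' => Ari P s' (runOps l env) ∧ Kept 64 s s' := by
  induction l generalizing s env with
  | nil => exact (Runs.skip ⟨A, Kept.refl _ _⟩).of_le (by simp)
  | cons o l ih =>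
    obtain ⟨hz, hx, hy, hc⟩ := hl o (by simp)
    apply Runs.of_le
    · apply Runs.call_seq (mac_spec O A.num hz hx hy hc (A.slot _ hx) (A.slot _ hy) (A.slot _ hc))
      intro s1 f1 h1
      have hf : ∀ a, a ≠ o.z → 16 ≤ a → s1.arr a = s.arr a := fun a ha ha' =>
        f1.arr a fun h => by
          rcases warrs_mac _ _ _ _ a h with h | h
          · exact ha h
          · omega
      apply Runs.mono (ih (fun o ho => hl o (by simp [ho]))
        (env := Function.update env o.z ((env o.x + env o.y) * env o.c))
        ⟨A.num.frame_mac hz f1, fun a ha => ?_⟩)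
      · intro s2 ⟨h2, h3⟩
        refine ⟨h2, Kept.trans ⟨fun x hx => f1.reg x fun h => ?_, f1.out (prints_mac _ _ _ _),
          fun a ha ha' => hf a (by omega) ha⟩ h3⟩
        have := (wregs_mac _ _ _ _ x h).2
        omega
      · by_cases h : a = o.z
        · subst h; rw [Function.update_self]; exact h1
        · rw [Function.update_of_ne h]
          exact (A.slot a ha).frame (hf a h (by omega))
    · rw [List.length_cons, Nat.succ_mul]; omega

section RunOps

variable {K : Type*} [CommRing K]

theorem runOps_append (l l' : List Op) (env : ℕ → K) :
    runOps (l ++ l') env = runOps l' (runOps l env) := by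
  induction l generalizing env with
  | nil => rfl
  | cons o l ih => exact ih _

theorem runOps_of_notMem {l : List Op} {a : ℕ} (h : a ∉ l.map Op.z) (env : ℕ → K) :
    runOps l env a = env a := by
  induction l generalizing env with
  | nil => rfl
  | cons o l ih =>
    simp only [List.map_cons, List.mem_cons, not_or] at h
    rw [runOps, ih h.2, Function.update_of_ne h.1]

/-- Compute the number with the given binary digits, starting from `1` in array `32` and `0` in
array `33`. -/
def mkDigits (z : ℕ) : List ℕ → List Op
  | [] => [⟨z, 33, 33, 32⟩]
  | d :: l => mkDigits z l ++ ⟨z, z, z, 32⟩ :: (if d = 0 then [] else [⟨z, z, 32, 32⟩])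

/-- Compute the residue class of `c`. -/
def mkConst (z c : ℕ) : List Op := mkDigits z (Nat.digits 2 c)

theorem runOps_mkDigits {z : ℕ} (hz : z ≠ 32) {env : ℕ → K} (h1 : env 32 = 1)
    (h0 : env 33 = 0) (l : List ℕ) (hl : ∀ d ∈ l, d < 2) :
    runOps (mkDigits z l) env = Function.update env z (Nat.ofDigits 2 l : ℕ) := by
  induction l with
  | nil => simp [mkDigits, runOps, h0]
  | cons d l ih =>
    have hd := hl d (by simp)
    rw [mkDigits, runOps_append, ih fun d hd => hl d (by simp [hd])]
    obtain rfl | rfl : d = 0 ∨ d = 1 := by omega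
    · simp [runOps, hz.symm, h1, Nat.ofDigits_cons, two_mul]
    · simp [runOps, hz.symm, h1, Nat.ofDigits_cons, two_mul]
      congr 1
      ring

theorem runOps_mkConst {z c : ℕ} (hz : z ≠ 32) {env : ℕ → K} (h1 : env 32 = 1)
    (h0 : env 33 = 0) : runOps (mkConst z c) env = Function.update env z (c : K) := by
  rw [mkConst, runOps_mkDigits hz h1 h0 _ fun d hd => Nat.digits_lt_base (by norm_num) hd,
    Nat.ofDigits_digits]

theorem mkDigits_ge {z : ℕ} (hz : 32 ≤ z) (l : List ℕ) :
    ∀ o ∈ mkDigits z l, 32 ≤ o.z ∧ 32 ≤ o.x ∧ 32 ≤ o.y ∧ 32 ≤ o.c := by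
  induction l with
  | nil => simp [mkDigits, hz]
  | cons d l ih =>
    intro o ho
    simp only [mkDigits, List.mem_append, List.mem_cons] at ho
    rcases ho with h | rfl | h
    · exact ih o h
    · simp [hz]
    · split_ifs at h
      · simp at h
      · simp only [List.mem_singleton] at h
        subst h; simp [hz]

/-- The doubling of the point `[X : Y : Z]` in the arrays `40`, `41`, `42` on the curve with the
coefficients in `43` and `44`.  The arrays `35`, …, `39` hold `-1`, `3`, `-3`, `-9` and `27`,
the arrays `32` and `33` hold `1` and `0`. -/
def dblOps : List Op :=
  [⟨50, 43, 33, 42⟩, ⟨51, 44, 33, 42⟩, ⟨52, 41, 33, 41⟩, ⟨53, 50, 33, 40⟩, ⟨54, 53, 33, 37⟩,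
    ⟨55, 52, 54, 40⟩, ⟨56, 40, 33, 42⟩, ⟨57, 51, 33, 56⟩, ⟨58, 57, 33, 38⟩, ⟨59, 50, 33, 50⟩,
    ⟨60, 59, 33, 42⟩, ⟨61, 55, 58, 32⟩, ⟨62, 61, 60, 32⟩, ⟨63, 41, 41, 32⟩, ⟨64, 62, 33, 63⟩,
    ⟨65, 52, 33, 52⟩, ⟨66, 53, 33, 52⟩, ⟨67, 66, 33, 36⟩, ⟨68, 40, 33, 40⟩, ⟨69, 51, 33, 40⟩,
    ⟨70, 69, 33, 68⟩, ⟨71, 70, 33, 39⟩, ⟨72, 51, 33, 52⟩, ⟨73, 72, 33, 42⟩, ⟨74, 73, 33, 38⟩,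
    ⟨75, 59, 33, 68⟩, ⟨76, 75, 33, 38⟩, ⟨77, 60, 33, 50⟩, ⟨78, 77, 33, 35⟩, ⟨79, 65, 67, 32⟩,
    ⟨80, 71, 74, 32⟩, ⟨81, 76, 78, 32⟩, ⟨82, 79, 80, 32⟩, ⟨83, 82, 81, 32⟩, ⟨84, 63, 33, 63⟩,
    ⟨85, 84, 33, 63⟩, ⟨42, 85, 33, 42⟩, ⟨40, 64, 33, 32⟩, ⟨41, 83, 33, 32⟩]

/-- The constants needed for doubling are in place. -/
structure DblEnv (W : WeierstrassCurve K) (env : ℕ → K) : Prop where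
  h32 : env 32 = 1
  h33 : env 33 = 0
  h35 : env 35 = -1
  h36 : env 36 = 3
  h37 : env 37 = -3
  h38 : env 38 = -9
  h39 : env 39 = 27
  h43 : env 43 = W.a₄
  h44 : env 44 = W.a₆

/-- Duplication on a curve `y ^ 2 = x ^ 3 + a₄ x + a₆` in homogeneous coordinates. -/
theorem dblXYZ_short (W : WeierstrassCurve K) (h1 : W.a₁ = 0) (h2 : W.a₂ = 0) (h3 : W.a₃ = 0)
    (X Y Z : K) : WeierstrassCurve.Projective.dblXYZ W.toProjective ![X, Y, Z] =
      ![2 * X * Y ^ 3 - 6 * W.a₄ * X ^ 2 * Y * Z - 18 * W.a₆ * X * Y * Z ^ 2 +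
          2 * W.a₄ ^ 2 * Y * Z ^ 3,
        Y ^ 4 + 3 * W.a₄ * X * Y ^ 2 * Z + 27 * W.a₆ * X ^ 3 * Z - 9 * W.a₆ * Y ^ 2 * Z ^ 2 -
          9 * W.a₄ ^ 2 * X ^ 2 * Z ^ 2 - W.a₄ ^ 3 * Z ^ 4,
        8 * Y ^ 3 * Z] := by
  simp only [WeierstrassCurve.Projective.dblXYZ, WeierstrassCurve.Projective.dblX,
    WeierstrassCurve.Projective.dblY, WeierstrassCurve.Projective.negDblY,
    WeierstrassCurve.Projective.dblZ, WeierstrassCurve.Projective.negY, WeierstrassCurve.toProjective,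
    h1, h2, h3, Matrix.cons_val_zero, Matrix.cons_val_one, Matrix.cons_val]
  congr 1
  · ring
  · congr 1
    · ring
    · congr 1
      ring

theorem runOps_dblOps {W : WeierstrassCurve K} (h1 : W.a₁ = 0) (h2 : W.a₂ = 0) (h3 : W.a₃ = 0)
    {env : ℕ → K} (D : DblEnv W env) :
    ![runOps dblOps env 40, runOps dblOps env 41, runOps dblOps env 42] =
      WeierstrassCurve.Projective.dblXYZ W.toProjective ![env 40, env 41, env 42] := by
  rw [dblXYZ_short W h1 h2 h3]
  have key : ∀ {l : List Op} {env : ℕ → K} {z x y c : ℕ} {v : K},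
      (env x + env y) * env c = v →
      runOps (⟨z, x, y, c⟩ :: l) env = runOps l (Function.update env z v) := by
    intro l env z x y c v h
    rw [← h]; rfl
  simp only [dblOps]
  obtain ⟨d1, d2, d3, d4, d5, d6, d7, d8, d9⟩ := D
  iterate 39
    rw [key (by simp only [Function.update_self, ne_eq, Function.update_of_ne, Nat.reduceEqDiff, not_false_eq_true, d1, d2, d3, d4, d5, d6, d7, d8, d9, add_zero, mul_one]; rfl)]
  simp only [runOps, Function.update_self, ne_eq, Function.update_of_ne, Nat.reduceEqDiff, not_false_eq_true]
  congr 1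
  · ring
  · congr 1
    · ring
    · congr 1
      ring

end RunOps

/-- Double the point in the arrays `40`, `41`, `42` as often as register `69` says. -/
def dblLoop : Prog := forN 68 69 (opsP dblOps)

theorem dblLoop_spec {P : Par} (O : P.OK) {s : State} {env : ℕ → ZMod P.F} {n : ℕ}
    (A : Ari P s env) (hn : s.reg 69 = n) {W : WeierstrassCurve (ZMod P.F)} (h1 : W.a₁ = 0)
    (h2 : W.a₂ = 0) (h3 : W.a₃ = 0) (D : DblEnv W env) :
    Runs P.w dblLoop (n * (39 * P.macN + 5) + 3) s fun s' => Kept 70 s s' ∧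
      ∃ env' : ℕ → ZMod P.F, Ari P s' env' ∧ (∀ a, a ∉ dblOps.map Op.z → env' a = env a) ∧
        ![env' 40, env' 41, env' 42] =
          (WeierstrassCurve.Projective.dblXYZ W.toProjective)^[n] ![env 40, env 41, env 42] := by
  apply Runs.forN (N := 39 * P.macN + 1) (n := n) (fun i s' => Kept 70 s s' ∧
      ∃ env' : ℕ → ZMod P.F, Ari P s' env' ∧ (∀ a, a ∉ dblOps.map Op.z → env' a = env a) ∧
        ![env' 40, env' 41, env' 42] =
          (WeierstrassCurve.Projective.dblXYZ W.toProjective)^[i] ![env 40, env 41, env 42])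
      hn (by decide) O.conv.hw
  · exact ⟨(Kept.refl _ _).set (by norm_num), env, A.set (by decide), fun _ _ => rfl, rfl⟩
  · intro i s1 hi hk f1 ⟨K1, env1, A1, e1, e2⟩
    have D1 : DblEnv W env1 := ⟨by rw [e1 _ (by decide), D.h32], by rw [e1 _ (by decide), D.h33],
      by rw [e1 _ (by decide), D.h35], by rw [e1 _ (by decide), D.h36],
      by rw [e1 _ (by decide), D.h37], by rw [e1 _ (by decide), D.h38],
      by rw [e1 _ (by decide), D.h39], by rw [e1 _ (by decide), D.h43],
      by rw [e1 _ (by decide), D.h44]⟩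
    apply Runs.mono (opsP_spec O dblOps (by decide) A1)
    intro s2 ⟨A2, K2⟩
    refine ⟨by rw [K2.reg _ (by norm_num), hk], ?_, runOps dblOps env1, ?_, ?_, ?_⟩
    · exact ((K1.trans (K2.mono (by norm_num))).set (by norm_num)).set (by norm_num)
    · exact (A2.set (by decide)).set (by decide)
    · intro a ha
      rw [runOps_of_notMem ha, e1 a ha]
    · rw [runOps_dblOps h1 h2 h3 D1, e2, Function.iterate_succ_apply']
  · intro s1 f1 hz h
    exact h

/-- Raise the residue classes in the arrays `87` and `89` to the power with the binary digits in array `16`,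
whose number is in register `66`, and multiply the results into the arrays `86` and `88`. -/
def powLoop : Prog :=
  block [.const 65 0] ;;
  forN 64 66 (block [.load 67 16 65] ;;
    .ite 67 (opsP [⟨86, 86, 33, 87⟩, ⟨88, 88, 33, 89⟩]) .skip ;;
    opsP [⟨87, 87, 33, 87⟩, ⟨89, 89, 33, 89⟩] ;; block [.const 0 1, .add 65 65 0])

theorem powLoop_spec {P : Par} (O : P.OK) {s : State} {env : ℕ → ZMod P.F} {n e : ℕ}
    (A : Ari P s env) (hn : s.reg 66 = n) (h33 : env 33 = 0) (hen : e < 2 ^ n)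
    (he : ∀ i < n, s.arr 16 i = e / 2 ^ i % 2) :
    Runs P.w powLoop (n * (4 * P.macN + 15) + 10) s fun s' => Kept 70 s s' ∧
      ∃ env' : ℕ → ZMod P.F, Ari P s' env' ∧ (∀ a, a ∉ [86, 87, 88, 89] → env' a = env a) ∧
        env' 86 = env 86 * env 87 ^ e ∧ env' 88 = env 88 * env 89 ^ e := by
  have hw := O.conv.hw
  apply Runs.of_small
  intro hs
  have hnw : n < 2 ^ P.w := hn ▸ hs.1 66
  apply Runs.of_le
  · apply Runs.block_seq
    · simp
    apply Runs.forN (N := 4 * P.macN + 11) (n := n) (fun i s' => Kept 70 s s' ∧ s'.reg 65 = i ∧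
      ∃ env' : ℕ → ZMod P.F, Ari P s' env' ∧ (∀ a, a ∉ [86, 87, 88, 89] → env' a = env a) ∧
        env' 86 = env 86 * env 87 ^ (e % 2 ^ i) ∧ env' 88 = env 88 * env 89 ^ (e % 2 ^ i) ∧
        env' 87 = env 87 ^ 2 ^ i ∧ env' 89 = env 89 ^ 2 ^ i) (by simp [hn]) (by decide) hw
    · refine ⟨?_, by simp, env, ?_, by simp [Nat.mod_one]⟩
      · exact ((Kept.refl _ _).set (by norm_num)).set (by norm_num)
      · exact (A.set (by decide)).set (by decide)
    · intro i s1 hi hk f1 ⟨K1, i1, env1, A1, e0, e1, e2, e3, e4⟩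
      have hb : s1.arr 16 i = e / 2 ^ i % 2 := by
        rw [K1.arr 16 (by norm_num) (by norm_num), he i hi]
      have hmod : e % 2 ^ (i + 1) = e % 2 ^ i + 2 ^ i * (e / 2 ^ i % 2) := by
        rw [pow_succ, Nat.mod_mul]
      have z1 : env1 33 = 0 := by rw [e0 _ (by decide), h33]
      apply Runs.of_le
      · apply Runs.block_seq
        · simp
        apply Runs.call_seq (N₁ := 2 * P.macN + 2) (Q₁ := fun s' => Kept 64 (s1.set 67 (s1.arr 16 i)) s' ∧
          ∃ env' : ℕ → ZMod P.F, Ari P s' env' ∧ (∀ a, a ∉ [86, 88] → env' a = env1 a) ∧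
          env' 86 = env 86 * env 87 ^ (e % 2 ^ (i + 1)) ∧
          env' 88 = env 88 * env 89 ^ (e % 2 ^ (i + 1)))
        · apply Runs.of_le
          · apply Runs.ite
            · intro h
              simp [i1, hb] at h
              apply Runs.mono (opsP_spec O [⟨86, 86, 33, 87⟩, ⟨88, 88, 33, 89⟩] (by decide)
                (A1.set (x := 67) (v := s1.arr 16 (s1.reg 65)) (by decide)))
              intro s2 ⟨A2, K2⟩
              refine ⟨by rw [i1] at K2; exact K2, _, A2, ?_, ?_, ?_⟩
              · intro a ha
                exact runOps_of_notMem (by simpa using ha) _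
              · simp [runOps, Function.update_apply, z1, e1, e3]
                rw [hmod, h, mul_one, pow_add]; ring
              · simp [runOps, Function.update_apply, z1, e2, e4]
                rw [hmod, h, mul_one, pow_add]; ring
            · intro h
              simp [i1, hb] at h
              apply Runs.skip
              simp only [runL_cons, runL_nil, run_load, i1]
              refine ⟨Kept.refl _ _, env1, A1.set (by decide), fun _ _ => rfl, ?_, ?_⟩
              · rw [hmod, h, mul_zero, add_zero, e1]
              · rw [hmod, h, mul_zero, add_zero, e2]
          · simp
        intro s2 _ ⟨K2, env2, A2, j0, j1, j2⟩
        have z2 : env2 33 = 0 := by rw [j0 _ (by decide), z1]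
        apply Runs.call_seq (opsP_spec O [⟨87, 87, 33, 87⟩, ⟨89, 89, 33, 89⟩] (by decide) A2)
        intro s3 _ ⟨A3, K3⟩
        have d1 : s3.reg 65 = i := by
          rw [K3.reg _ (by norm_num), K2.reg _ (by norm_num)]; simp [i1]
        have d2 : s3.reg 64 = n - i := by
          rw [K3.reg _ (by norm_num), K2.reg _ (by norm_num)]; simp [hk]
        apply Runs.block
        · simp [d1, hw.ne']; omega
        · simp only [runL_cons, runL_nil, run_const, run_add]
          refine ⟨by simp [d2], ?_, by simp [d1], runOps [⟨87, 87, 33, 87⟩, ⟨89, 89, 33, 89⟩] env2,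
            ?_, ?_, ?_⟩
          · have K0 : Kept 70 s (s1.set 67 (s1.arr 16 i)) := K1.set (by norm_num)
            refine Kept.set (Kept.set (Kept.set (Kept.set ?_ (by norm_num)) (by norm_num))
              (by norm_num)) (by norm_num)
            exact K0.trans ((K2.trans K3).mono (by norm_num))
          · exact (((A3.set (by decide)).set (by decide)).set (by decide)).set (by decide)
          · intro a ha
            simp only [List.mem_cons, List.not_mem_nil, or_false, not_or] at ha
            rw [runOps_of_notMem (by simp [ha]), j0 a (by simp [ha]), e0 a (by simp [ha])]
          · simp [runOps, Function.update_apply, z2, j1, j2]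
            rw [j0 87 (by decide), j0 89 (by decide), e3, e4, pow_succ, pow_mul, pow_mul]
            exact ⟨by ring, by ring⟩
      · simp; omega
    · intro s1 f1 hz ⟨K1, i1, env1, A1, e0, e1, e2, e3, e4⟩
      rw [Nat.mod_eq_of_lt hen] at e1 e2
      exact ⟨K1, env1, A1, e0, e1, e2⟩
  · have : n * (4 * P.macN + 11 + 4) = n * (4 * P.macN + 15) := rfl
    simp
    omega

end RAM

/-! ### The numbers `F k` and the curve -/

namespace FkTest

/-- The coordinates of `α ^ k` with respect to the basis `1, α`. -/
def co : ℕ → ℤ × ℤ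
  | 0 => (1, 0)
  | k + 1 => (-4 * (co k).2, (co k).1 + (co k).2)

theorem alpha_pow (k : ℕ) : α ^ k = ⟨(co k).1, (co k).2⟩ := by
  induction k with
  | zero => rw [pow_zero]; rfl
  | succ k ih =>
    rw [pow_succ, ih]
    ext <;> simp [α, co]

/-- The norm of `α ^ k` is `4 ^ k`. -/
theorem co_norm (k : ℕ) : (co k).1 ^ 2 + (co k).1 * (co k).2 + 4 * (co k).2 ^ 2 = 4 ^ k := by
  induction k with
  | zero => simp [co]
  | succ k ih => simp only [co]; rw [pow_succ (4 : ℤ) k, ← ih]; ring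

/-- The trace of `α ^ k`. -/
def tr (k : ℕ) : ℤ := 2 * (co k).1 + (co k).2

theorem tr_sq (k : ℕ) : tr k ^ 2 ≤ 4 * 4 ^ k := by
  rw [← co_norm, tr]
  nlinarith [sq_nonneg (co k).2]

theorem norm_eq (k : ℕ) : QuadraticAlgebra.norm (1 - 4 * α ^ k) = 1 - 4 * tr k + 16 * 4 ^ k := by
  have h : (1 - 4 * α ^ k : OK) = ⟨1 - 4 * (co k).1, -4 * (co k).2⟩ := by
    rw [alpha_pow, show (1 : OK) = ⟨1, 0⟩ from rfl, show (4 : OK) = ⟨4, 0⟩ from rfl]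
    ext <;> simp
  rw [h, ← co_norm, QuadraticAlgebra.norm_def, tr]
  ring

theorem F_cast (k : ℕ) : (F k : ℤ) = 1 - 4 * tr k + 16 * 4 ^ k := by
  rw [F, norm_eq, Int.toNat_of_nonneg]
  have h1 := tr_sq k
  nlinarith [sq_nonneg (tr k - 8 * 4 ^ k), sq_nonneg (tr k - 2), one_le_pow₀ (M₀ := ℤ) (n := k) (show (1 : ℤ) ≤ 4 by norm_num)]

theorem F_lt (k : ℕ) : F k < 2 ^ (2 * k + 5) := by
  have h : (F k : ℤ) < 2 ^ (2 * k + 5) := by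
    rw [F_cast, pow_add, pow_mul]
    have h1 := tr_sq k
    have h2 := one_le_pow₀ (M₀ := ℤ) (n := k) (show (1 : ℤ) ≤ 4 by norm_num)
    norm_num
    nlinarith [sq_nonneg (tr k + 2)]
  exact_mod_cast h

theorem F_gt {k : ℕ} (hk : 2 ≤ k) : 2 ^ (2 * k) < F k := by
  have h : (2 ^ (2 * k) : ℤ) < F k := by
    rw [F_cast, pow_mul]
    have h1 := tr_sq k
    have h2 : (16 : ℤ) ≤ 4 ^ k := by
      calc (16 : ℤ) = 4 ^ 2 := by norm_num
        _ ≤ 4 ^ k := pow_le_pow_right₀ (by norm_num) hk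
    norm_num
    nlinarith [sq_nonneg (tr k - 2)]
  exact_mod_cast h

theorem co_parity {k : ℕ} (hk : 1 ≤ k) : (co k).1 % 2 = 0 ∧ (co k).2 % 2 = 1 := by
  induction k, hk using Nat.le_induction with
  | base => simp [co]
  | succ k hk ih => simp only [co]; omega

theorem F_mod {k : ℕ} (hk : 1 ≤ k) : F k % 8 = 5 := by
  have h := F_cast k
  obtain ⟨h1, h2⟩ := co_parity hk
  rw [tr] at h
  omega

/-- The coordinates of `α ^ k` modulo `231`. -/
def coMod : ℕ → ZMod 231 × ZMod 231
  | 0 => (1, 0)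
  | k + 1 => (-4 * (coMod k).2, (coMod k).1 + (coMod k).2)

theorem coMod_eq (k : ℕ) : coMod k = (((co k).1 : ZMod 231), ((co k).2 : ZMod 231)) := by
  induction k with
  | zero => simp [coMod, co]
  | succ k ih => simp [coMod, co, ih]

theorem coMod_add (k : ℕ) : coMod (k + 240) = coMod k := by
  induction k with
  | zero => decide +kernel
  | succ k ih => rw [Nat.add_right_comm, coMod, ih, coMod]

theorem coMod_mod (k : ℕ) : coMod k = coMod (k % 240) := by
  induction k using Nat.strong_induction_on with
  | _ k ih =>
    rcases Nat.lt_or_ge k 240 with h | h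
    · rw [Nat.mod_eq_of_lt h]
    · obtain ⟨j, rfl⟩ := Nat.exists_eq_add_of_le' h
      rw [coMod_add, Nat.add_mod_right, ih j (by omega)]

/-- The powers of `α` modulo `231 = 3 * 7 * 11` are periodic with period `240`, so it suffices to look
at the residues modulo `240` that define `S`. -/
theorem F_coprime {k : ℕ} (hk : k ∈ S) : (F k).Coprime 231 := by
  have h1 : ((F k : ℕ) : ZMod 231) = (1 - 4 * (coMod k).1) ^ 2 - 4 * (coMod k).2 *
      (1 - 4 * (coMod k).1) + 64 * (coMod k).2 ^ 2 := by
    have h := congrArg (Int.cast : ℤ → ZMod 231) (F_cast k)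
    rw [← co_norm, tr] at h
    rw [coMod_eq]
    push_cast at h
    rw [h]; ring
  have h2 : ∀ r ∈ ({9, 19, 39, 45, 59, 63, 67, 85, 105, 123, 129, 133, 159,
      169, 173, 181, 183, 221, 223, 225, 229} : Finset ℕ), Nat.Coprime (ZMod.val
      ((1 - 4 * (coMod r).1) ^ 2 - 4 * (coMod r).2 * (1 - 4 * (coMod r).1) +
      64 * (coMod r).2 ^ 2)) 231 := by decide +kernel
  have h3 := h2 (k % 240) hk
  rw [← coMod_mod, ← h1, ZMod.val_natCast] at h3
  have h4 : (F k % 231).gcd 231 = 1 := h3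
  rwa [← Nat.gcd_rec, Nat.gcd_comm] at h4

theorem F_coprime_disc {k : ℕ} (hk : k ∈ S) (hk1 : 1 ≤ k) :
    (F k).Coprime (2 ^ 28 * 3 ^ 6 * 7 ^ 12 * 11 ^ 6) := by
  have h := F_coprime hk
  rw [show 231 = 3 * 7 * 11 by norm_num] at h
  have h2 : (F k).Coprime 2 := by
    rw [Nat.coprime_two_right, Nat.odd_iff]
    have := F_mod hk1
    omega
  exact (((h2.pow_right 28).mul_right (h.coprime_mul_right_right.coprime_mul_right_right.pow_right 6)).mul_right
    (h.coprime_mul_right_right.coprime_mul_left_right.pow_right 12)).mul_right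
    (h.coprime_mul_left_right.pow_right 6)

theorem yP_cast (k : ℕ) (hF : F k ≠ 0) :
    ((yP k : ℕ) : ZMod (F k)) = -10179930516 + 4552603328 * (d k : ZMod (F k)) := by
  have h : ((yP k : ℕ) : ℤ) = (-10179930516 + 4552603328 * (d k : ℤ)) % (F k : ℤ) :=
    Int.toNat_of_nonneg (Int.emod_nonneg _ (by exact_mod_cast hF))
  have h' := congrArg (Int.cast : ℤ → ZMod (F k)) h
  rw [Int.cast_natCast, ZMod.intCast_mod] at h'
  rw [h']
  push_cast
  ring

section Curve

variable {K : Type*} [Field K] (δ : K)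

/-- The curve of the test over a field containing a square root `δ` of `5`. -/
def curve : WeierstrassCurve K where
  a₁ := 0
  a₂ := 0
  a₃ := 0
  a₄ := -3234 * (16195646845 - 7242913457 * δ)
  a₆ := 38416 * (5395199151946361 - 2412806411180256 * δ)

variable {δ}

/-- Up to a factor `-16`, the discriminant of the curve divides `2 ^ 28 * 3 ^ 6 * 7 ^ 12 * 11 ^ 6`: this
is the product of `4 * a₄ ^ 3 + 27 * a₆ ^ 2` and its conjugate over `ℚ(√5)`. -/
theorem curve_disc (hδ : δ ^ 2 = 5) (hK : (2 ^ 28 * 3 ^ 6 * 7 ^ 12 * 11 ^ 6 : K) ≠ 0) :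
    (curve δ).Δ ≠ 0 := by
  have h1 : 4 * (curve δ).a₄ ^ 3 + 27 * (curve δ).a₆ ^ 2 =
      20727746513877983454228894134788393869312 - 9269730045083091804950892124044182790144 * δ := by
    simp only [curve]
    linear_combination (-112876154080500861856773747065610641143008 +
      51406723717056348400207323526362430406688 * δ) * hδ
  have h2 : (4 * (curve δ).a₄ ^ 3 + 27 * (curve δ).a₆ ^ 2) *
      (20727746513877983454228894134788393869312 + 9269730045083091804950892124044182790144 * δ) =
      2 ^ 28 * 3 ^ 6 * 7 ^ 12 * 11 ^ 6 := by
    rw [h1]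
    linear_combination (-9269730045083091804950892124044182790144 ^ 2) * hδ
  have h3 : (curve δ).Δ = -(16 * (4 * (curve δ).a₄ ^ 3 + 27 * (curve δ).a₆ ^ 2)) := by
    simp only [WeierstrassCurve.Δ, WeierstrassCurve.b₂, WeierstrassCurve.b₄, WeierstrassCurve.b₆,
      WeierstrassCurve.b₈, show (curve δ).a₁ = 0 from rfl, show (curve δ).a₂ = 0 from rfl,
      show (curve δ).a₃ = 0 from rfl]
    ring
  have h16 : (16 : K) ≠ 0 := by
    intro h
    apply hK
    rw [show (2 ^ 28 * 3 ^ 6 * 7 ^ 12 * 11 ^ 6 : K) = 16 * (2 ^ 24 * 3 ^ 6 * 7 ^ 12 * 11 ^ 6) by ring,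
      h, zero_mul]
  rw [h3, neg_ne_zero]
  refine mul_ne_zero h16 fun h => hK ?_
  rw [← h2, h, zero_mul]

theorem curve_nonsingular (hδ : δ ^ 2 = 5) (hK : (2 ^ 28 * 3 ^ 6 * 7 ^ 12 * 11 ^ 6 : K) ≠ 0)
    (n : ℕ) : (curve δ).toProjective.Nonsingular
      ((WeierstrassCurve.Projective.dblXYZ (curve δ).toProjective)^[n]
        ![0, -10179930516 + 4552603328 * δ, 1]) := by
  classical
  induction n with
  | zero =>
    rw [Function.iterate_zero, id, WeierstrassCurve.Projective.nonsingular_some]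
    rw [← WeierstrassCurve.Affine.equation_iff_nonsingular_of_Δ_ne_zero (curve_disc hδ hK),
      WeierstrassCurve.Affine.equation_iff]
    simp only [curve]
    linear_combination (20726197062116675584) * hδ
  | succ n ih =>
    rw [Function.iterate_succ_apply', ← WeierstrassCurve.Projective.add_self]
    exact WeierstrassCurve.Projective.nonsingular_add ih ih

theorem ne_zero_of_nonsingular {W : WeierstrassCurve K} {P : Fin 3 → K}
    (h : W.toProjective.Nonsingular P) : ∃ i, P i ≠ 0 := by
  by_contra! hc
  rw [WeierstrassCurve.Projective.nonsingular_iff] at h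
  simp [hc] at h

end Curve

/-- The coordinates of the multiple of the point do not all vanish modulo a prime divisor of `F k`:
modulo such a prime, `d k` is a square root of `5`, the curve is nonsingular, and duplication leads
from nonsingular points to nonsingular points. -/
theorem exists_unit_coordinate {k : ℕ} (hk : k ∈ S) (hk1 : 2 ≤ k)
    (hd : d k ^ 2 ≡ 5 [MOD F k]) {p : ℕ}
    (hp : p.Prime) (hpF : p ∣ F k) : ∃ i, ZMod.castHom hpF (ZMod p) (Q k i) ≠ 0 := by
  have : Fact p.Prime := ⟨hp⟩
  set f := ZMod.castHom hpF (ZMod p) with hf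
  have hδ : (d k : ZMod p) ^ 2 = 5 := by
    have := (ZMod.natCast_eq_natCast_iff _ _ _).2 (hd.of_dvd hpF)
    push_cast at this
    exact this
  have hK : (2 ^ 28 * 3 ^ 6 * 7 ^ 12 * 11 ^ 6 : ZMod p) ≠ 0 := by
    intro h
    have h' : (((2 ^ 28 * 3 ^ 6 * 7 ^ 12 * 11 ^ 6 : ℕ)) : ZMod p) = 0 := by
      have h0 := h
      norm_num at h0 ⊢
      exact h0
    rw [ZMod.natCast_eq_zero_iff] at h'
    exact hp.one_lt.ne' (Nat.eq_one_of_dvd_coprimes (F_coprime_disc hk (by omega)) hpF h')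
  have hF : F k ≠ 0 := by have := F_mod (k := k) (by omega); omega
  have hmap : (E k).map f = curve (d k : ZMod p) := by
    ext <;> simp [E, curve, WeierstrassCurve.map, map_ofNat f]
  have key : ∀ n, f ∘ ((WeierstrassCurve.Projective.dblXYZ (E k).toProjective)^[n] (P k)) =
      (WeierstrassCurve.Projective.dblXYZ (curve (d k : ZMod p)).toProjective)^[n]
        ![0, -10179930516 + 4552603328 * (d k : ZMod p), 1] := by
    intro n
    induction n with
    | zero =>
      simp only [Function.iterate_zero, id, P]
      rw [yP_cast k hF]
      funext i
      fin_cases i <;> simp [map_ofNat f]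
    | succ n ih =>
      rw [Function.iterate_succ_apply', Function.iterate_succ_apply', ← ih,
        ← WeierstrassCurve.Projective.map_dblXYZ, ← hmap]
  obtain ⟨i, hi⟩ := ne_zero_of_nonsingular (curve_nonsingular hδ hK (2 * k + 1))
  refine ⟨i, fun h => hi ?_⟩
  rw [← key]
  exact h

/-- The greatest common divisor of integral coordinates of the point is prime to `F k`, so division by
it does not change the point of the projective plane over `ℤ / F k ℤ`. -/
theorem coprime_of_eq_smul {k : ℕ} (hk : k ∈ S) (hk1 : 2 ≤ k) (hd : d k ^ 2 ≡ 5 [MOD F k])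
    {X Y Z : ℕ} {u : (ZMod (F k))ˣ}
    (h : ![(X : ZMod (F k)), (Y : ZMod (F k)), (Z : ZMod (F k))] = u • Q k) :
    (Nat.gcd X (Nat.gcd Y Z)).Coprime (F k) := by
  by_contra hc
  obtain ⟨p, hp, h1, h2⟩ := Nat.Prime.not_coprime_iff_dvd.1 hc
  obtain ⟨i, hi⟩ := exists_unit_coordinate hk hk1 hd hp h2
  apply hi
  have hX : p ∣ X := h1.trans (Nat.gcd_dvd_left _ _)
  have hYZ : p ∣ Nat.gcd Y Z := h1.trans (Nat.gcd_dvd_right _ _)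
  have hY : p ∣ Y := hYZ.trans (Nat.gcd_dvd_left _ _)
  have hZ : p ∣ Z := hYZ.trans (Nat.gcd_dvd_right _ _)
  have h0 : ∀ j, ZMod.castHom h2 (ZMod p) ((u • Q k) j) = 0 := by
    rw [← h]
    intro j
    fin_cases j <;> simp [ZMod.natCast_eq_zero_iff, hX, hY, hZ]
  have h4 := h0 i
  rw [Pi.smul_apply, Units.smul_def, smul_eq_mul, map_mul] at h4
  have hu : IsUnit (ZMod.castHom h2 (ZMod p) (u : ZMod (F k))) := u.isUnit.map _
  exact (hu.mul_right_eq_zero).1 h4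

end FkTest

/-! ### Long numbers -/

theorem dval_succ' (β : ℕ) (f : ℕ → ℕ) (n : ℕ) :
    dval β f (n + 1) = f 0 + β * dval β (fun i => f (i + 1)) n := by
  rw [add_comm n 1, dval_append]
  simp [dval, add_comm]

theorem dval_digits (β v n : ℕ) : dval β (fun j => v / β ^ j % β) n = v % β ^ n := by
  induction n with
  | zero => simp [dval, Nat.mod_one]
  | succ n ih => rw [dval_succ, ih, pow_succ, Nat.mod_mul, mul_comm (β ^ n)]

namespace RAM

variable {w : ℕ}

/-- Write the digits of the number in register `x` to the array `a`. -/
def toDigits (a x : ℕ) : Prog :=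
  block [.copy vx' x, .const 65 0] ;;
  forN 64 rh (block [.copy vx vx'] ;; split rb ;; block [.store a 65 vx, .const 0 1, .add 65 65 0])

theorem toDigits_spec {s : State} {a x v b h : ℕ} (hw : 0 < w) (hb : s.reg rb = b)
    (hh : s.reg rh = h) (hhw : h < 2 ^ w) (hx : s.reg x = v) :
    Runs w (toDigits a x) (h * (b * 12 + 40) + 10) s fun s' =>
      ∀ j, s'.arr a j = if j < h then v / (2 ^ b) ^ j % 2 ^ b else s.arr a j := by
  apply Runs.of_le
  · apply Runs.block_seq
    · simp
    apply Runs.forN (N := b * 12 + 36) (n := h) (fun i s' => s'.reg 65 = i ∧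
        s'.reg vx' = v / (2 ^ b) ^ i ∧ s'.reg rb = b ∧
        ∀ j, s'.arr a j = if j < i then v / (2 ^ b) ^ j % 2 ^ b else s.arr a j)
      (by simp [hh]) (by decide) hw
    · simp [hx, hb]
    · intro i s1 hi hk f1 ⟨i1, i2, i3, i4⟩
      apply Runs.of_le
      · apply Runs.block_seq
        · simp
        apply Runs.call_seq (split_spec (b := b) hw (by decide) (by simp [i3]))
        intro s2 f2 ⟨h1, h2⟩
        simp [i2] at h1 h2
        have d1 : s2.reg 65 = i := by rw [f2.reg _ (by decide +kernel)]; simp [i1]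
        have d2 : s2.reg 64 = h - i := by rw [f2.reg _ (by decide +kernel)]; simp [hk]
        have d3 : s2.reg rb = b := by rw [f2.reg _ (by decide +kernel)]; simp [i3]
        have d4 : s2.arr = s1.arr := by
          funext a
          rw [f2.arr _ (by simp [split, hlv, dbl, forN, warrs, RAM.block, Instr.warrs])]
          simp
        apply Runs.block
        · simp [d1, hw.ne']; omega
        · simp [d1, d2, d3, d4, h1, h2]
          refine ⟨?_, ?_⟩
          · rw [Nat.div_div_eq_div_mul, pow_succ]
          · intro j
            rw [i4]
            split_ifs with c1 c2 c3 <;> first | rfl | omega | (rw [c1])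
      · simp; omega
    · intro s1 _ _ ⟨_, _, _, i4⟩
      exact i4
  · have : h * (b * 12 + 36 + 4) = h * (b * 12 + 40) := by ring
    simp; omega

theorem digs_of_digits {P : Par} {s : State} {a v : ℕ} (hv : v < P.R)
    (h : ∀ j < P.h, s.arr a j = v / (2 ^ P.b) ^ j % 2 ^ P.b) : Digs P s a v := by
  refine ⟨fun p hp => by rw [h p hp]; exact Nat.mod_lt _ (by positivity), ?_⟩
  rw [dval_congr h, dval_digits]
  exact Nat.mod_eq_of_lt hv

/-- Compute in register `74` the number whose digits are in the array `a`. -/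
def toReg (a : ℕ) : Prog :=
  block [.const 74 0, .copy 65 rh] ;;
  forN 64 rh (dbl 74 rb ;; block [.const 0 1, .sub 65 65 0, .load 0 a 65, .add 74 74 0])

theorem toReg_spec {P : Par} {s : State} {a n : ℕ} (hw : P.b * P.h < w) (hb : s.reg rb = P.b)
    (hh : s.reg rh = P.h) (ha : Digs P s a n) :
    Runs w (toReg a) (P.h * (P.b * 6 + 20) + 10) s fun s' => s'.reg 74 = n := by
  obtain ⟨ha, rfl⟩ := ha
  have hw0 : 0 < w := by omega
  have hRw : (2 ^ P.b) ^ P.h < 2 ^ w := by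
    rw [← pow_mul]; exact Nat.pow_lt_pow_right (by norm_num) hw
  apply Runs.of_le
  · apply Runs.block_seq
    · simp
    apply Runs.forN (N := P.b * 6 + 16) (n := P.h) (fun i s' => s'.reg 65 = P.h - i ∧
        s'.reg 74 = dval (2 ^ P.b) (fun j => s.arr a (P.h - i + j)) i ∧ s'.reg rb = P.b ∧
        s'.arr a = s.arr a)
      (by simp [hh]) (by decide) hw0
    · simp [hh, hb, dval]
    · intro i s1 hi hk f1 ⟨i1, i2, i3, i4⟩
      have hlt := dval_lt (β := 2 ^ P.b) (n := i + 1) (f := fun j => s.arr a (P.h - (i + 1) + j))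
        (fun j hj => ha _ (by omega))
      have hle : (2 ^ P.b) ^ (i + 1) ≤ (2 ^ P.b) ^ P.h := Nat.pow_le_pow_right (by positivity) hi
      have hs : dval (2 ^ P.b) (fun j => s.arr a (P.h - (i + 1) + j)) (i + 1) =
          s.arr a (P.h - i - 1) + s1.reg 74 * 2 ^ P.b := by
        rw [dval_succ', i2, mul_comm]
        congr 2
        · congr 1
          funext j
          congr 1
          omega
      rw [hs] at hlt
      apply Runs.of_le
      · apply Runs.call_seq (dbl_spec (n := P.b) hw0 (by decide) (by decide) i3 (by omega))
        intro s2 f2 h2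
        have d1 : s2.reg 65 = P.h - i := by rw [f2.reg _ (by decide +kernel), i1]
        have d2 : s2.reg 64 = P.h - i := by rw [f2.reg _ (by decide +kernel), hk]
        have d3 : s2.reg rb = P.b := by rw [f2.reg _ (by decide +kernel), i3]
        have d4 : s2.arr a = s.arr a := by
          rw [f2.arr _ (by simp [dbl, forN, warrs, RAM.block, Instr.warrs]), i4]
        apply Runs.block
        · simp [d1, d4, h2, hw0.ne']
          omega
        · simp [d1, d2, d3, d4, h2, hs]
          exact ⟨by omega, add_comm _ _⟩
      · simp
    · intro s1 _ _ ⟨_, i2, _, _⟩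
      simpa using i2
  · have : P.h * (P.b * 6 + 16 + 4) = P.h * (P.b * 6 + 20) := by ring
    simp; omega

/-- Reduce the number in register `x`, which is less than `2 * F`, modulo the number `F` in
register `85`. -/
def canon (x : ℕ) : Prog := block [.sub 0 85 x] ;; .ite 0 .skip (block [.sub x x 85])

theorem canon_spec {s : State} {x v F : ℕ} (hx : x ≠ 0) (hF : s.reg 85 = F) (hv : s.reg x = v)
    (hvF : v < 2 * F) : Runs w (canon x) 10 s fun s' => s'.reg x = v % F := by
  apply Runs.of_le
  · apply Runs.block_seq
    · simp
    apply Runs.ite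
    · intro h
      simp [hF, hv] at h
      apply Runs.skip
      simp [hv, hx]
      rw [Nat.mod_eq_of_lt (by omega)]
    · intro h
      simp [hF, hv] at h
      apply Runs.block
      · simp
      · simp [hF, hv, hx]
        rw [Nat.mod_eq_sub_mod (by omega), Nat.mod_eq_of_lt (by omega)]
  · simp

/-- Replace the number in register `88`, which is odd, by its greatest common divisor with the
number in register `87`; register `98` bounds the number of iterations. -/
def bgcd : Prog :=
  forN 64 98 (.ite 87 (
    block [.half 83 87, .add 0 83 83, .sub 0 87 0] ;;
    .ite 0 (block [.sub 0 88 87] ;;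
        .ite 0 (block [.copy 83 87, .sub 87 88 87, .half 87 87, .copy 88 83])
          (block [.sub 87 87 88, .half 87 87]))
      (block [.copy 87 83])) .skip)

theorem gcd_half_left {u v : ℕ} (hu : u % 2 = 0) (hv : v % 2 = 1) :
    Nat.gcd (u / 2) v = Nat.gcd u v := by
  obtain ⟨c, rfl⟩ := Nat.dvd_of_mod_eq_zero hu
  rw [Nat.mul_div_cancel_left _ (by norm_num)]
  exact (Nat.Coprime.gcd_mul_left_cancel c (Nat.coprime_two_left.2 (Nat.odd_iff.2 hv))).symm

/-- The binary algorithm: in each step the product of the two numbers is at least halved. -/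
theorem bgcd_spec {s : State} {u v n : ℕ} (hw : 0 < w) (hu : s.reg 87 = u) (hv : s.reg 88 = v)
    (hn : s.reg 98 = n) (hv1 : v % 2 = 1) (huv : u * v < 2 ^ n) :
    Runs w bgcd (n * 30 + 10) s fun s' => s'.reg 88 = Nat.gcd u v := by
  apply Runs.of_le
  · apply Runs.forN (N := 20) (n := n) (fun i s' => Nat.gcd (s'.reg 87) (s'.reg 88) = Nat.gcd u v ∧
        s'.reg 88 % 2 = 1 ∧ s'.reg 87 * s'.reg 88 * 2 ^ i ≤ u * v) hn (by decide) hw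
    · simp [hu, hv, hv1]
    · intro i s1 hi hk f1 ⟨i1, i2, i3⟩
      apply Runs.of_small
      intro hs
      have hsm := hs.1 87
      have h2 : ∀ x y : ℕ, 2 * x ≤ y → y * 2 ^ i ≤ u * v → x * 2 ^ (i + 1) ≤ u * v := by
        intro x y h1 h2
        rw [pow_succ', ← mul_assoc, mul_comm x 2]
        exact (Nat.mul_le_mul_right _ h1).trans h2
      apply Runs.of_le
      · apply Runs.ite
        · intro h0
          apply Runs.block_seq
          · simp; omega
          apply Runs.ite
          · intro h
            simp at h
            have hodd : s1.reg 87 % 2 = 1 := by omega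
            apply Runs.block_seq
            · simp
            apply Runs.ite
            · intro h'
              simp at h'
              apply Runs.block
              · simp
              · simp [hk, hodd]
                refine ⟨?_, h2 _ _ ?_ i3⟩
                · rw [gcd_half_left (by omega) hodd, ← i1,
                    Nat.gcd_sub_self_left (by omega), Nat.gcd_comm]
                · rw [mul_comm (s1.reg 87), ← mul_assoc]
                  exact Nat.mul_le_mul_right _ (by omega)
            · intro h'
              simp at h'
              apply Runs.block
              · simp
              · simp [hk, i2]
                refine ⟨?_, h2 _ _ ?_ i3⟩
                · rw [gcd_half_left (by omega) i2, ← i1, Nat.gcd_sub_self_left (by omega)]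
                · rw [← mul_assoc]
                  exact Nat.mul_le_mul_right _ (by omega)
          · intro h
            simp at h
            apply Runs.block
            · simp
            · simp [hk, i2]
              refine ⟨?_, h2 _ _ ?_ i3⟩
              · rw [gcd_half_left (by omega) i2, i1]
              · rw [← mul_assoc]
                exact Nat.mul_le_mul_right _ (by omega)
        · intro h0
          apply Runs.skip
          simp [hk, i2, h0] at i1 ⊢
          exact i1
      · simp
    · intro s1 f1 hz ⟨i1, i2, i3⟩
      have h0 : s1.reg 87 = 0 := by
        by_contra h
        have h1 : 0 < s1.reg 87 * s1.reg 88 := Nat.mul_pos (by omega) (by omega)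
        have h2 : 2 ^ n ≤ s1.reg 87 * s1.reg 88 * 2 ^ n := Nat.le_mul_of_pos_left _ h1
        omega
      rw [h0, Nat.gcd_zero_left] at i1
      exact i1
  · omega

/-- Exact division from the lowest bit on: divide the number in register `84` by the odd number in register `88`, of which it is a
multiple, and write the quotient to register `100`; register `98` bounds the number of bits. -/
def exactDiv : Prog :=
  block [.const 100 0, .const 99 1] ;;
  forN 64 98 (block [.half 83 84, .add 0 83 83, .sub 0 84 0] ;;
    .ite 0 (block [.sub 84 84 88, .half 84 84, .add 100 100 99]) (block [.copy 84 83]) ;;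
    block [.add 99 99 99])

theorem exactDiv_spec {s : State} {c g n : ℕ} (hw : n < w) (hg : s.reg 88 = g)
    (hc : s.reg 84 = c * g) (hn : s.reg 98 = n) (hg1 : g % 2 = 1) (hcn : c < 2 ^ n) :
    Runs w exactDiv (n * 30 + 10) s fun s' => s'.reg 100 = c := by
  have hnw : 2 ^ n < 2 ^ w := Nat.pow_lt_pow_right (by norm_num) hw
  apply Runs.of_le
  · apply Runs.block_seq
    · simp; omega
    apply Runs.forN (N := 20) (n := n) (fun i s' => s'.reg 84 = c / 2 ^ i * g ∧
        s'.reg 100 = c % 2 ^ i ∧ s'.reg 99 = 2 ^ i ∧ s'.reg 88 = g) (by simp [hn]) (by decide)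
        (by omega)
    · simp [hc, hg, Nat.mod_one]
    · intro i s1 hi hk f1 ⟨i1, i2, i3, i4⟩
      apply Runs.of_small
      intro hs
      have hsm := hs.1 84
      have hi2 : 2 ^ (i + 1) ≤ 2 ^ n := Nat.pow_le_pow_right (by norm_num) hi
      have hlt : c % 2 ^ i < 2 ^ i := Nat.mod_lt _ (by positivity)
      have hmod : c % 2 ^ (i + 1) = c % 2 ^ i + 2 ^ i * (c / 2 ^ i % 2) := by
        rw [pow_succ, Nat.mod_mul]
      have hdiv : c / 2 ^ (i + 1) = c / 2 ^ i / 2 := by rw [pow_succ, Nat.div_div_eq_div_mul]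
      -- as `g` is odd, the next bit of the quotient is the lowest bit of what is left
      have hpar : c / 2 ^ i * g % 2 = c / 2 ^ i % 2 := by rw [Nat.mul_mod, hg1]; simp
      rw [pow_succ] at hi2
      generalize c / 2 ^ i = t at *
      have hdm := Nat.div_add_mod t 2
      apply Runs.of_le
      · apply Runs.block_seq
        · simp; omega
        apply Runs.call_seq (N₁ := 10) (Q₁ := fun s' => s'.reg 84 = t / 2 * g ∧
          s'.reg 100 = c % 2 ^ (i + 1) ∧ s'.reg 99 = 2 ^ i ∧ s'.reg 88 = g ∧ s'.reg 64 = n - i)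
        · apply Runs.of_le
          · apply Runs.ite
            · intro h
              simp [i1] at h
              have h1 : t % 2 = 1 := by omega
              apply Runs.block
              · simp [i2, i3]; omega
              · simp [i1, i2, i3, i4, hk, hmod, h1]
                rw [← Nat.sub_one_mul, show t - 1 = 2 * (t / 2) by omega, mul_assoc,
                  Nat.mul_div_cancel_left _ (by norm_num)]
            · intro h
              simp [i1] at h
              have h1 : t % 2 = 0 := by omega
              apply Runs.block
              · simp
              · simp [i1, i2, i3, i4, hk, hmod, h1]
                rw [show t * g = 2 * (t / 2 * g) by rw [← mul_assoc]; congr 1; omega,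
                  Nat.mul_div_cancel_left _ (by norm_num)]
          · simp
        intro s2 _ ⟨j1, j2, j3, j4, j5⟩
        apply Runs.block
        · simp [j3]; omega
        · simp [j1, j2, j3, j4, j5, hdiv]
          rw [pow_succ]
          omega
      · simp
    · intro s1 f1 hz ⟨i1, i2, i3, i4⟩
      rw [i2, Nat.mod_eq_of_lt hcn]
  · simp; omega

end RAM

namespace RAM

variable {w : ℕ}

/-! ### The parameters of the arithmetic -/

/-!
The registers from `64` on are used outside the modular multiplication: `70` holds the input `k`,
`71` records whether `5 ^ ((F - 1) / 4)` differs from `1` modulo `F`, and `85` holds `F` while it is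
needed as a single word.
-/

/-- Half the binary logarithm of the number in register `70`, rounded down: the number `b` of bits of
a digit.  Register `72` receives `4 ^ b`. -/
def parB : Prog :=
  block [.const 3 0, .const 72 1] ;;
  forN 64 70 (block [.add 74 72 72, .add 74 74 74, .sub 0 74 70] ;;
    .ite 0 .skip (block [.copy 72 74, .const 0 1, .add 3 3 0]))

theorem parB_spec {s : State} {k : ℕ} (hw : 0 < w) (hk : s.reg 70 = k) (hk1 : 1 ≤ k)
    (hkw : 4 * k < 2 ^ w) :
    Runs w parB (k * 20 + 10) s fun s' =>
      s'.reg 72 = 4 ^ s'.reg 3 ∧ 4 ^ s'.reg 3 ≤ k ∧ k < 4 * 4 ^ s'.reg 3 := by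
  apply Runs.of_le
  · apply Runs.block_seq
    · simp [hw.ne']
    apply Runs.forN (N := 12) (n := k) (fun i s' => s'.reg 70 = k ∧ s'.reg 72 = 4 ^ s'.reg 3 ∧
      4 ^ s'.reg 3 ≤ k ∧ (i = s'.reg 3 ∨ k < 4 * 4 ^ s'.reg 3)) (by simp [hk]) (by decide) hw
    · simp [hk, hk1]
    · intro i s1 hi hc f1 ⟨i1, i2, i3, i4⟩
      have h3 := (Nat.lt_pow_self (n := s1.reg 3) (a := 4) (by norm_num))
      apply Runs.of_le
      · apply Runs.block_seq
        · simp [i2]; omega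
        apply Runs.ite
        · intro h
          simp [i1, i2] at h
          apply Runs.skip
          simp [i1, i2, i3, hc]
          omega
        · intro h
          simp [i1, i2] at h
          apply Runs.block
          · simp [hw.ne']; omega
          · simp [i1, i2, hc, pow_succ]
            omega
      · simp
    · intro s1 f1 hz ⟨i1, i2, i3, i4⟩
      refine ⟨i2, i3, i4.resolve_left fun h => ?_⟩
      have h3 := (Nat.lt_pow_self (n := s1.reg 3) (a := 4) (by norm_num))
      omega
  · simp; omega

/-- The number of digits: the least power of two that makes numbers of `2 k + 8` bits possible. -/
def parH : Prog :=
  block [.const 5 1, .copy 73 3, .const 6 1, .add 66 70 70, .const 0 8, .add 66 66 0] ;;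
  forN 64 70 (block [.sub 0 66 73] ;;
    .ite 0 (block [.add 73 73 73, .add 5 5 5, .const 0 1, .add 6 6 0]) .skip)

theorem parH_spec {s : State} {k b : ℕ} (hw : 3 < w) (hk : s.reg 70 = k) (hb : s.reg 3 = b)
    (hk1 : 6 ≤ k) (hb1 : 1 ≤ b) (hbk : b < 2 * (2 * k + 8)) (hkw : 4 * (2 * k + 8) < 2 ^ w) :
    Runs w parH (k * 20 + 10) s fun s' => ∃ h, s'.reg 5 = h ∧ s'.reg 73 = b * h ∧
      2 * h = 2 ^ s'.reg 6 ∧ s'.reg 66 = 2 * k + 8 ∧ 1 ≤ s'.reg 6 ∧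
      2 * k + 8 ≤ b * h ∧ b * h < 2 * (2 * k + 8) := by
  have hw8 : 2 ^ 3 < 2 ^ w := Nat.pow_lt_pow_right (by norm_num) hw
  apply Runs.of_le
  · apply Runs.block_seq
    · simp [hk]; omega
    apply Runs.forN (N := 10) (n := k) (fun i s' => s'.reg 66 = 2 * k + 8 ∧
      s'.reg 73 = b * s'.reg 5 ∧ 2 * s'.reg 5 = 2 ^ s'.reg 6 ∧ 1 ≤ s'.reg 6 ∧
      b * s'.reg 5 < 2 * (2 * k + 8) ∧ (2 ^ i ≤ s'.reg 5 ∨ 2 * k + 8 ≤ b * s'.reg 5))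
      (by simp [hk]) (by decide) (by omega)
    · simp [hk, hb]
      omega
    · intro i s1 hi hc f1 ⟨i1, i2, i3, i4, i5, i6⟩
      have h6 := (Nat.lt_pow_self (n := s1.reg 6) (a := 2) (by norm_num))
      have h5 : s1.reg 5 ≤ b * s1.reg 5 := Nat.le_mul_of_pos_left _ hb1
      apply Runs.of_le
      · apply Runs.block_seq
        · simp
        apply Runs.ite
        · intro h
          simp [i1, i2] at h
          apply Runs.block
          · simp [i2]; omega
          · simp [i1, i2, hc]
            refine ⟨by ring, ?_, ?_, ?_⟩
            · rw [pow_succ, ← i3]; ring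
            · rw [mul_add]; omega
            · rw [pow_succ]; omega
        · intro h
          simp [i1, i2] at h
          apply Runs.skip
          simp [i1, i2, i3, i4, i5, hc]
          omega
      · simp
    · intro s1 f1 hz ⟨i1, i2, i3, i4, i5, i6⟩
      refine ⟨_, rfl, i2, i3, i1, i4, i6.elim (fun h => ?_) id, i5⟩
      have h5 : s1.reg 5 ≤ b * s1.reg 5 := Nat.le_mul_of_pos_left _ hb1
      have h6 : 2 * k + 8 ≤ 2 ^ k := by
        clear * - hk1
        induction k, hk1 using Nat.le_induction with
        | base => norm_num
        | succ k _ ih => rw [pow_succ]; omega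
      omega
  · simp; omega

/-- The length `2 ^ q` of the transforms and the number of levels. -/
def parL : Prog :=
  block [.add 4 5 5, .copy 76 6, .const 7 0] ;;
  forN 64 6 (block [.const 0 1, .sub 0 76 0] ;;
    .ite 0 (block [.half 77 76, .sub 76 76 77, .const 0 1, .add 7 7 0]) .skip)

theorem parL_spec {s : State} {h q : ℕ} (hw : 0 < w) (hh : s.reg 5 = h) (hq : s.reg 6 = q)
    (hhq : 2 * h = 2 ^ q) (hq1 : 1 ≤ q) (hqw : 2 ^ q < 2 ^ w) :
    Runs w parL (q * 20 + 10) s fun s' => s'.reg 4 = 2 ^ q ∧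
      lv q (s'.reg 7) = 1 ∧ ∀ i < s'.reg 7, 2 ≤ lv q i := by
  have hlt := (Nat.lt_pow_self (n := q) (a := 2) (by norm_num))
  apply Runs.of_le
  · apply Runs.block_seq
    · simp [hh, hw.ne']; omega
    apply Runs.forN (N := 10) (n := q) (fun i s' => s'.reg 4 = 2 ^ q ∧
      s'.reg 76 = lv q (s'.reg 7) ∧ 1 ≤ lv q (s'.reg 7) ∧ (∀ i < s'.reg 7, 2 ≤ lv q i) ∧
      s'.reg 7 ≤ i ∧ (s'.reg 7 = i ∨ lv q (s'.reg 7) = 1))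
      (by simp [hq]) (by decide) (by omega)
    · simp [hh, hq, lv, hq1]
      omega
    · intro i s1 hi hc f1 ⟨i1, i2, i3, i4, i5, i6⟩
      apply Runs.of_le
      · apply Runs.block_seq
        · simp [hw.ne']
        apply Runs.ite
        · intro h'
          simp [i1, i2] at h'
          apply Runs.block
          · simp [hw.ne']; omega
          · simp [i1, i2, hc, lv]
            refine ⟨by omega, ?_, by omega, by omega⟩
            intro j hj
            rcases Nat.lt_or_eq_of_le hj with h | rfl
            · exact i4 j h
            · omega
        · intro h'
          simp [i1, i2] at h'
          apply Runs.skip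
          simp [i1, i2, i3, hc]
          exact ⟨i4, by omega, by omega⟩
      · simp
    · intro s1 f1 hz ⟨i1, i2, i3, i4, i5, i6⟩
      refine ⟨i1, i6.elim (fun h => ?_) id, i4⟩
      have hb := lv_bound q (s1.reg 7)
      rw [h] at hb i3 ⊢
      by_contra hne
      have : 2 ^ q * 1 ≤ 2 ^ q * (lv q q - 1) := Nat.mul_le_mul_left _ (by omega)
      omega
  · simp; omega

/-- The modulus `4 ^ b * 2 ^ q + 1` of the digit products: it is odd and exceeds the coefficients of
a product. -/
def parM : Prog := block [.copy 2 72] ;; dbl 2 6 ;; block [.const 0 1, .add 2 2 0]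

theorem parM_spec {s : State} {B q : ℕ} (hw : 0 < w) (hB : s.reg 72 = B) (hq : s.reg 6 = q)
    (hw' : B * 2 ^ q + 1 < 2 ^ w) :
    Runs w parM (q * 6 + 20) s fun s' => s'.reg 2 = B * 2 ^ q + 1 := by
  apply Runs.of_le
  · apply Runs.block_seq
    · simp
    apply Runs.call_seq (dbl_spec (n := q) hw (by decide) (by decide) (by simp [hq])
      (by simp [hB]; omega))
    intro s1 f1 h1
    apply Runs.block
    · simp [h1, hB, hw.ne']; omega
    · simp [h1, hB]
  · simp; omega

/-! ### The number `F k` and its inverse -/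

/-- Compute `F k`, following the powers of `α` by their coordinates, each of which is the difference
of two registers. -/
def parF : Prog :=
  block [.const 78 1, .const 79 0, .const 80 0, .const 81 0, .const 82 1] ;;
  forN 64 70 (block [.add 83 78 80, .add 84 79 81, .add 78 81 81, .add 78 78 78, .add 79 80 80,
    .add 79 79 79, .copy 80 83, .copy 81 84, .add 82 82 82, .add 82 82 82]) ;;
  block [.add 82 82 82, .add 82 82 82, .add 82 82 82, .add 82 82 82,
    .add 79 79 79, .add 79 79 81, .add 79 79 79, .add 79 79 79,
    .add 78 78 78, .add 78 78 80, .add 78 78 78, .add 78 78 78,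
    .const 0 1, .add 82 82 0, .add 82 82 79, .sub 85 82 78]

theorem parF_spec {s : State} {k : ℕ} (hw : 2 * k + 10 < w) (hk : s.reg 70 = k) :
    Runs w parF (k * 20 + 30) s fun s' => s'.reg 85 = FkTest.F k := by
  have hw0 : 0 < w := by omega
  have hkw : 64 * 4 ^ k < 2 ^ w := by
    calc 64 * 4 ^ k = 2 ^ (2 * k + 6) := by rw [pow_add, pow_mul]; ring
      _ < 2 ^ w := Nat.pow_lt_pow_right (by norm_num) (by omega)
  apply Runs.of_le
  · apply Runs.block_seq
    · simp [hw0.ne']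
    apply Runs.call_seq
    -- the bounds `2 * 4 ^ i` and `4 ^ i` keep the coordinates within words of `O(k)` bits
    · apply Runs.forN (N := 11) (n := k) (fun i s' =>
        (s'.reg 78 : ℤ) - s'.reg 79 = (FkTest.co i).1 ∧
        (s'.reg 80 : ℤ) - s'.reg 81 = (FkTest.co i).2 ∧
        s'.reg 78 + s'.reg 79 ≤ 2 * 4 ^ i ∧ s'.reg 80 + s'.reg 81 ≤ 4 ^ i ∧ s'.reg 82 = 4 ^ i)
        (by simp [hk]) (by decide) hw0
      · simp [FkTest.co]
      · intro i s1 hi hc f1 ⟨i1, i2, i3, i4, i5⟩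
        have hi4 : 4 ^ (i + 1) ≤ 4 ^ k := Nat.pow_le_pow_right (by norm_num) hi
        rw [pow_succ] at hi4
        apply Runs.block
        · simp [i5]; omega
        · simp only [FkTest.co, pow_succ]
          simp [hc, i5]
          omega
      · exact fun s' f hz h => h
    intro s1 f1 ⟨i1, i2, i3, i4, i5⟩
    have hp := Nat.one_le_pow k 4 (by norm_num)
    apply Runs.block
    · simp [i5, hw0.ne']; omega
    · have hF := FkTest.F_cast k
      have h4 : ((4 ^ k : ℕ) : ℤ) = 4 ^ k := by push_cast; rfl
      rw [FkTest.tr, ← i1, ← i2, ← h4] at hF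
      simp [i5]
      omega
  · simp; omega

/-- Compute in register `87` the negative of the inverse of `F` modulo the power of two whose
exponent is in register `73`, bit by bit: after `i` steps, the number `f` found satisfies
`F * f + 1 = t * 2 ^ i`, with `t` in register `86`, and the next bit has to make `t` even. -/
def parInv : Prog :=
  block [.const 86 1, .const 87 0, .const 88 1] ;;
  forN 64 73 (block [.half 83 86, .add 0 83 83, .sub 0 86 0] ;;
    .ite 0 (block [.add 87 87 88, .add 86 86 85, .half 86 86]) (block [.copy 86 83]) ;;
    block [.add 88 88 88])

theorem parInv_spec {s : State} {F n : ℕ} (hF : s.reg 85 = F) (hn : s.reg 73 = n)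
    (hF1 : F % 2 = 1) (hFw : 2 * F < 2 ^ w) (hnw : n < w) :
    Runs w parInv (n * 30 + 10) s fun s' => s'.reg 87 < 2 ^ n ∧
      2 ^ n ∣ F * s'.reg 87 + 1 := by
  have hnw' : 2 ^ n < 2 ^ w := Nat.pow_lt_pow_right (by norm_num) hnw
  have hw0 : 0 < w := by omega
  apply Runs.of_le
  · apply Runs.block_seq
    · simp [hw0.ne']
    apply Runs.forN (N := 20) (n := n) (fun i s' => s'.reg 85 = F ∧
        F * s'.reg 87 + 1 = s'.reg 86 * 2 ^ i ∧ s'.reg 87 < 2 ^ i ∧ s'.reg 86 ≤ F ∧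
        s'.reg 88 = 2 ^ i) (by simp [hn]) (by decide) hw0
    · simp [hF]; omega
    · intro i s1 hi hk f1 ⟨i1, i2, i3, i4, i5⟩
      have hi2 : 2 ^ (i + 1) ≤ 2 ^ n := Nat.pow_le_pow_right (by norm_num) hi
      have hpow : 2 ^ (i + 1) = 2 ^ i + 2 ^ i := by rw [pow_succ]; ring
      apply Runs.of_le
      · apply Runs.block_seq
        · simp; omega
        apply Runs.call_seq (N₁ := 10) (Q₁ := fun s' => s'.reg 85 = F ∧
          F * s'.reg 87 + 1 = s'.reg 86 * 2 ^ (i + 1) ∧ s'.reg 87 < 2 ^ (i + 1) ∧ s'.reg 86 ≤ F ∧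
          s'.reg 88 = 2 ^ i ∧ s'.reg 64 = n - i)
        · apply Runs.of_le
          · apply Runs.ite
            · intro h
              simp at h
              have h1 : s1.reg 86 % 2 = 1 := by omega
              apply Runs.block
              · simp [i1, i5]; omega
              · simp [i1, i5, hk]
                refine ⟨?_, by omega, by omega⟩
                obtain ⟨c, hc⟩ : ∃ c, s1.reg 86 + F = 2 * c := ⟨(s1.reg 86 + F) / 2, by omega⟩
                rw [hc, Nat.mul_div_cancel_left _ (by norm_num), pow_succ,
                  show F * (s1.reg 87 + 2 ^ i) + 1 = F * s1.reg 87 + 1 + F * 2 ^ i by ring, i2,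
                  ← add_mul, hc]
                ring
            · intro h
              simp at h
              apply Runs.block
              · simp
              · simp [i1, i5, hk]
                refine ⟨?_, by omega, by omega⟩
                obtain ⟨c, hc⟩ : ∃ c, s1.reg 86 = 2 * c := ⟨s1.reg 86 / 2, by omega⟩
                rw [i2, hc, Nat.mul_div_cancel_left _ (by norm_num), pow_succ]
                ring
          · simp
        intro s2 _ ⟨j1, j2, j3, j4, j5, j6⟩
        apply Runs.block
        · simp [j5]; omega
        · simp [j1, j2, j3, j4, j5, j6]
          omega
      · simp
    · intro s1 f1 hz ⟨i1, i2, i3, i4, i5⟩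
      exact ⟨i3, i2 ▸ Dvd.intro_left _ rfl⟩
  · simp; omega

/-- Compute in register `89` the residue modulo `F` of the power of two whose exponent is in
register `73`, and in register `90` its negative. -/
def parR : Prog :=
  block [.const 89 1] ;;
  forN 64 73 (block [.add 89 89 89, .add 0 89 89, .sub 83 89 85, .sub 0 85 89] ;;
    .ite 0 .skip (block [.copy 89 83])) ;;
  block [.sub 90 85 89]

theorem parR_spec {s : State} {F n : ℕ} (hw : 0 < w) (hF : s.reg 85 = F) (hn : s.reg 73 = n)
    (hF1 : 1 < F) (hFw : 4 * F < 2 ^ w) :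
    Runs w parR (n * 20 + 10) s fun s' => s'.reg 89 = 2 ^ n % F ∧ s'.reg 90 = F - 2 ^ n % F := by
  apply Runs.of_le
  · apply Runs.block_seq
    · simp [hw.ne']
    apply Runs.call_seq
    · apply Runs.forN (N := 12) (n := n) (fun i s' => s'.reg 85 = F ∧ s'.reg 89 = 2 ^ i % F)
        (by simp [hn]) (by decide) hw
      · simp [hF, Nat.mod_eq_of_lt hF1]
      · intro i s1 hi hk f1 ⟨i1, i2⟩
        have hlt := Nat.mod_lt (2 ^ i) (show 0 < F by omega)
        have hpow : 2 ^ (i + 1) % F = (2 ^ i % F + 2 ^ i % F) % F := by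
          rw [← Nat.add_mod, pow_succ]; congr 1; ring
        apply Runs.of_le
        · apply Runs.block_seq
          · simp [i2]; omega
          apply Runs.ite
          · intro h
            simp [i1, i2] at h
            apply Runs.skip
            simp [i1, i2, hk]
            exact (hpow.trans (Nat.mod_eq_of_lt (by omega))).symm
          · intro h
            simp [i1, i2] at h
            apply Runs.block
            · simp
            · simp [i1, i2, hk]
              exact (hpow.trans ((Nat.mod_eq_sub_mod (by omega)).trans
                (Nat.mod_eq_of_lt (by omega)))).symm
        · simp
      · exact fun s' f hz h => h
    intro s1 f1 ⟨i1, i2⟩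
    apply Runs.block
    · simp
    · simp [i1, i2]
  · simp; omega

/-- Write the binary digits of `(F - 5) / 8` to array `16`. -/
def parE : Prog :=
  block [.const 0 5, .sub 91 85 0, .half 91 91, .half 91 91, .half 91 91, .const 65 0] ;;
  forN 64 66 (block [.half 83 91, .add 0 83 83, .sub 0 91 0, .store 16 65 0, .copy 91 83,
    .const 0 1, .add 65 65 0])

theorem parE_spec {s : State} {F n : ℕ} (hw : 2 < w) (hF : s.reg 85 = F) (hn : s.reg 66 = n) :
    Runs w parE (n * 12 + 20) s fun s' =>
      ∀ i, s'.arr 16 i = if i < n then (F - 5) / 8 / 2 ^ i % 2 else s.arr 16 i := by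
  have hw8 : 2 ^ 3 ≤ 2 ^ w := Nat.pow_le_pow_right (by norm_num) hw
  apply Runs.of_small
  intro hs
  have hnw : n < 2 ^ w := hn ▸ hs.1 66
  apply Runs.of_le
  · apply Runs.block_seq
    · simp; omega
    apply Runs.forN (N := 8) (n := n) (fun i s' => s'.reg 65 = i ∧
      s'.reg 91 = (F - 5) / 8 / 2 ^ i ∧
      ∀ j, s'.arr 16 j = if j < i then (F - 5) / 8 / 2 ^ j % 2 else s.arr 16 j)
      (by simp [hn]) (by decide) (by omega)
    · simp [hF, Nat.div_div_eq_div_mul]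
    · intro i s1 hi hk f1 ⟨i1, i2, i3⟩
      apply Runs.of_small
      intro hs1
      have hs91 := hs1.1 91
      apply Runs.block
      · simp [i1]; omega
      · simp [i1, i2, hk]
        refine ⟨by rw [Nat.div_div_eq_div_mul _ (2 ^ i), pow_succ], fun j => ?_⟩
        rw [i3]
        split_ifs with c1 c2 c3 <;> first | rfl | omega | (rw [c1]; omega)
    · exact fun s1 f1 hz ⟨i1, i2, i3⟩ => i3
  · simp; omega

end RAM

namespace RAM

variable {w : ℕ}

/-! ### Preparation -/

/-- The parameters for the exponent `k`: words have `O(log k)` bits, digits have about half as many bits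
as `k`, and the number of digits is the power of two for which the number of all bits is between
`2 k + 8` and twice that. -/
structure Par.For (P : Par) (k : ℕ) : Prop where
  hw : P.w = 2 * k.size + 20
  hF : P.F = FkTest.F k
  hbk : 4 ^ P.b ≤ k
  hkb : k < 4 * 4 ^ P.b
  hD : 2 * P.h = 2 ^ P.q
  hbh : 2 * k + 8 ≤ P.b * P.h
  hbh' : P.b * P.h < 2 * (2 * k + 8)
  hM : P.M = 4 ^ P.b * 2 ^ P.q + 1
  hlv1 : lv P.q P.L = 1
  hlv : ∀ i < P.L, 2 ≤ lv P.q i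
  hF' : P.F' < P.R
  hinv : P.R ∣ P.F * P.F' + 1

theorem Par.For.one_le_b {P : Par} {k : ℕ} (H : P.For k) (hk : 9 ≤ k) : 1 ≤ P.b := by
  have := H.hkb
  rcases Nat.eq_zero_or_pos P.b with h | h
  · rw [h] at this; omega
  · exact h

theorem Par.For.R_eq {P : Par} : P.R = 2 ^ (P.b * P.h) := by rw [Par.R, pow_mul]

theorem Par.For.two_pow_le {P : Par} {k : ℕ} (H : P.For k) (hk : 9 ≤ k) : 2 ^ P.q ≤ 12 * k := by
  have h1 : P.h ≤ P.b * P.h := Nat.le_mul_of_pos_left _ (H.one_le_b hk)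
  have := H.hD
  have := H.hbh'
  omega

theorem Par.For.one_le_q {P : Par} {k : ℕ} (H : P.For k) : 1 ≤ P.q := by
  by_contra h
  have h0 : P.q = 0 := by omega
  have := H.hD
  rw [h0] at this
  omega

/-- Words are long enough for all numbers of the size of a constant times `k ^ 2`. -/
theorem Par.For.lt_pow {P : Par} {k : ℕ} (H : P.For k) : 2 ^ 20 * (k * k) < 2 ^ P.w := by
  have h := Nat.lt_size_self k
  rw [H.hw, pow_add, two_mul, pow_add, mul_comm]
  have := Nat.mul_lt_mul'' h h
  omega

theorem Par.For.M_le {P : Par} {k : ℕ} (H : P.For k) (hk : 9 ≤ k) : P.M ≤ 13 * (k * k) := by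
  have h2 : 4 ^ P.b * 2 ^ P.q ≤ k * (12 * k) := Nat.mul_le_mul H.hbk (H.two_pow_le hk)
  have h3 : 9 * 9 ≤ k * k := Nat.mul_le_mul hk hk
  rw [H.hM]
  nlinarith

theorem Par.For.ok {P : Par} {k : ℕ} (H : P.For k) (hk : 9 ≤ k) : P.OK := by
  have h1 := H.lt_pow
  have h2 := H.M_le hk
  have h3 := H.two_pow_le hk
  have hq : P.q < 2 ^ P.q := Nat.lt_pow_self (by norm_num)
  have h4 : 4 ^ P.b = 2 ^ P.b * 2 ^ P.b := by rw [← mul_pow]; norm_num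
  have hk2 : k ≤ k * k := Nat.le_mul_self k
  have hF := FkTest.F_lt k
  have hF1 := FkTest.F_gt (k := k) (by omega)
  have h5 : 0 < 2 ^ P.q := by positivity
  have h6 : 0 < 4 ^ P.b := by positivity
  refine ⟨⟨?_, ?_, by omega, H.one_le_q, H.hlv1, H.hlv, ?_⟩, H.hD, H.one_le_b hk, ?_, by omega,
    ?_, ?_, H.hF', H.hinv⟩
  · have : 2 ∣ 4 ^ P.b * 2 ^ P.q :=
      Dvd.dvd.mul_left (dvd_pow_self 2 (by have := H.one_le_q; omega)) _
    rw [H.hM]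
    omega
  · rw [H.hM]
    have := Nat.mul_pos h6 h5
    omega
  · have : P.q * 2 ^ P.q ≤ (12 * k) * (12 * k) := Nat.mul_le_mul (by omega) h3
    have : (12 * k) * (12 * k) = 144 * (k * k) := by ring
    omega
  · rw [H.hM, h4, ← H.hD]
    apply Nat.lt_succ_of_le
    apply le_of_eq
    ring
  · rw [H.hF]
    have := Nat.one_le_two_pow (n := 2 * k)
    omega
  · rw [H.hF, Par.For.R_eq]
    calc 8 * FkTest.F k ≤ 8 * 2 ^ (2 * k + 5) := by omega
      _ = 2 ^ (2 * k + 8) := by rw [show 2 * k + 8 = 2 * k + 5 + 3 by rfl, pow_add _ _ 3]; ring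
      _ ≤ 2 ^ (P.b * P.h) := Nat.pow_le_pow_right (by norm_num) H.hbh

/-- Compute the parameters, `F` and the constants depending on it.  The numbers are handled as single
words of `O(k)` bits here, in `O(k)` steps. -/
def prepA : Prog :=
  block [.copy 70 0] ;; parB ;; parH ;; parL ;; parM ;; parF ;; parInv ;; parR

theorem prepA_spec {k : ℕ} (hk : 9 ≤ k) (hw : 4 * k + 60 ≤ w) :
    Runs w prepA (1000 * k) (init k) fun s' => ∃ P : Par, P.For k ∧ s'.reg 2 = P.M ∧
      s'.reg 3 = P.b ∧ s'.reg 4 = 2 ^ P.q ∧ s'.reg 5 = P.h ∧ s'.reg 6 = P.q ∧ s'.reg 7 = P.L ∧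
      s'.reg 70 = k ∧ s'.reg 66 = 2 * k + 8 ∧ s'.reg 85 = P.F ∧ s'.reg 87 = P.F' ∧
      s'.reg 89 = P.R % P.F ∧ s'.reg 90 = P.F - P.R % P.F := by
  have hkw : k < 2 ^ k := Nat.lt_two_pow_self
  have hkw2 : 2 ^ (4 * k) = 2 ^ k * 2 ^ k * 2 ^ k * 2 ^ k := by
    rw [← pow_add, ← pow_add, ← pow_add]; congr 1; omega
  have hww : 2 ^ (4 * k) * 2 ^ 60 ≤ 2 ^ w := by
    rw [← pow_add]; exact Nat.pow_le_pow_right (by norm_num) hw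
  have hkk : 2 ^ 60 * (k * k) ≤ 2 ^ w := by
    refine le_trans ?_ hww
    rw [hkw2, mul_comm]
    refine Nat.mul_le_mul_right _ ?_
    calc k * k ≤ 2 ^ k * 2 ^ k := Nat.mul_le_mul hkw.le hkw.le
      _ ≤ 2 ^ k * 2 ^ k * (2 ^ k * 2 ^ k) := Nat.le_mul_of_pos_right _ (by positivity)
      _ = _ := by ring
  have hk2 : k ≤ k * k := Nat.le_mul_self k
  have hF := FkTest.F_lt k
  have hF1 := FkTest.F_gt (k := k) (by omega)
  have hFm := FkTest.F_mod (k := k) (by omega)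
  have hFw : 4 * FkTest.F k < 2 ^ w := by
    calc 4 * FkTest.F k < 4 * 2 ^ (2 * k + 5) := by omega
      _ = 2 ^ (2 * k + 7) := by rw [show 2 * k + 7 = 2 * k + 5 + 2 by rfl, pow_add _ _ 2]; ring
      _ ≤ 2 ^ w := Nat.pow_le_pow_right (by norm_num) (by omega)
  have hF2 : 1 < FkTest.F k := by
    have := Nat.one_le_two_pow (n := 2 * k)
    omega
  clear hF hww hkw2 hF1
  have hw0 : 0 < w := by omega
  apply Runs.of_le (N := 1 + 1 + ((k * 20 + 10) + ((k * 20 + 10) + ((12 * k * 20 + 10) +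
    ((12 * k * 6 + 20) + ((k * 20 + 30) + ((2 * (2 * k + 8) * 30 + 10) +
    (2 * (2 * k + 8) * 20 + 10))))))))
  · apply Runs.block_seq
    · simp
    apply Runs.call_seq (parB_spec (k := k) hw0 (by simp [init]) (by omega) (by omega))
    intro s1 f1 ⟨b1, b2, b3⟩
    have a70 : s1.reg 70 = k := by rw [f1.reg _ (by decide +kernel)]; simp [init]
    generalize hb : s1.reg 3 = b at *
    have hb1 : 1 ≤ b := by
      rcases Nat.eq_zero_or_pos b with h | h
      · rw [h] at b3; omega
      · exact h
    have hb4 : b < 4 ^ b := Nat.lt_pow_self (by norm_num)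
    apply Runs.call_seq (parH_spec (by omega) a70 hb (by omega) hb1 (by omega) (by omega))
    intro s2 f2 ⟨h, h1, h2, h3, h4, h5, h6, h7⟩
    have b70 : s2.reg 70 = k := by rw [f2.reg _ (by decide +kernel), a70]
    have b72 : s2.reg 72 = 4 ^ b := by rw [f2.reg _ (by decide +kernel), b1]
    have b03 : s2.reg 3 = b := by rw [f2.reg _ (by decide +kernel), hb]
    generalize hq : s2.reg 6 = q at *
    have hbh : h ≤ b * h := Nat.le_mul_of_pos_left _ hb1
    have hqq : q < 2 ^ q := Nat.lt_pow_self (by norm_num)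
    apply Runs.call_seq (N₁ := 12 * k * 20 + 10) (Runs.of_le (parL_spec hw0 h1 hq h3 h5 (by omega)) (by omega))
    intro s3 f3 ⟨l1, l2, l3⟩
    have c70 : s3.reg 70 = k := by rw [f3.reg _ (by decide +kernel), b70]
    have c72 : s3.reg 72 = 4 ^ b := by rw [f3.reg _ (by decide +kernel), b72]
    have c03 : s3.reg 3 = b := by rw [f3.reg _ (by decide +kernel), b03]
    have c05 : s3.reg 5 = h := by rw [f3.reg _ (by decide +kernel), h1]
    have c06 : s3.reg 6 = q := by rw [f3.reg _ (by decide +kernel), hq]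
    have c73 : s3.reg 73 = b * h := by rw [f3.reg _ (by decide +kernel), h2]
    have c66 : s3.reg 66 = 2 * k + 8 := by rw [f3.reg _ (by decide +kernel), h4]
    have hMw : 4 ^ b * 2 ^ q + 1 < 2 ^ w := by
      have : 4 ^ b * 2 ^ q ≤ k * (12 * k) := Nat.mul_le_mul b2 (by omega)
      have : k * (12 * k) = 12 * (k * k) := by ring
      omega
    apply Runs.call_seq (N₁ := 12 * k * 6 + 20) (Runs.of_le (parM_spec hw0 c72 c06 hMw) (by omega))
    intro s4 f4 m1
    have d70 : s4.reg 70 = k := by rw [f4.reg _ (by decide +kernel), c70]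
    apply Runs.call_seq (parF_spec (by omega) d70)
    intro s5 f5 g1
    have e73 : s5.reg 73 = b * h := by
      rw [f5.reg _ (by decide +kernel), f4.reg _ (by decide +kernel), c73]
    apply Runs.call_seq (N₁ := 2 * (2 * k + 8) * 30 + 10)
      (Runs.of_le (parInv_spec g1 e73 (by omega) (by omega) (by omega)) (by omega))
    intro s6 f6 ⟨i1, i2⟩
    apply Runs.call (N := 2 * (2 * k + 8) * 20 + 10) (Runs.of_le (parR_spec hw0 (F := FkTest.F k) (n := b * h)
      (by rw [f6.reg _ (by decide +kernel), g1]) (by rw [f6.reg _ (by decide +kernel), e73])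
      hF2 hFw) (by omega))
    intro s7 f7 ⟨r1, r2⟩
    have key : ∀ x, x ∉ wregs (parM ;; parF ;; parInv ;; parR) → s7.reg x = s3.reg x := by
      intro x hx
      simp only [wregs, List.mem_append, not_or] at hx
      rw [f7.reg _ hx.2.2.2, f6.reg _ hx.2.2.1, f5.reg _ hx.2.1, f4.reg _ hx.1]
    refine ⟨⟨2 * k.size + 20, 4 ^ b * 2 ^ q + 1, q, s3.reg 7, b, h, FkTest.F k, s6.reg 87⟩,
      ⟨rfl, rfl, b2, b3, h3, h6, h7, rfl, l2, l3, ?_, ?_⟩, ?_, ?_, ?_, ?_, ?_, ?_, ?_, ?_, ?_, ?_,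
      ?_, ?_⟩
    · rw [Par.For.R_eq]; exact i1
    · rw [Par.For.R_eq]; exact i2
    · rw [f7.reg _ (by decide +kernel), f6.reg _ (by decide +kernel),
        f5.reg _ (by decide +kernel), m1]
    · rw [key _ (by decide +kernel), c03]
    · rw [key _ (by decide +kernel), l1]
    · rw [key _ (by decide +kernel), c05]
    · rw [key _ (by decide +kernel), c06]
    · rw [key _ (by decide +kernel)]
    · rw [key _ (by decide +kernel), c70]
    · rw [key _ (by decide +kernel), c66]
    · rw [f7.reg _ (by decide +kernel), f6.reg _ (by decide +kernel), g1]
    · rw [f7.reg _ (by decide +kernel)]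
    · rw [r1, Par.For.R_eq]
    · rw [r2, Par.For.R_eq]
  · omega

/-- The registers that keep their values between the parts of the program.  The other registers, which
may contain long words, are cleared, so that the modular multiplications run with short words. -/
def kept : List ℕ := [2, 3, 4, 5, 6, 7, 70, 71]

/-- Make all registers zero but those to be kept. -/
def clear : Prog := block (((List.range 112).filter (· ∉ kept)).map (Instr.const · 0))

theorem runL_zero (l : List ℕ) (s : State) :
    (∀ x, (runL (l.map (Instr.const · 0)) s).reg x = if x ∈ l then 0 else s.reg x) ∧
    (runL (l.map (Instr.const · 0)) s).arr = s.arr ∧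
    (runL (l.map (Instr.const · 0)) s).out = s.out := by
  induction l generalizing s with
  | nil => simp
  | cons y l ih =>
    obtain ⟨h1, h2, h3⟩ := ih (s.set y 0)
    refine ⟨fun x => ?_, h2, h3⟩
    rw [List.map_cons, runL_cons, run_const, h1, State.set_reg]
    by_cases h : x = y <;> by_cases h' : x ∈ l <;> simp [h, h']

theorem fitsL_zero (l : List ℕ) (s : State) : FitsL w (l.map (Instr.const · 0)) s := by
  induction l generalizing s with
  | nil => simp
  | cons y l ih => exact ⟨by simp, ih _⟩

theorem clear_spec (s : State) :
    Runs w clear 120 s fun s' => (∀ x, s'.reg x = if x < 112 ∧ x ∉ kept then 0 else s.reg x) ∧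
      s'.arr = s.arr ∧ s'.out = s.out := by
  apply Runs.of_le
  · apply Runs.block _ (fitsL_zero _ _)
    obtain ⟨h1, h2, h3⟩ := runL_zero ((List.range 112).filter (· ∉ kept)) s
    exact ⟨fun x => by rw [h1]; simp, h2, h3⟩
  · rw [List.length_map]
    exact Nat.succ_le_succ ((List.length_filter_le _ _).trans (by simp))

/-- The contents of the registers between the parts of the program. -/
structure Regs (k : ℕ) (P : Par) (s : State) : Prop where
  hM : s.reg rM = P.M
  hb : s.reg rb = P.b
  hD : s.reg rD = 2 ^ P.q
  hh : s.reg rh = P.h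
  hq : s.reg rq = P.q
  hL : s.reg rL = P.L
  hk : s.reg 70 = k
  hc : s.reg 71 ≤ 1
  h0 : ∀ x, x ∉ kept → s.reg x = 0

theorem Par.For.L_le {P : Par} {k : ℕ} (H : P.For k) : P.L ≤ P.q := by
  by_contra h
  have h1 := lv_bound P.q P.q
  have h2 := H.hlv P.q (by omega)
  have h3 : P.q < 2 ^ P.q := Nat.lt_pow_self (by norm_num)
  have h4 : 2 ^ P.q * 1 ≤ 2 ^ P.q * (lv P.q P.q - 1) := Nat.mul_le_mul_left _ (by omega)
  omega

theorem Regs.small {k : ℕ} {P : Par} {s : State} (R : Regs k P s) (H : P.For k) (hk : 9 ≤ k)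
    (x : ℕ) : s.reg x < 2 ^ P.w := by
  have h1 := H.lt_pow
  have h2 := H.M_le hk
  have h3 := H.two_pow_le hk
  have hq : P.q < 2 ^ P.q := Nat.lt_pow_self (by norm_num)
  have hk2 : k ≤ k * k := Nat.le_mul_self k
  have hL := H.L_le
  have hD := H.hD
  have hb : P.b < 4 ^ P.b := Nat.lt_pow_self (by norm_num)
  have hbk := H.hbk
  by_cases hx : x ∈ kept
  · simp only [kept, List.mem_cons, List.not_mem_nil, or_false] at hx
    rcases hx with rfl | rfl | rfl | rfl | rfl | rfl | rfl | rfl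
    · rw [R.hM]; omega
    · rw [R.hb]; omega
    · rw [R.hD]; omega
    · rw [R.hh]; omega
    · rw [R.hq]; omega
    · rw [R.hL]; omega
    · rw [R.hk]; omega
    · have := R.hc; omega
  · rw [R.h0 x hx]; positivity

end RAM

namespace RAM

variable {w : ℕ}

/-- What the preparation leaves in the arrays.  The arrays `32`, `35` and `34` hold the Montgomery forms
of `1`, `-1` and of the inverse of the base `R`; array `16` holds the binary digits of the
exponent. -/
structure Arrs (k : ℕ) (P : Par) (s : State) : Prop where
  hF : Digs P s aFm P.F
  hF' : Digs P s aFi P.F'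
  h1 : Digs P s 32 (P.R % P.F)
  hn : Digs P s 35 (P.F - P.R % P.F)
  hi : Digs P s 34 1
  he : ∀ i < 2 * k + 8, s.arr 16 i = (P.F - 5) / 8 / 2 ^ i % 2
  h0 : ∀ a, a ∉ [aFm, aFi, 16, 32, 34, 35] → ∀ i, s.arr a i = 0
  lt : ∀ a i, s.arr a i < 2 ^ P.w

/-- Write the numbers needed to the arrays. -/
def prepB : Prog :=
  parE ;; toDigits aFm 85 ;; toDigits aFi 87 ;; toDigits 32 89 ;; toDigits 35 90 ;;
    block [.const 0 0, .const 83 1, .store 34 0 83]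

theorem warrs_toDigits (a x : ℕ) : warrs (toDigits a x) = [a] := by
  simp [toDigits, warrs, forN, RAM.block, Instr.warrs, split, hlv, dbl]

theorem wregs_toDigits (a x : ℕ) : wregs (toDigits a x) = wregs (toDigits 0 0) := by
  simp [toDigits, wregs, forN, RAM.block, Instr.wregs]

theorem prepB_spec {k : ℕ} {P : Par} {s : State} (H : P.For k) (hk : 9 ≤ k) (hPw : P.w ≤ w)
    (hb : s.reg 3 = P.b) (hh : s.reg 5 = P.h) (h66 : s.reg 66 = 2 * k + 8) (h85 : s.reg 85 = P.F)
    (h87 : s.reg 87 = P.F') (h89 : s.reg 89 = P.R % P.F) (h90 : s.reg 90 = P.F - P.R % P.F)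
    (h0 : ∀ a i, s.arr a i = 0) :
    Runs w prepB (1500 * k) s (Arrs k P) := by
  have O := H.ok hk
  have hb1 := H.one_le_b hk
  have hh1 : P.h ≤ P.b * P.h := Nat.le_mul_of_pos_left _ hb1
  have hbh := H.hbh'
  have hbh2 := H.hbh
  have hw1 := H.hw
  have hlt := H.lt_pow
  have hk2 : k ≤ k * k := Nat.le_mul_self k
  have hww : 2 ^ P.w ≤ 2 ^ w := Nat.pow_le_pow_right (by norm_num) hPw
  have hw0 : 0 < w := by omega
  have hF := O.hF
  have hF1 := O.hF1
  have hh0 : 0 < P.h := by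
    rcases Nat.eq_zero_or_pos P.h with h | h
    · rw [h] at hbh2; omega
    · exact h
  have hβ : 1 < 2 ^ P.b := Nat.one_lt_two_pow (by omega)
  have hβ' : 2 ^ P.b < 2 ^ P.w := by
    have h4 : 2 ^ P.b ≤ 4 ^ P.b := Nat.pow_le_pow_left (by norm_num) _
    have := H.hbk
    omega
  have hmod := Nat.mod_lt P.R (show 0 < P.F by omega)
  apply Runs.of_le (N := ((2 * k + 8) * 12 + 20) + ((P.h * (P.b * 12 + 40) + 10) +
    ((P.h * (P.b * 12 + 40) + 10) + ((P.h * (P.b * 12 + 40) + 10) +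
    ((P.h * (P.b * 12 + 40) + 10) + 4)))))
  · apply Runs.call_seq (parE_spec (by omega) h85 h66)
    intro s1 f1 e1
    have key : ∀ x ∈ [85, 87, 89, 90, 3, 5], x ∉ wregs parE ∧ x ∉ wregs (toDigits 0 0) := by
      decide +kernel
    simp only [List.forall_mem_cons] at key
    obtain ⟨k85, k87, k89, k90, k3, k5, -⟩ := key
    apply Runs.call_seq (toDigits_spec hw0 (by rw [f1.reg _ k3.1, hb]) (by rw [f1.reg _ k5.1, hh])
      (by omega) (by rw [f1.reg _ k85.1, h85]))
    intro s2 f2 e2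
    apply Runs.call_seq (toDigits_spec hw0
      (by rw [f2.reg _ (wregs_toDigits _ _ ▸ k3.2), f1.reg _ k3.1, hb])
      (by rw [f2.reg _ (wregs_toDigits _ _ ▸ k5.2), f1.reg _ k5.1, hh])
      (by omega) (by rw [f2.reg _ (wregs_toDigits _ _ ▸ k87.2), f1.reg _ k87.1, h87]))
    intro s3 f3 e3
    apply Runs.call_seq (toDigits_spec hw0
      (by rw [f3.reg _ (wregs_toDigits _ _ ▸ k3.2), f2.reg _ (wregs_toDigits _ _ ▸ k3.2),
            f1.reg _ k3.1, hb])
      (by rw [f3.reg _ (wregs_toDigits _ _ ▸ k5.2), f2.reg _ (wregs_toDigits _ _ ▸ k5.2),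
            f1.reg _ k5.1, hh])
      (by omega) (by rw [f3.reg _ (wregs_toDigits _ _ ▸ k89.2),
            f2.reg _ (wregs_toDigits _ _ ▸ k89.2), f1.reg _ k89.1, h89]))
    intro s4 f4 e4
    apply Runs.call_seq (toDigits_spec hw0
      (by rw [f4.reg _ (wregs_toDigits _ _ ▸ k3.2), f3.reg _ (wregs_toDigits _ _ ▸ k3.2),
            f2.reg _ (wregs_toDigits _ _ ▸ k3.2), f1.reg _ k3.1, hb])
      (by rw [f4.reg _ (wregs_toDigits _ _ ▸ k5.2), f3.reg _ (wregs_toDigits _ _ ▸ k5.2),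
            f2.reg _ (wregs_toDigits _ _ ▸ k5.2), f1.reg _ k5.1, hh])
      (by omega) (by rw [f4.reg _ (wregs_toDigits _ _ ▸ k90.2),
            f3.reg _ (wregs_toDigits _ _ ▸ k90.2), f2.reg _ (wregs_toDigits _ _ ▸ k90.2),
            f1.reg _ k90.1, h90]))
    intro s5 f5 e5
    have w1 : warrs parE = [16] := by decide +kernel
    have g1 : ∀ a, a ≠ 16 → s1.arr a = s.arr a := fun a h => f1.arr _ (by simpa [w1] using h)
    have g2 : ∀ a, a ≠ aFm → s2.arr a = s1.arr a := fun a h =>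
      f2.arr _ (by simpa [warrs_toDigits] using h)
    have g3 : ∀ a, a ≠ aFi → s3.arr a = s2.arr a := fun a h =>
      f3.arr _ (by simpa [warrs_toDigits] using h)
    have g4 : ∀ a, a ≠ 32 → s4.arr a = s3.arr a := fun a h =>
      f4.arr _ (by simpa [warrs_toDigits] using h)
    have g5 : ∀ a, a ≠ 35 → s5.arr a = s4.arr a := fun a h =>
      f5.arr _ (by simpa [warrs_toDigits] using h)
    have d16 : ∀ i, s5.arr 16 i = if i < 2 * k + 8 then (P.F - 5) / 8 / 2 ^ i % 2 else 0 := by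
      intro i
      rw [g5 _ (by norm_num), g4 _ (by norm_num), g3 _ (by norm_num), g2 _ (by norm_num), e1, h0]
    have d9 : ∀ i, s5.arr aFm i = if i < P.h then P.F / (2 ^ P.b) ^ i % 2 ^ P.b else 0 := by
      intro i
      rw [g5 _ (by norm_num), g4 _ (by norm_num), g3 _ (by norm_num), e2, g1 _ (by norm_num), h0]
    have d10 : ∀ i, s5.arr aFi i = if i < P.h then P.F' / (2 ^ P.b) ^ i % 2 ^ P.b else 0 := by
      intro i
      rw [g5 _ (by norm_num), g4 _ (by norm_num), e3, g2 _ (by norm_num), g1 _ (by norm_num), h0]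
    have d32 : ∀ i, s5.arr 32 i =
        if i < P.h then (P.R % P.F) / (2 ^ P.b) ^ i % 2 ^ P.b else 0 := by
      intro i
      rw [g5 _ (by norm_num), e4, g3 _ (by norm_num), g2 _ (by norm_num), g1 _ (by norm_num), h0]
    have d35 : ∀ i, s5.arr 35 i =
        if i < P.h then (P.F - P.R % P.F) / (2 ^ P.b) ^ i % 2 ^ P.b else 0 := by
      intro i
      rw [e5, g4 _ (by norm_num), g3 _ (by norm_num), g2 _ (by norm_num), g1 _ (by norm_num), h0]
    have d0 : ∀ a, a ∉ [aFm, aFi, 16, 32, 35] → ∀ i, s5.arr a i = 0 := by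
      intro a ha i
      simp only [List.mem_cons, List.not_mem_nil, or_false, not_or] at ha
      rw [g5 _ ha.2.2.2.2, g4 _ ha.2.2.2.1, g3 _ ha.2.1, g2 _ ha.1, g1 _ ha.2.2.1, h0]
    apply Runs.block
    · simp [hw0.ne']
    · have hr : runL [.const 0 0, .const 83 1, .store 34 0 83] s5 =
          ((s5.set 0 0).set 83 1).put 34 0 1 := by simp
      rw [hr]
      set s6 := ((s5.set 0 0).set 83 1).put 34 0 1 with hs6
      have k34 : ∀ a, a ≠ 34 → s6.arr a = s5.arr a := by
        intro a ha; funext j; simp [hs6, ha]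
      have d34 : ∀ i, s6.arr 34 i = if i = 0 then 1 else 0 := by
        intro i; simp [hs6]; rw [d0 34 (by decide)]
      refine ⟨?_, ?_, ?_, ?_, ?_, ?_, ?_, ?_⟩
      · exact digs_of_digits (by omega) fun j hj => by rw [k34 _ (by norm_num), d9, if_pos hj]
      · exact digs_of_digits H.hF' fun j hj => by rw [k34 _ (by norm_num), d10, if_pos hj]
      · exact digs_of_digits (by omega) fun j hj => by rw [k34 _ (by norm_num), d32, if_pos hj]
      · exact digs_of_digits (by omega) fun j hj => by rw [k34 _ (by norm_num), d35, if_pos hj]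
      · refine digs_of_digits (by omega) fun j hj => ?_
        rw [d34]
        split_ifs with h
        · subst h; simp; exact (Nat.mod_eq_of_lt hβ).symm
        · rw [Nat.div_eq_of_lt (Nat.one_lt_pow h hβ)]; simp
      · intro i hi
        rw [k34 _ (by norm_num), d16, if_pos hi]
      · intro a ha i
        simp only [List.mem_cons, List.not_mem_nil, or_false, not_or] at ha
        rw [k34 _ ha.2.2.2.2.1, d0 _ (by simp [ha])]
      · intro a i
        by_cases h34 : a = 34
        · subst h34; rw [d34]; split_ifs <;> omega
        rw [k34 _ h34]
        by_cases ha : a ∈ [aFm, aFi, 16, 32, 35]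
        · have hlt : ∀ n, n % 2 ^ P.b < 2 ^ P.w := fun n => (Nat.mod_lt _ (by omega)).trans hβ'
          simp only [List.mem_cons, List.not_mem_nil, or_false] at ha
          rcases ha with rfl | rfl | rfl | rfl | rfl
          · rw [d9]; split_ifs <;> [exact hlt _; omega]
          · rw [d10]; split_ifs <;> [exact hlt _; omega]
          · rw [d16]; split_ifs <;> omega
          · rw [d32]; split_ifs <;> [exact hlt _; omega]
          · rw [d35]; split_ifs <;> [exact hlt _; omega]
        · rw [d0 a ha]; omega
  · have h1 : P.h * (P.b * 12 + 40) = 12 * (P.b * P.h) + 40 * P.h := by ring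
    rw [h1]
    have h2 : 2 * P.h = 2 ^ P.q := H.hD
    have h3 := H.two_pow_le hk
    omega

theorem Arrs.congr {k : ℕ} {P : Par} {s s' : State} (h : Arrs k P s) (e : s'.arr = s.arr) :
    Arrs k P s' :=
  ⟨h.hF.frame (by rw [e]), h.hF'.frame (by rw [e]), h.h1.frame (by rw [e]),
    h.hn.frame (by rw [e]), h.hi.frame (by rw [e]), by rw [e]; exact h.he, by rw [e]; exact h.h0,
    by rw [e]; exact h.lt⟩

/-- The preparation: the parameters of the arithmetic, the number `F k`, and the constants
depending on it. -/
def prep : Prog := prepA ;; prepB ;; clear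

theorem prep_spec {k : ℕ} (hk : 9 ≤ k) (hw : 4 * k + 60 ≤ w) :
    Runs w prep (3000 * k) (init k) fun s' => ∃ P : Par, P.For k ∧ Regs k P s' ∧ Arrs k P s' ∧
      s'.out = [] := by
  apply Runs.of_le (N := 1000 * k + (1500 * k + 120))
  · apply Runs.call_seq (prepA_spec hk hw)
    intro s1 f1 ⟨P, H, h2, h3, h4, h5, h6, h7, h70, h66, h85, h87, h89, h90⟩
    have hPw : P.w ≤ w := by
      have : k.size ≤ k := Nat.size_le.2 Nat.lt_two_pow_self
      rw [H.hw]; omega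
    have w1 : warrs prepA = [] := by decide +kernel
    have r1 : ∀ x ∈ wregs (prepA ;; prepB), x < 112 ∧ x ≠ 71 := by decide +kernel
    apply Runs.call_seq (prepB_spec H hk hPw h3 h5 h66 h85 h87 h89 h90
      (by intro a i; rw [f1.arr _ (by simp [w1])]; rfl))
    intro s2 f2 A
    apply Runs.mono (clear_spec s2)
    intro s3 ⟨c1, c2, c3⟩
    have key : ∀ x ∈ kept, x ∉ wregs prepB := by decide +kernel
    have hr : ∀ x ∈ kept, s3.reg x = s1.reg x := fun x hx => by
      rw [c1, if_neg (by simp [hx]), f2.reg _ (key x hx)]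
    have hfr : ∀ x, ¬ (x < 112 ∧ x ≠ 71) → s2.reg x = (init k).reg x := fun x hx => by
      have h : x ∉ wregs (prepA ;; prepB) := fun h => hx (r1 x h)
      simp only [wregs, List.mem_append, not_or] at h
      rw [f2.reg _ h.2, f1.reg _ h.1]
    refine ⟨P, H, ⟨?_, ?_, ?_, ?_, ?_, ?_, ?_, ?_, ?_⟩, A.congr c2, ?_⟩
    · rw [hr _ (by decide), h2]
    · rw [hr _ (by decide), h3]
    · rw [hr _ (by decide), h4]
    · rw [hr _ (by decide), h5]
    · rw [hr _ (by decide), h6]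
    · rw [hr _ (by decide), h7]
    · rw [hr _ (by decide), h70]
    · rw [c1, if_neg (by decide), hfr _ (by simp)]; simp [init]
    · intro x hx
      rw [c1]
      by_cases h : x < 112
      · rw [if_pos ⟨h, hx⟩]
      · rw [if_neg (by simp [h]), hfr _ (by simp [h])]
        simp [init, Function.update_apply]
        omega
    · rw [c3, f2.out (by decide +kernel), f1.out (by decide +kernel)]; rfl
  · omega

/-! ### The table of quarter squares -/

/-- Tabulate the quarters of the squares modulo `M`; the quarter squares of `i + 1` and `i` differ by
`⌊(i + 1) / 2⌋`. -/
def qsTable : Prog :=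
  block [.const 10 0, .const 11 0, .add 13 rM rM] ;;
  forN 64 13 (block [.const 0 1, .add 10 10 0, .half 12 10, .add 11 11 12, .sub 0 rM 11] ;;
    .ite 0 .skip (block [.sub 11 11 rM]) ;; block [.store aQS 10 11])

theorem qsTable_spec {s : State} {M : ℕ} (hw : 0 < w) (hM : s.reg rM = M) (hM1 : 1 ≤ M)
    (hMw : 2 * M < 2 ^ w) (h0 : s.arr aQS 0 = 0) :
    Runs w qsTable (2 * M * 20 + 10) s (QSOK M) := by
  apply Runs.of_le
  · apply Runs.block_seq
    · simp [hM]; omega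
    apply Runs.forN (N := 14) (n := 2 * M) (fun i s' => s'.reg rM = M ∧ s'.reg 10 = i ∧
      s'.reg 11 = i * i / 4 % M ∧ ∀ j ≤ i, s'.arr aQS j = j * j / 4 % M)
      (by simp [hM, two_mul]) (by decide) hw
    · simp [hM, h0]
    · intro i s1 hi hk f1 ⟨i1, i2, i3, i4⟩
      have hlt := Nat.mod_lt (i * i / 4) (show 0 < M by omega)
      have hstep : (i + 1) * (i + 1) / 4 = i * i / 4 + (i + 1) / 2 := by
        obtain ⟨m, rfl | rfl⟩ := Nat.even_or_odd' i
        · rw [show (2 * m + 1) * (2 * m + 1) = 1 + 4 * (m * m + m) by ring,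
            show 2 * m * (2 * m) = 4 * (m * m) by ring, Nat.add_mul_div_left _ _ (by norm_num),
            Nat.mul_div_cancel_left _ (by norm_num)]
          omega
        · rw [show (2 * m + 1 + 1) * (2 * m + 1 + 1) = 4 * (m * m + 2 * m + 1) by ring,
            show (2 * m + 1) * (2 * m + 1) = 1 + 4 * (m * m + m) by ring,
            Nat.add_mul_div_left _ _ (by norm_num), Nat.mul_div_cancel_left _ (by norm_num)]
          omega
      have hmod : (i + 1) * (i + 1) / 4 % M = (i * i / 4 % M + (i + 1) / 2) % M := by
        rw [hstep, Nat.mod_add_mod]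
      apply Runs.of_le
      · apply Runs.block_seq
        · simp [i2, i3, hw.ne']; omega
        apply Runs.call_seq (N₁ := 3) (Q₁ := fun s' => s'.reg rM = M ∧ s'.reg 10 = i + 1 ∧
          s'.reg 11 = (i + 1) * (i + 1) / 4 % M ∧ s'.reg 64 = 2 * M - i ∧ s'.arr = s1.arr)
        · apply Runs.of_le
          · apply Runs.ite
            · intro h
              simp [i1, i2, i3] at h
              apply Runs.skip
              simp [i1, i2, i3, hk]
              exact (hmod.trans (Nat.mod_eq_of_lt (by omega))).symm
            · intro h
              simp [i1, i2, i3] at h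
              apply Runs.block
              · simp
              · simp [i1, i2, i3, hk]
                exact (hmod.trans ((Nat.mod_eq_sub_mod (by omega)).trans
                  (Nat.mod_eq_of_lt (by omega)))).symm
          · simp
        intro s2 _ ⟨j1, j2, j3, j4, j5⟩
        apply Runs.block
        · simp
        · simp [j1, j2, j3, j4, j5]
          intro j hj
          split_ifs with h
          · rw [h]
          · exact i4 j (by omega)
      · simp
    · intro s1 f1 hz ⟨i1, i2, i3, i4⟩
      exact i4
  · simp; omega

end RAM

namespace RAM

variable {w : ℕ}

/-! ### The sequences of multiplications -/

section

variable {K : Type*} [CommRing K]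

theorem runOps_mkConst_append {z c : ℕ} (hz : z ≠ 32) {l : List Op} {env : ℕ → K} (h1 : env 32 = 1)
    (h0 : env 33 = 0) : runOps (mkConst z c ++ l) env = runOps l (Function.update env z (c : K)) := by
  rw [runOps_append, runOps_mkConst hz h1 h0]

/-- The arrays used by an operation are among those that hold residue classes. -/
def Op.OK (o : Op) : Prop := 32 ≤ o.z ∧ 32 ≤ o.x ∧ 32 ≤ o.y ∧ 32 ≤ o.c

theorem mkConst_ok {z : ℕ} (hz : 32 ≤ z) (c : ℕ) : ∀ o ∈ mkConst z c, o.OK := mkDigits_ge hz _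

/-- Prepare the computation of `5 ^ e` and `20 ^ e`. -/
def powOps : List Op :=
  mkConst 87 5 ++ (mkConst 89 20 ++ (mkConst 91 5 ++ (mkConst 92 10 ++ (mkConst 86 1 ++
    (mkConst 88 1 ++ [])))))

theorem powOps_ok : ∀ o ∈ powOps, o.OK := by
  simp only [powOps, List.forall_mem_append]
  refine ⟨mkConst_ok ?_ _, mkConst_ok ?_ _, mkConst_ok ?_ _, mkConst_ok ?_ _, mkConst_ok ?_ _,
    mkConst_ok ?_ _, ?_⟩ <;> norm_num

theorem runOps_powOps {env : ℕ → K} (h1 : env 32 = 1) (h0 : env 33 = 0) :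
    runOps powOps env = Function.update (Function.update (Function.update (Function.update
      (Function.update (Function.update env 87 5) 89 20) 91 5) 92 10) 86 1) 88 1 := by
  rw [powOps]
  iterate 6 rw [runOps_mkConst_append (by norm_num) (by simp [h1]) (by simp [h0])]
  simp [runOps]

/-- From `5 ^ e` and `20 ^ e`, the residue classes of `5 ^ (2 e + 1)`, `5 ^ (e + 1)` and
`2 ^ (2 e + 1) * 5 ^ (e + 1) = 10 * 20 ^ e`.  As array `34` holds the inverse of the base of the
Montgomery representation, multiplication by it turns a residue class into a number to be output. -/
def rootOps : List Op :=
  [⟨90, 86, 33, 86⟩, ⟨90, 90, 33, 91⟩, ⟨46, 90, 33, 34⟩, ⟨93, 86, 33, 91⟩, ⟨94, 88, 33, 92⟩]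

theorem runOps_rootOps {env : ℕ → K} (h0 : env 33 = 0) (h5 : env 91 = 5) (h10 : env 92 = 10)
    {e : ℕ} (h1 : env 86 = 5 ^ e) (h2 : env 88 = 20 ^ e) :
    runOps rootOps env 46 = 5 ^ (2 * e + 1) * env 34 ∧ runOps rootOps env 93 = 5 ^ (e + 1) ∧
      runOps rootOps env 94 = 2 ^ (2 * e + 1) * 5 ^ (e + 1) := by
  refine ⟨?_, ?_, ?_⟩
  · simp [rootOps, runOps, Function.update_apply, h0, h1, h5]
    ring
  · simp [rootOps, runOps, Function.update_apply, h0, h1, h5]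
    ring
  · simp [rootOps, runOps, Function.update_apply, h0, h2, h10]
    rw [show (20 : K) = 2 ^ 2 * 5 by norm_num, mul_pow, ← pow_mul]
    ring

/-- The curve, the point, and the constants needed for doubling, from the square root of `5` in
array `95`; the arrays `47`, `48`, `49` receive the numbers to be output. -/
def setupOps : List Op :=
  mkConst 36 3 ++ (⟨37, 36, 33, 35⟩ :: (mkConst 38 9 ++ (⟨38, 38, 33, 35⟩ :: (mkConst 39 27 ++
  (mkConst 50 16195646845 ++ (mkConst 51 7242913457 ++ (⟨51, 51, 33, 95⟩ :: ⟨51, 51, 33, 35⟩ ::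
  (mkConst 52 3234 ++ (⟨52, 52, 33, 35⟩ :: ⟨43, 50, 51, 52⟩ ::
  (mkConst 50 5395199151946361 ++ (mkConst 51 2412806411180256 ++ (⟨51, 51, 33, 95⟩ ::
    ⟨51, 51, 33, 35⟩ ::
  (mkConst 52 38416 ++ (⟨44, 50, 51, 52⟩ ::
  (mkConst 50 10179930516 ++ (⟨50, 50, 33, 35⟩ :: (mkConst 51 4552603328 ++ (⟨51, 51, 33, 95⟩ ::
    ⟨41, 50, 51, 32⟩ :: ⟨42, 32, 33, 32⟩ :: ⟨40, 33, 33, 32⟩ :: ⟨47, 95, 33, 34⟩ ::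
    ⟨48, 41, 33, 34⟩ :: ⟨49, 95, 33, 95⟩ :: ⟨49, 49, 33, 34⟩ :: []))))))))))))))))))

theorem setupOps_ok : ∀ o ∈ setupOps, o.OK := by
  have h : ∀ z c, 32 ≤ z → ∀ o ∈ mkConst z c, o.OK := fun z c hz => mkConst_ok hz c
  have h' : ∀ z x y c : ℕ, 32 ≤ z → 32 ≤ x → 32 ≤ y → 32 ≤ c → (Op.mk z x y c).OK :=
    fun z x y c h1 h2 h3 h4 => ⟨h1, h2, h3, h4⟩
  simp [setupOps, or_imp, forall_and, h']
  repeat' apply And.intro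
  all_goals exact h _ _ (by norm_num)

theorem runOps_setupOps {env : ℕ → K} (h1 : env 32 = 1) (h0 : env 33 = 0) (hm : env 35 = -1)
    {W : WeierstrassCurve K}
    (h4 : W.a₄ = -3234 * (16195646845 - 7242913457 * env 95))
    (h6 : W.a₆ = 38416 * (5395199151946361 - 2412806411180256 * env 95)) :
    DblEnv W (runOps setupOps env) ∧ runOps setupOps env 40 = 0 ∧
      runOps setupOps env 41 = -10179930516 + 4552603328 * env 95 ∧ runOps setupOps env 42 = 1 ∧
      runOps setupOps env 46 = env 46 ∧ runOps setupOps env 47 = env 95 * env 34 ∧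
      runOps setupOps env 48 = (-10179930516 + 4552603328 * env 95) * env 34 ∧
      runOps setupOps env 49 = env 95 ^ 2 * env 34 := by
  have key : ∀ {l : List Op} {env : ℕ → K} {z x y c : ℕ} {v : K},
      (env x + env y) * env c = v →
      runOps (⟨z, x, y, c⟩ :: l) env = runOps l (Function.update env z v) := by
    intro l env z x y c v h
    rw [← h]; rfl
  have key' : ∀ {l : List Op} {env : ℕ → K} {z c : ℕ} {v : K}, (c : K) = v → z ≠ 32 →
      env 32 = 1 → env 33 = 0 →
      runOps (mkConst z c ++ l) env = runOps l (Function.update env z v) := by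
    intro l env z c v h hz h1 h0
    rw [← h, runOps_mkConst_append hz h1 h0]
  rw [setupOps]
  repeat first
    | rw [key (by simp only [Function.update_self, ne_eq, Function.update_of_ne, Nat.reduceEqDiff, not_false_eq_true, h0, h1, hm, add_zero, mul_one, mul_neg, zero_mul]; rfl)]
    | rw [key' (by simp only [Nat.cast_ofNat]; rfl) (by norm_num)
        (by simp only [Function.update_self, ne_eq, Function.update_of_ne, Nat.reduceEqDiff, not_false_eq_true, h1])
        (by simp only [Function.update_self, ne_eq, Function.update_of_ne, Nat.reduceEqDiff, not_false_eq_true, h0])]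
  rw [runOps]
  refine ⟨⟨?_, ?_, ?_, ?_, ?_, ?_, ?_, ?_, ?_⟩, ?_, ?_, ?_, ?_, ?_, ?_, ?_⟩ <;>
    simp only [Function.update_self, ne_eq, Function.update_of_ne, Nat.reduceEqDiff,
      not_false_eq_true, h0, h1, hm, h4, h6] <;> ring

end

end RAM

namespace RAM

variable {w : ℕ} {k : ℕ} {P : Par}

/-! ### The multiplications modulo `F` -/

theorem Par.For.isUnit_R (H : P.For k) (hk : 9 ≤ k) : (P.R : ZMod P.F)⁻¹ * P.R = 1 := by
  have h1 : P.F % 8 = 5 := by rw [H.hF]; exact FkTest.F_mod (by omega)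
  rw [mul_comm]
  apply ZMod.coe_mul_inv_eq_one
  rw [Par.For.R_eq]
  exact (Nat.coprime_two_left.2 (Nat.odd_iff.2 (by omega))).pow_left _

/-- The residue classes in the arrays after the preparation. -/
noncomputable def env₀ (P : Par) (a : ℕ) : ZMod P.F :=
  if a = 32 then 1 else if a = 34 then (P.R : ZMod P.F)⁻¹ else if a = 35 then -1 else 0

theorem Arrs.ari (H : P.For k) (hk : 9 ≤ k) {s s' : State} (A : Arrs k P s)
    (hq : QSOK P.M s') (ha : ∀ a, a ≠ aQS → s'.arr a = s.arr a) (h2 : s'.reg 2 = P.M)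
    (h3 : s'.reg 3 = P.b) (h4 : s'.reg 4 = 2 ^ P.q) (h5 : s'.reg 5 = P.h) (h6 : s'.reg 6 = P.q)
    (h7 : s'.reg 7 = P.L) : Ari P s' (env₀ P) := by
  have O := H.ok hk
  have hF1 := O.hF1
  have hmod := Nat.mod_lt P.R (show 0 < P.F by omega)
  refine ⟨⟨⟨h2, h4, h6, h7, hq⟩, h3, h5, A.hF.frame (ha _ (by norm_num)),
    A.hF'.frame (ha _ (by norm_num)), fun p => ?_⟩, fun a h32 => ?_⟩
  · rw [ha _ (by norm_num), A.h0 _ (by decide)]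
  · have hd : ∀ {n}, Digs P s a n → Digs P s' a n := fun h => h.frame (ha _ (by omega))
    by_cases a1 : a = 32
    · subst a1
      exact ⟨_, hd A.h1, by omega, by simp [env₀]⟩
    by_cases a2 : a = 34
    · subst a2
      exact ⟨_, hd A.hi, by omega, by simp [env₀, H.isUnit_R hk]⟩
    by_cases a3 : a = 35
    · subst a3
      refine ⟨_, hd A.hn, by omega, ?_⟩
      rw [Nat.cast_sub hmod.le]
      simp [env₀]
    · refine ⟨0, hd ⟨fun p hp => ?_, ?_⟩, by omega, by simp [env₀, a1, a2, a3]⟩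
      · rw [A.h0 a (by simp [a1, a2, a3]; omega)]; positivity
      · rw [dval]
        exact Finset.sum_eq_zero fun i _ => by
          rw [A.h0 a (by simp [a1, a2, a3]; omega), zero_mul]

theorem Ari.congr {s s' : State} {env : ℕ → ZMod P.F} (A : Ari P s env) (e : s'.arr = s.arr)
    (R : Regs k P s') : Ari P s' env :=
  ⟨⟨⟨R.hM, R.hD, R.hq, R.hL, by intro i hi; rw [e]; exact A.num.conv.hQS i hi⟩, R.hb, R.hh,
    A.num.hF.frame (by rw [e]), A.num.hF'.frame (by rw [e]), by rw [e]; exact A.num.hZ⟩,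
    fun a ha => (A.slot a ha).frame (by rw [e])⟩

/-- After clearing the registers that are not to be kept. -/
theorem Regs.of_clear {s s' : State}
    (h : ∀ x, s'.reg x = if x < 112 ∧ x ∉ kept then 0 else s.reg x)
    (h2 : s.reg 2 = P.M) (h3 : s.reg 3 = P.b) (h4 : s.reg 4 = 2 ^ P.q) (h5 : s.reg 5 = P.h)
    (h6 : s.reg 6 = P.q) (h7 : s.reg 7 = P.L) (h70 : s.reg 70 = k) (h71 : s.reg 71 ≤ 1)
    (h0 : ∀ x, 112 ≤ x → s.reg x = 0) : Regs k P s' := by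
  have hx : ∀ x ∈ kept, s'.reg x = s.reg x := fun x hx => by rw [h, if_neg (by simp [hx])]
  refine ⟨?_, ?_, ?_, ?_, ?_, ?_, ?_, ?_, fun x hx' => ?_⟩
  · rw [hx _ (by decide), h2]
  · rw [hx _ (by decide), h3]
  · rw [hx _ (by decide), h4]
  · rw [hx _ (by decide), h5]
  · rw [hx _ (by decide), h6]
  · rw [hx _ (by decide), h7]
  · rw [hx _ (by decide), h70]
  · rw [hx _ (by decide)]; exact h71
  · rw [h]
    split_ifs with hc
    · rfl
    · exact h0 x (by by_contra h'; exact hc ⟨by omega, hx'⟩)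

/-- The clearing of the registers after a computation with residue classes. -/
theorem Ari.clear_spec {s₀ s : State} {env : ℕ → ZMod P.F} (A : Ari P s env) (R : Regs k P s₀)
    (hk : ∀ x, 70 ≤ x → s.reg x = s₀.reg x) :
    Runs w clear 120 s fun s' => Regs k P s' ∧ Ari P s' env ∧ s'.out = s.out := by
  apply Runs.mono (RAM.clear_spec s)
  intro s' ⟨h1, h2, h3⟩
  have R' : Regs k P s' := Regs.of_clear h1 A.num.conv.hM A.num.hb A.num.conv.hD A.num.hh
    A.num.conv.hq A.num.conv.hL (by rw [hk _ le_rfl, R.hk]) (by rw [hk _ (by norm_num)]; exact R.hc)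
    (fun x hx => by
      rw [hk _ (by omega)]
      refine R.h0 x ?_
      simp only [kept, List.mem_cons, List.not_mem_nil, or_false]
      omega)
  exact ⟨R', A.congr h2 R', h3⟩

/-- The table of quarter squares and the powers of `5` and `20`.  Since `F = 8 e + 5`, the number
`5 ^ ((F - 1) / 4)` is `5 ^ (2 e + 1)`. -/
def powPhase : Prog :=
  block [.add 66 70 70, .const 0 8, .add 66 66 0] ;; qsTable ;; opsP powOps ;; powLoop ;;
    opsP rootOps ;; clear

theorem powPhase_spec (H : P.For k) (hk : 9 ≤ k) {s : State} (R : Regs k P s) (A : Arrs k P s) :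
    Runs P.w powPhase (40 * P.M + (powOps.length + 200) * (k * P.macN)) s fun s' => Regs k P s' ∧
      s'.out = s.out ∧ ∃ env : ℕ → ZMod P.F, Ari P s' env ∧ env 32 = 1 ∧ env 33 = 0 ∧
        env 35 = -1 ∧ env 34 * P.R = 1 ∧ env 46 = 5 ^ (2 * ((P.F - 5) / 8) + 1) * env 34 ∧
        env 93 = 5 ^ ((P.F - 5) / 8 + 1) ∧
        env 94 = 2 ^ (2 * ((P.F - 5) / 8) + 1) * 5 ^ ((P.F - 5) / 8 + 1) := by
  have O := H.ok hk
  have hM4 := O.hM4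
  have hM1 := O.conv.hM1
  have hw := O.conv.hw
  have hlt := H.lt_pow
  have hk2 : 9 * k ≤ k * k := Nat.mul_le_mul_right _ hk
  have hF : (P.F - 5) / 8 < 2 ^ (2 * k + 8) := by
    have := FkTest.F_lt k
    have h2 : 2 ^ (2 * k + 5) ≤ 2 ^ (2 * k + 8) := Nat.pow_le_pow_right (by norm_num) (by omega)
    rw [H.hF]
    omega
  apply Runs.of_le (N := 4 + ((2 * P.M * 20 + 10) + ((powOps.length * P.macN + 1) +
    (((2 * k + 8) * (4 * P.macN + 15) + 10) + ((rootOps.length * P.macN + 1) + 120)))))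
  · apply Runs.block_seq
    · simp [R.hk]
      omega
    apply Runs.call_seq (qsTable_spec hw (by simp [R.hM]) (by omega) (by omega)
      (by simp [A.h0 aQS (by decide)]))
    intro s1 f1 q1
    have w1 : ∀ x ∈ wregs qsTable, x < 66 ∧ x ∉ [2, 3, 4, 5, 6, 7] := by decide +kernel
    have v1 : warrs qsTable = [aQS] := by decide +kernel
    have r66 : s1.reg 66 = 2 * k + 8 := by
      rw [f1.reg _ (by decide +kernel)]; simp [R.hk]; omega
    have A1 : Ari P s1 (env₀ P) := by
      apply A.ari H hk q1
      · intro a ha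
        rw [f1.arr _ (by simpa [v1] using ha)]; simp
      · rw [f1.reg _ (by decide +kernel)]; simp [R.hM]
      · rw [f1.reg _ (by decide +kernel)]; simp [R.hb]
      · rw [f1.reg _ (by decide +kernel)]; simp [R.hD]
      · rw [f1.reg _ (by decide +kernel)]; simp [R.hh]
      · rw [f1.reg _ (by decide +kernel)]; simp [R.hq]
      · rw [f1.reg _ (by decide +kernel)]; simp [R.hL]
    apply Runs.call_seq (opsP_spec O _ powOps_ok A1)
    intro s2 f2 ⟨A2, K2⟩
    rw [runOps_powOps (by simp [env₀]) (by simp [env₀])] at A2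
    set env2 := Function.update (Function.update (Function.update (Function.update
      (Function.update (Function.update (env₀ P) 87 5) 89 20) 91 5) 92 10) 86 1) 88 1 with henv2
    have r66' : s2.reg 66 = 2 * k + 8 := by rw [K2.reg _ (by norm_num), r66]
    apply Runs.call_seq (powLoop_spec O A2 r66' (by simp [henv2, env₀]) hF (by
      intro i hi
      rw [K2.arr _ (by norm_num) (by norm_num), f1.arr _ (by simp [v1])]
      simpa using A.he i hi))
    intro s3 f3 ⟨K3, env3, A3, e3, e86, e88⟩
    apply Runs.call_seq (opsP_spec O rootOps (by decide) A3)
    intro s4 f4 ⟨A4, K4⟩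
    have hroot := runOps_rootOps (env := env3) (e := (P.F - 5) / 8)
      (by rw [e3 _ (by decide)]; simp [henv2, env₀])
      (by rw [e3 _ (by decide)]; simp [henv2, env₀])
      (by rw [e3 _ (by decide)]; simp [henv2, env₀])
      (by rw [e86]; simp [henv2, env₀]) (by rw [e88]; simp [henv2, env₀])
    have h34 : env3 34 = (P.R : ZMod P.F)⁻¹ := by
      rw [e3 _ (by decide)]; simp [henv2, env₀]
    have hkeep : ∀ a ∈ [32, 33, 34, 35], runOps rootOps env3 a = env₀ P a := by
      intro a ha
      have h1 : a ∉ rootOps.map Op.z ∧ a ∉ [86, 87, 88, 89] ∧ a ∉ [87, 89, 91, 92, 86, 88] := by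
        revert a; decide
      rw [runOps_of_notMem h1.1, e3 _ h1.2.1]
      have h2 := h1.2.2
      simp only [List.mem_cons, List.not_mem_nil, or_false, not_or] at h2
      simp [henv2, Function.update_apply, h2]
    apply Runs.mono (A4.clear_spec R (by
      intro x hx
      rw [K4.reg _ (by omega), K3.reg _ (by omega), K2.reg _ (by omega), f1.reg _ (fun h => by
        have := (w1 x h).1; omega)]
      simp [show x ≠ 66 by omega, show x ≠ 0 by omega]))
    intro s5 ⟨R5, A5, o5⟩
    refine ⟨R5, ?_, _, A5, ?_, ?_, ?_, ?_, ?_, ?_, ?_⟩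
    · rw [o5, K4.out, K3.out, K2.out, f1.out (by decide +kernel)]; simp
    · rw [hkeep _ (by decide)]; simp [env₀]
    · rw [hkeep _ (by decide)]; simp [env₀]
    · rw [hkeep _ (by decide)]; simp [env₀]
    · rw [hkeep _ (by decide)]; simp [env₀, H.isUnit_R hk]
    · rw [hroot.1, hkeep 34 (by decide), h34]; simp [env₀]
    · exact hroot.2.1
    · exact hroot.2.2
  · have hm : 1 ≤ P.macN := by unfold Par.macN; omega
    have h1 : k ≤ k * P.macN := Nat.le_mul_of_pos_right _ hm
    have h2 : 9 * P.macN ≤ k * P.macN := Nat.mul_le_mul_right _ hk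
    have h3 : (2 * k + 8) * (4 * P.macN + 15) = 8 * (k * P.macN) + 30 * k + 32 * P.macN + 120 := by
      ring
    have h4 : powOps.length * P.macN ≤ powOps.length * (k * P.macN) :=
      Nat.mul_le_mul_left _ (by omega)
    rw [h3, Nat.add_mul, show rootOps.length = 5 from rfl]
    omega

/-- Record in register `71` whether `5 ^ ((F - 1) / 4)` is `1` modulo `F`. -/
def flagPhase : Prog :=
  (toReg aFm ;; block [.copy 85 74] ;; toReg 46 ;; canon 74 ;;
    block [.const 0 1, .sub 83 74 0, .sub 84 0 74, .add 83 83 84] ;;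
    .ite 83 (block [.const 71 1]) (block [.const 71 0])) ;; clear

theorem warrs_toReg (a : ℕ) : warrs (toReg a) = [] := by
  simp [toReg, warrs, forN, RAM.block, Instr.warrs, dbl]

theorem flagPhase_spec (H : P.For k) {s : State} {n : ℕ} (hw : 4 * k + 60 ≤ w) (R : Regs k P s)
    (hF : Digs P s aFm P.F) (hn : Digs P s 46 n) (hnF : n < 2 * P.F) :
    Runs w flagPhase (2 * (P.h * (P.b * 6 + 20)) + 170) s fun s' => Regs k P s' ∧
      s'.arr = s.arr ∧ s'.out = s.out ∧ s'.reg 71 = if n % P.F = 1 then 0 else 1 := by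
  have hbh := H.hbh'
  have hw0 : 0 < w := by omega
  apply Runs.of_le
  · apply Runs.call_seq (N₁ := 2 * (P.h * (P.b * 6 + 20)) + 50)
      (Q₁ := fun s' => s'.reg 71 = if n % P.F = 1 then 0 else 1)
    · apply Runs.of_le
      · apply Runs.call_seq (toReg_spec (by omega) R.hb R.hh hF)
        intro s1 f1 h1
        have a1 : s1.arr = s.arr := by
          funext a; exact f1.arr _ (by simp [warrs_toReg])
        apply Runs.block_seq
        · simp
        apply Runs.call_seq (toReg_spec (n := n) (P := P) (by omega)
          (by simp; rw [f1.reg _ (by decide +kernel), R.hb])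
          (by simp; rw [f1.reg _ (by decide +kernel), R.hh]) (hn.frame (by simp [a1])))
        intro s2 f2 h2
        apply Runs.call_seq (canon_spec (by decide) (F := P.F) (by rw [f2.reg _ (by decide +kernel)]; simp [h1])
          h2 hnF)
        intro s3 f3 h3
        apply Runs.of_small
        intro hs3
        have hs74 := hs3.1 74
        rw [h3] at hs74
        generalize n % P.F = r at *
        have h2w : 2 ≤ 2 ^ w := Nat.le_self_pow hw0.ne' 2
        apply Runs.block_seq
        · simp [hw0.ne', h3]; omega
        apply Runs.ite
        · intro h
          simp [h3] at h
          apply Runs.block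
          · simp [hw0.ne']
          · simp
            omega
        · intro h
          simp [h3] at h
          apply Runs.block
          · simp
          · simp
            omega
      · simp; omega
    intro s1 f1 h1
    have w1 : ∀ x ∈ wregs (toReg aFm ;; block [.copy 85 74] ;; toReg 46 ;; canon 74 ;;
        block [.const 0 1, .sub 83 74 0, .sub 84 0 74, .add 83 83 84] ;;
        .ite 83 (block [.const 71 1]) (block [.const 71 0])), x < 112 ∧ x ∉ [2, 3, 4, 5, 6, 7, 70] := by
      decide +kernel
    have hr : ∀ x, (112 ≤ x ∨ x ∈ [2, 3, 4, 5, 6, 7, 70]) → s1.reg x = s.reg x := fun x hx =>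
      f1.reg _ fun h => by
        have := w1 x h
        rcases hx with hx | hx
        · omega
        · exact this.2 hx
    apply Runs.mono (clear_spec s1)
    intro s2 ⟨c1, c2, c3⟩
    refine ⟨Regs.of_clear c1 ?_ ?_ ?_ ?_ ?_ ?_ ?_ ?_ ?_, ?_, ?_, ?_⟩
    · rw [hr _ (by decide), R.hM]
    · rw [hr _ (by decide), R.hb]
    · rw [hr _ (by decide), R.hD]
    · rw [hr _ (by decide), R.hh]
    · rw [hr _ (by decide), R.hq]
    · rw [hr _ (by decide), R.hL]
    · rw [hr _ (by decide), R.hk]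
    · rw [h1]; split_ifs <;> norm_num
    · intro x hx
      rw [hr _ (Or.inl hx)]
      refine R.h0 x ?_
      simp only [kept, List.mem_cons, List.not_mem_nil, or_false]
      omega
    · rw [c2]; funext a; exact f1.arr _ (by simp [warrs, warrs_toReg, RAM.block, Instr.warrs, canon])
    · rw [c3]; exact f1.out (by decide +kernel)
    · rw [c1, if_neg (by decide), h1]
  · omega

/-- Choose the square root of `5`, set up the curve and the point, and double the point `2 k + 1`
times. -/
def pointPhase : Prog :=
  .ite 71 (opsP [⟨95, 94, 33, 32⟩]) (opsP [⟨95, 93, 33, 32⟩]) ;;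
    block [.add 69 70 70, .const 0 1, .add 69 69 0] ;; opsP setupOps ;; dblLoop ;; clear

theorem pointPhase_spec (H : P.For k) (hk : 9 ≤ k) {s : State} (R : Regs k P s)
    {env : ℕ → ZMod P.F} (A : Ari P s env) (h1 : env 32 = 1) (h0 : env 33 = 0) (hm : env 35 = -1)
    {δ : ZMod P.F} (hδ : δ = if s.reg 71 = 0 then env 93 else env 94)
    {W : WeierstrassCurve (ZMod P.F)} (hW1 : W.a₁ = 0) (hW2 : W.a₂ = 0) (hW3 : W.a₃ = 0)
    (hW4 : W.a₄ = -3234 * (16195646845 - 7242913457 * δ))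
    (hW6 : W.a₆ = 38416 * (5395199151946361 - 2412806411180256 * δ)) :
    Runs P.w pointPhase ((setupOps.length + 300) * (k * P.macN)) s fun s' => Regs k P s' ∧
      s'.out = s.out ∧ ∃ env' : ℕ → ZMod P.F, Ari P s' env' ∧ env' 46 = env 46 ∧
        env' 47 = δ * env 34 ∧ env' 48 = (-10179930516 + 4552603328 * δ) * env 34 ∧
        env' 49 = δ ^ 2 * env 34 ∧ ![env' 40, env' 41, env' 42] =
          (WeierstrassCurve.Projective.dblXYZ W.toProjective)^[2 * k + 1]
            ![0, -10179930516 + 4552603328 * δ, 1] := by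
  have O := H.ok hk
  have hw := O.conv.hw
  have hlt := H.lt_pow
  have hk2 : 9 * k ≤ k * k := Nat.mul_le_mul_right _ hk
  apply Runs.of_le (N := (P.macN + 3) + (4 + ((setupOps.length * P.macN + 1) +
    (((2 * k + 1) * (39 * P.macN + 5) + 3) + 120))))
  · apply Runs.call_seq (N₁ := P.macN + 3) (Q₁ := fun s' => Kept 64 s s' ∧
      Ari P s' (Function.update env 95 δ))
    · apply Runs.of_le
      · apply Runs.ite
        · intro h
          apply Runs.mono (opsP_spec O [⟨95, 94, 33, 32⟩] (by decide) A)
          intro s1 ⟨A1, K1⟩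
          refine ⟨K1, ?_⟩
          rw [hδ, if_neg h]
          simpa [runOps, h0, h1] using A1
        · intro h
          apply Runs.mono (opsP_spec O [⟨95, 93, 33, 32⟩] (by decide) A)
          intro s1 ⟨A1, K1⟩
          refine ⟨K1, ?_⟩
          rw [hδ, if_pos h]
          simpa [runOps, h0, h1] using A1
      · simp
    intro s1 _ ⟨K1, A1⟩
    have r70 : s1.reg 70 = k := by rw [K1.reg _ (by norm_num), R.hk]
    apply Runs.block_seq
    · simp [r70, hw.ne']
      omega
    have hrun : runL [.add 69 70 70, .const 0 1, .add 69 69 0] s1 =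
        ((s1.set 69 (2 * k)).set 0 1).set 69 (2 * k + 1) := by simp [r70, two_mul]
    rw [hrun]
    have A2 := ((A1.set (x := 69) (v := 2 * k) (by decide)).set (x := 0) (v := 1) (by decide)).set
      (x := 69) (v := 2 * k + 1) (by decide)
    apply Runs.call_seq (opsP_spec O setupOps setupOps_ok A2)
    intro s3 _ ⟨A3, K3⟩
    obtain ⟨D, e40, e41, e42, e46, e47, e48, e49⟩ := runOps_setupOps
      (env := Function.update env 95 δ) (W := W) (by simp [h1]) (by simp [h0]) (by simp [hm])
      (by simp [hW4]) (by simp [hW6])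
    apply Runs.call_seq (dblLoop_spec O A3 (n := 2 * k + 1)
      (by rw [K3.reg _ (by norm_num)]; simp) hW1 hW2 hW3 D)
    intro s4 _ ⟨K4, env', A4, e4, hP⟩
    apply Runs.mono (A4.clear_spec R (by
      intro x hx
      rw [K4.reg _ (by omega), K3.reg _ (by omega)]
      simp [show x ≠ 69 by omega, show x ≠ 0 by omega, K1.reg x (by omega)]))
    intro s5 ⟨R5, A5, o5⟩
    refine ⟨R5, ?_, env', A5, ?_, ?_, ?_, ?_, ?_⟩
    · rw [o5, K4.out, K3.out]; simp [K1.out]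
    · rw [e4 _ (by decide), e46]; simp
    · rw [e4 _ (by decide), e47]; simp
    · rw [e4 _ (by decide), e48]; simp
    · rw [e4 _ (by decide), e49]; simp
    · rw [hP, e40, e41, e42]; simp
  · have hm : 1 ≤ P.macN := by unfold Par.macN; omega
    have h1 : k ≤ k * P.macN := Nat.le_mul_of_pos_right _ hm
    have h2 : 9 * P.macN ≤ k * P.macN := Nat.mul_le_mul_right _ hk
    have h3 : (2 * k + 1) * (39 * P.macN + 5) = 78 * (k * P.macN) + 10 * k + 39 * P.macN + 5 := by
      ring
    have h4 : setupOps.length * P.macN ≤ setupOps.length * (k * P.macN) :=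
      Nat.mul_le_mul_left _ (by omega)
    rw [h3, Nat.add_mul]
    omega

end RAM

namespace RAM

variable {w : ℕ} {k : ℕ} {P : Par}

/-! ### The output -/

/-- Compute, for each pair `(a, x)` of the list, the residue modulo `F` of the number whose digits
are in array `a`, and put it in register `x`. -/
def gets : List (ℕ × ℕ) → Prog
  | [] => .skip
  | ax :: l => (toReg ax.1 ;; canon 74 ;; block [.copy ax.2 74]) ;; gets l

theorem wregs_gets (l : List (ℕ × ℕ)) :
    ∀ x ∈ wregs (gets l), x ∈ [0, kl, 64, 65, 74] ∨ x ∈ l.map Prod.snd := by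
  induction l with
  | nil => simp [gets, wregs]
  | cons ax l ih =>
    intro x hx
    simp only [gets, wregs, List.mem_append] at hx
    rcases hx with h | h
    · simp [toReg, canon, forN, dbl, wregs, RAM.block, Instr.wregs] at h
      simp
      omega
    · rcases ih x h with h | h
      · exact Or.inl h
      · exact Or.inr (List.mem_cons_of_mem _ h)

theorem gets_spec {s : State} {F : ℕ} (hw : P.b * P.h < w) (hb : s.reg rb = P.b)
    (hh : s.reg rh = P.h) (hF : s.reg 85 = F) (v : ℕ → ℕ) (l : List (ℕ × ℕ))
    (hl : ∀ ax ∈ l, Digs P s ax.1 (v ax.1) ∧ v ax.1 < 2 * F ∧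
      ax.2 ∉ [0, rb, rh, kl, 64, 65, 74, 85]) (hnd : (l.map Prod.snd).Nodup) :
    Runs w (gets l) (l.length * (P.h * (P.b * 6 + 20) + 30) + 1) s fun s' =>
      ∀ ax ∈ l, s'.reg ax.2 = v ax.1 % F := by
  induction l generalizing s with
  | nil => exact (Runs.skip (by simp)).of_le (by simp)
  | cons ax l ih =>
    obtain ⟨a, x⟩ := ax
    obtain ⟨h1, h2, h3⟩ := hl _ (List.mem_cons_self ..)
    simp only [List.mem_cons, List.not_mem_nil, or_false, not_or] at h1 h2 h3
    rw [List.map_cons, List.nodup_cons] at hnd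
    apply Runs.of_le
    · apply Runs.call_seq (N₁ := P.h * (P.b * 6 + 20) + 30) (Q₁ := fun s' => s'.reg x = v a % F)
      · apply Runs.of_le
        · apply Runs.call_seq (toReg_spec hw hb hh h1)
          intro s1 f1 h1
          apply Runs.call_seq (canon_spec (by decide)
            (by rw [f1.reg _ (by simp [toReg, forN, dbl, wregs, RAM.block, Instr.wregs]), hF]) h1 h2)
          intro s2 f2 h2
          apply Runs.block
          · simp
          · simp [h2]
        · simp
      intro s1 f1 hx
      have fr : ∀ y, y ∉ [0, kl, 64, 65, 74, x] → s1.reg y = s.reg y := fun y hy => f1.reg _ (by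
        simp [toReg, canon, forN, dbl, wregs, RAM.block, Instr.wregs]
        simp at hy
        omega)
      have hx' : x ∉ wregs (gets l) := fun h => by
        rcases wregs_gets l x h with h | h
        · simp at h; omega
        · exact hnd.1 h
      apply Runs.call (ih (s := s1) (by rw [fr _ (by simp; omega), hb])
        (by rw [fr _ (by simp; omega), hh]) (by rw [fr _ (by simp; omega), hF]) (fun ax hax => ?_)
        hnd.2)
      · intro s2 f2 h2
        rw [List.forall_mem_cons]
        refine ⟨?_, h2⟩
        rw [f2.reg _ hx', hx]
      · obtain ⟨g1, g2⟩ := hl _ (List.mem_cons_of_mem _ hax)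
        refine ⟨g1.frame (f1.arr _ ?_), g2⟩
        simp [warrs, warrs_toReg, canon, RAM.block, Instr.warrs]
    · rw [List.length_cons, Nat.succ_mul]
      omega

/-- Bring the results from the arrays to the registers. -/
def fetch : Prog :=
  toReg aFm ;; block [.copy 85 74] ;;
    gets [(46, 75), (47, 76), (48, 78), (49, 79), (40, 80), (41, 81), (42, 82)] ;;
    block [.const 0 5, .sub 86 85 0, .half 86 86, .half 86 86, .half 86 86]

theorem fetch_spec (H : P.For k) {s : State} (hw : 4 * k + 60 ≤ w) (R : Regs k P s)
    (hF : Digs P s aFm P.F) (v : ℕ → ℕ)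
    (hv : ∀ a ∈ [46, 47, 48, 49, 40, 41, 42], Digs P s a (v a) ∧ v a < 2 * P.F) :
    Runs w fetch (8 * (P.h * (P.b * 6 + 20)) + 250) s fun s' => s'.reg 85 = P.F ∧
      s'.reg 75 = v 46 % P.F ∧ s'.reg 76 = v 47 % P.F ∧ s'.reg 78 = v 48 % P.F ∧
      s'.reg 79 = v 49 % P.F ∧ s'.reg 80 = v 40 % P.F ∧ s'.reg 81 = v 41 % P.F ∧
      s'.reg 82 = v 42 % P.F ∧ s'.reg 86 = (P.F - 5) / 8 ∧ s'.reg 70 = k := by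
  have hbh := H.hbh'
  have h8 : 2 ^ 3 ≤ 2 ^ w := Nat.pow_le_pow_right (by norm_num) (by omega)
  apply Runs.of_le
  · apply Runs.call_seq (toReg_spec (by omega) R.hb R.hh hF)
    intro s1 f1 h1
    have a1 : s1.arr = s.arr := by
      funext a; exact f1.arr _ (by simp [warrs_toReg])
    apply Runs.block_seq
    · simp
    apply Runs.call_seq (gets_spec (P := P) (F := P.F) (by omega)
      (by simp; rw [f1.reg _ (by decide +kernel), R.hb])
      (by simp; rw [f1.reg _ (by decide +kernel), R.hh]) (by simp [h1]) v _ ?_ (by decide))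
    · intro s2 f2 h2
      simp only [List.forall_mem_cons] at h2
      obtain ⟨g1, g2, g3, g4, g5, g6, g7, -⟩ := h2
      have g8 : s2.reg 85 = P.F := by rw [f2.reg _ (by decide +kernel)]; simp [h1]
      have g9 : s2.reg 70 = k := by
        rw [f2.reg _ (by decide +kernel)]; simp; rw [f1.reg _ (by decide +kernel), R.hk]
      apply Runs.block
      · simp; omega
      · simp [g1, g2, g3, g4, g5, g6, g7, g8, g9, Nat.div_div_eq_div_mul]
    · intro ax hax
      have hd : ∀ a n, Digs P s a n → Digs P (runL [.copy 85 74] s1) a n := fun a n h =>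
        h.frame (by simp [a1])
      have hm : ax.1 ∈ [46, 47, 48, 49, 40, 41, 42] := by
        simp only [List.mem_cons, List.not_mem_nil, or_false] at hax
        rcases hax with rfl | rfl | rfl | rfl | rfl | rfl | rfl <;> simp
      refine ⟨hd _ _ (hv _ hm).1, (hv _ hm).2, ?_⟩
      clear hd hm
      simp only [List.mem_cons, List.not_mem_nil, or_false] at hax
      rcases hax with rfl | rfl | rfl | rfl | rfl | rfl | rfl <;> decide
  · simp; omega

/-- Divide the coordinates by their greatest common divisor, and compute the greatest common divisor of
`F` and the last quotient.  Before that, the first coordinate is made odd by adding the odd number `F`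
if necessary, so that the binary algorithms apply. -/
def reduce : Prog :=
  block [.add 98 70 70, .add 98 98 98, .const 0 20, .add 98 98 0, .half 83 80, .add 83 83 83,
    .sub 83 80 83] ;;
  .ite 83 .skip (block [.add 80 80 85]) ;;
  block [.copy 88 80, .copy 87 81] ;; bgcd ;; block [.copy 87 82] ;; bgcd ;;
  block [.copy 84 80] ;; exactDiv ;; block [.copy 89 100, .copy 84 81] ;; exactDiv ;;
  block [.copy 90 100, .copy 84 82] ;; exactDiv ;;
  block [.copy 91 100, .copy 87 100, .copy 88 85] ;; bgcd

set_option maxHeartbeats 1000000 in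
/-- The bound `4 k + 20` in register `98` is the number of bits of a product of two numbers below
`2 * F`, which is what the binary algorithms need. -/
theorem reduce_spec {s : State} {F X Y Z : ℕ} (hw : 4 * k + 60 ≤ w) (h70 : s.reg 70 = k)
    (hF : s.reg 85 = F) (hF1 : F % 2 = 1) (hFk : F < 2 ^ (2 * k + 5)) (hX : s.reg 80 = X)
    (hY : s.reg 81 = Y) (hZ : s.reg 82 = Z) (hXF : X < F) (hYF : Y < F) (hZF : Z < F) :
    Runs w reduce (1000 * k + 5000) s fun s' => ∃ X' x y z g, (X' = X ∨ X' = X + F) ∧ X' = x * g ∧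
      Y = y * g ∧ Z = z * g ∧ Nat.gcd x (Nat.gcd y z) = 1 ∧ g = Nat.gcd X' (Nat.gcd Y Z) ∧
      s'.reg 89 = x ∧ s'.reg 90 = y ∧ s'.reg 91 = z ∧ s'.reg 88 = Nat.gcd z F := by
  have hkw : 4 * k + 20 < 2 ^ w := (Nat.lt_two_pow_self (n := 4 * k + 20)).trans
    (Nat.pow_lt_pow_right (by norm_num) (by omega))
  have hw0 : 0 < w := by omega
  have hFw : 4 * F < 2 ^ w := by
    calc 4 * F < 4 * 2 ^ (2 * k + 5) := by omega
      _ = 2 ^ (2 * k + 7) := by rw [show 2 * k + 7 = 2 * k + 5 + 2 by rfl, pow_add _ _ 2]; ring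
      _ ≤ 2 ^ w := Nat.pow_le_pow_right (by norm_num) (by omega)
  have hmul : ∀ {a b : ℕ}, a < 2 * F → b < 2 * F → a * b < 2 ^ (4 * k + 20) := by
    intro a b ha hb
    calc a * b ≤ (2 * 2 ^ (2 * k + 5)) * (2 * 2 ^ (2 * k + 5)) :=
          Nat.mul_le_mul (by omega) (by omega)
      _ = 2 ^ (4 * k + 12) := by
          rw [← pow_succ', ← pow_add]; congr 1; omega
      _ < 2 ^ (4 * k + 20) := Nat.pow_lt_pow_right (by norm_num) (by omega)
  have hlt : ∀ {a : ℕ}, a < 2 * F → a < 2 ^ (4 * k + 20) := by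
    intro a ha
    have := hmul ha (show 1 < 2 * F by omega)
    omega
  apply Runs.of_le (N := 8 + (4 + (3 + (((4 * k + 20) * 30 + 10) + (2 + (((4 * k + 20) * 30 + 10) +
    (2 + (((4 * k + 20) * 30 + 10) + (3 + (((4 * k + 20) * 30 + 10) + (3 +
    (((4 * k + 20) * 30 + 10) + (4 + ((4 * k + 20) * 30 + 10))))))))))))))
  · apply Runs.block_seq
    · simp [h70, hX]; omega
    apply Runs.call_seq (N₁ := 4) (Q₁ := fun s' => ∃ X', (X' = X ∨ X' = X + F) ∧ X' % 2 = 1 ∧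
      s'.reg 80 = X' ∧ s'.reg 81 = Y ∧ s'.reg 82 = Z ∧ s'.reg 85 = F ∧ s'.reg 98 = 4 * k + 20)
    · apply Runs.of_le
      · apply Runs.ite
        · intro h
          simp [hX] at h
          apply Runs.skip
          refine ⟨X, Or.inl rfl, by omega, ?_⟩
          simp [hX, hY, hZ, hF, h70]
          omega
        · intro h
          simp [hX] at h
          apply Runs.block
          · simp [hX, hF]; omega
          · refine ⟨X + F, Or.inr rfl, by omega, ?_⟩
            simp [hX, hY, hZ, hF, h70]
            omega
      · simp
    intro s1 _ ⟨X', hX', hodd, b80, b81, b82, b85, b98⟩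
    have hX2 : X' < 2 * F := by omega
    apply Runs.block_seq
    · simp
    apply Runs.call_seq (bgcd_spec (u := Y) (v := X') (n := 4 * k + 20) hw0 (by simp [b81])
      (by simp [b80]) (by simp [b98]) hodd (hmul (by omega) hX2))
    intro s2 f2 g2
    have hr2 : ∀ x ∈ [80, 81, 82, 85, 98], s2.reg x = s1.reg x := by
      intro x hx
      have : x ∉ wregs bgcd ∧ x ≠ 87 ∧ x ≠ 88 := by revert x; decide +kernel
      rw [f2.reg _ this.1]; simp [this]
    have hodd2 : ∀ d, d ∣ X' → d % 2 = 1 := fun d hd => by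
      obtain ⟨c, rfl⟩ := hd
      rcases Nat.mod_two_eq_zero_or_one d with h | h
      · rw [Nat.mul_mod, h] at hodd; simp at hodd
      · exact h
    have hpos : 0 < X' := by omega
    have hle : Nat.gcd Y X' ≤ X' := Nat.gcd_le_right _ hpos
    apply Runs.block_seq
    · simp
    apply Runs.call_seq (bgcd_spec (u := Z) (v := Nat.gcd Y X') (n := 4 * k + 20) hw0
      (by simp [hr2, b82]) (by simp [g2]) (by simp [hr2, b98]) (hodd2 _ (Nat.gcd_dvd_right _ _))
      (hmul (by omega) (by omega)))
    intro s3 f3 g3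
    have hr3 : ∀ x ∈ [80, 81, 82, 85, 98], s3.reg x = s1.reg x := by
      intro x hx
      have : x ∉ wregs bgcd ∧ x ≠ 87 ∧ x ≠ 88 := by revert x; decide +kernel
      rw [f3.reg _ this.1]; simp [this, hr2 x hx]
    have hgcd : Nat.gcd Z (Nat.gcd Y X') = Nat.gcd X' (Nat.gcd Y Z) := by
      rw [Nat.gcd_comm Z, Nat.gcd_comm Y X', Nat.gcd_assoc]
    rw [hgcd] at g3
    have hgo := hodd2 _ (Nat.gcd_dvd_left X' (Nat.gcd Y Z))
    have hgp : 0 < Nat.gcd X' (Nat.gcd Y Z) := by omega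
    obtain ⟨x, hx⟩ := Nat.gcd_dvd_left X' (Nat.gcd Y Z)
    obtain ⟨y, hy⟩ := (Nat.gcd_dvd_right X' (Nat.gcd Y Z)).trans (Nat.gcd_dvd_left Y Z)
    obtain ⟨z, hz⟩ := (Nat.gcd_dvd_right X' (Nat.gcd Y Z)).trans (Nat.gcd_dvd_right Y Z)
    have hcop : Nat.gcd x (Nat.gcd y z) = 1 := by
      have h : Nat.gcd X' (Nat.gcd Y Z) * Nat.gcd x (Nat.gcd y z) = Nat.gcd X' (Nat.gcd Y Z) * 1 := by
        rw [← Nat.gcd_mul_left, ← Nat.gcd_mul_left, ← hx, ← hy, ← hz, mul_one]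
      exact Nat.eq_of_mul_eq_mul_left hgp h
    generalize hg : Nat.gcd X' (Nat.gcd Y Z) = g at *
    have hxX : x ≤ X' := by rw [hx]; exact Nat.le_mul_of_pos_left _ hgp
    have hyY : y ≤ Y := by rw [hy]; exact Nat.le_mul_of_pos_left _ hgp
    have hzZ : z ≤ Z := by rw [hz]; exact Nat.le_mul_of_pos_left _ hgp
    apply Runs.block_seq
    · simp
    apply Runs.call_seq (exactDiv_spec (c := x) (g := g) (n := 4 * k + 20) (by omega) (by simp [g3])
      (by simp [hr3, b80]; rw [hx, mul_comm]) (by simp [hr3, b98]) hgo (hlt (by omega)))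
    intro s4 f4 g4
    have hr4 : ∀ x ∈ [80, 81, 82, 85, 98, 88], s4.reg x = s3.reg x := by
      intro x hx
      have : x ∉ wregs exactDiv ∧ x ≠ 84 := by revert x; decide +kernel
      rw [f4.reg _ this.1]; simp [this]
    apply Runs.block_seq
    · simp
    apply Runs.call_seq (exactDiv_spec (c := y) (g := g) (n := 4 * k + 20) (by omega)
      (by simp [hr4, g3])
      (by simp [hr4, hr3, b81]; rw [hy, mul_comm]) (by simp [hr4, hr3, b98]) hgo (hlt (by omega)))
    intro s5 f5 g5
    have hr5 : ∀ x ∈ [80, 81, 82, 85, 98, 88], s5.reg x = s4.reg x := by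
      intro x hx
      have : x ∉ wregs exactDiv ∧ x ≠ 84 ∧ x ≠ 89 := by revert x; decide +kernel
      rw [f5.reg _ this.1]; simp [this]
    have c89 : s5.reg 89 = x := by rw [f5.reg _ (by decide +kernel)]; simp [g4]
    apply Runs.block_seq
    · simp
    apply Runs.call_seq (exactDiv_spec (c := z) (g := g) (n := 4 * k + 20) (by omega)
      (by simp [hr5, hr4, g3])
      (by simp [hr5, hr4, hr3, b82]; rw [hz, mul_comm]) (by simp [hr5, hr4, hr3, b98]) hgo
      (hlt (by omega)))
    intro s6 f6 g6
    have d89 : s6.reg 89 = x := by rw [f6.reg _ (by decide +kernel)]; simp [c89]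
    have d90 : s6.reg 90 = y := by rw [f6.reg _ (by decide +kernel)]; simp [g5]
    have d85 : s6.reg 85 = F := by
      rw [f6.reg _ (by decide +kernel)]; simp [hr5, hr4, hr3, b85]
    have d98 : s6.reg 98 = 4 * k + 20 := by
      rw [f6.reg _ (by decide +kernel)]; simp [hr5, hr4, hr3, b98]
    apply Runs.block_seq
    · simp
    apply Runs.call (bgcd_spec (u := z) (v := F) (n := 4 * k + 20) hw0
      (by simp [g6]) (by simp [d85]) (by simp [d98]) hF1
      (hmul (by omega) (by omega)))
    intro s7 f7 g7
    refine ⟨X', x, y, z, g, hX', by rw [hx, mul_comm], by rw [hy, mul_comm], by rw [hz, mul_comm],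
      hcop, hg.symm, ?_, ?_, ?_, g7⟩
    · rw [f7.reg _ (by decide +kernel)]; simp [d89]
    · rw [f7.reg _ (by decide +kernel)]; simp [d90]
    · rw [f7.reg _ (by decide +kernel)]; simp [g6]
  · omega

/-- The list of the values computed by the test, where `t` is the residue of `d ^ 2`.  As `y < F`, the
condition on `y` in the last step is `y = 0`. -/
def outList (F r e d yP t x y z g : ℕ) : List ℕ :=
  if r ≠ 1 ∧ r ≠ F - 1 then [F, r, 0] else if t ≠ 5 then [F, r, e, d, 0] else
    [F, r, e, d, 0, yP, 1, x, y, z, g, if y = 0 ∧ g = 1 then 1 else 0]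

/-- Output the results. -/
def report : Prog :=
  block [.const 101 0, .const 102 1, .sub 94 75 102, .sub 83 102 75, .add 94 94 83, .sub 83 85 102,
    .sub 95 75 83, .sub 83 83 75, .add 95 95 83, .const 0 5, .sub 96 79 0, .sub 83 0 79,
    .add 96 96 83, .sub 97 88 102, .sub 83 102 88, .add 97 97 83, .print 85, .print 75] ;;
  .ite 94 (.ite 95 .skip (block [.const 103 1])) (block [.const 103 1]) ;;
  .ite 103
    (block [.print 86, .print 76] ;;
      .ite 96 (block [.print 101])
        (block [.print 101, .print 78, .print 102, .print 89, .print 90, .print 91, .print 88] ;;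
          .ite 90 (block [.print 101]) (.ite 97 (block [.print 101]) (block [.print 102]))))
    (block [.print 101])

theorem report_spec {s : State} {F r e d yP t x y z g : ℕ} (hw : 4 ≤ w) (h103 : s.reg 103 = 0)
    (h85 : s.reg 85 = F) (h75 : s.reg 75 = r) (h86 : s.reg 86 = e) (h76 : s.reg 76 = d)
    (h78 : s.reg 78 = yP) (h79 : s.reg 79 = t) (h89 : s.reg 89 = x) (h90 : s.reg 90 = y)
    (h91 : s.reg 91 = z) (h88 : s.reg 88 = g) (hF : 1 ≤ F) (ho : s.out = []) :
    Runs w report 100 s fun s' => s'.out = outList F r e d yP t x y z g := by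
  apply Runs.of_small
  intro hs
  have i1 := hs.1 85
  have i2 := hs.1 75
  have i3 := hs.1 79
  have i4 := hs.1 88
  have hw2 : 2 ^ 4 ≤ 2 ^ w := Nat.pow_le_pow_right (by norm_num) hw
  apply Runs.of_le
  · apply Runs.block_seq
    · simp; omega
    apply Runs.call_seq (N₁ := 10) (Q₁ := fun s' =>
        (s'.reg 103 = if r ≠ 1 ∧ r ≠ F - 1 then 0 else 1) ∧
        s'.reg 101 = 0 ∧ s'.reg 102 = 1 ∧ s'.reg 86 = e ∧ s'.reg 76 = d ∧ s'.reg 78 = yP ∧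
        s'.reg 96 = (t - 5) + (5 - t) ∧ s'.reg 97 = (g - 1) + (1 - g) ∧ s'.reg 89 = x ∧
        s'.reg 90 = y ∧ s'.reg 91 = z ∧ s'.reg 88 = g ∧ s'.out = [F, r])
    · apply Runs.of_le
      · apply Runs.ite
        · intro h
          simp [h75] at h
          apply Runs.ite
          · intro h'
            simp [h75, h85] at h'
            apply Runs.skip
            rw [if_pos (by omega)]
            simp [h103, h85, h75, h86, h76, h78, h79, h89, h90, h91, h88, ho]
          · intro h'
            simp [h75, h85] at h'
            apply Runs.block
            · simp; omega
            · rw [if_neg (by omega)]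
              simp [h103, h85, h75, h86, h76, h78, h79, h89, h90, h91, h88, ho]
        · intro h
          simp [h75] at h
          apply Runs.block
          · simp; omega
          · rw [if_neg (by omega)]
            simp [h103, h85, h75, h86, h76, h78, h79, h89, h90, h91, h88, ho]
      · simp
    intro s1 _ ⟨j0, j1, j2, j3, j4, j5, j6, j7, j8, j9, j10, j11, j12⟩
    rw [outList]
    apply Runs.ite
    · intro h
      have hc : ¬ (r ≠ 1 ∧ r ≠ F - 1) := fun hc => h (by rw [j0, if_pos hc])
      rw [if_neg hc]
      apply Runs.block_seq
      · simp
      apply Runs.ite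
      · intro h
        simp [j6] at h
        apply Runs.block
        · simp
        · rw [if_pos (by omega)]
          simp [j1, j3, j4, j12]
      · intro h
        simp [j6] at h
        rw [if_neg (by omega)]
        apply Runs.block_seq
        · simp
        apply Runs.ite
        · intro h
          simp [j9] at h
          apply Runs.block
          · simp
          · rw [if_neg (by omega)]
            simp [j1, j2, j3, j4, j5, j8, j9, j10, j11, j12]
        · intro h
          simp [j9] at h
          apply Runs.ite
          · intro h'
            simp [j7] at h'
            apply Runs.block
            · simp
            · rw [if_neg (by omega)]
              simp [j1, j2, j3, j4, j5, j8, j9, j10, j11, j12]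
          · intro h'
            simp [j7] at h'
            apply Runs.block
            · simp
            · rw [if_pos (by omega)]
              simp [j1, j2, j3, j4, j5, j8, j9, j10, j11, j12]
    · intro h
      have hc : r ≠ 1 ∧ r ≠ F - 1 := by
        by_contra hc
        rw [j0, if_neg hc] at h
        omega
      rw [if_pos hc]
      apply Runs.block
      · simp
      · simp [j1, j12]
  · simp

end RAM

/-! ### The program and its correctness -/

namespace RAM

variable {w : ℕ} {k : ℕ} {P : Par}

/-- Reduce the results and output them. -/
def outPhase : Prog := fetch ;; reduce ;; report

theorem outPhase_spec (H : P.For k) (hk : 9 ≤ k) {s : State} (hw : 4 * k + 60 ≤ w) (R : Regs k P s)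
    (hF : Digs P s aFm P.F) (v : ℕ → ℕ)
    (hv : ∀ a ∈ [46, 47, 48, 49, 40, 41, 42], Digs P s a (v a) ∧ v a < 2 * P.F) (ho : s.out = []) :
    Runs w outPhase (8 * (P.h * (P.b * 6 + 20)) + 1000 * k + 5350) s fun s' =>
      ∃ X' x y z g, (X' = v 40 % P.F ∨ X' = v 40 % P.F + P.F) ∧ X' = x * g ∧
        v 41 % P.F = y * g ∧ v 42 % P.F = z * g ∧ Nat.gcd x (Nat.gcd y z) = 1 ∧
        g = Nat.gcd X' (Nat.gcd (v 41 % P.F) (v 42 % P.F)) ∧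
        s'.out = outList P.F (v 46 % P.F) ((P.F - 5) / 8) (v 47 % P.F) (v 48 % P.F) (v 49 % P.F)
          x y z (Nat.gcd z P.F) := by
  have hF8 := FkTest.F_mod (k := k) (by omega)
  have hFk := FkTest.F_lt k
  rw [← H.hF] at hF8 hFk
  have hmod : ∀ n, n % P.F < P.F := fun n => Nat.mod_lt _ (by omega)
  apply Runs.of_le
  · apply Runs.call_seq (fetch_spec H hw R hF v hv)
    intro s1 f1 ⟨g1, g2, g3, g4, g5, g6, g7, g8, g9, g10⟩
    apply Runs.call_seq (reduce_spec hw g10 g1 (by omega) hFk g6 g7 g8 (hmod _) (hmod _) (hmod _))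
    intro s2 f2 ⟨X', x, y, z, g, r1, r2, r3, r4, r5, r6, r7, r8, r9, r10⟩
    have hr : ∀ x ∈ [85, 75, 76, 78, 79, 86], s2.reg x = s1.reg x := by
      intro x hx
      exact f2.reg _ (by revert x; decide +kernel)
    apply Runs.mono (report_spec (by omega)
      (by rw [f2.reg _ (by decide +kernel), f1.reg _ (by decide +kernel)]; exact R.h0 _ (by decide))
      (by rw [hr _ (by decide), g1]) (by rw [hr _ (by decide), g2]) (by rw [hr _ (by decide), g9])
      (by rw [hr _ (by decide), g3]) (by rw [hr _ (by decide), g4]) (by rw [hr _ (by decide), g5])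
      r7 r8 r9 r10 (by omega)
      (by rw [f2.out (by decide +kernel), f1.out (by decide +kernel), ho]))
    intro s3 h3
    exact ⟨X', x, y, z, g, r1, r2, r3, r4, r5, r6, h3⟩
  · omega

end RAM

namespace FkTest

theorem mod_of_cast {F n m : ℕ} (h : (n : ZMod F) = m) : n % F = m % F :=
  (ZMod.natCast_eq_natCast_iff' _ _ _).1 h

/-- The list that the program prints is a list of the values computed by the test. -/
theorem transcript {k : ℕ} (hk : k ∈ S) (hk1 : 9 ≤ k) {X Y Z X' x y z g : ℕ} {R : (ZMod (F k))ˣ}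
    (hQ : ![(X : ZMod (F k)), (Y : ZMod (F k)), (Z : ZMod (F k))] = R • Q k)
    (hX : X' = X % F k ∨ X' = X % F k + F k) (hx : X' = x * g) (hy : Y % F k = y * g)
    (hz : Z % F k = z * g) (hc : Nat.gcd x (Nat.gcd y z) = 1)
    (hg : g = Nat.gcd X' (Nat.gcd (Y % F k) (Z % F k))) :
    Transcript k (RAM.outList (F k) (r k) (e k) (d k) (yP k) (d k ^ 2 % F k) x y z
      (Nat.gcd z (F k))) := by
  have hF := F_gt (k := k) (by omega)
  have h16 : 2 ^ 4 ≤ 2 ^ (2 * k) := Nat.pow_le_pow_right (by norm_num) (by omega)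
  have h5 : 5 % F k = 5 := Nat.mod_eq_of_lt (by omega)
  have hY := Nat.mod_lt Y (show 0 < F k by omega)
  rw [RAM.outList]
  split_ifs with c1 c2 c3
  · exact .stop_power c1.1 c1.2
  · exact .stop_root (by tauto) fun h => c2 (by rw [h, h5])
  all_goals
    have hd : d k ^ 2 ≡ 5 [MOD F k] := by
      rw [Nat.ModEq, h5]; exact not_not.1 c2
    have hX' : (X' : ZMod (F k)) = X := by rcases hX with rfl | rfl <;> simp
    have hQ' : ![(X' : ZMod (F k)), ((Y % F k : ℕ) : ZMod (F k)), ((Z % F k : ℕ) : ZMod (F k))] =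
        R • Q k := by
      rw [← hQ, hX', ZMod.natCast_mod, ZMod.natCast_mod]
    have hcop := coprime_of_eq_smul hk (by omega) hd hQ'
    rw [← hg] at hcop
    have hlift : Lift k x y z := by
      refine ⟨hc, (ZMod.unitOfCoprime g hcop)⁻¹ * R, ?_⟩
      rw [mul_smul, ← hQ', eq_inv_smul_iff, hx, hy, hz]
      ext i
      fin_cases i <;> simp [Units.smul_def, mul_comm]
    have hr : r k = 1 ∨ r k = F k - 1 := by tauto
    have hyF : y < F k := by
      rcases Nat.eq_zero_or_pos g with h0 | h0
      · rw [h0, Nat.coprime_zero_left] at hcop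
        omega
      · have : y ≤ y * g := Nat.le_mul_of_pos_right _ h0
        omega
    have hy0 : y ≡ 0 [MOD F k] ↔ y = 0 := by
      rw [Nat.ModEq, Nat.mod_eq_of_lt hyF, Nat.zero_mod]
  · exact .prime x y z hr hd hlift (hy0.2 c3.1) c3.2
  · exact .stop_point x y z hr hd hlift (by rw [hy0]; tauto)

end FkTest

namespace RAM

variable {w : ℕ} {k : ℕ} {P : Par}

/-- The primality test. -/
def testProg : Prog := prep ;; powPhase ;; flagPhase ;; pointPhase ;; outPhase

/-- Preparation and output take `O(k)` steps on words of `O(k)` bits; the modular multiplications are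
`O(k)` in number and work with words of `P.w = O(log k)` bits. -/
theorem testProg_exec {k : ℕ} (hk : k ∈ FkTest.S) (hk9 : 9 ≤ k) :
    ∃ (P : Par) (s : State) (t : ℕ), P.For k ∧ Exec testProg (init k) s t ∧
      FkTest.Transcript k s.out ∧
      t ≤ (4000 * k + 5520 + 10 * (P.h * (P.b * 6 + 20))) * (2 * (4 * k + 60) + 1) +
        (40 * P.M + (powOps.length + setupOps.length + 500) * (k * P.macN)) * (2 * P.w + 1) := by
  have hs0 : Small (4 * k + 60) (init k) := by
    have : k < 2 ^ (4 * k + 60) := Nat.lt_two_pow_self.trans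
      (Nat.pow_lt_pow_right (by norm_num) (by omega))
    refine ⟨fun x => ?_, fun a i => by simp [init]⟩
    simp only [init, Function.update_apply]
    split_ifs <;> omega
  obtain ⟨s1, t1, E1, T1, -, P, H, R1, A1, o1⟩ := prep_spec hk9 le_rfl hs0
  have hF := H.hF
  obtain ⟨Pw, PM, Pq, PL, Pb, Ph, PF, PF'⟩ := P
  dsimp only at hF
  subst hF
  set P : Par := ⟨Pw, PM, Pq, PL, Pb, Ph, FkTest.F k, PF'⟩ with hP
  change Par.For P k at H
  have O := H.ok hk9
  have hF0 : 0 < FkTest.F k := by have := O.hF1; change 1 < FkTest.F k at this; omega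
  have hww : P.w ≤ 4 * k + 60 := by
    have : k.size ≤ k := Nat.size_le.2 Nat.lt_two_pow_self
    rw [H.hw]; omega
  have hmono : ∀ {s}, Small P.w s → Small (4 * k + 60) s := fun h =>
    have h2 : 2 ^ P.w ≤ 2 ^ (4 * k + 60) := Nat.pow_le_pow_right (by norm_num) hww
    ⟨fun x => (h.1 x).trans_le h2, fun a i => (h.2 a i).trans_le h2⟩
  obtain ⟨s2, t2, E2, T2, S2, R2, o2, env, A2, e32, e33, e35, e34, e46, e93, e94⟩ :=
    powPhase_spec H hk9 R1 A1 ⟨R1.small H hk9, A1.lt⟩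
  obtain ⟨n, hn, hnF, hnv⟩ := A2.slot 46 (by norm_num)
  have hr : n % FkTest.F k = FkTest.r k := by
    have h8 := FkTest.F_mod (k := k) (by omega)
    have : (n : ZMod (FkTest.F k)) = ((5 ^ ((FkTest.F k - 1) / 4) : ℕ) : ZMod (FkTest.F k)) := by
      refine hnv.trans ?_
      rw [e46, mul_assoc, e34, mul_one]
      push_cast
      congr 1
      change 2 * ((FkTest.F k - 5) / 8) + 1 = _
      omega
    exact FkTest.mod_of_cast this
  obtain ⟨s3, t3, E3, T3, S3, R3, a3, o3, r3⟩ :=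
    flagPhase_spec H le_rfl R2 A2.num.hF hn hnF (hmono S2)
  have hδ : (FkTest.d k : ZMod (FkTest.F k)) = if s3.reg 71 = 0 then env 93 else env 94 := by
    change s3.reg 71 = if n % FkTest.F k = 1 then 0 else 1 at r3
    rw [hr] at r3
    rw [r3, FkTest.d]
    split_ifs with h1 h2 h2
    · rw [ZMod.natCast_mod, e93]
      push_cast
      rfl
    · simp at h2
    · simp at h2
    · rw [ZMod.natCast_mod, e94]
      push_cast
      rfl
  obtain ⟨s4, t4, E4, T4, S4, R4, o4, env', A4, g46, g47, g48, g49, gQ⟩ :=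
    pointPhase_spec H hk9 R3 (A2.congr a3 R3) e32 e33 e35 (δ := (FkTest.d k : ZMod (FkTest.F k))) hδ
      (W := FkTest.E k) rfl rfl rfl rfl rfl
      ⟨R3.small H hk9, by rw [a3]; exact S2.2⟩
  choose v hv using fun a : ℕ => fun ha : 32 ≤ a => A4.slot a ha
  have hv' : ∀ a ∈ [46, 47, 48, 49, 40, 41, 42], Digs P s4 a ((fun a => if h : 32 ≤ a then v a h else 0) a) ∧
      (fun a => if h : 32 ≤ a then v a h else 0) a < 2 * P.F ∧
      (((fun a => if h : 32 ≤ a then v a h else 0) a : ℕ) : ZMod (FkTest.F k)) = env' a * P.R := by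
    intro a ha
    have h32 : 32 ≤ a := by revert a; decide
    simp only [h32, dif_pos]
    exact hv a h32
  generalize (fun a => if h : 32 ≤ a then v a h else 0) = u at hv'
  obtain ⟨s5, t5, E5, T5, S5, X', x, y, z, g, x1, x2, x3, x4, x5, x6, x7⟩ :=
    outPhase_spec H hk9 le_rfl R4 A4.num.hF u (fun a ha => ⟨(hv' a ha).1, (hv' a ha).2.1⟩)
      (by rw [o4, o3, o2, o1]) (hmono S4)
  refine ⟨P, s5, _, H, .seq E1 (.seq E2 (.seq E3 (.seq E4 E5))), ?_, ?_⟩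
  · have c46 : u 46 % FkTest.F k = FkTest.r k := by
      rw [← hr]
      apply FkTest.mod_of_cast
      rw [(hv' 46 (by decide)).2.2, g46]
      exact hnv.symm
    have c47 : u 47 % FkTest.F k = FkTest.d k := by
      have h : (u 47 : ZMod (FkTest.F k)) = (FkTest.d k : ℕ) := by
        rw [(hv' 47 (by decide)).2.2, g47, mul_assoc, e34, mul_one]
      rw [FkTest.mod_of_cast h]
      apply Nat.mod_eq_of_lt
      rw [FkTest.d]
      split_ifs <;> exact Nat.mod_lt _ hF0
    have c48 : u 48 % FkTest.F k = FkTest.yP k := by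
      have h : (u 48 : ZMod (FkTest.F k)) = (FkTest.yP k : ℕ) := by
        rw [(hv' 48 (by decide)).2.2, g48, mul_assoc, e34, mul_one, FkTest.yP_cast k hF0.ne']
      rw [FkTest.mod_of_cast h]
      apply Nat.mod_eq_of_lt
      rw [FkTest.yP]
      have h1 := Int.emod_lt_of_pos (-10179930516 + 4552603328 * (FkTest.d k : ℤ))
        (show (0 : ℤ) < FkTest.F k by exact_mod_cast hF0)
      omega
    have c49 : u 49 % FkTest.F k = FkTest.d k ^ 2 % FkTest.F k := by
      apply FkTest.mod_of_cast
      rw [(hv' 49 (by decide)).2.2, g49, mul_assoc, e34, mul_one]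
      push_cast
      rfl
    rw [x7]
    change FkTest.Transcript k (outList (FkTest.F k) (u 46 % FkTest.F k) ((FkTest.F k - 5) / 8)
      (u 47 % FkTest.F k) (u 48 % FkTest.F k) (u 49 % FkTest.F k) x y z (Nat.gcd z (FkTest.F k)))
    rw [c46, c47, c48, c49]
    refine FkTest.transcript hk hk9 (R := ⟨P.R, env 34, by rw [mul_comm]; exact e34, e34⟩) ?_ x1 x2
      x3 x4 x5 x6
    have hQ : FkTest.Q k = ![env' 40, env' 41, env' 42] := by
      rw [gQ, FkTest.Q, FkTest.P, FkTest.yP_cast k hF0.ne']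
    rw [hQ, (hv' 40 (by decide)).2.2, (hv' 41 (by decide)).2.2, (hv' 42 (by decide)).2.2]
    ext i
    fin_cases i <;> simp [Units.smul_def, mul_comm]
  · refine (Nat.add_le_add T1 (Nat.add_le_add T2 (Nat.add_le_add T3 (Nat.add_le_add T4 T5)))).trans
      (le_of_eq ?_)
    ring

end RAM

namespace RAM

variable {k : ℕ} {P : Par}

/-! ### The time -/

theorem Par.For.q_lt (H : P.For k) (hk : 9 ≤ k) : P.q < 2 * P.b + 6 := by
  have h1 := H.two_pow_le hk
  have h2 := H.hkb
  have h3 : 2 ^ P.q < 2 ^ (2 * P.b + 6) := by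
    rw [pow_add, pow_mul]
    norm_num
    omega
  exact (Nat.pow_lt_pow_iff_right (by norm_num)).1 h3

/-- There are at most `log log k + O(1)` levels. -/
theorem Par.For.two_pow_L_le (H : P.For k) (hk : 9 ≤ k) : 2 ^ P.L ≤ 16 * P.b := by
  have h1 := (H.ok hk).conv.last
  have h2 := H.q_lt hk
  have h3 := H.one_le_b hk
  omega

theorem Par.For.w_le (H : P.For k) (hk : 9 ≤ k) : 2 * P.w + 1 ≤ 57 * P.b := by
  have h1 : k.size ≤ 2 * P.b + 2 := by
    rw [Nat.size_le, pow_add, pow_mul]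
    norm_num
    have := H.hkb
    omega
  have h3 := H.one_le_b hk
  rw [H.hw]
  omega

/-- A modular multiplication takes `O(k * log log k)` steps: there are `O(k / log k)` digits, and a
level of the transform takes `O(log k)` steps for each of them. -/
theorem Par.For.macN_le (H : P.For k) (hk : 9 ≤ k) : P.macN ≤ 2500000 * ((P.L + 1) * k) := by
  have h1 := H.hbh'
  have hb := H.one_le_b hk
  have h2 : P.q * 2 ^ P.q ≤ 96 * k := by
    calc P.q * 2 ^ P.q ≤ (8 * P.b) * (2 * P.h) := by
          rw [H.hD]; exact Nat.mul_le_mul_right _ (by have := H.q_lt hk; omega)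
      _ = 16 * (P.b * P.h) := by ring
      _ ≤ 96 * k := by omega
  have h3 : (P.L + 1) * (P.q * 2 ^ P.q) ≤ (P.L + 1) * (96 * k) := Nat.mul_le_mul_left _ h2
  have h4 : (P.L + 1) * (96 * k) = 96 * ((P.L + 1) * k) := by ring
  have h5 : k ≤ (P.L + 1) * k := Nat.le_mul_of_pos_left _ (by omega)
  have h6 : P.h ≤ P.b * P.h := Nat.le_mul_of_pos_left _ hb
  unfold Par.macN Par.mulN
  omega

/-- Preparation and output take time `O(k ^ 2)`, and so does the table of quarter squares, which has
`O(k ^ 2 / log k)` entries.  The modular multiplications dominate: their time is `O(k)` times the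
number of steps of one of them times the word length `O(b)`. -/
theorem Par.For.time_le (H : P.For k) (hk : 9 ≤ k) (c : ℕ) :
    (4000 * k + 5520 + 10 * (P.h * (P.b * 6 + 20))) * (2 * (4 * k + 60) + 1) +
      (40 * P.M + c * (k * P.macN)) * (2 * P.w + 1) ≤
    (1000000 + c * 142500000) * (k * k * ((P.L + 1) * P.b)) := by
  have hb := H.one_le_b hk
  have hbh := H.hbh'
  have h6 : P.h ≤ P.b * P.h := Nat.le_mul_of_pos_left _ hb
  have hV : k * k ≤ k * k * ((P.L + 1) * P.b) :=
    Nat.le_mul_of_pos_right _ (Nat.mul_pos (by omega) (by omega))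
  have h1 : (4000 * k + 5520 + 10 * (P.h * (P.b * 6 + 20))) * (2 * (4 * k + 60) + 1) ≤
      (7000 * k) * (22 * k) := by
    apply Nat.mul_le_mul
    · rw [show P.h * (P.b * 6 + 20) = 6 * (P.b * P.h) + 20 * P.h by ring]
      omega
    · omega
  have h2 : 40 * P.M * (2 * P.w + 1) ≤ 50000 * (k * k) := by
    have hM : P.M ≤ 3 * (k * P.h) := by
      have h7 : 4 ^ P.b * (2 * P.h) ≤ k * (2 * P.h) := Nat.mul_le_mul_right _ H.hbk
      have h8 : 1 ≤ P.h := by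
        rcases Nat.eq_zero_or_pos P.h with h | h
        · have := H.hbh; rw [h] at this; omega
        · exact h
      have h9 : 1 * 1 ≤ k * P.h := Nat.mul_le_mul (by omega) h8
      rw [H.hM, ← H.hD]
      have h10 : k * (2 * P.h) = 2 * (k * P.h) := by ring
      omega
    calc 40 * P.M * (2 * P.w + 1) ≤ 40 * (3 * (k * P.h)) * (57 * P.b) :=
          Nat.mul_le_mul (Nat.mul_le_mul_left _ hM) (H.w_le hk)
      _ = 6840 * (k * (P.b * P.h)) := by ring
      _ ≤ 6840 * (k * (6 * k)) :=
          Nat.mul_le_mul_left _ (Nat.mul_le_mul_left _ (by omega))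
      _ = 41040 * (k * k) := by ring
      _ ≤ 50000 * (k * k) := Nat.mul_le_mul_right _ (by norm_num)
  have h3 : c * (k * P.macN) * (2 * P.w + 1) ≤
      c * 142500000 * (k * k * ((P.L + 1) * P.b)) := by
    calc c * (k * P.macN) * (2 * P.w + 1) ≤
        c * (k * (2500000 * ((P.L + 1) * k))) * (57 * P.b) :=
          Nat.mul_le_mul (Nat.mul_le_mul_left _ (Nat.mul_le_mul_left _ (H.macN_le hk))) (H.w_le hk)
      _ = c * 142500000 * (k * k * ((P.L + 1) * P.b)) := by ring
  rw [Nat.add_mul (40 * P.M), Nat.add_mul (1000000 : ℕ)]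
  have h4 : 7000 * k * (22 * k) = 154000 * (k * k) := by ring
  omega

/-- The number of levels and the number of bits of a digit grow as the iterated logarithm and the
logarithm of `k`. -/
theorem Par.For.log_bound (H : P.For k) (hk : 9 ≤ k) :
    (((P.L + 1) * P.b : ℕ) : ℝ) ≤ 12 * (Real.log k * Real.log (Real.log k)) := by
  have hk0 : (9 : ℝ) ≤ k := by exact_mod_cast hk
  have hl2 : (1 : ℝ) / 2 < Real.log 2 := by have := Real.log_two_gt_d9; linarith
  have hlog2 : (2 : ℝ) ≤ Real.log k := by
    have h8 : Real.log 8 = 3 * Real.log 2 := by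
      rw [show (8 : ℝ) = 2 ^ 3 by norm_num, Real.log_pow]; norm_num
    have := Real.log_two_gt_d9
    have := Real.log_le_log (by norm_num) (show (8 : ℝ) ≤ k by linarith)
    linarith
  have hll : (1 : ℝ) / 2 ≤ Real.log (Real.log k) :=
    hl2.le.trans (Real.log_le_log (by norm_num) hlog2)
  have hb : (P.b : ℝ) ≤ Real.log k := by
    have h1 : ((4 : ℝ) ^ P.b) ≤ k := by exact_mod_cast H.hbk
    have h2 := Real.log_le_log (by positivity) h1
    rw [Real.log_pow, show (4 : ℝ) = 2 ^ 2 by norm_num, Real.log_pow] at h2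
    push_cast at h2
    have h3 : (0 : ℝ) ≤ P.b := Nat.cast_nonneg _
    nlinarith
  have hL : (P.L : ℝ) + 1 ≤ 12 * Real.log (Real.log k) := by
    have h1 : ((2 : ℝ) ^ P.L) ≤ 2 ^ 4 * Real.log k := by
      have h := H.two_pow_L_le hk
      have h' : ((2 : ℝ) ^ P.L) ≤ 16 * P.b := by exact_mod_cast h
      linarith
    have h2 := Real.log_le_log (by positivity) h1
    rw [Real.log_pow, Real.log_mul (by norm_num) (by linarith), Real.log_pow] at h2
    push_cast at h2
    have h3 : (P.L : ℝ) * Real.log 2 ≤ (4 + 2 * Real.log (Real.log k)) * Real.log 2 := by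
      nlinarith
    have h4 := le_of_mul_le_mul_right h3 (by linarith)
    linarith
  push_cast
  calc ((P.L : ℝ) + 1) * P.b ≤ (12 * Real.log (Real.log k)) * Real.log k :=
        mul_le_mul hL hb (Nat.cast_nonneg _) (by linarith)
    _ = _ := by ring

end RAM

/-- In particular, `log (log k)` is bounded below by a positive constant on `S`. -/
theorem FkTest.nine_le {k : ℕ} (hk : k ∈ FkTest.S) : 9 ≤ k := by
  have h : k % 240 ∈ ({9, 19, 39, 45, 59, 63, 67, 85, 105, 123, 129, 133, 159,
    169, 173, 181, 183, 221, 223, 225, 229} : Finset ℕ) := hk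
  have h' : ∀ r ∈ ({9, 19, 39, 45, 59, 63, 67, 85, 105, 123, 129, 133, 159,
    169, 173, 181, 183, 221, 223, 225, 229} : Finset ℕ), 9 ≤ r := by decide
  exact (h' _ h).trans (Nat.mod_le _ _)

theorem theorem5p3 :
    ∃ (p : RAM.Prog) (C : ℝ), ∀ k : ℕ, k ∈ FkTest.S →
      ∃ (s : RAM.State) (t : ℕ), RAM.Exec p (RAM.init k) s t ∧
        FkTest.Transcript k s.out ∧
        (t : ℝ) ≤ C * ((k : ℝ) ^ 2 * Real.log k * Real.log (Real.log k)) := by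
  set c := RAM.powOps.length + RAM.setupOps.length + 500 with hc
  refine ⟨RAM.testProg, ((1000000 + c * 142500000 : ℕ) : ℝ) * 12, fun k hk => ?_⟩
  have hk9 := FkTest.nine_le hk
  obtain ⟨P, s, t, H, hE, hT, ht⟩ := RAM.testProg_exec hk hk9
  refine ⟨s, t, hE, hT, ?_⟩
  rw [← hc] at ht
  have h1 : (t : ℝ) ≤ ((1000000 + c * 142500000 : ℕ) : ℝ) *
      ((k : ℝ) * k * (((P.L + 1) * P.b : ℕ) : ℝ)) := by
    exact_mod_cast ht.trans (H.time_le hk9 c)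
  have h2 : (k : ℝ) * k * (((P.L + 1) * P.b : ℕ) : ℝ) ≤
      (k : ℝ) * k * (12 * (Real.log k * Real.log (Real.log k))) :=
    mul_le_mul_of_nonneg_left (H.log_bound hk9) (by positivity)
  calc (t : ℝ) ≤ _ := h1
    _ ≤ ((1000000 + c * 142500000 : ℕ) : ℝ) *
        ((k : ℝ) * k * (12 * (Real.log k * Real.log (Real.log k)))) :=
      mul_le_mul_of_nonneg_left h2 (Nat.cast_nonneg _)
    _ = _ := by ring
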